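/- **Setting.** Let $1\le N\le K$ be integers, let $\Sigma_{N,K}$ be the set of the $N$-element subsets $\sigma$ of $\{1,\dots,K\}$, and let $r=\binom KN=|\Sigma_{N,K}|$. For $k\in\sigma$ let $\sigma^{-1}(k)$ be the position of $k$ in the increasing enumeration of $\sigma$, and for distinct $k,l\in\sigma$ put $(-1)^{\sigma}_{k,l}=(-1)^{\sigma^{-1}(k)+\sigma^{-1}(l)+1}$ if $k<l$ and $(-1)^{\sigma}_{k,l}=(-1)^{\sigma^{-1}(k)+\sigma^{-1}(l)}$ if $k>l$. For $C\in\mathbb C^r$ (indexed by $\Sigma_{N,K}$), $\Phi=(\phi_1,\dots,\phi_K):\mathbb R^3\to\mathbb C^K$ and real potentials $U=U(x)$, $V=V(|x|)$ on $\mathbb R^3$ let $$\Gamma[C]_{ij}=\sum_{\sigma\ni i,\ \tau\ni j,\ \sigma\setminus\{i\}=\tau\setminus\{j\}}(-1)^{\sigma^{-1}(i)+\tau^{-1}(j)}\,\overline{C_\sigma}\,C_\tau ,$$ $$\mathbb K[\Phi]_{\sigma\tau}=\tfrac12\sum_{\substack{i\ne j\in\tau,\ k\neq l\in\sigma\\ \tau\setminus\{i,j\}=\sigma\setminus\{k,l\}}}(-1)^\tau_{i,j}(-1)^\sigma_{k,l}\iint\phi_i(x)\overline{\phi_k(x)}\,V(|x-y|)\,\phi_j(y)\overline{\phi_l(y)}\,dx\,dy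 ,$$ $$\mathbb W[C,\Phi]_{ij}(x)=2\sum_{k,l=1}^K\gamma_{jkil}\int\phi_k(y)V(|x-y|)\overline{\phi_l(y)}\,dy,\qquad \gamma_{ijkl}=\tfrac12\sum_{\substack{i,j\in\sigma,\ k,l\in\tau\\ \sigma\setminus\{i,j\}=\tau\setminus\{k,l\}}}(-1)^\sigma_{i,j}(-1)^\tau_{k,l}\,C_\sigma\overline{C_\tau}$$ for $i\neq j$ and $k\neq l$, and $\gamma_{ijkl}=0$ otherwise. Let $\mathbf P_\Phi\psi=\sum_i\big(\int\psi\,\overline{\phi_i}\big)\phi_i$ (acting on each component of a vector) and, when $\Gamma[C]$ is invertible, $\mathbb L[C,\Phi]=\Gamma[C]^{-1}(I-\mathbf P_\Phi)\,\mathbb W[C,\Phi]\,\Phi$. Let $\partial\mathcal F_{N,K}$ be the set of the $(C,\Phi)\in\mathbb C^r\times L^2(\mathbb R^3)^K$ with $\sum_\sigma|C_\sigma|^2=1$, $\int\phi_i\overline{\phi_j}=\delta_{ij}$ and $\operatorname{rank}\Gamma[C]=K$. All vectors in $\mathbb C^r$ and $\mathbb C^K$ carry the Euclidean norm, and matrices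 the operator norm. Let $\mathbf U(t)=e^{\frac i2t\Delta}$, $L^{p,q}_T=L^p([0,T];L^q(\mathbb R^3))$, and let $X^{p,q}_T=L^\infty([0,T];\mathbb C^r)\times\big(L^{\infty,2}_T\cap L^{p,q}_T\big)$ carry the sum of the norms. A pair of reals $(p,q)$, $p>0$, is *admissible* if $\frac2{3p}=\frac12-\frac1q$ and $2\le q<6$. Let $\rho(p)$ be the least constant with $\|\mathbf U(\cdot)\phi\|_{L^{p,q}_T}\le\rho(p)\|\phi\|_{L^2}$ for all $T>0$ and $\phi\in L^2(\mathbb R^3)$. A *solution on $[0,T]$* with data $(C^0,\Phi^0)$ is a pair $(C,\Phi)\in X^{p,q}_T$, with $C$ represented by its continuous version, such that $\Gamma[C(t)]$ is invertible for all $t\in[0,T]$ and $$C(t)=C^0-i\int_0^t\mathbb K[\Phi(s)]\,C(s)\,ds,\qquad \Phi(t)=\mathbf U(t)\Phi^0-i\int_0^t\mathbf U(t-s)\big[U\Phi(s)+\mathbb L[C(s),\Phi(s)]\big]\,ds ,$$ the first equation for all $t\in[0,T]$ and the second for almost every $t\in[0,T]$, its integral being understood in the sense of tempered distributions on $\mathbb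 R^3$. **Statement.** Let $d>\frac32$ be real, $q=\frac{2d}{d-1}$ and $(p,q)$ admissible. Then $\rho(p)<\infty$. Moreover, for all $A,B,\theta\ge0$ there are $T>0$ and $L\ge0$, depending only on $N,K,d,p,q,A,B,\theta$, such that for all $U,V\in L^d(\mathbb R^3)$ with $\|U\|_{L^d}\le A$, $\|V(|\cdot|)\|_{L^d}\le B$ the following holds. 1. For every $(C^0,\Phi^0)\in\partial\mathcal F_{N,K}$ with $\|\Gamma[C^0]^{-1}\|\le\theta$ there is a unique solution $(C,\Phi)\in X^{p,q}_T$ on $[0,T]$ with data $(C^0,\Phi^0)$, and it satisfies $$\|\Phi\|_{L^{p,q}_T}\le2\rho(p)\|\Phi^0\|_{L^2}.$$ 2. If $(C,\Phi)$ and $(C',\Phi')$ are the solutions on $[0,T]$ with data $(C^0,\Phi^0),(C'^0,\Phi'^0)\in\partial\mathcal F_{N,K}$, where $\|\Gamma[C^0]^{-1}\|,\|\Gamma[C'^0]^{-1}\|\le\theta$, then $$\|(C,\Phi)-(C',\Phi')\|_{X^{p,q}_T}\le L\,\big(\|C^0-C'^0\|_{\mathbb C^r}+\|\Phi^0-\Phi'^0\|_{L^2}\big).$$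 -/

import Mathlib

open MeasureTheory
open scoped ENNReal NNReal

namespace MCTDHF

open scoped SchwartzMap ComplexConjugate FourierTransform

noncomputable section

/-- Physical space `ℝ³` with its Euclidean norm. -/
abbrev E3 : Type := EuclideanSpace ℝ (Fin 3)

/-- The index set `Σ_{N,K}` of the `N`-element subsets of `{1, …, K}` (written as `Fin K`). -/
abbrev MultiIndex (N K : ℕ) : Type := {σ : Finset (Fin K) // σ.card = N}

/-- The coefficient space `ℂ^r`, `r = K choose N`, with its Euclidean norm. -/
abbrev Coeff (N K : ℕ) : Type := EuclideanSpace ℂ (MultiIndex N K)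

/-- `ℂ^K` with its Euclidean norm, the space of values of `Φ = (φ₁, …, φ_K)`. -/
abbrev Orb (K : ℕ) : Type := EuclideanSpace ℂ (Fin K)

/-- `L²(ℝ³; F)`. For `F = ℂ^K` this is `L²(ℝ³)^K` with the norm `(∑ᵢ ‖φᵢ‖²)^{1/2}`. -/
abbrev L2 (F : Type) [NormedAddCommGroup F] : Type := Lp F 2 (volume : Measure E3)

/-! ### The algebraic objects of the system -/

section Algebra

variable {N K : ℕ}

/-- `σ⁻¹(k)`: the position (counted from `1`) of the entry `k` in the increasing list `σ`. -/
def pos (σ : MultiIndex N K) (k : Fin K) : ℕ := (σ.1.filter (fun m => m ≤ k)).card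

/-- The sign `(-1)^σ_{k,l}`; it is only used for `k ≠ l`. -/
def pairSign (σ : MultiIndex N K) (k l : Fin K) : ℂ :=
  if k < l then (-1) ^ (pos σ k + pos σ l + 1) else (-1) ^ (pos σ k + pos σ l)

/-- The density matrix `Γ[C]`. The sum runs over the pairs `σ ∋ i`, `τ ∋ j` with
`σ ∖ {i} = τ ∖ {j}`. -/
def densityMatrix (C : Coeff N K) : Matrix (Fin K) (Fin K) ℂ :=
  Matrix.of fun i j => ∑ σ : MultiIndex N K, ∑ τ : MultiIndex N K,
    if i ∈ σ.1 ∧ j ∈ τ.1 ∧ σ.1 \ {i} = τ.1 \ {j} then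
      (-1) ^ (pos σ i + pos τ j) * conj (C σ) * C τ
    else 0

/-- The coefficients `γ_{ijkl}` of the two-particle density matrix. -/
def gammaCoeff (C : Coeff N K) (i j k l : Fin K) : ℂ :=
  if i ≠ j ∧ k ≠ l then
    (1 / 2) * ∑ σ : MultiIndex N K, ∑ τ : MultiIndex N K,
      if i ∈ σ.1 ∧ j ∈ σ.1 ∧ k ∈ τ.1 ∧ l ∈ τ.1 ∧ σ.1 \ {i, j} = τ.1 \ {k, l} then
        pairSign σ i j * pairSign τ k l * C σ * conj (C τ)
      else 0
  else 0

/-- The `r × r` matrix `𝕂[Φ]` of the interaction `V(|x - y|)`. -/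
def kMatrix (V : ℝ → ℝ) (Φ : E3 → Orb K) : Matrix (MultiIndex N K) (MultiIndex N K) ℂ :=
  Matrix.of fun σ τ => (1 / 2) *
    ∑ i ∈ τ.1, ∑ j ∈ τ.1, ∑ k ∈ σ.1, ∑ l ∈ σ.1,
      if i ≠ j ∧ k ≠ l ∧ τ.1 \ {i, j} = σ.1 \ {k, l} then
        pairSign τ i j * pairSign σ k l *
          ∫ z : E3 × E3, Φ z.1 i * conj (Φ z.1 k) * (V ‖z.1 - z.2‖ : ℂ) *
            (Φ z.2 j * conj (Φ z.2 l))
      else 0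

/-- The `K × K` matrix `𝕎[C, Φ](x)`. -/
def wMatrix (V : ℝ → ℝ) (C : Coeff N K) (Φ : E3 → Orb K) (x : E3) :
    Matrix (Fin K) (Fin K) ℂ :=
  Matrix.of fun i j => 2 * ∑ k : Fin K, ∑ l : Fin K,
    gammaCoeff C j k i l * ∫ y : E3, Φ y k * (V ‖x - y‖ : ℂ) * conj (Φ y l)

/-- The projection `P_Φ ψ = ∑ᵢ (∫ ψ conj(φᵢ)) φᵢ` of a scalar function `ψ`. -/
def proj (Φ : E3 → Orb K) (ψ : E3 → ℂ) (x : E3) : ℂ :=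
  ∑ i : Fin K, (∫ y : E3, ψ y * conj (Φ y i)) * Φ x i

/-- The components of `(I - P_Φ) 𝕎[C, Φ] Φ`, where `P_Φ` acts on each component. -/
def projectedForce (V : ℝ → ℝ) (C : Coeff N K) (Φ : E3 → Orb K) (i : Fin K) (x : E3) : ℂ :=
  (wMatrix V C Φ x).mulVec (Φ x) i - proj Φ (fun y => (wMatrix V C Φ y).mulVec (Φ y) i) x

/-- `𝕃[C, Φ] = Γ[C]⁻¹ (I - P_Φ) 𝕎[C, Φ] Φ`. -/
def lTerm (V : ℝ → ℝ) (C : Coeff N K) (Φ : E3 → Orb K) (x : E3) : Orb K :=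
  WithLp.toLp 2 ((densityMatrix C)⁻¹.mulVec (fun i => projectedForce V C Φ i x))

/-- The nonlinearity `U Φ + 𝕃[C, Φ]` of the orbital equations. -/
def forcing (U : E3 → ℝ) (V : ℝ → ℝ) (C : Coeff N K) (Φ : E3 → Orb K) (x : E3) : Orb K :=
  (U x : ℂ) • Φ x + lTerm V C Φ x

/-- The set `∂F_{N,K}`: normalized coefficients, orthonormal orbitals, density matrix of full
rank. -/
structure IsRegularData (C : Coeff N K) (Φ : L2 (Orb K)) : Prop where
  normalized : ∑ σ : MultiIndex N K, ‖C σ‖ ^ 2 = 1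
  orthonormal : ∀ i j : Fin K, ∫ x : E3, Φ x i * conj (Φ x j) = if i = j then 1 else 0
  full_rank : (densityMatrix C).rank = K

end Algebra

/-! ### The free Schrödinger group `U(t) = exp(i t Δ / 2)` -/

/-- The Fourier symbol of `exp(i t Δ / 2)`: with the convention
`𝓕 f(ξ) = ∫ f(x) exp(-2πi x·ξ) dx` the operator `Δ` has the symbol `-4π²|ξ|²`. -/
def symbol (t : ℝ) (ξ : E3) : ℂ :=
  Complex.exp (Complex.I * ((-(2 * Real.pi ^ 2 * t) * ‖ξ‖ ^ 2 : ℝ) : ℂ))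

theorem norm_symbol (t : ℝ) (ξ : E3) : ‖symbol t ξ‖ = 1 := by
  unfold symbol
  rw [mul_comm]
  exact Complex.norm_exp_ofReal_mul_I _

theorem continuous_symbol (t : ℝ) : Continuous (symbol t) := by
  unfold symbol
  fun_prop

theorem memLp_symbol_smul {F : Type} [NormedAddCommGroup F] [NormedSpace ℂ F] (t : ℝ) (f : L2 F) :
    MemLp (fun ξ => symbol t ξ • f ξ) 2 (volume : Measure E3) := by
  refine (Lp.memLp f).of_le
    ((continuous_symbol t).aestronglyMeasurable.smul (Lp.aestronglyMeasurable f)) ?_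
  filter_upwards with ξ
  rw [norm_smul, norm_symbol, one_mul]

/-- The symbol is smooth with derivatives of polynomial growth, so that Mathlib's Fourier
multipliers with this symbol have their intended meaning. -/
theorem hasTemperateGrowth_symbol (t : ℝ) : (symbol t).HasTemperateGrowth := by
  have key : ∀ n : ℕ, iteratedDeriv n (fun s : ℝ => Complex.exp (Complex.I * (s : ℂ))) =
      fun s : ℝ => Complex.I ^ n * Complex.exp (Complex.I * (s : ℂ)) := by
    intro n
    induction n with
    | zero => ext s; simp
    | succ n ih =>
      rw [iteratedDeriv_succ, ih]
      ext s
      have h : HasDerivAt (fun s : ℝ => Complex.I * (s : ℂ)) (Complex.I * 1) s :=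
        (Complex.ofRealCLM.hasDerivAt (x := s)).const_mul Complex.I
      rw [((h.cexp).const_mul (Complex.I ^ n)).deriv]
      ring
  have hexp : (fun s : ℝ => Complex.exp (Complex.I * (s : ℂ))).HasTemperateGrowth := by
    refine ⟨?_, fun n => ⟨0, 1, fun s => ?_⟩⟩
    · exact (contDiff_const.mul Complex.ofRealCLM.contDiff).cexp
    · rw [norm_iteratedFDeriv_eq_norm_iteratedDeriv, key n]
      have h1 : ‖Complex.exp (Complex.I * (s : ℂ))‖ = 1 := by
        rw [mul_comm]
        exact Complex.norm_exp_ofReal_mul_I s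
      simp [h1]
  have hin : (fun ξ : E3 => -(2 * Real.pi ^ 2 * t) * ‖ξ‖ ^ 2).HasTemperateGrowth :=
    (Function.HasTemperateGrowth.const _).mul (Function.hasTemperateGrowth_norm_sq E3)
  exact hexp.comp hin

/-- `U(t)` on `L²(ℝ³; F)`. -/
def freeFlow {F : Type} [NormedAddCommGroup F] [InnerProductSpace ℂ F] [CompleteSpace F]
    (t : ℝ) (f : L2 F) : L2 F :=
  𝓕⁻ (MemLp.toLp _ (memLp_symbol_smul t (𝓕 f)))

/-- `U(t)` on Schwartz functions. -/
def freeFlowSchwartz (t : ℝ) (g : 𝓢(E3, ℂ)) : 𝓢(E3, ℂ) :=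
  SchwartzMap.fourierMultiplierCLM ℂ (symbol t) g

/-- `u = ∫₀ᵗ U(t - s) F(s) ds` as an identity of tempered distributions on `ℝ³`: for every
Schwartz function `g` one has `⟨u, g⟩ = ∫₀ᵗ ⟨F(s), U(t - s) g⟩ ds`, where all the integrals
converge absolutely. (The pairing is bilinear and `U(t)` is its own transpose.) -/
def IsDuhamelIntegral {K : ℕ} (F : ℝ → E3 → Orb K) (t : ℝ) (u : E3 → Orb K) : Prop :=
  ∀ g : 𝓢(E3, ℂ),
    (∀ᵐ s ∂(volume.restrict (Set.Icc 0 t)),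
      Integrable (fun x => freeFlowSchwartz (t - s) g x • F s x) (volume : Measure E3)) ∧
    IntervalIntegrable (fun s => ∫ x : E3, freeFlowSchwartz (t - s) g x • F s x) volume 0 t ∧
    ∫ x : E3, g x • u x = ∫ s in (0 : ℝ)..t, ∫ x : E3, freeFlowSchwartz (t - s) g x • F s x

/-! ### Mixed norms and the solution space -/

/-- Lebesgue measure on `[0, T]`. -/
abbrev timeMeasure (T : ℝ) : Measure ℝ := volume.restrict (Set.Icc 0 T)

/-- The norm of `L^{p,q}_T = L^p([0, T]; L^q(ℝ³))`, possibly infinite. -/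
def mixedNorm {F : Type} [NormedAddCommGroup F] (p q : ℝ≥0∞) (T : ℝ) (u : ℝ → L2 F) : ℝ≥0∞ :=
  eLpNorm (fun t => eLpNorm (u t) q (volume : Measure E3)) p (timeMeasure T)

/-- Admissible pairs. -/
def Admissible (p q : ℝ) : Prop :=
  0 < p ∧ 2 / (3 * p) = 1 / 2 - 1 / q ∧ 2 ≤ q ∧ q < 6

/-- The Strichartz constant `ρ`: the least constant with
`‖U(·)φ‖_{L^{p,q}_T} ≤ ρ ‖φ‖_{L²}` for all `T > 0` and all `φ ∈ L²(ℝ³; ℂ)`. -/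
def strichartzConst (p q : ℝ) : ℝ≥0∞ :=
  sInf {ρ : ℝ≥0∞ | ∀ T : ℝ, 0 < T → ∀ φ : L2 ℂ,
    mixedNorm (.ofReal p) (.ofReal q) T (fun t => freeFlow t φ) ≤ ρ * ‖φ‖ₑ}

section Solutions

variable {N K : ℕ}

/-- The norm of `X^{p,q}_T = L^∞([0, T]; ℂ^r) × (L^{∞,2}_T ∩ L^{p,q}_T)`. -/
def xNorm (p q T : ℝ) (C : ℝ → Coeff N K) (Φ : ℝ → L2 (Orb K)) : ℝ≥0∞ :=
  eLpNorm C ∞ (timeMeasure T) + (mixedNorm ∞ 2 T Φ + mixedNorm (.ofReal p) (.ofReal q) T Φ)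

/-- Membership in `X^{p,q}_T`. -/
structure MemX (p q T : ℝ) (C : ℝ → Coeff N K) (Φ : ℝ → L2 (Orb K)) : Prop where
  coeff_meas : AEStronglyMeasurable C (timeMeasure T)
  orbital_meas : AEStronglyMeasurable Φ (timeMeasure T)
  norm_lt_top : xNorm p q T C Φ < ∞

/-- `(C, Φ) ∈ X^{p,q}_T` solves the integral formulation with data `(C⁰, Φ⁰)` on `[0, T]`.
The coefficients are represented by their continuous version, for which the first equation holds at
every time and `Γ[C(t)]` has to be invertible at every time; the second equation is an identity
in `L^∞([0, T]; L²)`, that is, for almost every time. -/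
structure IsSolution (p q T : ℝ) (U : E3 → ℝ) (V : ℝ → ℝ) (C₀ : Coeff N K) (Φ₀ : L2 (Orb K))
    (C : ℝ → Coeff N K) (Φ : ℝ → L2 (Orb K)) : Prop where
  mem : MemX p q T C Φ
  full_rank : ∀ t ∈ Set.Icc 0 T, IsUnit (densityMatrix (C t))
  coeff_integrable : IntervalIntegrable
    (fun s => Matrix.toEuclideanCLM (𝕜 := ℂ) (kMatrix V (Φ s)) (C s)) volume 0 T
  coeff_eq : ∀ t ∈ Set.Icc 0 T, C t = C₀ - Complex.I •
    ∫ s in (0 : ℝ)..t, Matrix.toEuclideanCLM (𝕜 := ℂ) (kMatrix V (Φ s)) (C s)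
  orbital_eq : ∀ᵐ t ∂(timeMeasure T), ∃ u : L2 (Orb K),
    IsDuhamelIntegral (fun s => forcing U V (C s) (Φ s)) t u ∧
      Φ t = freeFlow t Φ₀ - Complex.I • u

end Solutions

end

end MCTDHF

/-! The proof is a contraction argument in $X^{p,q}_T$ that rests on Strichartz estimates. The
choice $q=2d/(d-1)$ gives $1/d+2/q=1$, so that multiplication by an $L^d$ potential maps $L^q$ to
$L^{q'}$, and admissibility then forces $p=4d/3>2$. This inequality is the subcriticality on which
everything depends: the decay $|t|^{-2/p}$ of $\mathbf U(t):L^{q'}\to L^q$ is integrable near $t=0$,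
and Hölder's inequality in time from $L^p$ to $L^{p'}$ gains the factor $T^{1-2/p}$.

Linear theory. A Gaussian regularization of the Fourier symbol gives $L^1\to L^\infty$ decay, and
interpolation with the $L^2$ isometry gives `exists_eLpNorm_freeFlow_le`. The $TT^*$ argument with
the one-dimensional Hardy-Littlewood-Sobolev inequality yields the homogeneous estimate and
$\rho(p)<\infty$. For the Duhamel term (`exists_duhamel_estimate`) no inhomogeneous Strichartz
estimate is required: since the force is $L^p$ in time, Young's inequality with the kernel
$|t-s|^{-2/p}$ on a finite interval is enough.

Nonlinearity. The force is never treated as an element of a function space; it is only tested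
against functions $h\in L^2\cap L^q$. The terms with $U$ and $\mathbb W$ act on $h$ with the bound
$\|\Phi\|_{L^q}\|h\|_{L^q}$ up to constants. The projected term is a combination of the orbitals
with scalar coefficients, so it is an element of $L^2$ of size $\|\Phi\|_{L^q}^2$. These bounds for
the interaction, and the one for $\mathbb K[\Phi]$, come from one estimate of the quartic form: the
two functions of $x$ are placed in $L^q$ and the two functions of $y$ in $L^2$
(`lintegral_quart_le`).

Density matrix. The normalized $C$ with $\|\Gamma[C]^{-1}\|\le\theta$ lie in a compact set of
coefficients with invertible $\Gamma$. A closed $\delta$-neighbourhood of it still has this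
property, and there the coefficients of the cubic terms are bounded and Lipschitz with constants
that depend only on $N,K,\theta$ (`exists_isCoeffBound`). Hence the existence time is uniform.

Conclusion. Everything nonlinear is concentrated in `exists_image_sub_le`, an estimate for the
difference of the images of two curves under the integral equations. Comparison with vanishing
orbitals makes it the self-map property of a ball; applied to two curves in the ball it gives the
contraction and the Lipschitz dependence on the data. Uniqueness is claimed among all solutions and
not only inside the ball. It is obtained by comparing two solutions on successive short intervals,
which is why the difference estimate allows for curves that already agree up to a time $t_0$ and
gains a power of $T-t_0$. -/

namespace MCTDHF

open scoped SchwartzMap ComplexConjugate FourierTransform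

noncomputable section

/-! ### Minkowski's integral inequality and approximation by Schwartz functions -/

section

/-- **Minkowski's integral inequality**, for the exponent `p > 1` and with prescribed majorants of
the inner norms, measurable version. -/
theorem lintegral_lintegral_rpow_le_of_measurable {α β : Type*} [MeasurableSpace α]
    [MeasurableSpace β] {μ : Measure α} {ν : Measure β} [SFinite μ] [SFinite ν] {p : ℝ} (hp : 1 < p)
    {f : α → β → ℝ≥0∞} (hf : Measurable (Function.uncurry f)) {w : β → ℝ≥0∞} (hw : Measurable w)
    (h : ∀ᵐ s ∂ν, ∫⁻ t, f t s ^ p ∂μ ≤ w s ^ p) :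
    ∫⁻ t, (∫⁻ s, f t s ∂ν) ^ p ∂μ ≤ (∫⁻ s, w s ∂ν) ^ p := by
  have hp0 : 0 < p := by linarith
  by_cases hfin : ∫⁻ s, w s ∂ν = ∞
  · rw [hfin, ENNReal.top_rpow_of_pos hp0]; exact le_top
  have hwfin : ∀ᵐ s ∂ν, w s < ∞ := ae_lt_top hw hfin
  have hpq : p.HolderConjugate p.conjExponent := .conjExponent hp
  set q := p.conjExponent with hq
  have hq0 : 0 < q := hpq.symm.pos
  have hfs : ∀ s, Measurable fun t => f t s := fun s => hf.comp measurable_prodMk_right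
  -- Where `w s = 0` the hypothesis forces `f t s = 0` for almost every `t`; elsewhere `w s` is
  -- finite and non-zero, so the negative powers of `w` below cancel correctly.
  have hgood : ∀ᵐ t ∂μ, ∀ᵐ s ∂ν, (w s ≠ 0 ∧ w s ≠ ∞) ∨ f t s = 0 := by
    have hm : MeasurableSet {x : α × β | (w x.2 ≠ 0 ∧ w x.2 ≠ ∞) ∨ f x.1 x.2 = 0} := by
      refine MeasurableSet.union (MeasurableSet.inter ?_ ?_) ?_
      · exact ((measurableSet_singleton (0 : ℝ≥0∞)).preimage (hw.comp measurable_snd)).compl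
      · exact ((measurableSet_singleton ∞).preimage (hw.comp measurable_snd)).compl
      · exact (measurableSet_singleton (0 : ℝ≥0∞)).preimage hf
    rw [Measure.ae_ae_comm hm]
    filter_upwards [h, hwfin] with s hs hs'
    by_cases h0 : w s = 0
    · rw [h0, ENNReal.zero_rpow_of_pos hp0, nonpos_iff_eq_zero,
        lintegral_eq_zero_iff ((hfs s).pow_const p)] at hs
      filter_upwards [hs] with t ht
      exact .inr (by simpa [hp0.le, not_lt.2 hp0.le, hp0] using ht)
    · exact .of_forall fun t => .inl ⟨h0, hs'.ne⟩
  -- Hölder's inequality in `s` for the factorization `w^(1/q) · (w^(-1/q) f)` with `q` conjugate to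
  -- `p`. Since `p/q = p - 1`, interchanging the integrals leaves `w^(-(p-1)) · w^p = w`.
  calc ∫⁻ t, (∫⁻ s, f t s ∂ν) ^ p ∂μ
      ≤ ∫⁻ t, (∫⁻ s, w s ∂ν) ^ (p - 1) * ∫⁻ s, w s ^ (-(p - 1)) * f t s ^ p ∂ν ∂μ := by
        refine lintegral_mono_ae ?_
        filter_upwards [hgood] with t ht
        have h1 : ∫⁻ s, f t s ∂ν ≤ ∫⁻ s, (fun s => w s ^ (1 / q)) s *
            (fun s => w s ^ (-(1 / q)) * f t s) s ∂ν := by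
          refine lintegral_mono_ae ?_
          filter_upwards [ht] with s hs
          rcases hs with hs | hs
          · rw [← mul_assoc, ← ENNReal.rpow_add _ _ hs.1 hs.2, add_neg_cancel, ENNReal.rpow_zero,
              one_mul]
          · rw [hs]; exact zero_le
        have hft : Measurable (f t) := hf.comp measurable_prodMk_left
        have h2 := ENNReal.lintegral_mul_le_Lp_mul_Lq ν hpq.symm
          (f := fun s => w s ^ (1 / q)) (g := fun s => w s ^ (-(1 / q)) * f t s)
          (hw.pow_const _).aemeasurable ((hw.pow_const _).mul hft).aemeasurable
        refine (ENNReal.rpow_le_rpow (h1.trans h2) hp0.le).trans (le_of_eq ?_)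
        rw [ENNReal.mul_rpow_of_nonneg _ _ hp0.le, ← ENNReal.rpow_mul, ← ENNReal.rpow_mul]
        have e1 : 1 / q * p = p - 1 := by
          have := hpq.sub_one_mul_conj
          field_simp; linarith
        have e2 : 1 / p * p = 1 := by field_simp
        rw [e1, e2, ENNReal.rpow_one]
        congr 1
        · congr 1
          refine lintegral_congr fun s => ?_
          rw [← ENNReal.rpow_mul, one_div_mul_cancel hq0.ne', ENNReal.rpow_one]
        · refine lintegral_congr fun s => ?_
          rw [ENNReal.mul_rpow_of_nonneg _ _ hp0.le, ← ENNReal.rpow_mul, neg_mul, e1]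
    _ = (∫⁻ s, w s ∂ν) ^ (p - 1) * ∫⁻ s, w s ^ (-(p - 1)) * ∫⁻ t, f t s ^ p ∂μ ∂ν := by
        rw [lintegral_const_mul', lintegral_lintegral_swap]
        · congr 1
          refine lintegral_congr fun s => ?_
          rw [lintegral_const_mul _ ((hfs s).pow_const p)]
        · exact (((hw.comp measurable_snd).pow_const _).mul (hf.pow_const p)).aemeasurable
        · exact ENNReal.rpow_ne_top_of_nonneg (by linarith) hfin
    _ ≤ (∫⁻ s, w s ∂ν) ^ (p - 1) * ∫⁻ s, w s ∂ν := by
        gcongr 1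
        refine lintegral_mono_ae ?_
        filter_upwards [h, hwfin] with s hs hs'
        calc w s ^ (-(p - 1)) * ∫⁻ t, f t s ^ p ∂μ ≤ w s ^ (-(p - 1)) * w s ^ p := by gcongr
          _ ≤ w s := by
            by_cases h0 : w s = 0
            · rw [h0, ENNReal.zero_rpow_of_pos hp0, mul_zero]
            · rw [← ENNReal.rpow_add _ _ h0 hs'.ne, show -(p - 1) + p = 1 by ring,
                ENNReal.rpow_one]
    _ = (∫⁻ s, w s ∂ν) ^ p := by
        nth_rw 2 [← ENNReal.rpow_one (∫⁻ s, w s ∂ν)]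
        rw [← ENNReal.rpow_add_of_nonneg _ _ (by linarith) zero_le_one]
        congr 1; ring

/-- **Minkowski's integral inequality**, for the exponent `p > 1` and with prescribed majorants of
the inner norms. -/
theorem lintegral_lintegral_rpow_le {α β : Type*} [MeasurableSpace α]
    [MeasurableSpace β] {μ : Measure α} {ν : Measure β} [SFinite μ] [SFinite ν] {p : ℝ} (hp : 1 < p)
    {f : α → β → ℝ≥0∞} (hf : AEMeasurable (Function.uncurry f) (μ.prod ν)) {w : β → ℝ≥0∞}
    (hw : AEMeasurable w ν) (h : ∀ᵐ s ∂ν, ∫⁻ t, f t s ^ p ∂μ ≤ w s ^ p) :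
    ∫⁻ t, (∫⁻ s, f t s ∂ν) ^ p ∂μ ≤ (∫⁻ s, w s ∂ν) ^ p := by
  have h1 : ∀ᵐ t ∂μ, ∀ᵐ s ∂ν, f t s = hf.mk _ (t, s) :=
    Measure.ae_ae_of_ae_prod hf.ae_eq_mk
  have h2 : ∀ᵐ s ∂ν, ∀ᵐ t ∂μ, f t s = hf.mk _ (t, s) :=
    Measure.ae_ae_of_ae_prod ((Measure.measurePreserving_swap (μ := ν)
      (ν := μ)).quasiMeasurePreserving.tendsto_ae.eventually hf.ae_eq_mk)
  have key := lintegral_lintegral_rpow_le_of_measurable (μ := μ) (ν := ν) hp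
    (f := fun t s => hf.mk _ (t, s)) hf.measurable_mk hw.measurable_mk (by
      filter_upwards [h, h2, hw.ae_eq_mk] with s hs h2s hws
      rw [← hws]
      refine le_trans (le_of_eq (lintegral_congr_ae ?_)) hs
      filter_upwards [h2s] with t ht
      rw [ht])
  rw [lintegral_congr_ae hw.ae_eq_mk]
  refine le_trans (le_of_eq (lintegral_congr_ae ?_)) key
  filter_upwards [h1] with t ht
  rw [lintegral_congr_ae ht]

/-- Truncation to a large ball is a good approximation in `L^r`. -/
theorem exists_eLpNorm_indicator_compl_closedBall_le {F : Type*} [NormedAddCommGroup F] {f : E3 → F}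
    {r : ℝ≥0∞} (hr : r ≠ ∞) (hr0 : r ≠ 0) (hf : MemLp f r volume) {ε : ℝ≥0∞} (hε : ε ≠ 0) :
    ∃ R₀ : ℝ, ∀ R ≥ R₀, eLpNorm ((Metric.closedBall 0 R)ᶜ.indicator f) r volume ≤ ε := by
  have hr' : 0 < r.toReal := ENNReal.toReal_pos hr0 hr
  have key : Filter.Tendsto
      (fun R : ℝ => ∫⁻ x, ‖(Metric.closedBall (0 : E3) R)ᶜ.indicator f x‖ₑ ^ r.toReal)
      Filter.atTop (nhds (∫⁻ x : E3, 0)) := by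
    refine tendsto_lintegral_filter_of_dominated_convergence' (fun x => ‖f x‖ₑ ^ r.toReal)
      (.of_forall fun R => ?_) (.of_forall fun R => .of_forall fun x => ?_) ?_ ?_
    · exact ((hf.1.indicator Metric.isClosed_closedBall.measurableSet.compl).enorm).pow_const _
    · gcongr
      exact enorm_indicator_le_enorm_self f x
    · exact (lintegral_rpow_enorm_lt_top_of_eLpNorm_lt_top hr0 hr hf.2).ne
    · refine .of_forall fun x => ?_
      refine tendsto_const_nhds.congr' ?_
      filter_upwards [Filter.eventually_ge_atTop ‖x‖] with R hR
      rw [Set.indicator_of_notMem (by simpa using hR), enorm_zero, ENNReal.zero_rpow_of_pos hr']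
  rw [lintegral_zero] at key
  by_cases hεt : ε = ∞
  · exact ⟨0, fun R _ => hεt ▸ le_top⟩
  have hε' : 0 < ε ^ r.toReal := ENNReal.rpow_pos (pos_iff_ne_zero.2 hε) hεt
  obtain ⟨R₀, hR₀⟩ := Filter.eventually_atTop.1 (key.eventually_lt_const hε')
  refine ⟨R₀, fun R hR => ?_⟩
  rw [eLpNorm_eq_lintegral_rpow_enorm_toReal hr0 hr]
  refine (ENNReal.rpow_le_rpow (hR₀ R hR).le (by positivity)).trans (le_of_eq ?_)
  rw [← ENNReal.rpow_mul, mul_one_div_cancel hr'.ne', ENNReal.rpow_one]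

/-- Schwartz functions are dense in `L² ∩ L^r`. -/
theorem exists_schwartz_eLpNorm_sub_le {f : E3 → ℂ} {r : ℝ≥0∞} (hr1 : 1 ≤ r) (hr2 : r ≤ 2)
    (hf2 : MemLp f 2 volume) (hfr : MemLp f r volume) {ε : ℝ≥0∞} (hε : ε ≠ 0) :
    ∃ g : 𝓢(E3, ℂ), eLpNorm (fun x => f x - g x) 2 volume ≤ ε ∧
      eLpNorm (fun x => f x - g x) r volume ≤ ε := by
  have hrt : r ≠ ∞ := ne_top_of_le_ne_top ENNReal.ofNat_ne_top hr2
  have hr0 : r ≠ 0 := (zero_lt_one.trans_le hr1).ne'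
  have hε2 : ε / 2 ≠ 0 := by simpa using hε
  obtain ⟨R₁, hR₁⟩ := exists_eLpNorm_indicator_compl_closedBall_le ENNReal.ofNat_ne_top two_ne_zero
    hf2 hε2
  obtain ⟨R₂, hR₂⟩ := exists_eLpNorm_indicator_compl_closedBall_le hrt hr0 hfr hε2
  set R : ℝ := max (max R₁ R₂) 1 with hR
  have hRpos : 0 < R := lt_of_lt_of_le one_pos (le_max_right _ _)
  -- The approximation is `χ g₀` with `g₀` close to `f` in `L²`. The error is `(1 - χ) f`, small by
  -- the choice of `R` in both norms, plus `χ (f - g₀)`, which lives on a bounded set, where `r ≤ 2`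
  -- lets the `L²` norm control the `L^r` norm.
  let χ : ContDiffBump (0 : E3) := ⟨R, R + 1, hRpos, by linarith⟩
  set B : Set E3 := Metric.closedBall 0 (R + 1) with hB
  have hBm : MeasurableSet B := Metric.isClosed_closedBall.measurableSet
  have hBfin : volume B ≠ ∞ := (isCompact_closedBall _ _).measure_ne_top
  -- The constant of the inclusion of `L²(B)` in `L^r(B)`. The accuracy `η` below satisfies `η (c +
  -- 1) ≤ ε / 2`, which serves both norms at once.
  set c : ℝ≥0∞ := (volume.restrict B) Set.univ ^ (1 / r.toReal - 1 / (2 : ℝ≥0∞).toReal) with hc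
  have hexp : 0 ≤ 1 / r.toReal - 1 / (2 : ℝ≥0∞).toReal := by
    rw [sub_nonneg]
    exact one_div_le_one_div_of_le (ENNReal.toReal_pos hr0 hrt)
      (ENNReal.toReal_mono ENNReal.ofNat_ne_top hr2)
  have hct : c ≠ ∞ := by
    rw [hc]
    refine ENNReal.rpow_ne_top_of_nonneg hexp ?_
    rwa [Measure.restrict_apply_univ]
  set η : ℝ≥0∞ := min 1 (ε / 2 / (c + 1)) with hη
  have hη0 : η ≠ 0 := by
    rw [hη, ← pos_iff_ne_zero, lt_min_iff]
    exact ⟨one_pos, ENNReal.div_pos hε2 (by simp [hct])⟩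
  have hηt : η ≠ ∞ := ne_top_of_le_ne_top ENNReal.one_ne_top (min_le_left _ _)
  have hη1 : η * (c + 1) ≤ ε / 2 := by
    have := min_le_right 1 (ε / 2 / (c + 1))
    rwa [← hη, ENNReal.le_div_iff_mul_le (by simp) (by simp [hct])] at this
  obtain ⟨g₀, hg1, hg2, hg3⟩ := MemLp.exist_eLpNorm_sub_le ENNReal.ofNat_ne_top
    (by norm_num : (1 : ℝ≥0∞) ≤ 2) hf2 (ε := η.toReal) (ENNReal.toReal_pos hη0 hηt)
  rw [ENNReal.ofReal_toReal hηt] at hg3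
  have hsupp : HasCompactSupport (fun x => (χ x : ℂ) * g₀ x) := hg1.mul_left
  have hsm : ContDiff ℝ ((⊤ : ℕ∞) : WithTop ℕ∞) (fun x => (χ x : ℂ) * g₀ x) :=
    (Complex.ofRealCLM.contDiff.comp χ.contDiff).mul hg2
  have hsplit : (fun x => f x - (χ x : ℂ) * g₀ x) =
      (fun x => ((1 - χ x : ℝ) : ℂ) * f x) + fun x => (χ x : ℂ) * (f x - g₀ x) := by
    ext x; simp; ring
  have hχc : Continuous χ := χ.continuous
  have part1 : ∀ s : ℝ≥0∞, eLpNorm ((Metric.closedBall 0 R)ᶜ.indicator f) s volume ≤ ε / 2 →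
      eLpNorm (fun x => ((1 - χ x : ℝ) : ℂ) * f x) s volume ≤ ε / 2 := by
    intro s hs
    refine le_trans (eLpNorm_mono fun x => ?_) hs
    by_cases hx : x ∈ Metric.closedBall (0 : E3) R
    · rw [χ.one_of_mem_closedBall hx]; simp
    · rw [Set.indicator_of_mem (by exact hx), norm_mul, Complex.norm_real]
      refine mul_le_of_le_one_left (norm_nonneg _) ?_
      rw [Real.norm_of_nonneg (sub_nonneg.2 χ.le_one)]
      linarith [χ.nonneg (x := x)]
  have hdm : AEStronglyMeasurable (fun x => f x - g₀ x) volume :=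
    hf2.1.sub hg2.continuous.aestronglyMeasurable
  have part2 : eLpNorm (fun x => (χ x : ℂ) * (f x - g₀ x)) 2 volume ≤ ε / 2 := by
    refine le_trans (eLpNorm_mono (g := fun x => f x - g₀ x) fun x => ?_) (hg3.trans ?_)
    · rw [norm_mul, Complex.norm_real, Real.norm_of_nonneg χ.nonneg]
      exact mul_le_of_le_one_left (norm_nonneg _) χ.le_one
    · refine le_trans ?_ hη1
      exact le_mul_of_one_le_right' le_add_self
  have part3 : eLpNorm (fun x => (χ x : ℂ) * (f x - g₀ x)) r volume ≤ ε / 2 := by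
    have e1 : eLpNorm (fun x => (χ x : ℂ) * (f x - g₀ x)) r volume ≤
        eLpNorm (B.indicator fun x => (f x - g₀ x)) r volume := by
      refine eLpNorm_mono fun x => ?_
      by_cases hx : x ∈ B
      · rw [Set.indicator_of_mem hx, norm_mul, Complex.norm_real, Real.norm_of_nonneg χ.nonneg]
        exact mul_le_of_le_one_left (norm_nonneg _) χ.le_one
      · rw [χ.zero_of_le_dist (not_le.1 (fun h => hx (Metric.mem_closedBall.2 h))).le]; simp
    refine e1.trans ?_
    rw [eLpNorm_indicator_eq_eLpNorm_restrict hBm]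
    refine (eLpNorm_le_eLpNorm_mul_rpow_measure_univ hr2 hdm.restrict).trans ?_
    refine le_trans ?_ hη1
    gcongr
    · exact (eLpNorm_mono_measure _ Measure.restrict_le_self).trans hg3
    · exact le_self_add
  have hm1 : AEStronglyMeasurable (fun x => ((1 - χ x : ℝ) : ℂ) * f x) volume :=
    (by fun_prop : Continuous fun x => ((1 - χ x : ℝ) : ℂ)).aestronglyMeasurable.mul hf2.1
  have hm2 : AEStronglyMeasurable (fun x => (χ x : ℂ) * (f x - g₀ x)) volume :=
    (by fun_prop : Continuous fun x => (χ x : ℂ)).aestronglyMeasurable.mul hdm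
  refine ⟨hsupp.toSchwartzMap hsm, ?_, ?_⟩
  · change eLpNorm (fun x => f x - (χ x : ℂ) * g₀ x) 2 volume ≤ ε
    rw [hsplit]
    refine (eLpNorm_add_le hm1 hm2 (by norm_num)).trans ?_
    rw [← ENNReal.add_halves ε]
    exact add_le_add (part1 2 (hR₁ R ((le_max_left _ _).trans (le_max_left _ _)))) part2
  · change eLpNorm (fun x => f x - (χ x : ℂ) * g₀ x) r volume ≤ ε
    rw [hsplit]
    refine (eLpNorm_add_le hm1 hm2 hr1).trans ?_
    rw [← ENNReal.add_halves ε]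
    exact add_le_add (part1 r (hR₂ R ((le_max_right _ _).trans (le_max_left _ _)))) part3

end

/-! ### The `L^q` norm on `L²`: lower semicontinuity and duality -/

section

/-- The `L^q` norm is a lower semicontinuous function on `L²`. -/
theorem lowerSemicontinuous_eLpNorm {F : Type} [NormedAddCommGroup F] (q : ℝ≥0∞) :
    LowerSemicontinuous fun f : L2 F => eLpNorm f q (volume : Measure E3) := by
  rw [lowerSemicontinuous_iff_isClosed_preimage]
  intro c
  refine IsSeqClosed.isClosed fun f g hf hfg => ?_
  have h1 : TendstoInMeasure volume (fun n => (f n : E3 → F)) Filter.atTop g :=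
    tendstoInMeasure_of_tendsto_Lp hfg
  obtain ⟨ns, -, hns⟩ := h1.exists_seq_tendsto_ae
  refine (Lp.eLpNorm_lim_le_liminf_eLpNorm (f := fun n => (f (ns n) : E3 → F))
    (fun n => Lp.aestronglyMeasurable _) g hns).trans ?_
  refine Filter.liminf_le_of_le (by isBoundedDefault) fun b hb => ?_
  obtain ⟨n, hn⟩ := hb.exists
  exact hn.trans (hf (ns n))

/-- A lower semicontinuous function is Borel, so the mixed norm of a measurable curve in `L²` is an
integral of a measurable function of time without any choice of a representative on space-time. -/
theorem aemeasurable_eLpNorm {F : Type} [NormedAddCommGroup F] (q : ℝ≥0∞) {α : Type*}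
    [MeasurableSpace α] {μ : Measure α} {u : α → L2 F} (hu : AEStronglyMeasurable u μ) :
    AEMeasurable (fun t => eLpNorm (u t) q (volume : Measure E3)) μ := by
  borelize (L2 F)
  exact (lowerSemicontinuous_eLpNorm q).measurable.comp_aemeasurable hu.aemeasurable

/-- An `L²` function that defines a bounded functional on Schwartz functions for the `L^{q'}` norm
is in `L^q`. -/
theorem eLpNorm_le_of_schwartz_pairing {v : L2 ℂ} {q q' : ℝ} (hq : 2 < q)
    (hqq : q.HolderConjugate q') {M : ℝ≥0∞} (hM : M ≠ ∞)
    (h : ∀ g : 𝓢(E3, ℂ), ‖∫ x, g x * v x‖ₑ ≤ M * eLpNorm g (.ofReal q') volume) :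
    eLpNorm v (.ofReal q) volume ≤ M := by
  have hq0 : 0 < q := by linarith
  have hq'0 : 0 < q' := hqq.symm.pos
  have hq'1 : 1 ≤ q' := hqq.symm.lt.le
  have hq'2 : q' ≤ 2 := by
    rw [hqq.conjugate_eq, div_le_iff₀ (by linarith)]; linarith
  have hv := Lp.memLp v
  -- The bound extends from Schwartz functions to `L² ∩ L^{q'}`: the approximation is simultaneous
  -- in both norms, the `L²` norm controlling the pairing and the `L^{q'}` norm the right-hand side.
  have ext : ∀ f : E3 → ℂ, MemLp f 2 volume → MemLp f (.ofReal q') volume →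
      ‖∫ x, f x * v x‖ₑ ≤ M * eLpNorm f (.ofReal q') volume := by
    intro f hf2 hfq
    refine ENNReal.le_of_forall_pos_le_add fun ε hε _ => ?_
    set K : ℝ≥0∞ := eLpNorm v 2 volume + M + 1 with hK
    have hKt : K ≠ ∞ := by simp [hK, hv.2.ne, hM]
    have hK0 : K ≠ 0 := by simp [hK]
    have hε' : (ε : ℝ≥0∞) / K ≠ 0 := (ENNReal.div_pos (by simpa using hε.ne') hKt).ne'
    obtain ⟨g, hg2, hgq⟩ := exists_schwartz_eLpNorm_sub_le (r := .ofReal q')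
      (by simpa using hq'1) (by simpa using ENNReal.ofReal_le_ofReal hq'2) hf2 hfq hε'
    have hgm := g.memLp 2 (volume : Measure E3)
    have i1 : Integrable (fun x => (f x - g x) * v x) volume := (hf2.sub hgm).integrable_mul hv
    have i2 : Integrable (fun x => g x * v x) volume := hgm.integrable_mul hv
    have e1 : ∫ x, f x * v x = (∫ x, (f x - g x) * v x) + ∫ x, g x * v x := by
      rw [← integral_add i1 i2]; congr 1; ext x; ring
    have e2 : ‖∫ x, (f x - g x) * v x‖ₑ ≤ ε / K * eLpNorm v 2 volume := by
      refine (enorm_integral_le_lintegral_enorm _).trans ?_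
      rw [← eLpNorm_one_eq_lintegral_enorm]
      refine (eLpNorm_smul_le_mul_eLpNorm (p := 2) (q := 2) hv.1 (hf2.sub hgm).1).trans ?_
      gcongr
      exact hg2
    have e3 : eLpNorm g (.ofReal q') volume ≤ ε / K + eLpNorm f (.ofReal q') volume := by
      have : (g : E3 → ℂ) = (fun x => g x - f x) + f := by ext x; simp
      conv_lhs => rw [this]
      refine (eLpNorm_add_le (g.continuous.aestronglyMeasurable.sub hfq.1) hfq.1
        (by simpa using hq'1)).trans ?_
      gcongr
      refine le_trans (le_of_eq ?_) hgq
      exact eLpNorm_congr_norm_ae (.of_forall fun x => norm_sub_rev _ _)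
    calc ‖∫ x, f x * v x‖ₑ ≤ ε / K * eLpNorm v 2 volume + M * eLpNorm g (.ofReal q') volume := by
          rw [e1]; exact (enorm_add_le _ _).trans (add_le_add e2 (h g))
      _ ≤ ε / K * eLpNorm v 2 volume + M * (ε / K + eLpNorm f (.ofReal q') volume) := by gcongr
      _ = M * eLpNorm f (.ofReal q') volume + ε / K * (eLpNorm v 2 volume + M) := by ring
      _ ≤ M * eLpNorm f (.ofReal q') volume + ε / K * K := by
          gcongr; exact le_self_add
      _ = M * eLpNorm f (.ofReal q') volume + ε := by rw [ENNReal.div_mul_cancel hK0 hKt]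
  obtain ⟨v', hv'm, hv'e⟩ := hv.1
  have hv'2 : MemLp v' 2 volume := hv.ae_eq hv'e
  have ext' : ∀ f : E3 → ℂ, MemLp f 2 volume → MemLp f (.ofReal q') volume →
      ‖∫ x, f x * v' x‖ₑ ≤ M * eLpNorm f (.ofReal q') volume := by
    intro f hf2 hfq
    rw [← integral_congr_ae (f := fun x => f x * v x)]
    · exact ext f hf2 hfq
    · filter_upwards [hv'e] with x hx; rw [hx]
  rw [eLpNorm_congr_ae hv'e]
  have hmeas : Measurable v' := hv'm.measurable
  -- On `E n` the function is bounded by `n`, so that the integral of `|v'|^q` over it is at most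
  -- `n^(q-2)` times the square of the `L²` norm. Its finiteness permits the division below.
  set E : ℕ → Set E3 := fun n => {x | ‖v' x‖ ≤ n} with hE
  have hEm : ∀ n, MeasurableSet (E n) := fun n => measurableSet_le hmeas.norm measurable_const
  set I : ℕ → ℝ≥0∞ := fun n => ∫⁻ x in E n, ‖v' x‖ₑ ^ q with hI
  have hq2 : 0 < q - 2 := by linarith
  have hIfin : ∀ n, I n ≠ ∞ := by
    intro n
    have h2 : ∫⁻ x, ‖v' x‖ₑ ^ (2 : ℝ) < ∞ := by
      have := lintegral_rpow_enorm_lt_top_of_eLpNorm_lt_top two_ne_zero ENNReal.ofNat_ne_top hv'2.2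
      simpa using this
    have h3 : I n ≤ (n : ℝ≥0∞) ^ (q - 2) * ∫⁻ x, ‖v' x‖ₑ ^ (2 : ℝ) := by
      rw [← lintegral_const_mul' _ _ (ENNReal.rpow_ne_top_of_nonneg hq2.le (by simp))]
      refine le_trans (setLIntegral_mono' (hEm n) fun x hx => ?_) (setLIntegral_le_lintegral _ _)
      have hx' : ‖v' x‖ₑ ≤ n := by
        rw [← ofReal_norm]
        exact ENNReal.ofReal_le_of_le_toReal (by rw [ENNReal.toReal_natCast]; exact hx)
      calc ‖v' x‖ₑ ^ q = ‖v' x‖ₑ ^ (q - 2) * ‖v' x‖ₑ ^ (2 : ℝ) := by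
            rw [← ENNReal.rpow_add_of_nonneg _ _ hq2.le zero_le_two]; congr 1; ring
        _ ≤ _ := by gcongr
    exact ne_top_of_le_ne_top (ENNReal.mul_ne_top
      (ENNReal.rpow_ne_top_of_nonneg hq2.le (by simp)) h2.ne) h3
  have hbound : ∀ n, I n ≤ M ^ q := by
    intro n
    -- The extremal function of Hölder's inequality, cut off to `E n`: there `f v'` and `|f|^{q'}`
    -- both equal `|v'|^q`, so the bound becomes `I n ≤ M (I n)^(1/q')`.
    set f : E3 → ℂ := (E n).indicator fun x => ((‖v' x‖ ^ (q - 2) : ℝ) : ℂ) * conj (v' x) with hf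
    have hfm : Measurable f := by
      refine Measurable.indicator ?_ (hEm n)
      have h1 : Measurable fun x => ‖v' x‖ ^ (q - 2) := hmeas.norm.pow_const _
      exact (Complex.measurable_ofReal.comp h1).mul (Complex.continuous_conj.measurable.comp hmeas)
    have hfn : ∀ x, ‖f x‖ₑ = (E n).indicator (fun x => ‖v' x‖ₑ ^ (q - 1)) x := by
      intro x
      by_cases hx : x ∈ E n
      · rw [hf, Set.indicator_of_mem hx, Set.indicator_of_mem hx, enorm_mul, RCLike.enorm_conj,
          ← ofReal_norm, Complex.norm_real, Real.norm_of_nonneg (by positivity),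
          ← ENNReal.ofReal_rpow_of_nonneg (norm_nonneg _) hq2.le, ofReal_norm]
        nth_rw 2 [← ENNReal.rpow_one ‖v' x‖ₑ]
        rw [← ENNReal.rpow_add_of_nonneg _ _ hq2.le zero_le_one]
        congr 1; ring
      · rw [hf, Set.indicator_of_notMem hx, Set.indicator_of_notMem hx, enorm_zero]
    have hf2 : MemLp f 2 volume := by
      refine hv'2.of_le_mul (c := (n : ℝ) ^ (q - 2)) hfm.aestronglyMeasurable
        (.of_forall fun x => ?_)
      by_cases hx : x ∈ E n
      · rw [hf, Set.indicator_of_mem hx, norm_mul, RCLike.norm_conj, Complex.norm_real,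
          Real.norm_of_nonneg (by positivity)]
        gcongr
        exact hx
      · rw [hf, Set.indicator_of_notMem hx, norm_zero]; positivity
    have hq1q : (q - 1) * q' = q := hqq.sub_one_mul_conj
    have hnorm : eLpNorm f (.ofReal q') volume = I n ^ (1 / q') := by
      rw [eLpNorm_eq_lintegral_rpow_enorm_toReal (by simpa using hq'0) ENNReal.ofReal_ne_top,
        ENNReal.toReal_ofReal hq'0.le]
      congr 1
      change _ = ∫⁻ x in E n, ‖v' x‖ₑ ^ q
      rw [← lintegral_indicator (hEm n)]
      refine lintegral_congr fun x => ?_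
      rw [hfn]
      by_cases hx : x ∈ E n
      · rw [Set.indicator_of_mem hx, Set.indicator_of_mem hx, ← ENNReal.rpow_mul, hq1q]
      · rw [Set.indicator_of_notMem hx, Set.indicator_of_notMem hx, ENNReal.zero_rpow_of_pos hq'0]
    have hfq : MemLp f (.ofReal q') volume :=
      ⟨hfm.aestronglyMeasurable, by
        rw [hnorm]; exact ENNReal.rpow_lt_top_of_nonneg (by positivity) (hIfin n)⟩
    have hint : ‖∫ x, f x * v' x‖ₑ = I n := by
      have e0 : ∀ x, f x * v' x = (((E n).indicator (fun x => ‖v' x‖ ^ q) x : ℝ) : ℂ) := by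
        intro x
        by_cases hx : x ∈ E n
        · rw [hf, Set.indicator_of_mem hx, Set.indicator_of_mem hx, mul_assoc, Complex.conj_mul',
            ← Complex.ofReal_pow, ← Complex.ofReal_mul]
          congr 1
          rcases eq_or_ne (‖v' x‖) 0 with h0 | h0
          · rw [h0, Real.zero_rpow hq0.ne']; simp
          · rw [← Real.rpow_natCast, ← Real.rpow_add (lt_of_le_of_ne (norm_nonneg _) h0.symm)]
            congr 1; push_cast; ring
        · rw [hf, Set.indicator_of_notMem hx, Set.indicator_of_notMem hx]; simp
      have hnn : ∀ x, 0 ≤ (E n).indicator (fun x => ‖v' x‖ ^ q) x := fun x =>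
        Set.indicator_nonneg (fun x _ => by positivity) x
      simp_rw [e0]
      rw [integral_complex_ofReal, ← ofReal_norm, Complex.norm_real,
        Real.norm_of_nonneg (integral_nonneg hnn), ofReal_integral_eq_lintegral_ofReal]
      · change _ = ∫⁻ x in E n, ‖v' x‖ₑ ^ q
        rw [← lintegral_indicator (hEm n)]
        refine lintegral_congr fun x => ?_
        by_cases hx : x ∈ E n
        · rw [Set.indicator_of_mem hx, Set.indicator_of_mem hx,
            ← ENNReal.ofReal_rpow_of_nonneg (norm_nonneg _) hq0.le, ofReal_norm]
        · rw [Set.indicator_of_notMem hx, Set.indicator_of_notMem hx, ENNReal.ofReal_zero]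
      · have : Integrable (fun x => f x * v' x) volume := hf2.integrable_mul hv'2
        refine (this.re).congr (.of_forall fun x => ?_)
        simp [e0]
      · exact .of_forall hnn
    have h4 := ext' f hf2 hfq
    rw [hint, hnorm] at h4
    rcases eq_or_ne (I n) 0 with h0 | h0
    · rw [h0]; exact zero_le
    have h5 : I n ^ (1 / q) ≤ M := by
      have e1 : I n = I n ^ (1 / q) * I n ^ (1 / q') := by
        rw [← ENNReal.rpow_add _ _ h0 (hIfin n), one_div, one_div, hqq.inv_add_inv_eq_one,
          ENNReal.rpow_one]
      have hpos : I n ^ (1 / q') ≠ 0 := by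
        simp [h0, hIfin n]
      have hne : I n ^ (1 / q') ≠ ∞ := ENNReal.rpow_ne_top_of_nonneg (by positivity) (hIfin n)
      exact (ENNReal.mul_le_mul_iff_left hpos hne).1 (e1.symm.le.trans h4)
    calc I n = (I n ^ (1 / q)) ^ q := by
          rw [← ENNReal.rpow_mul, one_div_mul_cancel hq0.ne', ENNReal.rpow_one]
      _ ≤ M ^ q := ENNReal.rpow_le_rpow h5 hq0.le
  have hsup : ∫⁻ x, ‖v' x‖ₑ ^ q ≤ M ^ q := by
    have hmono : Monotone E := fun m n hmn x hx => by
      have : (m : ℝ) ≤ n := by exact_mod_cast hmn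
      exact le_trans hx this
    have hun : ⋃ n, E n = Set.univ := by
      refine Set.eq_univ_of_forall fun x => ?_
      obtain ⟨n, hn⟩ := exists_nat_ge ‖v' x‖
      exact Set.mem_iUnion.2 ⟨n, hn⟩
    rw [← setLIntegral_univ, ← hun, setLIntegral_iUnion_of_directed _ hmono.directed_le]
    exact iSup_le hbound
  rw [eLpNorm_eq_lintegral_rpow_enorm_toReal (by simpa using hq0) ENNReal.ofReal_ne_top,
    ENNReal.toReal_ofReal hq0.le]
  calc (∫⁻ x, ‖v' x‖ₑ ^ q) ^ (1 / q) ≤ (M ^ q) ^ (1 / q) := by gcongr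
    _ = M := by rw [← ENNReal.rpow_mul, mul_one_div_cancel hq0.ne', ENNReal.rpow_one]

end

/-! ### Interpolation between `L² → L²` and `L¹ → L^∞` -/

section

theorem lintegral_Ioc_ofReal_rpow {s b : ℝ} (hs : -1 < s) (hb : 0 ≤ b) :
    ∫⁻ x in Set.Ioc 0 b, ENNReal.ofReal (x ^ s) = .ofReal (b ^ (s + 1) / (s + 1)) := by
  rw [← ofReal_integral_eq_lintegral_ofReal]
  · rw [← intervalIntegral.integral_of_le hb, integral_rpow (.inl hs),
      Real.zero_rpow (by linarith), sub_zero]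
  · exact (intervalIntegrable_iff_integrableOn_Ioc_of_le hb).1
      (intervalIntegral.intervalIntegrable_rpow' hs)
  · filter_upwards [ae_restrict_mem measurableSet_Ioc] with x hx
    exact Real.rpow_nonneg hx.1.le _

theorem lintegral_Ioi_ofReal_rpow {s b : ℝ} (hs : s < -1) (hb : 0 < b) :
    ∫⁻ x in Set.Ioi b, ENNReal.ofReal (x ^ s) = .ofReal (-b ^ (s + 1) / (s + 1)) := by
  rw [← ofReal_integral_eq_lintegral_ofReal]
  · rw [integral_Ioi_rpow_of_lt hs hb]
  · exact integrableOn_Ioi_rpow_of_lt hs hb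
  · filter_upwards [ae_restrict_mem measurableSet_Ioi] with x hx
    exact Real.rpow_nonneg (hb.trans hx).le _

theorem lintegral_comp_abs (G : ℝ → ℝ≥0∞) :
    ∫⁻ x : ℝ, G |x| = 2 * ∫⁻ x in Set.Ioi 0, G x := by
  have h1 : ∫⁻ x in Set.Ioi 0, G |x| = ∫⁻ x in Set.Ioi 0, G x :=
    setLIntegral_congr_fun measurableSet_Ioi fun x hx => by
      rw [abs_of_pos (Set.mem_Ioi.1 hx)]
  have h2 : ∫⁻ x in Set.Iic 0, G |x| = ∫⁻ x in Set.Ioi 0, G x := by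
    have e : (fun x : ℝ => (Set.Iic 0).indicator (fun x => G |x|) (-x)) =
        (Set.Ici 0).indicator (fun x => G |x|) := by
      ext x
      by_cases hx : 0 ≤ x
      · rw [Set.indicator_of_mem (by simpa using hx), Set.indicator_of_mem (by simpa using hx),
          abs_neg]
      · rw [Set.indicator_of_notMem (by simpa using hx), Set.indicator_of_notMem (by simpa using hx)]
    rw [← h1, ← lintegral_indicator measurableSet_Iic, ← lintegral_neg_eq_self, e,
      lintegral_indicator measurableSet_Ici]
    exact setLIntegral_congr Ioi_ae_eq_Ici.symm
  rw [← lintegral_add_compl (fun x : ℝ => G |x|) (measurableSet_Ioi (a := (0 : ℝ))), Set.compl_Ioi,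
    h1, h2, two_mul]

/-- Interpolation between `L² → L²` and `L¹ → L^∞`: a Marcinkiewicz type bound `L^{q'} → L^q`. -/
theorem exists_eLpNorm_le_of_L2_of_L1 {q q' : ℝ} (hq : 2 < q) (hqq : q.HolderConjugate q') :
    ∃ c : ℝ≥0, ∀ (T : L2 ℂ → L2 ℂ), (∀ f g, T (f + g) = T f + T g) → (∀ f, ‖T f‖ ≤ ‖f‖) →
      ∀ M : ℝ, 0 < M → (∀ f : L2 ℂ, MemLp f 1 volume →
        eLpNorm (T f) ∞ volume ≤ .ofReal M * eLpNorm f 1 volume) →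
      ∀ f : L2 ℂ, MemLp f (.ofReal q') volume →
        eLpNorm (T f) (.ofReal q) volume ≤
          c * .ofReal (M ^ (1 - 2 / q)) * eLpNorm f (.ofReal q') volume := by
  have hq0 : 0 < q := by linarith
  have hq2 : 0 < q - 2 := by linarith
  have hq'0 : 0 < q' := hqq.symm.pos
  have hq'1 : 0 < q' - 1 := by linarith [hqq.symm.lt]
  have hconj : (q' - 1) * (q - 2) = 2 - q' := by
    have h1 : (q - 1) * q' = q := hqq.sub_one_mul_conj
    linarith
  -- The factor `2^q` comes from splitting `T f` into two halves, `q` from the layer-cake formula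
  -- and `1 / (q - 2)` from the integral over the levels.
  set c₀ : ℝ := 2 ^ q * q / (q - 2) with hc₀
  have hc₀0 : 0 < c₀ := by positivity
  refine ⟨(c₀ ^ (1 / q)).toNNReal, fun T hadd h2 M hM h1 f hfq => ?_⟩
  obtain ⟨f', hf'm, hf'e⟩ := (Lp.memLp f).1
  have hmeas : Measurable f' := hf'm.measurable
  have hf'2 : MemLp f' 2 volume := (Lp.memLp f).ae_eq hf'e
  have hf'q : MemLp f' (.ofReal q') volume := hfq.ae_eq hf'e
  set N₀ : ℝ≥0∞ := ∫⁻ x, ‖f' x‖ₑ ^ q' with hN₀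
  have hN₀t : N₀ ≠ ∞ := by
    have := lintegral_rpow_enorm_lt_top_of_eLpNorm_lt_top (by simpa using hq'0)
      ENNReal.ofReal_ne_top hf'q.2
    rw [ENNReal.toReal_ofReal hq'0.le] at this
    exact this.ne
  have hfnorm : eLpNorm f (.ofReal q') volume = N₀ ^ (1 / q') := by
    rw [eLpNorm_congr_ae hf'e, eLpNorm_eq_lintegral_rpow_enorm_toReal (by simpa using hq'0)
      ENNReal.ofReal_ne_top, ENNReal.toReal_ofReal hq'0.le]
  set N : ℝ := N₀.toReal with hN
  have hN₀N : N₀ = .ofReal N := (ENNReal.ofReal_toReal hN₀t).symm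
  rcases eq_or_ne N₀ 0 with h0 | h0
  · have hf0 : f = 0 := by
      rw [hN₀, lintegral_eq_zero_iff (hmeas.enorm.pow_const _)] at h0
      rw [Lp.eq_zero_iff_ae_eq_zero]
      filter_upwards [hf'e, h0] with x hx h0x
      rw [hx]
      simpa [hq'0, not_lt.2 hq'0.le] using h0x
    have hTf : T f = 0 := by
      have := h2 f
      rw [hf0, norm_zero] at this
      rw [hf0]; exact norm_le_zero_iff.1 this
    rw [hTf, eLpNorm_congr_ae (Lp.coeFn_zero ℂ 2 volume), eLpNorm_zero]
    exact zero_le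
  have hNpos : 0 < N := ENNReal.toReal_pos h0 hN₀t
  -- At level `l` the function is cut where `|f'|^(q'-1) = M N / l`. The part above the cut has `L¹`
  -- norm at most `l / M`, so its image is bounded by `l`; hence `|T f| > 2 l` forces the image of
  -- the part below the cut to be at least `l`, and Chebyshev's inequality in `L²` applies to that
  -- image.
  set S : ℝ → Set E3 := fun l => {x | l * ‖f' x‖ ^ (q' - 1) ≤ M * N} with hS
  have hSm : ∀ l, MeasurableSet (S l) := fun l =>
    measurableSet_le ((hmeas.norm.pow_const _).const_mul l) measurable_const
  -- the distribution function of `T f`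
  have hdist : ∀ l : ℝ, 0 < l → volume {x | l < ‖T f x‖ / 2} ≤
      .ofReal (l ^ (-2 : ℝ)) * ∫⁻ x, (S l).indicator (fun x => ‖f' x‖ₑ ^ (2 : ℝ)) x := by
    intro l hl
    have hlo : MemLp ((S l).indicator f') 2 volume := hf'2.indicator (hSm l)
    have hhi : MemLp ((S l)ᶜ.indicator f') 2 volume := hf'2.indicator (hSm l).compl
    have hsum : f = hlo.toLp _ + hhi.toLp _ := by
      refine Lp.ext ?_
      filter_upwards [hf'e, Lp.coeFn_add (hlo.toLp _) (hhi.toLp _), hlo.coeFn_toLp,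
        hhi.coeFn_toLp] with x h1 h2 h3 h4
      rw [h1, h2, Pi.add_apply, h3, h4]
      exact (congrFun (Set.indicator_self_add_compl (S l) f') x).symm
    have hhi1 : eLpNorm ((S l)ᶜ.indicator f') 1 volume ≤ .ofReal (l / M) := by
      rw [eLpNorm_one_eq_lintegral_enorm]
      have hpt : ∀ x, ‖(S l)ᶜ.indicator f' x‖ₑ ≤ .ofReal (l / (M * N)) * ‖f' x‖ₑ ^ q' := by
        intro x
        by_cases hx : x ∈ (S l)ᶜ
        · rw [Set.indicator_of_mem hx]
          have hx' : M * N < l * ‖f' x‖ ^ (q' - 1) := not_le.1 hx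
          rw [← ofReal_norm, ENNReal.ofReal_rpow_of_nonneg (norm_nonneg _) hq'0.le,
            ← ENNReal.ofReal_mul (by positivity)]
          refine ENNReal.ofReal_le_ofReal ?_
          have : ‖f' x‖ ^ q' = ‖f' x‖ ^ (q' - 1) * ‖f' x‖ := by
            nth_rw 3 [← Real.rpow_one ‖f' x‖]
            rw [← Real.rpow_add_of_nonneg (norm_nonneg _) hq'1.le zero_le_one]
            congr 1; ring
          rw [this, ← mul_assoc]
          refine le_mul_of_one_le_left (norm_nonneg _) ?_
          rw [div_mul_eq_mul_div, le_div_iff₀ (by positivity)]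
          linarith
        · rw [Set.indicator_of_notMem hx, enorm_zero]; exact zero_le
      refine (lintegral_mono hpt).trans (le_of_eq ?_)
      rw [lintegral_const_mul' _ _ ENNReal.ofReal_ne_top, ← hN₀, hN₀N,
        ← ENNReal.ofReal_mul (by positivity)]
      congr 1; field_simp
    have hThi : ∀ᵐ x, ‖T (hhi.toLp _) x‖ ≤ l := by
      have hm : MemLp (hhi.toLp _ : L2 ℂ) 1 volume := by
        refine ⟨Lp.aestronglyMeasurable _, ?_⟩
        rw [eLpNorm_congr_ae hhi.coeFn_toLp]
        exact hhi1.trans_lt ENNReal.ofReal_lt_top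
      have h3 := h1 _ hm
      rw [eLpNorm_congr_ae hhi.coeFn_toLp] at h3
      have h4 : eLpNorm (T (hhi.toLp _)) ∞ volume ≤ .ofReal l := by
        refine h3.trans ((mul_le_mul_right hhi1 _).trans (le_of_eq ?_))
        rw [← ENNReal.ofReal_mul hM.le]; congr 1; field_simp
      rw [eLpNorm_exponent_top] at h4
      filter_upwards [ae_le_eLpNormEssSup (f := T (hhi.toLp _)) (μ := volume)] with x hx
      have h5 := hx.trans h4
      rwa [← ofReal_norm, ENNReal.ofReal_le_ofReal_iff hl.le] at h5
    have hsub : volume {x | l < ‖T f x‖ / 2} ≤ volume {x | ENNReal.ofReal l ≤ ‖T (hlo.toLp _) x‖ₑ} := by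
      refine measure_mono_ae ?_
      have hT : T f = T (hlo.toLp _) + T (hhi.toLp _) := by rw [hsum]; exact hadd _ _
      filter_upwards [hThi, Lp.coeFn_add (T (hlo.toLp _)) (T (hhi.toLp _))] with x hx hx2 hx3
      have hx3' : l < ‖T f x‖ / 2 := hx3
      change ENNReal.ofReal l ≤ ‖T (hlo.toLp _) x‖ₑ
      rw [hT, hx2, Pi.add_apply] at hx3'
      rw [← ofReal_norm]
      refine ENNReal.ofReal_le_ofReal ?_
      have := norm_add_le (T (hlo.toLp _) x) (T (hhi.toLp _) x)
      linarith
    refine hsub.trans ?_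
    have hcheb := mul_meas_ge_le_pow_eLpNorm' volume (p := 2) two_ne_zero ENNReal.ofNat_ne_top
      (Lp.aestronglyMeasurable (T (hlo.toLp _))) (.ofReal l)
    have hnorm : eLpNorm (T (hlo.toLp _)) 2 volume ^ (2 : ℝ) ≤
        ∫⁻ x, (S l).indicator (fun x => ‖f' x‖ₑ ^ (2 : ℝ)) x := by
      have h3 : eLpNorm (T (hlo.toLp _)) 2 volume ≤ eLpNorm ((S l).indicator f') 2 volume := by
        have := ENNReal.ofReal_le_ofReal (h2 (hlo.toLp _))
        rw [Lp.norm_def, Lp.norm_def, ENNReal.ofReal_toReal (Lp.eLpNorm_ne_top _),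
          ENNReal.ofReal_toReal (Lp.eLpNorm_ne_top _), eLpNorm_congr_ae hlo.coeFn_toLp] at this
        exact this
      refine (ENNReal.rpow_le_rpow h3 zero_le_two).trans (le_of_eq ?_)
      rw [eLpNorm_eq_lintegral_rpow_enorm_toReal two_ne_zero ENNReal.ofNat_ne_top,
        ← ENNReal.rpow_mul]
      simp only [ENNReal.toReal_ofNat, one_div, inv_mul_cancel₀ (two_ne_zero (α := ℝ)),
        ENNReal.rpow_one]
      refine lintegral_congr fun x => ?_
      by_cases hx : x ∈ S l
      · rw [Set.indicator_of_mem hx, Set.indicator_of_mem hx]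
      · rw [Set.indicator_of_notMem hx, Set.indicator_of_notMem hx]; simp
    simp only [ENNReal.toReal_ofNat] at hcheb
    have hlt : ENNReal.ofReal l ^ (2 : ℝ) ≠ ∞ := by simp
    have hl0 : ENNReal.ofReal l ^ (2 : ℝ) ≠ 0 := by simp [hl]
    have h5 := hcheb.trans hnorm
    rw [mul_comm, ← ENNReal.le_div_iff_mul_le (.inl hl0) (.inl hlt)] at h5
    refine h5.trans (le_of_eq ?_)
    rw [ENNReal.div_eq_inv_mul, ← ENNReal.rpow_neg, ENNReal.ofReal_rpow_of_pos hl]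
  have hTm : AEMeasurable (fun x => ‖T f x‖ / 2) volume :=
    (Lp.aestronglyMeasurable (T f)).norm.aemeasurable.div_const 2
  have hlayer := lintegral_rpow_eq_lintegral_meas_lt_mul (volume : Measure E3)
    (f := fun x => ‖T f x‖ / 2) (.of_forall fun x => by positivity) hTm hq0
  -- the inner integral
  have hinner : ∀ x, ∫⁻ l in Set.Ioi (0 : ℝ), ENNReal.ofReal (l ^ (q - 3)) *
      (S l).indicator (fun x => ‖f' x‖ₑ ^ (2 : ℝ)) x ≤
      .ofReal ((M * N) ^ (q - 2) / (q - 2)) * ‖f' x‖ₑ ^ q' := by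
    intro x
    rcases eq_or_ne (f' x) 0 with hx | hx
    · have : ∀ l, (S l).indicator (fun x => ‖f' x‖ₑ ^ (2 : ℝ)) x = 0 := by
        intro l
        by_cases hxl : x ∈ S l
        · rw [Set.indicator_of_mem hxl, hx]; simp
        · rw [Set.indicator_of_notMem hxl]
      simp_rw [this, mul_zero, lintegral_zero]
      exact zero_le
    have hfx : 0 < ‖f' x‖ := norm_pos_iff.2 hx
    have hfx1 : 0 < ‖f' x‖ ^ (q' - 1) := Real.rpow_pos_of_pos hfx _
    -- The point `x` lies in `S l` exactly for `l ≤ b`. By `(q' - 1)(q - 2) = 2 - q'` the product of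
    -- `b^(q-2)` with `|f' x|²` is a constant times `|f' x|^{q'}`.
    set b : ℝ := M * N / ‖f' x‖ ^ (q' - 1) with hb
    have hb0 : 0 < b := by positivity
    have e1 : ∀ l ∈ Set.Ioi (0 : ℝ), ENNReal.ofReal (l ^ (q - 3)) *
        (S l).indicator (fun x => ‖f' x‖ₑ ^ (2 : ℝ)) x =
        (Set.Iic b).indicator (fun l => ENNReal.ofReal (l ^ (q - 3))) l * ‖f' x‖ₑ ^ (2 : ℝ) := by
      intro l hl
      have hiff : x ∈ S l ↔ l ∈ Set.Iic b := by
        rw [Set.mem_Iic, hb, le_div_iff₀ hfx1]; rfl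
      by_cases hxl : x ∈ S l
      · rw [Set.indicator_of_mem hxl, Set.indicator_of_mem (hiff.1 hxl)]
      · rw [Set.indicator_of_notMem hxl, Set.indicator_of_notMem (fun h => hxl (hiff.2 h))]; simp
    rw [setLIntegral_congr_fun measurableSet_Ioi e1, lintegral_mul_const' _ _ (by simp),
      lintegral_indicator measurableSet_Iic, Measure.restrict_restrict measurableSet_Iic,
      Set.inter_comm, Set.Ioi_inter_Iic, lintegral_Ioc_ofReal_rpow (by linarith) hb0.le,
      ← ofReal_norm, ENNReal.ofReal_rpow_of_nonneg hfx.le zero_le_two,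
      ENNReal.ofReal_rpow_of_nonneg hfx.le hq'0.le, ← ENNReal.ofReal_mul (by
        rw [show q - 3 + 1 = q - 2 by ring]; positivity), ← ENNReal.ofReal_mul (by positivity)]
    refine ENNReal.ofReal_le_ofReal (le_of_eq ?_)
    rw [show q - 3 + 1 = q - 2 by ring, hb, Real.div_rpow (by positivity) hfx1.le,
      ← Real.rpow_mul hfx.le, hconj]
    have : ‖f' x‖ ^ (2 : ℝ) = ‖f' x‖ ^ (2 - q') * ‖f' x‖ ^ q' := by
      rw [← Real.rpow_add hfx]; congr 1; ring
    rw [this]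
    have : ‖f' x‖ ^ (2 - q') ≠ 0 := (Real.rpow_pos_of_pos hfx _).ne'
    field_simp
  have hmain : ∫⁻ x, ‖T f x‖ₑ ^ q ≤ .ofReal (c₀ * (M * N) ^ (q - 2) * N) := by
    have e1 : ∫⁻ x, ‖T f x‖ₑ ^ q =
        .ofReal (2 ^ q) * ∫⁻ x, ENNReal.ofReal ((‖T f x‖ / 2) ^ q) := by
      rw [← lintegral_const_mul' _ _ ENNReal.ofReal_ne_top]
      refine lintegral_congr fun x => ?_
      rw [← ENNReal.ofReal_mul (by positivity), ← Real.mul_rpow (by norm_num) (by positivity),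
        mul_div_cancel₀ _ (two_ne_zero (α := ℝ)), ← ENNReal.ofReal_rpow_of_nonneg (norm_nonneg _) hq0.le,
        ofReal_norm]
    have e2 : ∫⁻ l in Set.Ioi (0 : ℝ), volume {x | l < ‖T f x‖ / 2} * ENNReal.ofReal (l ^ (q - 1)) ≤
        ∫⁻ l in Set.Ioi (0 : ℝ), ∫⁻ x, ENNReal.ofReal (l ^ (q - 3)) *
          (S l).indicator (fun x => ‖f' x‖ₑ ^ (2 : ℝ)) x := by
      refine setLIntegral_mono' measurableSet_Ioi fun l hl => ?_
      have hl' : 0 < l := hl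
      rw [lintegral_const_mul' _ _ ENNReal.ofReal_ne_top]
      refine (mul_le_mul_left (hdist l hl') _).trans (le_of_eq ?_)
      rw [mul_right_comm, ← ENNReal.ofReal_mul (by positivity), ← Real.rpow_add hl']
      congr 3; ring
    have hjoint : Measurable (Function.uncurry fun (l : ℝ) (x : E3) => ENNReal.ofReal (l ^ (q - 3)) *
          (S l).indicator (fun x => ‖f' x‖ₑ ^ (2 : ℝ)) x) := by
      refine Measurable.mul ?_ ?_
      · exact ENNReal.measurable_ofReal.comp (measurable_fst.pow_const _)
      · have hset : MeasurableSet {z : ℝ × E3 | z.1 * ‖f' z.2‖ ^ (q' - 1) ≤ M * N} :=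
          measurableSet_le (measurable_fst.mul
            ((hmeas.comp measurable_snd).norm.pow_const _)) measurable_const
        exact (((hmeas.comp measurable_snd).enorm.pow_const (2 : ℝ)).indicator hset)
    rw [e1, hlayer]
    calc ENNReal.ofReal (2 ^ q) * (.ofReal q * ∫⁻ l in Set.Ioi (0 : ℝ),
          volume {x | l < ‖T f x‖ / 2} * ENNReal.ofReal (l ^ (q - 1)))
        ≤ .ofReal (2 ^ q) * (.ofReal q * ∫⁻ x, ∫⁻ l in Set.Ioi (0 : ℝ), ENNReal.ofReal (l ^ (q - 3)) *
          (S l).indicator (fun x => ‖f' x‖ₑ ^ (2 : ℝ)) x) := by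
          rw [← lintegral_lintegral_swap hjoint.aemeasurable]
          gcongr
      _ ≤ .ofReal (2 ^ q) * (.ofReal q * ∫⁻ x,
            .ofReal ((M * N) ^ (q - 2) / (q - 2)) * ‖f' x‖ₑ ^ q') := by
          gcongr with x
          exact hinner x
      _ = _ := by
          rw [lintegral_const_mul' _ _ ENNReal.ofReal_ne_top, ← hN₀, hN₀N,
            ← ENNReal.ofReal_mul (by positivity), ← ENNReal.ofReal_mul hq0.le,
            ← ENNReal.ofReal_mul (by positivity)]
          congr 1
          rw [hc₀]; field_simp
  rw [hfnorm, hN₀N, eLpNorm_eq_lintegral_rpow_enorm_toReal (by simpa using hq0)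
    ENNReal.ofReal_ne_top, ENNReal.toReal_ofReal hq0.le]
  refine (ENNReal.rpow_le_rpow hmain (by positivity)).trans (le_of_eq ?_)
  rw [ENNReal.ofReal_rpow_of_nonneg (by positivity) (by positivity),
    ENNReal.ofReal_rpow_of_pos hNpos, ← ENNReal.ofReal, ← ENNReal.ofReal_mul (by positivity),
    ← ENNReal.ofReal_mul (by positivity)]
  congr 1
  have hMN : c₀ * (M * N) ^ (q - 2) * N = c₀ * M ^ (q - 2) * N ^ (q - 1) := by
    rw [Real.mul_rpow hM.le hNpos.le, show q - 1 = (q - 2) + 1 by ring, Real.rpow_add_one hNpos.ne']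
    ring
  rw [hMN, Real.mul_rpow (by positivity) (by positivity), Real.mul_rpow hc₀0.le (by positivity),
    ← Real.rpow_mul hM.le, ← Real.rpow_mul hNpos.le]
  have h3 : (q - 1) * (1 / q) = 1 / q' := by
    have := hqq.inv_add_inv_eq_one
    rw [one_div, one_div, sub_mul, mul_inv_cancel₀ hq0.ne']; linarith
  have h4 : (q - 2) * (1 / q) = 1 - 2 / q := by field_simp
  rw [h3, h4]

end

/-! ### The Hardy-Littlewood-Sobolev inequality on the line -/

section

/-- The diagonal case of the one-dimensional Hardy-Littlewood-Sobolev inequality. -/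
theorem exists_lintegral_abs_rpow_le {p p' : ℝ} (hp : 2 < p) (hpp : p.HolderConjugate p') :
    ∃ C : ℝ≥0, ∀ a : ℝ → ℝ≥0∞, Measurable a →
      ∫⁻ s, ∫⁻ t, ENNReal.ofReal (|t - s| ^ (-(2 / p))) * a s * a t ≤
        C * (∫⁻ s, a s ^ p') ^ (2 / p') := by
  have hp0 : 0 < p := by linarith
  have hp'0 : 0 < p' := hpp.symm.pos
  have hp'1 : 1 < p' := hpp.symm.lt
  have hp'2 : p' < 2 := by
    rw [hpp.conjugate_eq, div_lt_iff₀ (by linarith)]; linarith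
  have hα1 : 0 < 1 - 2 / p := by
    rw [sub_pos, div_lt_one hp0]; exact hp
  have hid : p' / p = p' - 1 := by
    have := hpp.symm.sub_one_mul_conj
    field_simp; linarith
  set c₁ : ℝ := 2 / (1 - 2 / p) with hc₁
  set c₂ : ℝ := 2 ^ (1 / p) with hc₂
  have hc₁0 : 0 < c₁ := by positivity
  have hc₂0 : 0 < c₂ := by positivity
  set k : ℝ → ℝ≥0∞ := fun u => ENNReal.ofReal (|u| ^ (-(2 / p))) with hk
  have hkm : Measurable k := ENNReal.measurable_ofReal.comp (measurable_id.abs.pow_const _)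
  have hnear : ∀ R : ℝ, 0 < R → ∀ s : ℝ, ∫⁻ t in {t | |t - s| ≤ R}, k (t - s) =
      .ofReal (c₁ * R ^ (1 - 2 / p)) := by
    intro R hR s
    have hm : MeasurableSet {t : ℝ | |t| ≤ R} := measurableSet_le measurable_id.abs measurable_const
    have hms : MeasurableSet {t : ℝ | |t - s| ≤ R} :=
      measurableSet_le (measurable_id.sub_const s).abs measurable_const
    rw [← lintegral_indicator hms]
    have e1 : ({t : ℝ | |t - s| ≤ R}.indicator fun t => k (t - s)) =
        fun t => (fun u => (fun v => (Set.Iic R).indicator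
          (fun v => ENNReal.ofReal (v ^ (-(2 / p)))) v) |u|) (t - s) := by
      ext t; simp [Set.indicator, hk]
    rw [e1, lintegral_sub_right_eq_self, lintegral_comp_abs,
      lintegral_indicator measurableSet_Iic, Measure.restrict_restrict measurableSet_Iic,
      Set.inter_comm, Set.Ioi_inter_Iic, lintegral_Ioc_ofReal_rpow (by linarith) hR.le,
      ← ENNReal.ofReal_ofNat 2, ← ENNReal.ofReal_mul zero_le_two]
    congr 1
    rw [show -(2 / p) + 1 = 1 - 2 / p by ring, hc₁]; ring
  have hfar : ∀ R : ℝ, 0 < R → ∀ s : ℝ, (∫⁻ t in {t | |t - s| ≤ R}ᶜ, k (t - s) ^ p) ^ (1 / p) =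
      .ofReal (c₂ * R ^ (-(1 / p))) := by
    intro R hR s
    have hms : MeasurableSet {t : ℝ | |t - s| ≤ R} :=
      measurableSet_le (measurable_id.sub_const s).abs measurable_const
    rw [← lintegral_indicator hms.compl]
    have e1 : ({t : ℝ | |t - s| ≤ R}ᶜ.indicator fun t => k (t - s) ^ p) =
        fun t => (fun u => (fun v => (Set.Ioi R).indicator
          (fun v => ENNReal.ofReal (v ^ (-2 : ℝ))) v) |u|) (t - s) := by
      ext t
      by_cases ht : R < |t - s|
      · have h0 : 0 < |t - s| := hR.trans ht
        rw [Set.indicator_of_mem (by simpa using ht)]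
        simp only
        rw [Set.indicator_of_mem (by simpa using ht), hk,
          ENNReal.ofReal_rpow_of_nonneg (by positivity) hp0.le, ← Real.rpow_mul (abs_nonneg _)]
        congr 2; field_simp
      · rw [Set.indicator_of_notMem (by simpa using ht)]
        simp only
        rw [Set.indicator_of_notMem (by simpa using ht)]
    rw [e1, lintegral_sub_right_eq_self, lintegral_comp_abs,
      lintegral_indicator measurableSet_Ioi, Measure.restrict_restrict measurableSet_Ioi,
      Set.Ioi_inter_Ioi, sup_of_le_left hR.le, lintegral_Ioi_ofReal_rpow (by norm_num) hR,
      ← ENNReal.ofReal_ofNat 2, ← ENNReal.ofReal_mul zero_le_two,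
      ENNReal.ofReal_rpow_of_nonneg (by norm_num; positivity) (by positivity)]
    congr 1
    rw [show 2 * (-R ^ ((-2 : ℝ) + 1) / (-2 + 1)) = 2 * R ^ (-1 : ℝ) by norm_num,
      Real.mul_rpow zero_le_two (by positivity), ← Real.rpow_mul hR.le]
    congr 2; ring
  refine ⟨(2 * (c₁ + c₂)).toNNReal, fun a ha => ?_⟩
  set N₀ : ℝ≥0∞ := ∫⁻ s, a s ^ p' with hN₀
  rcases eq_or_ne N₀ 0 with h0 | h0
  · have ha0 : a =ᵐ[volume] 0 := by
      rw [hN₀, lintegral_eq_zero_iff (ha.pow_const _)] at h0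
      filter_upwards [h0] with s hs
      simpa [hp'0, not_lt.2 hp'0.le] using hs
    have : ∫⁻ s, ∫⁻ t, ENNReal.ofReal (|t - s| ^ (-(2 / p))) * a s * a t = 0 := by
      rw [lintegral_congr_ae (g := 0)]
      · simp
      · filter_upwards [ha0] with s hs
        simp [hs]
    rw [this]; exact zero_le
  rcases eq_or_ne N₀ ∞ with ht | ht
  · by_cases hC : (2 * (c₁ + c₂)).toNNReal = 0
    · exact absurd hC (by simp; positivity)
    · rw [ht, ENNReal.top_rpow_of_pos (by positivity), ENNReal.mul_top (by simpa using hC)]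
      exact le_top
  set N : ℝ := (N₀ ^ (1 / p')).toReal with hN
  have hN₁ : N₀ ^ (1 / p') ≠ ∞ := ENNReal.rpow_ne_top_of_nonneg (by positivity) ht
  have hNN : N₀ ^ (1 / p') = .ofReal N := (ENNReal.ofReal_toReal hN₁).symm
  have hNpos : 0 < N := ENNReal.toReal_pos (by simp [h0, ht]) hN₁
  -- By symmetry it suffices to integrate over the `t` with `a t ≤ a s`. At distance at most `R`
  -- from `s` the inequality `a t ≤ a s` is used; further away Hölder's inequality is used, the
  -- `p`-th power of the kernel being the integrable `|t - s|^(-2)`.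
  have hinner : ∀ s, a s ≠ ∞ → ∫⁻ t, {t | a t ≤ a s}.indicator
      (fun t => k (t - s) * a t) t * a s ≤ .ofReal ((c₁ + c₂) * N ^ (2 - p')) * a s ^ p' := by
    intro s hs
    rw [lintegral_mul_const' _ _ hs]
    rcases eq_or_ne (a s) 0 with hs0 | hs0
    · simp [hs0]
    set l : ℝ := (a s).toReal with hl
    have hal : a s = .ofReal l := (ENNReal.ofReal_toReal hs).symm
    have hl0 : 0 < l := ENNReal.toReal_pos hs0 hs
    -- This radius balances the near part `R^(1-2/p) l` with the far part `R^(-1/p) N`: both become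
    -- `N^(2-p') l^(p'-1)`.
    set R : ℝ := (N / l) ^ p' with hR
    have hR0 : 0 < R := by positivity
    have hms : MeasurableSet {t : ℝ | |t - s| ≤ R} :=
      measurableSet_le (measurable_id.sub_const s).abs measurable_const
    have hkms : Measurable fun t => k (t - s) := hkm.comp (measurable_id.sub_const s)
    have h1 : ∫⁻ t in {t | |t - s| ≤ R}, {t | a t ≤ a s}.indicator (fun t => k (t - s) * a t) t ≤
        .ofReal (c₁ * R ^ (1 - 2 / p)) * a s := by
      rw [← hnear R hR0 s, ← lintegral_mul_const' _ _ hs]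
      refine lintegral_mono fun t => ?_
      by_cases hts : a t ≤ a s
      · rw [Set.indicator_of_mem (show t ∈ {t | a t ≤ a s} from hts)]; gcongr
      · rw [Set.indicator_of_notMem (show t ∉ {t | a t ≤ a s} from hts)]; exact zero_le
    have h2 : ∫⁻ t in {t | |t - s| ≤ R}ᶜ, {t | a t ≤ a s}.indicator (fun t => k (t - s) * a t) t ≤
        .ofReal (c₂ * R ^ (-(1 / p))) * .ofReal N := by
      rw [← hfar R hR0 s, ← hNN]
      refine (lintegral_mono (Set.indicator_le_self _ _)).trans ?_
      refine (ENNReal.lintegral_mul_le_Lp_mul_Lq (volume.restrict {t | |t - s| ≤ R}ᶜ) hpp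
        hkms.aemeasurable ha.aemeasurable).trans ?_
      gcongr
      rw [hN₀]; exact setLIntegral_le_lintegral _ _
    have e1 : c₁ * R ^ (1 - 2 / p) * l = c₁ * (N ^ (2 - p') * l ^ (p' - 1)) := by
      have h3 : p' * (1 - 2 / p) = 2 - p' := by
        have : p' * (1 - 2 / p) = p' - 2 * (p' / p) := by ring
        rw [this, hid]; ring
      rw [hR, ← Real.rpow_mul (by positivity), h3, Real.div_rpow hNpos.le hl0.le,
        show p' - 1 = -(2 - p') + 1 by ring, Real.rpow_add_one hl0.ne', Real.rpow_neg hl0.le]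
      ring
    have e2 : c₂ * R ^ (-(1 / p)) * N = c₂ * (N ^ (2 - p') * l ^ (p' - 1)) := by
      have h3 : p' * (-(1 / p)) = -(p' - 1) := by
        rw [← hid]; ring
      rw [hR, ← Real.rpow_mul (by positivity), h3, Real.rpow_neg (by positivity),
        Real.div_rpow hNpos.le hl0.le, show 2 - p' = -(p' - 1) + 1 by ring,
        Real.rpow_add_one hNpos.ne', Real.rpow_neg hNpos.le]
      have : N ^ (p' - 1) ≠ 0 := (Real.rpow_pos_of_pos hNpos _).ne'
      have : l ^ (p' - 1) ≠ 0 := (Real.rpow_pos_of_pos hl0 _).ne'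
      field_simp
    have h3 : ∫⁻ t, {t | a t ≤ a s}.indicator (fun t => k (t - s) * a t) t ≤
        .ofReal ((c₁ + c₂) * (N ^ (2 - p') * l ^ (p' - 1))) := by
      rw [← lintegral_add_compl _ hms]
      refine (add_le_add h1 h2).trans (le_of_eq ?_)
      rw [hal, ← ENNReal.ofReal_mul (by positivity), ← ENNReal.ofReal_mul (by positivity), e1, e2,
        ← ENNReal.ofReal_add (by positivity) (by positivity)]
      congr 1; ring
    refine (mul_le_mul_left h3 _).trans (le_of_eq ?_)
    rw [hal, ENNReal.ofReal_rpow_of_pos hl0, ← ENNReal.ofReal_mul (by positivity),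
      ← ENNReal.ofReal_mul (by positivity)]
    congr 1
    have : l ^ p' = l ^ (p' - 1) * l := by
      rw [← Real.rpow_add_one hl0.ne']; congr 1; ring
    rw [this]; ring
  have hafin : ∀ᵐ s, a s < ∞ := by
    have := ae_lt_top (ha.pow_const p') ht
    filter_upwards [this] with s hs
    by_contra hcon
    rw [not_lt, top_le_iff] at hcon
    rw [hcon, ENNReal.top_rpow_of_pos hp'0] at hs
    exact lt_irrefl _ hs
  have hhalf : ∫⁻ s, ∫⁻ t, {t | a t ≤ a s}.indicator (fun t => k (t - s) * a t) t * a s ≤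
      .ofReal ((c₁ + c₂) * N ^ (2 - p')) * N₀ := by
    rw [hN₀, ← lintegral_const_mul' _ _ ENNReal.ofReal_ne_top]
    refine lintegral_mono_ae ?_
    filter_upwards [hafin] with s hs
    exact hinner s hs.ne
  set G : ℝ → ℝ → ℝ≥0∞ := fun s t => {t | a t ≤ a s}.indicator (fun t => k (t - s) * a t) t * a s
    with hG
  have hGm : Measurable (Function.uncurry G) := by
    have hset : MeasurableSet {z : ℝ × ℝ | a z.2 ≤ a z.1} :=
      measurableSet_le (ha.comp measurable_snd) (ha.comp measurable_fst)
    have h1 : Measurable fun z : ℝ × ℝ => k (z.2 - z.1) * a z.2 :=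
      (hkm.comp (measurable_snd.sub measurable_fst)).mul (ha.comp measurable_snd)
    exact (h1.indicator hset).mul (ha.comp measurable_fst)
  have hsplit : ∀ s t, ENNReal.ofReal (|t - s| ^ (-(2 / p))) * a s * a t ≤ G s t + G t s := by
    intro s t
    rcases le_total (a t) (a s) with h | h
    · refine le_trans (le_of_eq ?_) le_self_add
      simp only [hG, hk]
      rw [Set.indicator_of_mem (show t ∈ {t | a t ≤ a s} from h), mul_right_comm]
    · refine le_trans (le_of_eq ?_) le_add_self
      simp only [hG, hk]
      rw [Set.indicator_of_mem (show s ∈ {t_1 | a t_1 ≤ a t} from h), abs_sub_comm, mul_right_comm]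
  calc ∫⁻ s, ∫⁻ t, ENNReal.ofReal (|t - s| ^ (-(2 / p))) * a s * a t
      ≤ ∫⁻ s, ∫⁻ t, (G s t + G t s) := by gcongr with s t; exact hsplit s t
    _ = (∫⁻ s, ∫⁻ t, G s t) + ∫⁻ s, ∫⁻ t, G t s := by
        rw [← lintegral_add_left (show Measurable fun s => ∫⁻ t, G s t from hGm.lintegral_prod_right')]
        refine lintegral_congr fun s => ?_
        exact lintegral_add_left (hGm.comp measurable_prodMk_left) _
    _ = 2 * ∫⁻ s, ∫⁻ t, G s t := by
        rw [lintegral_lintegral_swap (f := fun s t => G t s) (hGm.comp measurable_swap).aemeasurable,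
          two_mul]
    _ ≤ 2 * (.ofReal ((c₁ + c₂) * N ^ (2 - p')) * N₀) := by gcongr
    _ = (2 * (c₁ + c₂)).toNNReal * N₀ ^ (2 / p') := by
        have e1 : N₀ = (N₀ ^ (1 / p')) ^ p' := by
          rw [← ENNReal.rpow_mul, one_div_mul_cancel hp'0.ne', ENNReal.rpow_one]
        have e2 : N₀ ^ (2 / p') = (N₀ ^ (1 / p')) ^ (2 : ℝ) := by
          rw [← ENNReal.rpow_mul]; congr 1; ring
        rw [e2]
        nth_rw 1 [e1]
        rw [hNN, ENNReal.ofReal_rpow_of_pos hNpos, ENNReal.ofReal_rpow_of_pos hNpos,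
          ← ENNReal.ofReal, ← ENNReal.ofReal_mul (by positivity), ← ENNReal.ofReal_mul (by positivity),
          ← ENNReal.ofReal_ofNat 2, ← ENNReal.ofReal_mul (by positivity)]
        congr 1
        have : N ^ (2 : ℝ) = N ^ (2 - p') * N ^ p' := by
          rw [← Real.rpow_add hNpos]; congr 1; ring
        rw [this]; ring

end

/-! ### The free Schrödinger group on `L²` and its transpose -/

section

section FreeFlow

variable {F : Type} [NormedAddCommGroup F] [InnerProductSpace ℂ F]

theorem symbol_add (s t : ℝ) (ξ : E3) : symbol (s + t) ξ = symbol s ξ * symbol t ξ := by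
  rw [symbol, symbol, symbol, ← Complex.exp_add]
  congr 1; push_cast; ring

theorem symbol_neg_right (t : ℝ) (ξ : E3) : symbol t (-ξ) = symbol t ξ := by
  simp [symbol]

theorem continuous_symbol_left (ξ : E3) : Continuous fun t => symbol t ξ := by
  unfold symbol; fun_prop

/-- Multiplication by the symbol on `L²`. -/
def mulSymbol (t : ℝ) (f : L2 F) : L2 F := (memLp_symbol_smul t f).toLp _

theorem coeFn_mulSymbol (t : ℝ) (f : L2 F) : mulSymbol t f =ᵐ[volume] fun ξ => symbol t ξ • f ξ :=
  MemLp.coeFn_toLp _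

theorem mulSymbol_add (t : ℝ) (f g : L2 F) : mulSymbol t (f + g) = mulSymbol t f + mulSymbol t g := by
  refine Lp.ext ?_
  filter_upwards [coeFn_mulSymbol t (f + g), coeFn_mulSymbol t f, coeFn_mulSymbol t g,
    Lp.coeFn_add f g, Lp.coeFn_add (mulSymbol t f) (mulSymbol t g)] with ξ h1 h2 h3 h4 h5
  rw [h1, h5, Pi.add_apply, h2, h3, h4, Pi.add_apply, smul_add]

theorem mulSymbol_smul (t : ℝ) (c : ℂ) (f : L2 F) : mulSymbol t (c • f) = c • mulSymbol t f := by
  refine Lp.ext ?_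
  filter_upwards [coeFn_mulSymbol t (c • f), coeFn_mulSymbol t f, Lp.coeFn_smul c f,
    Lp.coeFn_smul c (mulSymbol t f)] with ξ h1 h2 h3 h4
  rw [h1, h4, Pi.smul_apply, h2, h3, Pi.smul_apply, smul_comm]

theorem norm_mulSymbol (t : ℝ) (f : L2 F) : ‖mulSymbol t f‖ = ‖f‖ := by
  rw [Lp.norm_def, Lp.norm_def]
  congr 1
  refine eLpNorm_congr_norm_ae ?_
  filter_upwards [coeFn_mulSymbol t f] with ξ h
  rw [h, norm_smul, norm_symbol, one_mul]

theorem mulSymbol_mulSymbol (s t : ℝ) (f : L2 F) :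
    mulSymbol s (mulSymbol t f) = mulSymbol (s + t) f := by
  refine Lp.ext ?_
  filter_upwards [coeFn_mulSymbol s (mulSymbol t f), coeFn_mulSymbol t f,
    coeFn_mulSymbol (s + t) f] with ξ h1 h2 h3
  rw [h1, h2, h3, symbol_add, smul_smul]

/-- Dominated convergence: the symbol is continuous in `t` and of modulus one, so `(2 |f|)²` is a
majorant. -/
theorem continuous_mulSymbol_left (f : L2 F) : Continuous fun t => mulSymbol t f := by
  rw [continuous_iff_continuousAt]
  intro t₀
  rw [ContinuousAt, Lp.tendsto_Lp_iff_tendsto_eLpNorm']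
  have key : Filter.Tendsto (fun t => ∫⁻ ξ, ‖(symbol t ξ - symbol t₀ ξ) • f ξ‖ₑ ^ (2 : ℝ)) (nhds t₀)
      (nhds (∫⁻ ξ : E3, 0)) := by
    refine tendsto_lintegral_filter_of_dominated_convergence' (fun ξ => (2 * ‖f ξ‖ₑ) ^ (2 : ℝ))
      (.of_forall fun t => ?_) (.of_forall fun t => .of_forall fun ξ => ?_) ?_ ?_
    · exact ((((continuous_symbol t).sub (continuous_symbol t₀)).aestronglyMeasurable.smul
        (Lp.aestronglyMeasurable f)).enorm).pow_const _
    · gcongr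
      rw [enorm_smul]
      gcongr
      refine (enorm_sub_le).trans (le_of_eq ?_)
      rw [← ofReal_norm, ← ofReal_norm, norm_symbol, norm_symbol, ENNReal.ofReal_one]
      norm_num
    · simp_rw [ENNReal.mul_rpow_of_nonneg _ _ (zero_le_two (α := ℝ))]
      rw [lintegral_const_mul' _ _ (by simp)]
      refine ENNReal.mul_ne_top (by simp) ?_
      have := lintegral_rpow_enorm_lt_top_of_eLpNorm_lt_top two_ne_zero ENNReal.ofNat_ne_top
        (Lp.memLp f).2
      simpa using this.ne
    · refine .of_forall fun ξ => ?_
      have h1 : Filter.Tendsto (fun t => ‖(symbol t ξ - symbol t₀ ξ) • f ξ‖ₑ ^ (2 : ℝ)) (nhds t₀)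
          (nhds (‖(symbol t₀ ξ - symbol t₀ ξ) • f ξ‖ₑ ^ (2 : ℝ))) := by
        refine Filter.Tendsto.ennrpow_const _ ?_
        refine Filter.Tendsto.enorm ?_
        exact (((continuous_symbol_left ξ).tendsto t₀).sub_const _).smul_const _
      simpa using h1
  rw [lintegral_zero] at key
  have h2 : ∀ t, eLpNorm (⇑(mulSymbol t f) - ⇑(mulSymbol t₀ f)) 2 volume =
      (∫⁻ ξ, ‖(symbol t ξ - symbol t₀ ξ) • f ξ‖ₑ ^ (2 : ℝ)) ^ (1 / 2 : ℝ) := by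
    intro t
    rw [eLpNorm_eq_lintegral_rpow_enorm_toReal two_ne_zero ENNReal.ofNat_ne_top]
    simp only [ENNReal.toReal_ofNat]
    congr 1
    refine lintegral_congr_ae ?_
    filter_upwards [coeFn_mulSymbol t f, coeFn_mulSymbol t₀ f] with ξ h1 h2
    rw [Pi.sub_apply, h1, h2, sub_smul]
  simp_rw [h2]
  have := key.ennrpow_const (1 / 2 : ℝ)
  simpa using this

variable [CompleteSpace F]

theorem freeFlow_def (t : ℝ) (f : L2 F) : freeFlow t f = 𝓕⁻ (mulSymbol t (𝓕 f)) := rfl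

theorem freeFlow_add (t : ℝ) (f g : L2 F) : freeFlow t (f + g) = freeFlow t f + freeFlow t g := by
  rw [freeFlow_def, freeFlow_def, freeFlow_def, FourierAdd.fourier_add, mulSymbol_add,
    FourierInvAdd.fourierInv_add]

theorem freeFlow_smul (t : ℝ) (c : ℂ) (f : L2 F) : freeFlow t (c • f) = c • freeFlow t f := by
  rw [freeFlow_def, freeFlow_def, FourierSMul.fourier_smul, mulSymbol_smul,
    FourierInvSMul.fourierInv_smul]

theorem norm_freeFlow (t : ℝ) (f : L2 F) : ‖freeFlow t f‖ = ‖f‖ := by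
  rw [freeFlow_def, ← Lp.norm_fourier_eq, FourierTransform.fourier_fourierInv_eq, norm_mulSymbol,
    Lp.norm_fourier_eq]

theorem freeFlow_freeFlow (s t : ℝ) (f : L2 F) : freeFlow s (freeFlow t f) = freeFlow (s + t) f := by
  rw [freeFlow_def, freeFlow_def t, FourierTransform.fourier_fourierInv_eq, mulSymbol_mulSymbol,
    freeFlow_def]

/-- `U(t)` as a linear isometry of `L²`. -/
def freeFlowₗᵢ (t : ℝ) : L2 F →ₗᵢ[ℂ] L2 F where
  toFun := freeFlow t
  map_add' := freeFlow_add t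
  map_smul' := freeFlow_smul t
  norm_map' := norm_freeFlow t

theorem freeFlow_sub (t : ℝ) (f g : L2 F) : freeFlow t (f - g) = freeFlow t f - freeFlow t g :=
  map_sub (freeFlowₗᵢ t) f g

theorem freeFlow_zero (t : ℝ) : freeFlow t (0 : L2 F) = 0 := map_zero (freeFlowₗᵢ t)

theorem continuous_freeFlow_left (f : L2 F) : Continuous fun t => freeFlow t f := by
  simp_rw [freeFlow_def]
  exact (Lp.fourierTransformₗᵢ E3 F).symm.continuous.comp (continuous_mulSymbol_left (𝓕 f))

/-- The free flow is jointly continuous in time and data. -/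
theorem continuous_freeFlow : Continuous fun z : ℝ × L2 F => freeFlow z.1 z.2 := by
  rw [continuous_iff_continuousAt]
  rintro ⟨t₀, f₀⟩
  rw [ContinuousAt, tendsto_iff_norm_sub_tendsto_zero]
  have h1 : Filter.Tendsto (fun z : ℝ × L2 F => ‖z.2 - f₀‖ + ‖freeFlow z.1 f₀ - freeFlow t₀ f₀‖)
      (nhds (t₀, f₀)) (nhds 0) := by
    have h2 : Continuous fun z : ℝ × L2 F =>
        ‖z.2 - f₀‖ + ‖freeFlow z.1 f₀ - freeFlow t₀ f₀‖ :=
      ((continuous_snd.sub continuous_const).norm).add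
        ((((continuous_freeFlow_left f₀).comp continuous_fst).sub continuous_const).norm)
    have := h2.tendsto (t₀, f₀)
    simpa using this
  refine squeeze_zero (fun _ => norm_nonneg _) (fun z => ?_) h1
  have : freeFlow z.1 z.2 - freeFlow t₀ f₀ =
      freeFlow z.1 (z.2 - f₀) + (freeFlow z.1 f₀ - freeFlow t₀ f₀) := by
    rw [freeFlow_sub]; abel
  rw [this]
  refine (norm_add_le _ _).trans ?_
  rw [norm_freeFlow]

/-- `U(t)` on Schwartz functions with values in `F`. -/
theorem freeFlow_toLp_fourierMultiplier (t : ℝ) (g : 𝓢(E3, F)) :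
    freeFlow t (g.toLp 2) = (SchwartzMap.fourierMultiplierCLM F (symbol t) g).toLp 2 := by
  rw [freeFlow_def, SchwartzMap.toLp_fourier_eq, SchwartzMap.fourierMultiplierCLM_apply,
    ← SchwartzMap.toLp_fourierInv_eq]
  congr 1
  refine Lp.ext ?_
  filter_upwards [coeFn_mulSymbol t ((𝓕 g).toLp 2), (𝓕 g).coeFn_toLp 2 volume,
    (SchwartzMap.smulLeftCLM F (symbol t) (𝓕 g)).coeFn_toLp 2 volume] with ξ h1 h2 h3
  rw [h1, h2, h3, SchwartzMap.smulLeftCLM_apply_apply (hasTemperateGrowth_symbol t)]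

theorem freeFlow_toLp (t : ℝ) (g : 𝓢(E3, ℂ)) :
    freeFlow t (g.toLp 2) = (freeFlowSchwartz t g).toLp 2 :=
  freeFlow_toLp_fourierMultiplier t g

theorem coeFn_freeFlow_toLp (t : ℝ) (g : 𝓢(E3, ℂ)) :
    freeFlow t (g.toLp 2) =ᵐ[volume] freeFlowSchwartz t g := by
  rw [freeFlow_toLp]; exact SchwartzMap.coeFn_toLp _ _ _

/-- The bilinear pairing of `L²(ℝ³; ℂ)` with itself. -/
def pairing (f g : L2 ℂ) : ℂ := ∫ x, f x * g x

theorem pairing_eq_inner (f g : L2 ℂ) : pairing f g = inner ℂ (star f) g := by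
  rw [L2.inner_def, pairing]
  refine integral_congr_ae ?_
  filter_upwards [Lp.coeFn_star f] with x hx
  rw [hx]; simp [mul_comm]

theorem pairing_comm (f g : L2 ℂ) : pairing f g = pairing g f := by
  simp_rw [pairing, mul_comm]

theorem norm_star_L2 (f : L2 ℂ) : ‖star f‖ = ‖f‖ := by
  rw [Lp.norm_def, Lp.norm_def]
  congr 1
  refine eLpNorm_congr_norm_ae ?_
  filter_upwards [Lp.coeFn_star f] with x hx
  rw [hx]; simp

theorem norm_pairing_le (f g : L2 ℂ) : ‖pairing f g‖ ≤ ‖f‖ * ‖g‖ := by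
  rw [pairing_eq_inner, ← norm_star_L2 f]; exact norm_inner_le_norm _ _

theorem pairing_add_right (f g h : L2 ℂ) : pairing f (g + h) = pairing f g + pairing f h := by
  simp_rw [pairing_eq_inner]; exact inner_add_right _ _ _

theorem pairing_smul_right (f g : L2 ℂ) (c : ℂ) : pairing f (c • g) = c * pairing f g := by
  simp_rw [pairing_eq_inner]; exact inner_smul_right _ _ _

/-- The pairing as a continuous bilinear map. -/
def pairingCLM : L2 ℂ →L[ℂ] L2 ℂ →L[ℂ] ℂ :=
  LinearMap.mkContinuous₂ (LinearMap.mk₂ ℂ pairing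
    (fun f g h => by rw [pairing_comm, pairing_add_right, pairing_comm h, pairing_comm h])
    (fun c f g => by rw [pairing_comm, pairing_smul_right, pairing_comm g, smul_eq_mul])
    pairing_add_right
    (fun c f g => by rw [pairing_smul_right, smul_eq_mul])) 1
    (fun f g => by rw [one_mul]; exact norm_pairing_le f g)

theorem pairingCLM_apply (f g : L2 ℂ) : pairingCLM f g = pairing f g := rfl

theorem pairing_sub_right (f g h : L2 ℂ) : pairing f (g - h) = pairing f g - pairing f h :=
  map_sub (pairingCLM f) g h

theorem continuous_pairing : Continuous fun z : L2 ℂ × L2 ℂ => pairing z.1 z.2 :=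
  pairingCLM.continuous₂

theorem pairing_toLp (g : 𝓢(E3, ℂ)) (f : L2 ℂ) : pairing (g.toLp 2) f = ∫ x, g x * f x := by
  refine integral_congr_ae ?_
  filter_upwards [g.coeFn_toLp 2 volume] with x hx
  rw [hx]

theorem denseRange_toLp {F : Type} [NormedAddCommGroup F] [InnerProductSpace ℂ F] :
    DenseRange fun g : 𝓢(E3, F) => (g.toLp 2 : L2 F) :=
  SchwartzMap.denseRange_toLpCLM (F := F) (E := E3) ENNReal.ofNat_ne_top

/-- `U(t)` is its own transpose for the bilinear pairing. -/
theorem pairing_freeFlow (t : ℝ) (f g : L2 ℂ) : pairing (freeFlow t f) g = pairing f (freeFlow t g) := by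
  have hc : Continuous (freeFlow t : L2 ℂ → L2 ℂ) := (freeFlowₗᵢ t).continuous
  refine denseRange_toLp.induction_on₂
    (p := fun f g : L2 ℂ => pairing (freeFlow t f) g = pairing f (freeFlow t g)) ?_ (fun a b => ?_) f g
  · exact isClosed_eq (continuous_pairing.comp ((hc.comp continuous_fst).prodMk continuous_snd))
      (continuous_pairing.comp (continuous_fst.prodMk (hc.comp continuous_snd)))
  · rw [freeFlow_toLp, freeFlow_toLp, pairing_toLp, pairing_comm, pairing_toLp]
    have e1 : ∀ (c : 𝓢(E3, ℂ)) (x : E3), ((c.toLp 2 : L2 ℂ) : E3 → ℂ) =ᵐ[volume] c := fun c x =>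
      c.coeFn_toLp 2 volume
    have e2 : ∫ x, freeFlowSchwartz t a x * (b.toLp 2 : L2 ℂ) x = ∫ x, freeFlowSchwartz t a x * b x :=
      integral_congr_ae (by filter_upwards [e1 b 0] with x hx; rw [hx])
    have e3 : ∫ x, freeFlowSchwartz t b x * (a.toLp 2 : L2 ℂ) x = ∫ x, freeFlowSchwartz t b x * a x :=
      integral_congr_ae (by filter_upwards [e1 a 0] with x hx; rw [hx])
    rw [e2, e3]
    unfold freeFlowSchwartz
    rw [SchwartzMap.fourierMultiplierCLM_apply, SchwartzMap.fourierMultiplierCLM_apply,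
      SchwartzMap.integral_fourierInv_mul_eq, SchwartzMap.integral_fourierInv_mul_eq]
    have h1 : ∀ (a : 𝓢(E3, ℂ)) ξ, SchwartzMap.smulLeftCLM ℂ (symbol t) a ξ = symbol t ξ * a ξ :=
      fun a ξ => SchwartzMap.smulLeftCLM_apply_apply (hasTemperateGrowth_symbol t) a ξ
    simp_rw [h1]
    have h2 : ∀ (a : 𝓢(E3, ℂ)) ξ, 𝓕⁻ a ξ = 𝓕 a (-ξ) := by
      intro a ξ
      rw [SchwartzMap.fourierInv_coe, Real.fourierInv_eq_fourier_neg]; rfl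
    -- The symbol is even in `ξ`, and the reflection `ξ ↦ -ξ` interchanges the Fourier transform
    -- with its inverse.
    rw [← integral_neg_eq_self (fun ξ => symbol t ξ * 𝓕 a ξ * 𝓕⁻ b ξ)]
    refine integral_congr_ae (.of_forall fun ξ => ?_)
    simp only
    rw [symbol_neg_right, h2 b, h2 a, neg_neg]; ring

end FreeFlow

end

/-! ### Exponents and dispersive decay -/

section

/-- The relations between the exponents: `(p, q)` is an admissible pair with `q > 2`, the potentials
are in `L^d`, and `p'`, `q'` are the conjugate exponents. -/
structure IsExponents (d p p' q q' : ℝ) : Prop where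
  d_gt : 3 / 2 < d
  p_gt : 2 < p
  q_gt : 2 < q
  conj_p : p.HolderConjugate p'
  conj_q : q.HolderConjugate q'
  decay : 3 / 2 * (1 - 2 / q) = 2 / p
  potential : 1 / d + 2 / q = 1

/-- The pointwise dispersive estimate for Schwartz functions. -/
theorem norm_freeFlowSchwartz_le {t : ℝ} (ht : t ≠ 0) (f : 𝓢(E3, ℂ)) (x : E3) :
    ‖freeFlowSchwartz t f x‖ ≤ (1 / (2 * Real.pi * |t|)) ^ (3 / 2 : ℝ) * ∫ y, ‖f y‖ := by
  have hpi := Real.pi_pos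
  -- The symbol is damped by `exp (-ε |ξ|²)`; `b ε` is the coefficient of the resulting complex
  -- Gaussian. All bounds are uniform in `ε > 0`, and `ε → 0` recovers the free evolution.
  set b : ℝ → ℂ := fun ε => (ε : ℂ) + Complex.I * ((2 * Real.pi ^ 2 * t : ℝ) : ℂ) with hb
  have hbre : ∀ ε, (b ε).re = ε := by
    intro ε
    simp only [hb, Complex.add_re, Complex.ofReal_re, Complex.mul_re, Complex.I_re, Complex.I_im,
      Complex.ofReal_im]
    ring
  have hbim : ∀ ε, (b ε).im = 2 * Real.pi ^ 2 * t := by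
    intro ε
    simp only [hb, Complex.add_im, Complex.ofReal_re, Complex.mul_im, Complex.I_re, Complex.I_im,
      Complex.ofReal_im]
    ring
  set A : ℝ → ℂ := fun ε => ∫ ξ : E3, Complex.exp (-b ε * ‖ξ‖ ^ 2 +
    2 * Real.pi * Complex.I * (inner ℝ x ξ : ℝ)) * 𝓕 f ξ with hA
  have hint : Integrable (fun ξ => 𝓕 f ξ) (volume : Measure E3) := (𝓕 f).integrable
  have hlim : Filter.Tendsto A (nhdsWithin 0 (Set.Ioi 0)) (nhds (freeFlowSchwartz t f x)) := by
    have e1 : freeFlowSchwartz t f x = ∫ ξ : E3, Complex.exp (-b 0 * ‖ξ‖ ^ 2 +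
        2 * Real.pi * Complex.I * (inner ℝ x ξ : ℝ)) * 𝓕 f ξ := by
      unfold freeFlowSchwartz
      rw [SchwartzMap.fourierMultiplierCLM_apply, SchwartzMap.fourierInv_coe, Real.fourierInv_eq']
      refine integral_congr_ae (.of_forall fun ξ => ?_)
      simp only
      rw [SchwartzMap.smulLeftCLM_apply_apply (hasTemperateGrowth_symbol t), smul_eq_mul,
        smul_eq_mul, ← mul_assoc, symbol, ← Complex.exp_add, real_inner_comm]
      congr 2
      simp only [hb]
      push_cast; ring
    rw [e1]
    refine tendsto_integral_filter_of_dominated_convergence (fun ξ => ‖𝓕 f ξ‖) ?_ ?_ hint.norm ?_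
    · refine .of_forall fun ε => ?_
      exact (by fun_prop : Continuous fun ξ : E3 => Complex.exp (-b ε * ‖ξ‖ ^ 2 +
        2 * Real.pi * Complex.I * (inner ℝ x ξ : ℝ))).aestronglyMeasurable.mul hint.1
    · filter_upwards [self_mem_nhdsWithin] with ε hε
      refine .of_forall fun ξ => ?_
      rw [norm_mul]
      refine mul_le_of_le_one_left (norm_nonneg _) ?_
      rw [Complex.norm_exp, Real.exp_le_one_iff]
      have : (-b ε * (‖ξ‖ : ℂ) ^ 2 + 2 * Real.pi * Complex.I * ((inner ℝ x ξ : ℝ) : ℂ)).re =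
          -(ε * ‖ξ‖ ^ 2) := by
        have h0 : (2 * Real.pi * Complex.I * ((inner ℝ x ξ : ℝ) : ℂ)).re = 0 := by simp
        rw [← Complex.ofReal_pow, Complex.add_re, h0, Complex.re_mul_ofReal, Complex.neg_re, hbre]
        ring
      rw [this]
      have : 0 < ε := hε
      have : 0 ≤ ε * ‖ξ‖ ^ 2 := by positivity
      linarith
    · refine .of_forall fun ξ => ?_
      have hc : Continuous fun ε : ℝ => Complex.exp (-b ε * ‖ξ‖ ^ 2 +
          2 * Real.pi * Complex.I * (inner ℝ x ξ : ℝ)) * 𝓕 f ξ := by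
        simp only [hb]; fun_prop
      exact (hc.tendsto 0).mono_left nhdsWithin_le_nhds
  refine le_of_tendsto hlim.norm ?_
  filter_upwards [self_mem_nhdsWithin] with ε hε
  have hε0 : 0 < ε := hε
  have hbpos : 0 < (b ε).re := by rw [hbre]; exact hε
  have hb0 : b ε ≠ 0 := fun h => by rw [h] at hbpos; simp at hbpos
  have hgauss : Integrable (fun ξ : E3 => Complex.exp (-b ε * ‖ξ‖ ^ 2 +
      2 * Real.pi * Complex.I * (inner ℝ x ξ : ℝ))) volume :=
    GaussianFourier.integrable_cexp_neg_mul_sq_norm_add hbpos (2 * Real.pi * Complex.I) x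
  -- Moving the Fourier transform from `f` to the Gaussian produces an explicit kernel of modulus at
  -- most `|π / b ε|^(3/2)`, and `|b ε| ≥ 2 π² |t|`.
  have hflip : A ε = ∫ y, 𝓕 (fun ξ : E3 => Complex.exp (-b ε * ‖ξ‖ ^ 2 +
      2 * Real.pi * Complex.I * (inner ℝ x ξ : ℝ))) y * f y := by
    have := VectorFourier.integral_bilin_fourierIntegral_eq_flip (ContinuousLinearMap.mul ℂ ℂ)
      (L := innerₗ E3) (μ := volume) (ν := volume) Real.continuous_fourierChar continuous_inner hgauss f.integrable
    simpa [hA] using! this.symm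
  rw [hflip]
  rw [← integral_const_mul]
  refine norm_integral_le_of_norm_le (f.integrable.norm.const_mul _) (.of_forall fun y => ?_)
  rw [norm_mul]
  gcongr
  rw [fourier_gaussian_innerProductSpace' hbpos, norm_mul]
  have h1 : ‖Complex.exp (-(Real.pi : ℂ) ^ 2 * ‖x - y‖ ^ 2 / b ε)‖ ≤ 1 := by
    rw [Complex.norm_exp, Real.exp_le_one_iff]
    have : (-(Real.pi : ℂ) ^ 2 * ‖x - y‖ ^ 2 / b ε).re =
        -(Real.pi ^ 2 * ‖x - y‖ ^ 2 * (ε / Complex.normSq (b ε))) := by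
      rw [show -(Real.pi : ℂ) ^ 2 * ‖x - y‖ ^ 2 / b ε =
        ((-(Real.pi ^ 2 * ‖x - y‖ ^ 2) : ℝ) : ℂ) * (b ε)⁻¹ by push_cast; ring,
        Complex.re_ofReal_mul, Complex.inv_re, hbre]
      ring
    rw [this]
    have : 0 ≤ Complex.normSq (b ε) := Complex.normSq_nonneg _
    have : 0 ≤ Real.pi ^ 2 * ‖x - y‖ ^ 2 * (ε / Complex.normSq (b ε)) := by positivity
    linarith
  have h2 : ‖((Real.pi : ℂ) / b ε) ^ ((Module.finrank ℝ E3 : ℂ) / 2)‖ ≤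
      (1 / (2 * Real.pi * |t|)) ^ (3 / 2 : ℝ) := by
    have e : ((Module.finrank ℝ E3 : ℂ) / 2) = ((3 / 2 : ℝ) : ℂ) := by
      rw [finrank_euclideanSpace_fin]; push_cast; ring
    rw [e, Complex.norm_cpow_real]
    refine Real.rpow_le_rpow (norm_nonneg _) ?_ (by norm_num)
    rw [norm_div, Complex.norm_real, Real.norm_of_nonneg hpi.le]
    have h3 : 2 * Real.pi ^ 2 * |t| ≤ ‖b ε‖ := by
      refine le_trans (le_of_eq ?_) (Complex.abs_im_le_norm (b ε))
      rw [hbim, abs_mul, abs_of_nonneg (by positivity : (0 : ℝ) ≤ 2 * Real.pi ^ 2)]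
    have ht' : 0 < |t| := abs_pos.2 ht
    rw [div_le_div_iff₀ (norm_pos_iff.2 hb0) (by positivity)]
    nlinarith [h3]
  calc _ ≤ (1 / (2 * Real.pi * |t|)) ^ (3 / 2 : ℝ) * 1 := by gcongr
    _ = _ := mul_one _

/-- The dispersive estimate `L¹ → L^∞`. -/
theorem eLpNorm_top_freeFlow_le {t : ℝ} (ht : t ≠ 0) (f : L2 ℂ) (hf : MemLp f 1 volume) :
    eLpNorm (freeFlow t f) ∞ volume ≤
      .ofReal ((1 / (2 * Real.pi * |t|)) ^ (3 / 2 : ℝ)) * eLpNorm f 1 volume := by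
  set M : ℝ := (1 / (2 * Real.pi * |t|)) ^ (3 / 2 : ℝ) with hM
  have hS : ∀ g : 𝓢(E3, ℂ), eLpNorm (freeFlow t (g.toLp 2)) ∞ volume ≤
      .ofReal M * eLpNorm g 1 volume := by
    intro g
    rw [eLpNorm_congr_ae (coeFn_freeFlow_toLp t g), eLpNorm_exponent_top]
    refine eLpNormEssSup_le_of_ae_enorm_bound (.of_forall fun x => ?_)
    rw [eLpNorm_one_eq_lintegral_enorm, ← ofReal_norm,
      ← ofReal_integral_norm_eq_lintegral_enorm g.integrable,
      ← ENNReal.ofReal_mul (by positivity)]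
    exact ENNReal.ofReal_le_ofReal (norm_freeFlowSchwartz_le ht g x)
  refine ENNReal.le_of_forall_pos_le_add fun ε hε _ => ?_
  -- By lower semicontinuity the functions whose `L^∞` norm obeys the bound enlarged by `ε` form a
  -- closed subset of `L²`. Hence the approximating data must converge in `L²`, but need only be
  -- `δ`-close in `L¹`.
  have hcl := (lowerSemicontinuous_iff_isClosed_preimage.1 (lowerSemicontinuous_eLpNorm (F := ℂ) ∞))
    (.ofReal M * eLpNorm f 1 volume + ε)
  obtain ⟨δ, hδ0, hδ⟩ : ∃ δ : ℝ≥0∞, δ ≠ 0 ∧ ENNReal.ofReal M * δ ≤ ε := by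
    refine ⟨ε / (.ofReal M + 1), ?_, ?_⟩
    · exact (ENNReal.div_pos (by simpa using hε.ne') (by simp)).ne'
    · calc ENNReal.ofReal M * (ε / (.ofReal M + 1)) ≤
          (ENNReal.ofReal M + 1) * (ε / (.ofReal M + 1)) := by gcongr; exact le_self_add
        _ ≤ ε := ENNReal.mul_div_le
  have hg : ∀ n : ℕ, ∃ g : 𝓢(E3, ℂ), eLpNorm (fun x => f x - g x) 2 volume ≤ min δ (1 / (n + 1)) ∧
      eLpNorm (fun x => f x - g x) 1 volume ≤ min δ (1 / (n + 1)) := fun n =>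
    exists_schwartz_eLpNorm_sub_le le_rfl (by norm_num) (Lp.memLp f) hf
      (by rw [← pos_iff_ne_zero, lt_min_iff]; exact ⟨pos_iff_ne_zero.2 hδ0, by simp⟩)
  choose g hg2 hg1 using hg
  have hconv : Filter.Tendsto (fun n => ((g n).toLp 2 : L2 ℂ)) Filter.atTop (nhds f) := by
    rw [Lp.tendsto_Lp_iff_tendsto_eLpNorm']
    have hz : Filter.Tendsto (fun n : ℕ => (1 / ((n : ℝ≥0∞) + 1))) Filter.atTop (nhds 0) := by
      have := (Filter.tendsto_add_atTop_iff_nat 1).2 ENNReal.tendsto_inv_nat_nhds_zero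
      simpa using this
    refine tendsto_of_tendsto_of_tendsto_of_le_of_le tendsto_const_nhds hz (fun _ => zero_le)
      fun n => ?_
    refine le_trans (le_of_eq ?_) ((hg2 n).trans (min_le_right _ _))
    refine eLpNorm_congr_norm_ae ?_
    filter_upwards [(g n).coeFn_toLp 2 volume] with x hx
    rw [Pi.sub_apply, hx, norm_sub_rev]
  have hmem : ∀ n, eLpNorm (freeFlow t ((g n).toLp 2)) ∞ volume ≤
      .ofReal M * eLpNorm f 1 volume + ε := by
    intro n
    refine (hS (g n)).trans ?_
    have : eLpNorm (g n) 1 volume ≤ eLpNorm f 1 volume + δ := by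
      have e : (g n : E3 → ℂ) = f + fun x => g n x - f x := by ext x; simp
      conv_lhs => rw [e]
      refine (eLpNorm_add_le (Lp.aestronglyMeasurable f)
        ((g n).continuous.aestronglyMeasurable.sub (Lp.aestronglyMeasurable f)) le_rfl).trans ?_
      gcongr
      refine le_trans (le_of_eq ?_) ((hg1 n).trans (min_le_left _ _))
      exact eLpNorm_congr_norm_ae (.of_forall fun x => norm_sub_rev _ _)
    calc ENNReal.ofReal M * eLpNorm (g n) 1 volume ≤ .ofReal M * (eLpNorm f 1 volume + δ) := by gcongr
      _ ≤ _ := by rw [mul_add]; gcongr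
  have hconv' : Filter.Tendsto (fun n => freeFlow t ((g n).toLp 2 : L2 ℂ)) Filter.atTop
      (nhds (freeFlow t f)) := ((freeFlowₗᵢ t).continuous.tendsto f).comp hconv
  exact hcl.mem_of_tendsto hconv' (.of_forall hmem)

/-- The decay estimate `L^{q'} → L^q`. -/
theorem exists_eLpNorm_freeFlow_le {d p p' q q' : ℝ} (h : IsExponents d p p' q q') :
    ∃ c : ℝ≥0, ∀ t : ℝ, t ≠ 0 → ∀ f : L2 ℂ, MemLp f (.ofReal q') volume →
      eLpNorm (freeFlow t f) (.ofReal q) volume ≤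
        c * .ofReal (|t| ^ (-(2 / p))) * eLpNorm f (.ofReal q') volume := by
  obtain ⟨c, hc⟩ := exists_eLpNorm_le_of_L2_of_L1 h.q_gt h.conj_q
  have hpi := Real.pi_pos
  refine ⟨c * ((2 * Real.pi) ^ (-(2 / p))).toNNReal, fun t ht f hf => ?_⟩
  have ht' : 0 < |t| := abs_pos.2 ht
  have := hc (freeFlow t) (freeFlow_add t) (fun f => (norm_freeFlow t f).le)
    ((1 / (2 * Real.pi * |t|)) ^ (3 / 2 : ℝ)) (by positivity)
    (fun f hf => eLpNorm_top_freeFlow_le ht f hf) f hf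
  refine this.trans (le_of_eq ?_)
  -- Interpolation raises `(2 π |t|)^(-3/2)` to the power `1 - 2/q`, and `3/2 · (1 - 2/q) = 2/p` is
  -- the admissibility relation.
  have e : ENNReal.ofReal (((1 / (2 * Real.pi * |t|)) ^ (3 / 2 : ℝ)) ^ (1 - 2 / q)) =
      ((2 * Real.pi) ^ (-(2 / p))).toNNReal * .ofReal (|t| ^ (-(2 / p))) := by
    change _ = ENNReal.ofReal _ * _
    rw [← Real.rpow_mul (by positivity), h.decay, ← ENNReal.ofReal_mul (by positivity),
      ← Real.mul_rpow (by positivity) (by positivity), one_div, Real.inv_rpow (by positivity),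
      Real.rpow_neg (by positivity)]
  rw [e, ENNReal.coe_mul]
  ring

end

section

/-! ### Homogeneous Strichartz estimates -/

/-- Hölder's inequality for a product under the integral sign. -/
theorem enorm_integral_mul_le {q q' : ℝ} (hqq : q.HolderConjugate q') {f g : E3 → ℂ}
    (hf : AEStronglyMeasurable f volume) (hg : AEStronglyMeasurable g volume) :
    ‖∫ x, f x * g x‖ₑ ≤ eLpNorm f (.ofReal q) volume * eLpNorm g (.ofReal q') volume := by
  refine (enorm_integral_le_lintegral_enorm _).trans ?_
  have hq0 := hqq.pos
  have hq'0 := hqq.symm.pos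
  rw [eLpNorm_eq_lintegral_rpow_enorm_toReal (by simpa using hq0) ENNReal.ofReal_ne_top,
    eLpNorm_eq_lintegral_rpow_enorm_toReal (by simpa using hq'0) ENNReal.ofReal_ne_top,
    ENNReal.toReal_ofReal hq0.le, ENNReal.toReal_ofReal hq'0.le]
  simp_rw [enorm_mul]
  exact ENNReal.lintegral_mul_le_Lp_mul_Lq volume hqq hf.enorm hg.enorm

/-- The truncated duality map `z ↦ conj z · min(|z|, M)^s`. -/
def dualityFun (s M : ℝ) (z : ℂ) : ℂ := ((min ‖z‖ M ^ s : ℝ) : ℂ) * conj z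

/-- With `|w| ≤ |z|` the difference splits into a multiple of `conj (z - w)` and the variation of
the radial factor times `conj w`. The latter vanishes once `|w| ≥ M`, and otherwise is controlled by
the convexity of the power `s + 1`. -/
theorem norm_dualityFun_sub_le {s M : ℝ} (hs : 0 < s) (hM : 0 ≤ M) (z w : ℂ) :
    ‖dualityFun s M z - dualityFun s M w‖ ≤ (s + 2) * M ^ s * ‖z - w‖ := by
  wlog hzw : ‖w‖ ≤ ‖z‖ generalizing z w
  · rw [norm_sub_rev, norm_sub_rev z]; exact this w z (not_le.1 hzw).le
  set a := min ‖z‖ M with ha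
  set b := min ‖w‖ M with hb
  have ha0 : 0 ≤ a := le_min (norm_nonneg _) hM
  have hb0 : 0 ≤ b := le_min (norm_nonneg _) hM
  have hba : b ≤ a := min_le_min_right _ hzw
  have haM : a ≤ M := min_le_right _ _
  have e : dualityFun s M z - dualityFun s M w =
      ((a ^ s : ℝ) : ℂ) * conj (z - w) + (((a ^ s - b ^ s : ℝ)) : ℂ) * conj w := by
    simp only [dualityFun, ← ha, ← hb]; push_cast; rw [map_sub]; ring
  have hmono : b ^ s ≤ a ^ s := Real.rpow_le_rpow hb0 hba hs.le
  have key : (a ^ s - b ^ s) * ‖w‖ ≤ (s + 1) * M ^ s * ‖z - w‖ := by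
    rcases le_or_gt M ‖w‖ with hMw | hMw
    · have h1 : b = M := min_eq_right hMw
      have h2 : a = M := min_eq_right (hMw.trans hzw)
      rw [h1, h2, sub_self, zero_mul]; positivity
    · have h1 : b = ‖w‖ := min_eq_left hMw.le
      rw [← h1]
      have h3 : a - b ≤ ‖z - w‖ := by
        have : a ≤ ‖z‖ := min_le_left _ _
        have := norm_sub_norm_le z w
        rw [h1]; linarith
      have h4 : a ^ s * a - b ^ s * b ≤ (s + 1) * a ^ s * (a - b) := by
        rcases eq_or_lt_of_le ha0 with h | h
        · have hb' : b = 0 := le_antisymm (h ▸ hba) hb0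
          rw [← h, hb']; simp
        -- Bernoulli's inequality for `(b / a)^(s+1)`, that is, `a^(s+1) - b^(s+1) ≤ (s+1) a^s (a -
        -- b)`.
        · have hB := one_add_mul_self_le_rpow_one_add (s := b / a - 1)
            (by have : 0 ≤ b / a := by positivity
                linarith) (show 1 ≤ s + 1 by linarith)
          rw [add_sub_cancel, Real.div_rpow hb0 ha0, Real.rpow_add_one h.ne',
            Real.rpow_add_one' hb0 (by positivity), le_div_iff₀ (by positivity)] at hB
          have : (1 + (s + 1) * (b / a - 1)) * (a ^ s * a) =
              a ^ s * a - (s + 1) * a ^ s * (a - b) := by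
            field_simp; ring
          linarith
      have h5 : a ^ s * b ≤ a ^ s * a := by gcongr
      calc (a ^ s - b ^ s) * b ≤ a ^ s * a - b ^ s * b := by linarith
        _ ≤ (s + 1) * a ^ s * (a - b) := h4
        _ ≤ (s + 1) * M ^ s * ‖z - w‖ := by
          have : 0 ≤ a - b := sub_nonneg.2 hba
          gcongr
  rw [e]
  refine (norm_add_le _ _).trans ?_
  rw [norm_mul, norm_mul, RCLike.norm_conj, RCLike.norm_conj, Complex.norm_real, Complex.norm_real,
    Real.norm_of_nonneg (by positivity), Real.norm_of_nonneg (sub_nonneg.2 hmono)]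
  have h6 : a ^ s * ‖z - w‖ ≤ M ^ s * ‖z - w‖ := by gcongr
  linarith

theorem lipschitzWith_dualityFun {s M : ℝ} (hs : 0 < s) (hM : 0 ≤ M) :
    LipschitzWith ((s + 2) * M ^ s).toNNReal (dualityFun s M) := by
  refine LipschitzWith.of_dist_le_mul fun z w => ?_
  rw [dist_eq_norm, dist_eq_norm, Real.coe_toNNReal _ (by positivity)]
  exact norm_dualityFun_sub_le hs hM z w

theorem dualityFun_zero (s M : ℝ) : dualityFun s M 0 = 0 := by simp [dualityFun]

/-- Hölder's inequality for the inner product of `L²`. -/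
theorem enorm_inner_le {q q' : ℝ} (hqq : q.HolderConjugate q') (f g : L2 ℂ) :
    ‖inner ℂ f g‖ₑ ≤ eLpNorm f (.ofReal q') volume * eLpNorm g (.ofReal q) volume := by
  have e : inner ℂ f g = ∫ x, g x * conj (f x) := by
    rw [L2.inner_def]
    refine integral_congr_ae (.of_forall fun x => ?_)
    simp [RCLike.inner_apply]
  rw [e, mul_comm]
  refine (enorm_integral_mul_le hqq (Lp.aestronglyMeasurable g)
    (Complex.continuous_conj.comp_aestronglyMeasurable (Lp.aestronglyMeasurable f))).trans (le_of_eq ?_)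
  congr 1
  exact eLpNorm_congr_norm_ae (.of_forall fun x => by simp)

theorem inner_freeFlow_freeFlow (s t : ℝ) (f g : L2 ℂ) :
    inner ℂ (freeFlow s f) (freeFlow t g) = inner ℂ f (freeFlow (t - s) g) := by
  have : freeFlow t g = freeFlow s (freeFlow (t - s) g) := by
    rw [freeFlow_freeFlow]; congr 1; ring
  rw [this]
  exact (freeFlowₗᵢ s).inner_map_map f _

theorem aestronglyMeasurable_comp_prodMk {X : Type} [TopologicalSpace X] {u : ℝ × X → X}
    (hu : Continuous u) {α : Type*} [MeasurableSpace α] {μ : Measure α} {τ : α → ℝ}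
    (hτ : AEStronglyMeasurable τ μ) {G : α → X} (hG : AEStronglyMeasurable G μ) :
    AEStronglyMeasurable (fun t => u (τ t, G t)) μ :=
  hu.comp_aestronglyMeasurable (hτ.prodMk hG)

theorem aestronglyMeasurable_freeFlow {F : Type} [NormedAddCommGroup F] [InnerProductSpace ℂ F]
    [CompleteSpace F] {α : Type*} [MeasurableSpace α] {μ : Measure α} {τ : α → ℝ}
    (hτ : AEMeasurable τ μ) {G : α → L2 F} (hG : AEStronglyMeasurable G μ) :
    AEStronglyMeasurable (fun t => freeFlow (τ t) (G t)) μ :=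
  aestronglyMeasurable_comp_prodMk continuous_freeFlow hτ.aestronglyMeasurable hG

/-- The TT* argument: the `L²` norm of the superposition of free waves with data `G(t)`. -/
theorem exists_enorm_integral_freeFlow_le {d p p' q q' : ℝ} (h : IsExponents d p p' q q') :
    ∃ C : ℝ≥0, ∀ G : ℝ → L2 ℂ, Integrable G → ∀ a : ℝ → ℝ≥0∞, Measurable a →
      (∀ t, eLpNorm (G t) (.ofReal q') volume ≤ a t) → (∀ t, a t ≠ ∞) →
      ‖∫ t, freeFlow t (G t)‖ₑ ^ 2 ≤ C * (∫⁻ t, a t ^ p') ^ (2 / p') := by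
  obtain ⟨c, hc⟩ := exists_eLpNorm_freeFlow_le h
  obtain ⟨C, hC⟩ := exists_lintegral_abs_rpow_le h.p_gt h.conj_p
  refine ⟨c * C, fun G hG a ha hGa hat => ?_⟩
  have hI : Integrable fun t => freeFlow t (G t) := by
    refine (hG.norm).mono' (aestronglyMeasurable_freeFlow aemeasurable_id hG.1) ?_
    exact .of_forall fun t => (norm_freeFlow t (G t)).le
  set y := ∫ t, freeFlow t (G t) with hy
  -- Expanding the square of the norm gives the pairings of `G s` with `U(t - s) G t`. The decay
  -- estimate applies off the diagonal, and for each `s` the point `t = s` is a null set.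
  have hpt : ∀ s t : ℝ, t ≠ s → ‖inner ℂ (freeFlow s (G s)) (freeFlow t (G t))‖ₑ ≤
      c * (.ofReal (|t - s| ^ (-(2 / p))) * a s * a t) := by
    intro s t hst
    rw [inner_freeFlow_freeFlow]
    refine (enorm_inner_le h.conj_q _ _).trans ?_
    have h1 := hc (t - s) (sub_ne_zero.2 hst) (G t)
      ⟨Lp.aestronglyMeasurable _, (hGa t).trans_lt (hat t).lt_top⟩
    calc eLpNorm (G s) (.ofReal q') volume * eLpNorm (freeFlow (t - s) (G t)) (.ofReal q) volume
        ≤ a s * (c * .ofReal (|t - s| ^ (-(2 / p))) * a t) := by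
          gcongr
          · exact hGa s
          · exact h1.trans (by gcongr; exact hGa t)
      _ = _ := by ring
  have h1 : ∀ s, ‖inner ℂ (freeFlow s (G s)) y‖ₑ ≤
      c * ∫⁻ t, .ofReal (|t - s| ^ (-(2 / p))) * a s * a t := by
    intro s
    rw [hy, ← integral_inner hI]
    refine (enorm_integral_le_lintegral_enorm _).trans ?_
    rw [← lintegral_const_mul' _ _ ENNReal.coe_ne_top]
    refine lintegral_mono_ae ?_
    have : ∀ᵐ t : ℝ, t ≠ s := by simp [ae_iff]
    filter_upwards [this] with t ht
    exact hpt s t ht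
  have h2 : ‖y‖ₑ ^ 2 ≤ ∫⁻ s, ‖inner ℂ (freeFlow s (G s)) y‖ₑ := by
    have e : ‖y‖ₑ ^ 2 = ‖inner ℂ y y‖ₑ := by
      rw [inner_self_eq_norm_sq_to_K, enorm_pow, ← ofReal_norm, ← ofReal_norm]
      simp
    rw [e]
    nth_rw 2 [hy]
    rw [← integral_inner hI]
    refine (enorm_integral_le_lintegral_enorm _).trans (le_of_eq ?_)
    refine lintegral_congr fun s => ?_
    rw [← inner_conj_symm, RCLike.enorm_conj]
  calc ‖y‖ₑ ^ 2 ≤ ∫⁻ s, c * ∫⁻ t, .ofReal (|t - s| ^ (-(2 / p))) * a s * a t :=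
        h2.trans (lintegral_mono h1)
    _ = c * ∫⁻ s, ∫⁻ t, .ofReal (|t - s| ^ (-(2 / p))) * a s * a t :=
        lintegral_const_mul' _ _ ENNReal.coe_ne_top
    _ ≤ c * (C * (∫⁻ t, a t ^ p') ^ (2 / p')) := by gcongr; exact hC a ha
    _ = _ := by push_cast; ring

/-- A supremum bound uniform in time. It provides a level at which the truncation in `dualityFun`
has no effect along the free wave of a Schwartz datum. -/
theorem norm_freeFlowSchwartz_le_fourier (t : ℝ) (φ : 𝓢(E3, ℂ)) (x : E3) :
    ‖freeFlowSchwartz t φ x‖ ≤ ∫ ξ, ‖𝓕 φ ξ‖ := by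
  unfold freeFlowSchwartz
  rw [SchwartzMap.fourierMultiplierCLM_apply, SchwartzMap.fourierInv_coe, Real.fourierInv_eq']
  refine (norm_integral_le_integral_norm _).trans (le_of_eq ?_)
  refine integral_congr_ae (.of_forall fun ξ => ?_)
  simp only
  rw [SchwartzMap.smulLeftCLM_apply_apply (hasTemperateGrowth_symbol t), smul_eq_mul, smul_eq_mul,
    norm_mul, norm_mul, norm_symbol, one_mul, Complex.norm_exp]
  simp

/-- The Strichartz estimate for Schwartz data. -/
theorem exists_lintegral_eLpNorm_freeFlow_toLp_le {d p p' q q' : ℝ} (h : IsExponents d p p' q q') :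
    ∃ C : ℝ≥0, ∀ (T : ℝ) (φ : 𝓢(E3, ℂ)),
      ∫⁻ t in Set.Icc 0 T, eLpNorm (freeFlow t (φ.toLp 2)) (.ofReal q) volume ^ p ≤
        (C * ‖(φ.toLp 2 : L2 ℂ)‖ₑ ^ 2) ^ (p / 2) := by
  obtain ⟨C, hC⟩ := exists_enorm_integral_freeFlow_le h
  refine ⟨C, fun T φ => ?_⟩
  have hp0 : 0 < p := by linarith [h.p_gt]
  have hp'0 := h.conj_p.symm.pos
  have hq0 : 0 < q := by linarith [h.q_gt]
  have hq2 : 0 < q - 2 := by linarith [h.q_gt]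
  have hq'0 := h.conj_q.symm.pos
  have hqt : ENNReal.ofReal q ≠ 0 := by simpa using hq0
  have hq't : ENNReal.ofReal q' ≠ 0 := by simpa using hq'0
  set f : L2 ℂ := φ.toLp 2 with hf
  set v : ℝ → L2 ℂ := fun t => freeFlow t f with hv
  have hvc : Continuous v := continuous_freeFlow_left f
  set N : ℝ → ℝ≥0∞ := fun t => eLpNorm (v t) (.ofReal q) volume with hN
  have hNm : Measurable N := by
    borelize (L2 ℂ)
    exact (lowerSemicontinuous_eLpNorm _).measurable.comp hvc.measurable
  have hve : ∀ t, v t =ᵐ[volume] freeFlowSchwartz t φ := fun t => coeFn_freeFlow_toLp t φ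
  have hNt : ∀ t, N t ≠ ∞ := by
    intro t
    rw [hN]
    simp only
    rw [eLpNorm_congr_ae (hve t)]
    exact ((freeFlowSchwartz t φ).memLp _ volume).2.ne
  set M₀ : ℝ := ∫ ξ, ‖𝓕 φ ξ‖ with hM₀
  have hM₀0 : 0 ≤ M₀ := integral_nonneg fun _ => norm_nonneg _
  have hvM : ∀ t, ∀ᵐ x, ‖v t x‖ ≤ M₀ := by
    intro t
    filter_upwards [hve t] with x hx
    rw [hx]; exact norm_freeFlowSchwartz_le_fourier t φ x
  have hLip := lipschitzWith_dualityFun (s := q - 2) (M := M₀) hq2 hM₀0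
  -- The truncated duality map is Lipschitz, hence continuous on `L²`, and this gives the
  -- measurability of `t ↦ J (v t)`. At the level `M₀` the truncation is inactive along `v`.
  set J : L2 ℂ → L2 ℂ := fun u => hLip.compLp (dualityFun_zero _ _) u with hJ
  have hJc : Continuous J := hLip.continuous_compLp (dualityFun_zero _ _)
  have hJe : ∀ t, J (v t) =ᵐ[volume] fun x => ((‖v t x‖ ^ (q - 2) : ℝ) : ℂ) * conj (v t x) := by
    intro t
    filter_upwards [hLip.coeFn_compLp (dualityFun_zero _ _) (v t), hvM t] with x hx hxM
    rw [hx, Function.comp_apply, dualityFun, min_eq_left hxM]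
  have hNq : ∀ t, ∫⁻ x, ‖v t x‖ₑ ^ q = N t ^ q := by
    intro t
    rw [hN]
    simp only
    rw [eLpNorm_eq_lintegral_rpow_enorm_toReal hqt ENNReal.ofReal_ne_top,
      ENNReal.toReal_ofReal hq0.le, ← ENNReal.rpow_mul, one_div_mul_cancel hq0.ne', ENNReal.rpow_one]
  have hJq : ∀ t, eLpNorm (J (v t)) (.ofReal q') volume = N t ^ (q - 1) := by
    intro t
    have hq1q : (q - 1) * q' = q := h.conj_q.sub_one_mul_conj
    rw [eLpNorm_congr_ae (hJe t), eLpNorm_eq_lintegral_rpow_enorm_toReal hq't ENNReal.ofReal_ne_top,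
      ENNReal.toReal_ofReal hq'0.le]
    have e : ∀ x, ‖((‖v t x‖ ^ (q - 2) : ℝ) : ℂ) * conj (v t x)‖ₑ ^ q' = ‖v t x‖ₑ ^ q := by
      intro x
      rw [enorm_mul, RCLike.enorm_conj, ← ofReal_norm, Complex.norm_real,
        Real.norm_of_nonneg (by positivity), ← ENNReal.ofReal_rpow_of_nonneg (norm_nonneg _) hq2.le,
        ofReal_norm]
      nth_rw 2 [← ENNReal.rpow_one ‖v t x‖ₑ]
      rw [← ENNReal.rpow_add_of_nonneg _ _ hq2.le zero_le_one, ← ENNReal.rpow_mul,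
        show (q - 2 + 1) * q' = q by rw [show q - 2 + 1 = q - 1 by ring]; exact hq1q]
    simp_rw [e]
    rw [hNq, ← ENNReal.rpow_mul]
    congr 1
    rw [mul_one_div, div_eq_iff hq'0.ne']
    exact hq1q.symm
  have hpair : ∀ t, pairing (v t) (J (v t)) = (((N t).toReal ^ q : ℝ) : ℂ) := by
    intro t
    have e1 : pairing (v t) (J (v t)) = ∫ x, ((‖v t x‖ ^ q : ℝ) : ℂ) := by
      refine integral_congr_ae ?_
      filter_upwards [hJe t] with x hx
      rw [hx, mul_left_comm, Complex.mul_conj', ← Complex.ofReal_pow, ← Complex.ofReal_mul]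
      congr 1
      rcases eq_or_ne (‖v t x‖) 0 with h0 | h0
      · rw [h0, Real.zero_rpow hq0.ne']; simp
      · rw [← Real.rpow_natCast, ← Real.rpow_add (lt_of_le_of_ne (norm_nonneg _) h0.symm)]
        congr 1; push_cast; ring
    rw [e1, integral_complex_ofReal]
    congr 1
    rw [integral_eq_lintegral_of_nonneg_ae (.of_forall fun x => by positivity)
      ((Lp.aestronglyMeasurable (v t)).norm.aemeasurable.pow_const q).aestronglyMeasurable,
      ENNReal.toReal_rpow, ← hNq]
    congr 1
    refine lintegral_congr fun x => ?_
    rw [← ENNReal.ofReal_rpow_of_nonneg (norm_nonneg _) hq0.le, ofReal_norm]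
  -- the estimate on a set where the norm is bounded above and below
  have main : ∀ n : ℕ, ∫⁻ t in (Set.Icc 0 T ∩ {t | ((n : ℝ≥0∞) + 1)⁻¹ ≤ N t ∧ N t ≤ n + 1}), N t ^ p ≤
      (C * ‖f‖ₑ ^ 2) ^ (p / 2) := by
    intro n
    set S : Set ℝ := Set.Icc 0 T ∩ {t | ((n : ℝ≥0∞) + 1)⁻¹ ≤ N t ∧ N t ≤ n + 1} with hS
    have hSm : MeasurableSet S := measurableSet_Icc.inter
      ((measurableSet_le measurable_const hNm).inter (measurableSet_le hNm measurable_const))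
    have hSfin : volume S ≠ ∞ :=
      ne_top_of_le_ne_top (by simp) (measure_mono (Set.inter_subset_left : S ⊆ Set.Icc 0 T))
    have hN0 : ∀ t ∈ S, N t ≠ 0 := by
      intro t ht h0
      have := ht.2.1
      rw [h0, nonpos_iff_eq_zero, ENNReal.inv_eq_zero] at this
      simp at this
    -- The weight turns the pairing `N^q` of `v t` with `J (v t)` into `N^p`, and the `L^{q'}` norm
    -- `N^(q-1)` of `J (v t)` into `N^(p-1)`, whose `p'`-th power is again `N^p`. The two-sided
    -- bound on `N` over `S` keeps the weight bounded whatever the sign of `p - q`.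
    set w : ℝ → ℝ := S.indicator fun t => (N t).toReal ^ (p - q) with hw
    have hwm : Measurable w := (hNm.ennreal_toReal.pow_const _).indicator hSm
    set G : ℝ → L2 ℂ := fun t => ((w t : ℝ) : ℂ) • J (v t) with hG
    have hGm : AEStronglyMeasurable G volume :=
      (Complex.measurable_ofReal.comp hwm).aestronglyMeasurable.smul
        (hJc.comp hvc).aestronglyMeasurable
    have hwb : ∀ t, |w t| ≤ S.indicator (fun _ => ((n : ℝ) + 1) ^ |p - q|) t := by
      intro t
      by_cases ht : t ∈ S
      · rw [hw, Set.indicator_of_mem ht, Set.indicator_of_mem ht, abs_of_nonneg (by positivity)]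
        have hup : (N t).toReal ≤ n + 1 := by
          have := ENNReal.toReal_mono (by simp) ht.2.2
          simpa [ENNReal.toReal_add] using this
        have hlow : ((n : ℝ) + 1)⁻¹ ≤ (N t).toReal := by
          have := ENNReal.toReal_mono (hNt t) ht.2.1
          simpa [ENNReal.toReal_add] using this
        have hpos : 0 < (N t).toReal := lt_of_lt_of_le (by positivity) hlow
        rcases le_total 0 (p - q) with hpq | hpq
        · rw [abs_of_nonneg hpq]; gcongr
        · rw [abs_of_nonpos hpq, show p - q = -(-(p - q)) by ring, Real.rpow_neg hpos.le,
            ← Real.inv_rpow hpos.le, neg_neg]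
          refine Real.rpow_le_rpow (by positivity) ?_ (by linarith)
          exact inv_le_of_inv_le₀ (by positivity) hlow
      · rw [hw, Set.indicator_of_notMem ht, Set.indicator_of_notMem ht, abs_zero]
    have hJb : ∀ t, ‖J (v t)‖ ≤ ((q - 2 + 2) * M₀ ^ (q - 2)).toNNReal * ‖f‖ := by
      intro t
      refine (hLip.norm_compLp_le (dualityFun_zero _ _) (v t)).trans (le_of_eq ?_)
      rw [hv]; simp only; rw [norm_freeFlow]
    have hGi : Integrable G := by
      have hb : Integrable (S.indicator fun _ => ((n : ℝ) + 1) ^ |p - q| *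
          (((q - 2 + 2) * M₀ ^ (q - 2)).toNNReal * ‖f‖)) volume :=
        (integrableOn_const hSfin).integrable_indicator hSm
      refine hb.mono' hGm (.of_forall fun t => ?_)
      rw [hG]
      simp only
      rw [norm_smul, Complex.norm_real, Real.norm_eq_abs]
      by_cases ht : t ∈ S
      · rw [Set.indicator_of_mem ht]
        have := hwb t
        rw [Set.indicator_of_mem ht] at this
        gcongr
        exact hJb t
      · have := hwb t
        rw [Set.indicator_of_notMem ht] at this
        rw [Set.indicator_of_notMem ht, le_antisymm this (abs_nonneg _), zero_mul]
    set a : ℝ → ℝ≥0∞ := S.indicator fun t => N t ^ (p - 1) with ha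
    have ham : Measurable a := (hNm.pow_const _).indicator hSm
    have hGa : ∀ t, eLpNorm (G t) (.ofReal q') volume ≤ a t := by
      intro t
      have e : eLpNorm (G t) (.ofReal q') volume = ‖((w t : ℝ) : ℂ)‖ₑ * N t ^ (q - 1) := by
        rw [← hJq, ← eLpNorm_const_smul, eLpNorm_congr_ae (Lp.coeFn_smul _ _)]
      rw [e]
      by_cases ht : t ∈ S
      · rw [hw, ha, Set.indicator_of_mem ht, Set.indicator_of_mem ht, ← ofReal_norm,
          Complex.norm_real, Real.norm_of_nonneg (by positivity),
          ← ENNReal.ofReal_rpow_of_pos (ENNReal.toReal_pos (hN0 t ht) (hNt t)),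
          ENNReal.ofReal_toReal (hNt t), ← ENNReal.rpow_add _ _ (hN0 t ht) (hNt t)]
        exact le_of_eq (by congr 1; ring)
      · rw [hw, Set.indicator_of_notMem ht]; simp
    have hat : ∀ t, a t ≠ ∞ := by
      intro t
      by_cases ht : t ∈ S
      · rw [ha, Set.indicator_of_mem ht]
        exact ENNReal.rpow_ne_top_of_nonneg (by linarith [h.p_gt]) (hNt t)
      · rw [ha, Set.indicator_of_notMem ht]; simp
    have hest := hC G hGi a ham hGa hat
    have haI : ∫⁻ t, a t ^ p' = ∫⁻ t in S, N t ^ p := by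
      rw [← lintegral_indicator hSm]
      refine lintegral_congr fun t => ?_
      by_cases ht : t ∈ S
      · rw [ha, Set.indicator_of_mem ht, Set.indicator_of_mem ht, ← ENNReal.rpow_mul,
          h.conj_p.sub_one_mul_conj]
      · rw [ha, Set.indicator_of_notMem ht, Set.indicator_of_notMem ht, ENNReal.zero_rpow_of_pos hp'0]
    set I : ℝ≥0∞ := ∫⁻ t in S, N t ^ p with hI
    have hIt : I ≠ ∞ := by
      have h1 : I ≤ ∫⁻ t in S, ((n : ℝ≥0∞) + 1) ^ p := by
        refine setLIntegral_mono' hSm fun t ht => ?_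
        gcongr
        exact ht.2.2
      refine ne_top_of_le_ne_top ?_ h1
      rw [setLIntegral_const]
      exact ENNReal.mul_ne_top (ENNReal.rpow_ne_top_of_nonneg hp0.le (by simp)) hSfin
    have hyI : pairing f (∫ t, freeFlow t (G t)) = ((I.toReal : ℝ) : ℂ) := by
      have hInt : Integrable fun t => freeFlow t (G t) :=
        hGi.norm.mono' (aestronglyMeasurable_freeFlow aemeasurable_id hGi.1)
          (.of_forall fun t => (norm_freeFlow t (G t)).le)
      rw [← pairingCLM_apply, ← ContinuousLinearMap.integral_comp_comm _ hInt]
      have e : ∀ t, pairingCLM f (freeFlow t (G t)) =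
          ((S.indicator (fun t => (N t).toReal ^ p) t : ℝ) : ℂ) := by
        intro t
        rw [pairingCLM_apply, ← pairing_freeFlow, hG]
        simp only
        rw [pairing_smul_right]
        change _ * pairing (v t) (J (v t)) = _
        rw [hpair, ← Complex.ofReal_mul]
        congr 1
        by_cases ht : t ∈ S
        · rw [hw, Set.indicator_of_mem ht, Set.indicator_of_mem ht,
            ← Real.rpow_add (ENNReal.toReal_pos (hN0 t ht) (hNt t))]
          congr 1; ring
        · rw [hw, Set.indicator_of_notMem ht, Set.indicator_of_notMem ht, zero_mul]
      simp_rw [e]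
      rw [integral_complex_ofReal, integral_indicator hSm]
      congr 1
      rw [integral_eq_lintegral_of_nonneg_ae (.of_forall fun x => by positivity)
        (hNm.ennreal_toReal.pow_const p).aestronglyMeasurable, hI]
      congr 1
      refine lintegral_congr fun t => ?_
      rw [ENNReal.toReal_rpow, ENNReal.ofReal_toReal
        (ENNReal.rpow_ne_top_of_nonneg hp0.le (hNt t))]
    have hIle : I ≤ ‖f‖ₑ * ‖∫ t, freeFlow t (G t)‖ₑ := by
      have h1 := norm_pairing_le f (∫ t, freeFlow t (G t))
      rw [hyI, Complex.norm_real, Real.norm_of_nonneg ENNReal.toReal_nonneg] at h1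
      rw [← ofReal_norm, ← ofReal_norm, ← ENNReal.ofReal_mul (norm_nonneg _),
        ← ENNReal.ofReal_toReal hIt]
      exact ENNReal.ofReal_le_ofReal h1
    rw [haI] at hest
    rcases eq_or_ne I 0 with hI0 | hI0
    · rw [hI0]; exact zero_le
    have h2 : I ^ 2 ≤ (C * ‖f‖ₑ ^ 2) * I ^ (2 / p') := by
      calc I ^ 2 ≤ (‖f‖ₑ * ‖∫ t, freeFlow t (G t)‖ₑ) ^ 2 := by gcongr
        _ = ‖f‖ₑ ^ 2 * ‖∫ t, freeFlow t (G t)‖ₑ ^ 2 := mul_pow _ _ _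
        _ ≤ ‖f‖ₑ ^ 2 * (C * I ^ (2 / p')) := by gcongr
        _ = _ := by ring
    -- Division by `I^(2/p')` requires `I` to be finite, which the bounded interval and the upper
    -- cut-off of `N` guarantee.
    have h3 : I ^ (2 / p) ≤ C * ‖f‖ₑ ^ 2 := by
      have e : I ^ 2 = I ^ (2 / p) * I ^ (2 / p') := by
        rw [← ENNReal.rpow_add _ _ hI0 hIt, ← ENNReal.rpow_natCast]
        congr 1
        have := h.conj_p.inv_add_inv_eq_one
        push_cast
        rw [div_eq_mul_inv, div_eq_mul_inv, ← mul_add, this, mul_one]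
      rw [e] at h2
      exact (ENNReal.mul_le_mul_iff_left (by simp [hI0, hIt])
        (ENNReal.rpow_ne_top_of_nonneg (by positivity) hIt)).1 h2
    calc I = (I ^ (2 / p)) ^ (p / 2) := by
          rw [← ENNReal.rpow_mul]
          rw [show 2 / p * (p / 2) = 1 by field_simp, ENNReal.rpow_one]
      _ ≤ _ := by gcongr
  set S : ℕ → Set ℝ := fun n => Set.Icc 0 T ∩ {t | ((n : ℝ≥0∞) + 1)⁻¹ ≤ N t ∧ N t ≤ n + 1} with hS
  have hSm : ∀ n, MeasurableSet (S n) := fun n => measurableSet_Icc.inter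
      ((measurableSet_le measurable_const hNm).inter (measurableSet_le hNm measurable_const))
  have hmono : Monotone S := by
    intro m n hmn t ht
    have hmn' : (m : ℝ≥0∞) + 1 ≤ n + 1 := by gcongr
    exact ⟨ht.1, (ENNReal.inv_le_inv.2 hmn').trans ht.2.1, ht.2.2.trans hmn'⟩
  have hle : ∫⁻ t in Set.Icc 0 T, N t ^ p ≤ ∫⁻ t in ⋃ n, S n, N t ^ p := by
    rw [← lintegral_indicator measurableSet_Icc, ← lintegral_indicator (MeasurableSet.iUnion hSm)]
    refine lintegral_mono fun t => ?_
    by_cases ht : t ∈ Set.Icc 0 T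
    · rw [Set.indicator_of_mem ht]
      rcases eq_or_ne (N t) 0 with h0 | h0
      · rw [h0, ENNReal.zero_rpow_of_pos hp0]; exact zero_le
      · obtain ⟨n₁, hn₁⟩ := ENNReal.exists_nat_gt (ENNReal.inv_ne_top.2 h0)
        obtain ⟨n₂, hn₂⟩ := ENNReal.exists_nat_gt (hNt t)
        have hmem : t ∈ ⋃ n, S n := by
          refine Set.mem_iUnion.2 ⟨max n₁ n₂, ht, ?_, ?_⟩
          · rw [ENNReal.inv_le_iff_inv_le]
            refine hn₁.le.trans ((Nat.cast_le.2 (le_max_left n₁ n₂)).trans le_self_add)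
          · exact hn₂.le.trans ((Nat.cast_le.2 (le_max_right n₁ n₂)).trans le_self_add)
        rw [Set.indicator_of_mem hmem]
    · rw [Set.indicator_of_notMem ht]; exact zero_le
  refine hle.trans ?_
  rw [setLIntegral_iUnion_of_directed _ hmono.directed_le]
  exact iSup_le main

end

/-! ### The Strichartz constant, and vector-valued functions by components -/

section

theorem mixedNorm_eq_lintegral {F : Type} [NormedAddCommGroup F] {p : ℝ} (hp : 0 < p) (q : ℝ≥0∞)
    (T : ℝ) (u : ℝ → L2 F) :
    mixedNorm (.ofReal p) q T u =
      (∫⁻ t, eLpNorm (u t) q volume ^ p ∂(timeMeasure T)) ^ (1 / p) := by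
  rw [mixedNorm, eLpNorm_eq_lintegral_rpow_enorm_toReal (by simpa using hp) ENNReal.ofReal_ne_top,
    ENNReal.toReal_ofReal hp.le]
  rfl

/-- The mixed norm is lower semicontinuous for almost everywhere convergence in `L²`. -/
theorem mixedNorm_le_of_tendsto {F : Type} [NormedAddCommGroup F] {p : ℝ} (hp : 0 < p) {q : ℝ≥0∞}
    {T : ℝ} {u : ℕ → ℝ → L2 F} {v : ℝ → L2 F} {c : ℝ≥0∞}
    (hm : ∀ n, AEStronglyMeasurable (u n) (timeMeasure T))
    (hlim : ∀ᵐ t ∂(timeMeasure T), Filter.Tendsto (fun n => u n t) Filter.atTop (nhds (v t)))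
    (hu : ∀ᶠ n in Filter.atTop, mixedNorm (.ofReal p) q T (u n) ≤ c) :
    mixedNorm (.ofReal p) q T v ≤ c := by
  rw [mixedNorm_eq_lintegral hp]
  have h1 : ∫⁻ t, eLpNorm (v t) q volume ^ p ∂(timeMeasure T) ≤ c ^ p := by
    -- Lower semicontinuity of the spatial norm at almost every time, followed by Fatou's lemma in
    -- time.
    calc ∫⁻ t, eLpNorm (v t) q volume ^ p ∂(timeMeasure T)
        ≤ ∫⁻ t, Filter.liminf (fun n => eLpNorm (u n t) q volume ^ p) Filter.atTop
            ∂(timeMeasure T) := by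
          refine lintegral_mono_ae ?_
          filter_upwards [hlim] with t ht
          have h2 : eLpNorm (v t) q volume ≤
              Filter.liminf (fun n => eLpNorm (u n t) q volume) Filter.atTop := by
            have h3 := (lowerSemicontinuous_eLpNorm (F := F) q).le_liminf (v t)
            refine h3.trans ?_
            exact Filter.liminf_le_liminf_of_le ht
          refine (ENNReal.rpow_le_rpow h2 hp.le).trans (le_of_eq ?_)
          have h4 := (ENNReal.orderIsoRpow p hp).liminf_apply
            (u := fun n => eLpNorm (u n t) q volume) (f := Filter.atTop)
          exact h4
      _ ≤ Filter.liminf (fun n => ∫⁻ t, eLpNorm (u n t) q volume ^ p ∂(timeMeasure T))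
            Filter.atTop :=
          lintegral_liminf_le' fun n => (aemeasurable_eLpNorm q (hm n)).pow_const p
      _ ≤ c ^ p := by
          refine Filter.liminf_le_of_le (by isBoundedDefault) fun b hb => ?_
          obtain ⟨n, hn, hn'⟩ := (hb.and hu).exists
          refine hn.trans ?_
          rw [mixedNorm_eq_lintegral hp] at hn'
          calc _ = ((∫⁻ t, eLpNorm (u n t) q volume ^ p ∂(timeMeasure T)) ^ (1 / p)) ^ p := by
                rw [← ENNReal.rpow_mul, one_div_mul_cancel hp.ne', ENNReal.rpow_one]
            _ ≤ c ^ p := by gcongr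
  calc _ ≤ (c ^ p) ^ (1 / p) := by gcongr
    _ = c := by rw [← ENNReal.rpow_mul, mul_one_div_cancel hp.ne', ENNReal.rpow_one]

/-- The homogeneous Strichartz estimate. -/
theorem exists_mixedNorm_freeFlow_le {d p p' q q' : ℝ} (h : IsExponents d p p' q q') :
    ∃ C : ℝ≥0, ∀ (T : ℝ) (φ : L2 ℂ),
      mixedNorm (.ofReal p) (.ofReal q) T (fun t => freeFlow t φ) ≤ C * ‖φ‖ₑ := by
  obtain ⟨C, hC⟩ := exists_lintegral_eLpNorm_freeFlow_toLp_le h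
  have hp0 : 0 < p := by linarith [h.p_gt]
  refine ⟨C ^ (1 / 2 : ℝ), fun T φ => ?_⟩
  have hS : ∀ g : 𝓢(E3, ℂ), mixedNorm (.ofReal p) (.ofReal q) T (fun t => freeFlow t (g.toLp 2 : L2 ℂ)) ≤
      (C ^ (1 / 2 : ℝ) : ℝ≥0) * ‖(g.toLp 2 : L2 ℂ)‖ₑ := by
    intro g
    rw [mixedNorm_eq_lintegral hp0]
    refine (ENNReal.rpow_le_rpow (hC T g) (by positivity)).trans (le_of_eq ?_)
    rw [← ENNReal.rpow_mul, show p / 2 * (1 / p) = 1 / 2 by field_simp,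
      ENNReal.mul_rpow_of_nonneg _ _ (by norm_num), ENNReal.coe_rpow_of_nonneg _ (by norm_num)]
    congr 1
    rw [← ENNReal.rpow_natCast, ← ENNReal.rpow_mul]
    norm_num
  obtain ⟨g, hg⟩ := mem_closure_iff_seq_limit.1 (denseRange_toLp (F := ℂ) φ)
  obtain ⟨hg1, hg2⟩ := hg
  refine ENNReal.le_of_forall_pos_le_add fun ε hε _ => ?_
  refine mixedNorm_le_of_tendsto (u := fun n t => freeFlow t (g n)) hp0 (fun n =>
    (continuous_freeFlow_left (g n)).aestronglyMeasurable) (.of_forall fun t =>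
      ((freeFlowₗᵢ t).continuous.tendsto φ).comp hg2) ?_
  have hlim : Filter.Tendsto (fun n => ((C ^ (1 / 2 : ℝ) : ℝ≥0) : ℝ≥0∞) * ‖g n‖ₑ) Filter.atTop
      (nhds ((C ^ (1 / 2 : ℝ) : ℝ≥0) * ‖φ‖ₑ)) :=
    ENNReal.Tendsto.const_mul hg2.enorm (.inr ENNReal.coe_ne_top)
  have hlt : ((C ^ (1 / 2 : ℝ) : ℝ≥0) : ℝ≥0∞) * ‖φ‖ₑ < (C ^ (1 / 2 : ℝ) : ℝ≥0) * ‖φ‖ₑ + ε :=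
    ENNReal.lt_add_right (ENNReal.mul_ne_top ENNReal.coe_ne_top enorm_ne_top) (by simpa using hε.ne')
  filter_upwards [hlim.eventually_lt_const hlt] with n hn
  obtain ⟨γ, hγ⟩ := hg1 n
  refine le_trans ?_ hn.le
  rw [← hγ]
  exact hS γ

theorem strichartzConst_lt_top {d p p' q q' : ℝ} (h : IsExponents d p p' q q') :
    strichartzConst p q < ∞ := by
  obtain ⟨C, hC⟩ := exists_mixedNorm_freeFlow_le h
  refine lt_of_le_of_lt (b := (C : ℝ≥0∞)) ?_ ENNReal.coe_lt_top
  unfold strichartzConst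
  refine sInf_le ?_
  intro T _ φ
  exact hC T φ

/-- The infimum that defines the constant is attained: the inequality can be divided by the norm of
the datum, a vanishing norm being treated separately. -/
theorem mixedNorm_freeFlow_le {d p p' q q' : ℝ} (h : IsExponents d p p' q q') {T : ℝ} (hT : 0 < T)
    (φ : L2 ℂ) : mixedNorm (.ofReal p) (.ofReal q) T (fun t => freeFlow t φ) ≤
      strichartzConst p q * ‖φ‖ₑ := by
  obtain ⟨C, hC⟩ := exists_mixedNorm_freeFlow_le h
  rcases eq_or_ne ‖φ‖ₑ 0 with h0 | h0
  · have := hC T φ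
    rw [h0, mul_zero] at this
    exact this.trans zero_le
  · rw [← ENNReal.div_le_iff_le_mul (.inl h0) (.inl enorm_ne_top)]
    refine le_sInf fun ρ hρ => ?_
    rw [ENNReal.div_le_iff_le_mul (.inl h0) (.inl enorm_ne_top)]
    exact hρ T hT φ

theorem exists_L2_ne_zero : ∃ φ : L2 ℂ, φ ≠ 0 := by
  have hfin : volume (Metric.ball (0 : E3) 1) ≠ ∞ := measure_ball_lt_top.ne
  refine ⟨indicatorConstLp 2 (measurableSet_ball (x := (0 : E3)) (ε := 1)) hfin (1 : ℂ), fun h => ?_⟩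
  have h1 := norm_indicatorConstLp (p := 2) (μ := volume) (c := (1 : ℂ)) (hs := measurableSet_ball (x := (0 : E3)) (ε := 1))
    (hμs := hfin) two_ne_zero ENNReal.ofNat_ne_top
  rw [h, norm_zero, norm_one, one_mul] at h1
  have : 0 < volume.real (Metric.ball (0 : E3) 1) :=
    ENNReal.toReal_pos (Metric.measure_ball_pos _ _ one_pos).ne' hfin
  have := Real.rpow_pos_of_pos this (1 / (2 : ℝ≥0∞).toReal)
  linarith

/-- Needed because one of the smallness conditions on the existence time has the constant on its
right-hand side. If it were zero, a free wave with non-zero datum would vanish at some time,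
contrary to the conservation of the `L²` norm. -/
theorem strichartzConst_ne_zero {d p p' q q' : ℝ} (h : IsExponents d p p' q q') :
    strichartzConst p q ≠ 0 := by
  intro h0
  obtain ⟨φ, hφ⟩ := exists_L2_ne_zero
  have hp0 : 0 < p := by linarith [h.p_gt]
  have hq0 : 0 < q := by linarith [h.q_gt]
  have h1 := mixedNorm_freeFlow_le h one_pos φ
  rw [h0, zero_mul, nonpos_iff_eq_zero, mixedNorm_eq_lintegral hp0, ENNReal.rpow_eq_zero_iff_of_pos
    (by positivity), lintegral_eq_zero_iff'
    ((aemeasurable_eLpNorm _ (continuous_freeFlow_left φ).aestronglyMeasurable).pow_const p)] at h1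
  have hne : (timeMeasure 1) ≠ 0 := by
    intro h2
    have : timeMeasure 1 (Set.Icc 0 1) = 0 := by rw [h2]; simp
    rw [Measure.restrict_apply_self] at this
    simp at this
  have : (ae (timeMeasure 1)).NeBot := ae_neBot.2 hne
  obtain ⟨t, ht⟩ := h1.exists
  rw [Pi.zero_apply, ENNReal.rpow_eq_zero_iff_of_pos hp0,
    eLpNorm_eq_zero_iff (Lp.aestronglyMeasurable _) (by simpa using hq0),
    ← Lp.eq_zero_iff_ae_eq_zero] at ht
  apply hφ
  rw [← norm_eq_zero, ← norm_freeFlow t φ, ht, norm_zero]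

/-! ### Components of vector-valued functions -/

variable {K : ℕ}

/-- The `i`-th component of `Φ ∈ L²(ℝ³; ℂ^K)`. -/
def comp (i : Fin K) : L2 (Orb K) →L[ℂ] L2 ℂ :=
  (EuclideanSpace.proj i : Orb K →L[ℂ] ℂ).compLpL 2 volume

theorem coeFn_comp (i : Fin K) (Φ : L2 (Orb K)) : comp i Φ =ᵐ[volume] fun x => Φ x i :=
  ContinuousLinearMap.coeFn_compLpL _ _

theorem enorm_sq_eq_lintegral {F : Type} [NormedAddCommGroup F] (f : L2 F) :
    ‖f‖ₑ ^ 2 = ∫⁻ x, ‖f x‖ₑ ^ 2 := by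
  rw [Lp.enorm_def, eLpNorm_eq_lintegral_rpow_enorm_toReal two_ne_zero ENNReal.ofNat_ne_top,
    ← ENNReal.rpow_natCast, ← ENNReal.rpow_mul]
  simp

theorem enorm_sq_orb (v : Orb K) : ‖v‖ₑ ^ 2 = ∑ i, ‖v i‖ₑ ^ 2 := by
  have h := EuclideanSpace.norm_sq_eq v
  rw [← ofReal_norm, ← ENNReal.ofReal_pow (norm_nonneg _), h,
    ENNReal.ofReal_sum_of_nonneg fun i _ => by positivity]
  refine Finset.sum_congr rfl fun i _ => ?_
  rw [ENNReal.ofReal_pow (norm_nonneg _), ofReal_norm]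

theorem enorm_sq_eq_sum_comp (Φ : L2 (Orb K)) : ‖Φ‖ₑ ^ 2 = ∑ i, ‖comp i Φ‖ₑ ^ 2 := by
  simp_rw [enorm_sq_eq_lintegral]
  rw [← lintegral_finsetSum' _ fun i _ => ((Lp.aestronglyMeasurable _).enorm.pow_const 2)]
  refine lintegral_congr_ae ?_
  have : ∀ᵐ x, ∀ i : Fin K, comp i Φ x = Φ x i := ae_all_iff.2 fun i => coeFn_comp i Φ
  filter_upwards [this] with x hx
  rw [enorm_sq_orb]
  simp_rw [hx]

theorem enorm_comp_le (i : Fin K) (Φ : L2 (Orb K)) : ‖comp i Φ‖ₑ ≤ ‖Φ‖ₑ := by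
  rw [Lp.enorm_def, Lp.enorm_def, eLpNorm_congr_ae (coeFn_comp i Φ)]
  exact eLpNorm_mono fun x => PiLp.norm_apply_le (Φ x) i

theorem comp_toLp (i : Fin K) (g : 𝓢(E3, Orb K)) :
    comp i (g.toLp 2) = (g.postcompCLM (EuclideanSpace.proj i : Orb K →L[ℂ] ℂ)).toLp 2 := by
  refine Lp.ext ?_
  filter_upwards [coeFn_comp i (g.toLp 2), g.coeFn_toLp 2 volume,
    (g.postcompCLM (EuclideanSpace.proj i : Orb K →L[ℂ] ℂ)).coeFn_toLp 2 volume] with x h1 h2 h3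
  rw [h1, h2, h3]; rfl

theorem fourier_postcompCLM (i : Fin K) (g : 𝓢(E3, Orb K)) :
    𝓕 (g.postcompCLM (EuclideanSpace.proj i : Orb K →L[ℂ] ℂ)) =
      (𝓕 g).postcompCLM (EuclideanSpace.proj i : Orb K →L[ℂ] ℂ) := by
  ext ξ
  rw [SchwartzMap.postcompCLM_apply, SchwartzMap.fourier_coe, SchwartzMap.fourier_coe,
    Real.fourier_eq, Real.fourier_eq, ← ContinuousLinearMap.integral_comp_comm]
  · rfl
  · exact (Real.fourierIntegral_convergent_iff ξ).2 g.integrable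

theorem fourierInv_postcompCLM (i : Fin K) (g : 𝓢(E3, Orb K)) :
    𝓕⁻ (g.postcompCLM (EuclideanSpace.proj i : Orb K →L[ℂ] ℂ)) =
      (𝓕⁻ g).postcompCLM (EuclideanSpace.proj i : Orb K →L[ℂ] ℂ) := by
  have h := fourier_postcompCLM i (𝓕⁻ g)
  rw [FourierTransform.fourier_fourierInv_eq] at h
  rw [← h, FourierTransform.fourierInv_fourier_eq]

/-- The Fourier transform commutes with coordinate projections and the symbol is scalar; this is
seen on Schwartz functions and extended by density. It reduces the evolution of `ℂ^K`-valued
functions to the scalar theory. -/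
theorem comp_freeFlow (i : Fin K) (t : ℝ) (Φ : L2 (Orb K)) :
    comp i (freeFlow t Φ) = freeFlow t (comp i Φ) := by
  refine denseRange_toLp.induction_on
    (p := fun Φ : L2 (Orb K) => comp i (freeFlow t Φ) = freeFlow t (comp i Φ)) Φ ?_ fun g => ?_
  · exact isClosed_eq ((comp i).continuous.comp (freeFlowₗᵢ t).continuous)
      ((freeFlowₗᵢ t).continuous.comp (comp i).continuous)
  · rw [freeFlow_toLp_fourierMultiplier, comp_toLp, comp_toLp, freeFlow_toLp_fourierMultiplier]
    congr 1
    rw [SchwartzMap.fourierMultiplierCLM_apply, SchwartzMap.fourierMultiplierCLM_apply,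
      fourier_postcompCLM, ← fourierInv_postcompCLM]
    congr 1
    ext ξ
    rw [SchwartzMap.postcompCLM_apply, SchwartzMap.smulLeftCLM_apply_apply (hasTemperateGrowth_symbol t),
      SchwartzMap.smulLeftCLM_apply_apply (hasTemperateGrowth_symbol t), SchwartzMap.postcompCLM_apply]
    rfl

/-- The function with prescribed components. -/
def ofComp (u : Fin K → L2 ℂ) : L2 (Orb K) :=
  ∑ i, (ContinuousLinearMap.toSpanSingleton ℂ (EuclideanSpace.single i (1 : ℂ) : Orb K)).compLpL 2
    volume (u i)

theorem comp_ofComp (u : Fin K → L2 ℂ) (i : Fin K) : comp i (ofComp u) = u i := by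
  rw [ofComp, map_sum, Finset.sum_eq_single i]
  · refine Lp.ext ?_
    filter_upwards [coeFn_comp i ((ContinuousLinearMap.toSpanSingleton ℂ
      (EuclideanSpace.single i (1 : ℂ) : Orb K)).compLpL 2 volume (u i)),
      ContinuousLinearMap.coeFn_compLpL (p := 2) (μ := volume) (ContinuousLinearMap.toSpanSingleton ℂ
      (EuclideanSpace.single i (1 : ℂ) : Orb K)) (u i)] with x h1 h2
    rw [h1, h2]; simp
  · intro j _ hj
    refine Lp.ext ?_
    filter_upwards [coeFn_comp i ((ContinuousLinearMap.toSpanSingleton ℂ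
      (EuclideanSpace.single j (1 : ℂ) : Orb K)).compLpL 2 volume (u j)),
      ContinuousLinearMap.coeFn_compLpL (p := 2) (μ := volume) (ContinuousLinearMap.toSpanSingleton ℂ
      (EuclideanSpace.single j (1 : ℂ) : Orb K)) (u j), Lp.coeFn_zero ℂ 2 (volume : Measure E3)] with x h1 h2 h3
    rw [h1, h2, h3]; simp [hj.symm]
  · simp

theorem continuous_ofComp {X : Type*} [TopologicalSpace X] {u : X → Fin K → L2 ℂ}
    (h : ∀ i, Continuous fun x => u x i) : Continuous fun x => ofComp (u x) :=
  continuous_finsetSum _ fun i _ => (ContinuousLinearMap.continuous _).comp (h i)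

theorem enorm_le_sum_comp (Φ : L2 (Orb K)) : ‖Φ‖ₑ ≤ ∑ i, ‖comp i Φ‖ₑ := by
  have h := enorm_sq_eq_sum_comp Φ
  have h2 : ‖Φ‖ₑ ^ 2 ≤ (∑ i, ‖comp i Φ‖ₑ) ^ 2 := by
    rw [h]
    exact Finset.sum_sq_le_sq_sum_of_nonneg (fun _ _ => zero_le)
  exact (ENNReal.pow_le_pow_left_iff two_ne_zero).1 h2

end

/-! ### Vector-valued Strichartz estimates with the scalar constant -/

section

variable {K : ℕ}

theorem lintegral_rpow_sum_le {α ι : Type*} [MeasurableSpace α] {μ : Measure α} {r : ℝ} (hr : 1 ≤ r)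
    (s : Finset ι) {g : ι → α → ℝ≥0∞} (hg : ∀ i, AEMeasurable (g i) μ) :
    (∫⁻ x, (∑ i ∈ s, g i x) ^ r ∂μ) ^ (1 / r) ≤ ∑ i ∈ s, (∫⁻ x, g i x ^ r ∂μ) ^ (1 / r) := by
  classical
  have hr0 : 0 < r := by linarith
  induction s using Finset.induction_on with
  | empty => simp [hr0]
  | insert i s hi ih =>
    simp_rw [Finset.sum_insert hi]
    refine (ENNReal.lintegral_Lp_add_le (hg i)
      (Finset.aemeasurable_fun_sum s fun i _ => hg i) hr).trans ?_
    gcongr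

/-- The square of an `L^q` norm, `q ≥ 2`, is subadditive under sums of squares. -/
theorem sq_lintegral_rpow_le {α ι : Type*} [MeasurableSpace α] [Fintype ι] {μ : Measure α} {q : ℝ}
    (hq : 2 ≤ q) {f : α → ℝ≥0∞} {g : ι → α → ℝ≥0∞} (hg : ∀ i, AEMeasurable (g i) μ)
    (h : ∀ᵐ x ∂μ, f x ^ 2 ≤ ∑ i, g i x ^ 2) :
    ((∫⁻ x, f x ^ q ∂μ) ^ (1 / q)) ^ 2 ≤ ∑ i, ((∫⁻ x, g i x ^ q ∂μ) ^ (1 / q)) ^ 2 := by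
  have hq0 : 0 < q := by linarith
  -- The square of an `L^q` norm is the `L^{q/2}` norm of the square, and `q / 2 ≥ 1` makes the
  -- triangle inequality available there.
  have e : ∀ f : α → ℝ≥0∞, ((∫⁻ x, f x ^ q ∂μ) ^ (1 / q)) ^ 2 =
      (∫⁻ x, (f x ^ 2) ^ (q / 2) ∂μ) ^ (1 / (q / 2)) := by
    intro f
    rw [← ENNReal.rpow_natCast, ← ENNReal.rpow_mul]
    congr 1
    · refine lintegral_congr fun x => ?_
      rw [← ENNReal.rpow_natCast, ← ENNReal.rpow_mul]
      congr 1
      push_cast; ring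
    · push_cast; field_simp
  simp_rw [e]
  refine le_trans ?_ (lintegral_rpow_sum_le (by linarith : 1 ≤ q / 2) Finset.univ
    fun i => (hg i).pow_const 2)
  refine ENNReal.rpow_le_rpow (lintegral_mono_ae ?_) (by positivity)
  filter_upwards [h] with x hx
  exact ENNReal.rpow_le_rpow hx (by positivity)

theorem eLpNorm_eq_lintegral {F : Type} [NormedAddCommGroup F] {q : ℝ} (hq : 0 < q) (f : E3 → F) :
    eLpNorm f (.ofReal q) volume = (∫⁻ x, ‖f x‖ₑ ^ q) ^ (1 / q) := by
  rw [eLpNorm_eq_lintegral_rpow_enorm_toReal (by simpa using hq) ENNReal.ofReal_ne_top,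
    ENNReal.toReal_ofReal hq.le]

theorem sq_eLpNorm_le_sum_comp {q : ℝ} (hq : 2 ≤ q) (Φ : L2 (Orb K)) :
    eLpNorm Φ (.ofReal q) volume ^ 2 ≤ ∑ i, eLpNorm (comp i Φ) (.ofReal q) volume ^ 2 := by
  have hq0 : 0 < q := by linarith
  simp_rw [eLpNorm_eq_lintegral hq0]
  refine sq_lintegral_rpow_le hq (fun i => (Lp.aestronglyMeasurable _).enorm) ?_
  have : ∀ᵐ x, ∀ i : Fin K, comp i Φ x = Φ x i := ae_all_iff.2 fun i => coeFn_comp i Φ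
  filter_upwards [this] with x hx
  simp_rw [enorm_sq_orb, hx, le_refl]

/-- Adding squares of norms, first in space and then in time, loses no factor depending on `K`. This
is why the constant of the scalar estimate also serves for systems. -/
theorem sq_mixedNorm_le_sum_comp {p q : ℝ} (hp : 2 ≤ p) (hq : 2 ≤ q) {T : ℝ} {u : ℝ → L2 (Orb K)}
    (hu : AEStronglyMeasurable u (timeMeasure T)) :
    mixedNorm (.ofReal p) (.ofReal q) T u ^ 2 ≤
      ∑ i, mixedNorm (.ofReal p) (.ofReal q) T (fun t => comp i (u t)) ^ 2 := by
  have hp0 : 0 < p := by linarith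
  simp_rw [mixedNorm_eq_lintegral hp0]
  exact sq_lintegral_rpow_le hp (fun i => aemeasurable_eLpNorm _
    ((comp i).continuous.comp_aestronglyMeasurable hu)) (.of_forall fun t => sq_eLpNorm_le_sum_comp hq _)

theorem mixedNorm_le_sum_comp {p q : ℝ} (hp : 2 ≤ p) (hq : 2 ≤ q) {T : ℝ} {u : ℝ → L2 (Orb K)}
    (hu : AEStronglyMeasurable u (timeMeasure T)) :
    mixedNorm (.ofReal p) (.ofReal q) T u ≤
      ∑ i, mixedNorm (.ofReal p) (.ofReal q) T (fun t => comp i (u t)) :=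
  (ENNReal.pow_le_pow_left_iff two_ne_zero).1 ((sq_mixedNorm_le_sum_comp hp hq hu).trans
    (Finset.sum_sq_le_sq_sum_of_nonneg fun _ _ => zero_le))

theorem mixedNorm_add_le {F : Type} [NormedAddCommGroup F] {p q : ℝ} (hp : 1 ≤ p) (hq : 1 ≤ q)
    {T : ℝ} {u v : ℝ → L2 F} (hu : AEStronglyMeasurable u (timeMeasure T))
    (hv : AEStronglyMeasurable v (timeMeasure T)) :
    mixedNorm (.ofReal p) (.ofReal q) T (u + v) ≤
      mixedNorm (.ofReal p) (.ofReal q) T u + mixedNorm (.ofReal p) (.ofReal q) T v := by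
  have hp0 : 0 < p := by linarith
  simp_rw [mixedNorm_eq_lintegral hp0]
  refine le_trans ?_ (ENNReal.lintegral_Lp_add_le (aemeasurable_eLpNorm _ hu)
    (aemeasurable_eLpNorm _ hv) hp)
  refine ENNReal.rpow_le_rpow (lintegral_mono fun t => ?_) (by positivity)
  refine ENNReal.rpow_le_rpow ?_ hp0.le
  rw [Pi.add_apply, Pi.add_apply, eLpNorm_congr_ae (Lp.coeFn_add _ _)]
  exact eLpNorm_add_le (Lp.aestronglyMeasurable _) (Lp.aestronglyMeasurable _) (by simpa using hq)

theorem eLpNorm_neg_L2 {F : Type} [NormedAddCommGroup F] (q : ℝ≥0∞) (f : L2 F) :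
    eLpNorm (-f : L2 F) q volume = eLpNorm f q volume := by
  rw [eLpNorm_congr_ae (Lp.coeFn_neg f), eLpNorm_neg]

theorem mixedNorm_neg {F : Type} [NormedAddCommGroup F] (p q : ℝ≥0∞) (T : ℝ) (u : ℝ → L2 F) :
    mixedNorm p q T (-u) = mixedNorm p q T u := by
  simp_rw [mixedNorm, Pi.neg_apply, eLpNorm_neg_L2]

theorem mixedNorm_sub_le {F : Type} [NormedAddCommGroup F] {p q : ℝ} (hp : 1 ≤ p) (hq : 1 ≤ q)
    {T : ℝ} {u v : ℝ → L2 F} (hu : AEStronglyMeasurable u (timeMeasure T))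
    (hv : AEStronglyMeasurable v (timeMeasure T)) :
    mixedNorm (.ofReal p) (.ofReal q) T (u - v) ≤
      mixedNorm (.ofReal p) (.ofReal q) T u + mixedNorm (.ofReal p) (.ofReal q) T v := by
  rw [sub_eq_add_neg, ← mixedNorm_neg _ _ _ v]
  exact mixedNorm_add_le hp hq hu hv.neg

/-- The Strichartz estimate for vector valued data, with the constant of the scalar case. -/
theorem mixedNorm_freeFlow_orb_le {d p p' q q' : ℝ} (h : IsExponents d p p' q q') {T : ℝ}
    (hT : 0 < T) (Φ : L2 (Orb K)) :
    mixedNorm (.ofReal p) (.ofReal q) T (fun t => freeFlow t Φ) ≤ strichartzConst p q * ‖Φ‖ₑ := by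
  refine (ENNReal.pow_le_pow_left_iff two_ne_zero).1 ?_
  refine (sq_mixedNorm_le_sum_comp h.p_gt.le h.q_gt.le
    (continuous_freeFlow_left Φ).aestronglyMeasurable).trans ?_
  rw [mul_pow, enorm_sq_eq_sum_comp, Finset.mul_sum]
  refine Finset.sum_le_sum fun i _ => ?_
  rw [← mul_pow]
  simp_rw [comp_freeFlow]
  exact pow_le_pow_left' (mixedNorm_freeFlow_le h hT _) 2

end

/-! ### Free waves from arbitrary times and fractional integration in time -/

section

variable {d p p' q q' : ℝ}

theorem IsExponents.p_pos (h : IsExponents d p p' q q') : 0 < p := by linarith [h.p_gt]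

theorem IsExponents.p'_pos (h : IsExponents d p p' q q') : 0 < p' := h.conj_p.symm.pos

theorem IsExponents.q_pos (h : IsExponents d p p' q q') : 0 < q := by linarith [h.q_gt]

theorem IsExponents.γ_pos (h : IsExponents d p p' q q') : 0 < 1 - 2 / p := by
  rw [sub_pos, div_lt_one h.p_pos]; exact h.p_gt

/-- The Strichartz estimate for free waves running in either direction from any time. -/
theorem lintegral_eLpNorm_freeFlow_sub_le (h : IsExponents d p p' q q') {T : ℝ} (hT : 0 < T)
    (t : ℝ) (φ : L2 ℂ) :
    ∫⁻ s in Set.Icc 0 T, eLpNorm (freeFlow (t - s) φ) (.ofReal q) volume ^ p ≤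
      (strichartzConst p q * ‖φ‖ₑ) ^ p := by
  -- One has `U(t - s) φ = U(T - s) U(t - T) φ`, and `s ↦ T - s` maps `[0, T]` onto itself.
  have h1 := mixedNorm_freeFlow_le h hT (freeFlow (t - T) φ)
  have e : ‖freeFlow (t - T) φ‖ₑ = ‖φ‖ₑ := by
    rw [← ofReal_norm, norm_freeFlow, ofReal_norm]
  rw [mixedNorm_eq_lintegral h.p_pos, e, one_div, ENNReal.rpow_inv_le_iff h.p_pos] at h1
  refine le_trans (le_of_eq ?_) h1
  have h2 := (Measure.measurePreserving_sub_left (volume : Measure ℝ) T).setLIntegral_comp_preimage_emb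
    (measurableEmbedding_subLeft T)
    (fun s => eLpNorm (freeFlow s (freeFlow (t - T) φ)) (.ofReal q) volume ^ p) (Set.Icc 0 T)
  rw [Set.preimage_const_sub_Icc, sub_self, sub_zero] at h2
  rw [← h2]
  refine lintegral_congr fun s => ?_
  rw [freeFlow_freeFlow, show T - s + (t - T) = t - s by ring]

theorem aemeasurable_eLpNorm_freeFlow_sub (μ : Measure ℝ) (t : ℝ) (φ : L2 ℂ) (q : ℝ≥0∞) :
    AEMeasurable (fun s => eLpNorm (freeFlow (t - s) φ) q volume) μ :=
  aemeasurable_eLpNorm _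
    ((continuous_freeFlow_left φ).comp (continuous_const.sub continuous_id)).aestronglyMeasurable

/-- At almost every time the evolved test function lies in `L^q`, so that the force can be paired
with it. -/
theorem ae_eLpNorm_freeFlow_sub_ne_top (h : IsExponents d p p' q q') {T : ℝ} (hT : 0 < T)
    (t : ℝ) (φ : L2 ℂ) :
    ∀ᵐ s ∂(timeMeasure T), eLpNorm (freeFlow (t - s) φ) (.ofReal q) volume ≠ ∞ := by
  have h1 := lintegral_eLpNorm_freeFlow_sub_le h hT t φ
  have h2 : (strichartzConst p q * ‖φ‖ₑ) ^ p ≠ ∞ :=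
    (ENNReal.rpow_lt_top_of_nonneg h.p_pos.le
      (ENNReal.mul_ne_top (strichartzConst_lt_top h).ne enorm_ne_top)).ne
  have h3 := ae_lt_top' ((aemeasurable_eLpNorm_freeFlow_sub _ t φ _).pow_const p)
    (ne_top_of_le_ne_top h2 h1)
  filter_upwards [h3] with s hs hs'
  rw [hs', ENNReal.top_rpow_of_pos h.p_pos] at hs
  exact lt_irrefl _ hs

theorem lintegral_mul_eLpNorm_freeFlow_le (h : IsExponents d p p' q q') {T : ℝ} (hT : 0 < T)
    {S : Set ℝ} (hS : S ⊆ Set.Icc 0 T) {a : ℝ → ℝ≥0∞} (ha : AEMeasurable a (volume.restrict S))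
    (t : ℝ) (φ : L2 ℂ) :
    ∫⁻ s in S, a s * eLpNorm (freeFlow (t - s) φ) (.ofReal q) volume ≤
      (∫⁻ s in S, a s ^ p') ^ (1 / p') * (strichartzConst p q * ‖φ‖ₑ) := by
  refine (ENNReal.lintegral_mul_le_Lp_mul_Lq _ h.conj_p.symm ha
    (aemeasurable_eLpNorm_freeFlow_sub _ t φ _)).trans ?_
  gcongr
  rw [one_div, ENNReal.rpow_inv_le_iff h.p_pos]
  exact (lintegral_mono_set hS).trans (lintegral_eLpNorm_freeFlow_sub_le h hT t φ)

/-- An `L²` function that defines a bounded functional on Schwartz functions for the `L²` norm. -/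
theorem enorm_le_of_schwartz_pairing {v : L2 ℂ} {M : ℝ≥0∞}
    (h : ∀ g : 𝓢(E3, ℂ), ‖∫ x, g x * v x‖ₑ ≤ M * ‖(g.toLp 2 : L2 ℂ)‖ₑ) : ‖v‖ₑ ≤ M := by
  rcases eq_or_ne M ∞ with rfl | hM
  · exact le_top
  lift M to ℝ≥0 using hM
  have key : ∀ f : L2 ℂ, ‖pairing f v‖ ≤ M * ‖f‖ := by
    intro f
    refine denseRange_toLp.induction_on (p := fun f : L2 ℂ => ‖pairing f v‖ ≤ M * ‖f‖) f ?_ ?_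
    · refine isClosed_le ?_ (continuous_const.mul continuous_norm)
      exact (continuous_pairing.comp (continuous_id.prodMk continuous_const)).norm
    · intro g
      have := h g
      rw [← pairing_toLp, ← ofReal_norm, ← ofReal_norm, ← ENNReal.ofReal_coe_nnreal,
        ← ENNReal.ofReal_mul (NNReal.coe_nonneg M)] at this
      exact (ENNReal.ofReal_le_ofReal_iff (by positivity)).1 this
  -- Tested with its complex conjugate, `v` gives the square of its norm.
  have h1 := key (star v)
  rw [pairing_eq_inner, star_star, norm_star_L2, inner_self_eq_norm_sq_to_K] at h1
  rw [← ofReal_norm, ← ENNReal.ofReal_coe_nnreal]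
  refine ENNReal.ofReal_le_ofReal ?_
  rcases (norm_nonneg v).eq_or_lt with h0 | h0
  · rw [← h0]; exact M.2
  · simp only [norm_pow, Complex.coe_algebraMap, Complex.norm_real, norm_norm] at h1
    rw [pow_two] at h1
    exact le_of_mul_le_mul_right h1 h0

/-- Hölder's inequality in time. -/
theorem lintegral_rpow_conj_le (h : IsExponents d p p' q q') {t₀ t₁ : ℝ} (ht : t₀ ≤ t₁)
    {a : ℝ → ℝ≥0∞} (ha : AEMeasurable a (volume.restrict (Set.Ioc t₀ t₁))) :
    (∫⁻ s in Set.Ioc t₀ t₁, a s ^ p') ^ (1 / p') ≤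
      .ofReal ((t₁ - t₀) ^ (1 - 2 / p)) * (∫⁻ s in Set.Ioc t₀ t₁, a s ^ p) ^ (1 / p) := by
  have hp0 := h.p_pos
  have hp'0 := h.p'_pos
  have hpp : p' ≤ p := by
    rw [h.conj_p.conjugate_eq, div_le_iff₀ (by linarith [h.p_gt])]; nlinarith [h.p_gt]
  have h1 := eLpNorm_le_eLpNorm_mul_rpow_measure_univ (p := .ofReal p') (q := .ofReal p)
    (ENNReal.ofReal_le_ofReal hpp) ha.aestronglyMeasurable
  rw [eLpNorm_eq_lintegral_rpow_enorm_toReal (by simpa using hp'0) ENNReal.ofReal_ne_top,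
    eLpNorm_eq_lintegral_rpow_enorm_toReal (by simpa using hp0) ENNReal.ofReal_ne_top,
    ENNReal.toReal_ofReal hp0.le, ENNReal.toReal_ofReal hp'0.le, Measure.restrict_apply_univ,
    Real.volume_Ioc] at h1
  simp only [enorm_eq_self] at h1
  rw [mul_comm]
  refine h1.trans (le_of_eq ?_)
  have e : 1 / p' - 1 / p = 1 - 2 / p := by
    have := h.conj_p.inv_add_inv_eq_one
    rw [one_div, one_div]
    field_simp at this ⊢
    linarith
  rw [e, ENNReal.ofReal_rpow_of_nonneg (sub_nonneg.2 ht) h.γ_pos.le]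

/-- Young's inequality for the kernel `|t - s|^{-2/p}` on an interval. -/
theorem lintegral_fractional_le (h : IsExponents d p p' q q') {t₀ t₁ : ℝ} (ht : t₀ ≤ t₁)
    {a : ℝ → ℝ≥0∞} (ha : Measurable a) :
    (∫⁻ t in Set.Icc 0 t₁, (∫⁻ s in Set.Ioc t₀ t, .ofReal (|t - s| ^ (-(2 / p))) * a s) ^ p) ^ (1 / p) ≤
      .ofReal ((t₁ - t₀) ^ (1 - 2 / p) / (1 - 2 / p)) *
        (∫⁻ s in Set.Ioc t₀ t₁, a s ^ p) ^ (1 / p) := by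
  have hp0 := h.p_pos
  set A : ℝ → ℝ≥0∞ := (Set.Ioc t₀ t₁).indicator a with hA
  have hAm : Measurable A := ha.indicator measurableSet_Ioc
  set k : ℝ → ℝ≥0∞ := fun r => .ofReal (r ^ (-(2 / p))) with hk
  have hkm : Measurable k := by fun_prop
  set N := (∫⁻ s in Set.Ioc t₀ t₁, a s ^ p) ^ (1 / p) with hN
  -- After the substitution `r = t - s`, Minkowski's inequality applies to translates of `A` with
  -- the weight `r^(-2/p)`, which is integrable on `(0, t₁ - t₀]` because `2/p < 1`.
  have h1 := lintegral_lintegral_rpow_le (μ := (volume : Measure ℝ))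
    (ν := volume.restrict (Set.Ioc 0 (t₁ - t₀))) (p := p) (by linarith [h.p_gt])
    (f := fun t r => k r * A (t - r)) (w := fun r => k r * N)
    (by
      refine Measurable.aemeasurable ?_
      exact (hkm.comp measurable_snd).mul (hAm.comp (measurable_fst.sub measurable_snd)))
    (hkm.mul_const _).aemeasurable (by
      refine .of_forall fun r => le_of_eq ?_
      simp_rw [ENNReal.mul_rpow_of_nonneg _ _ hp0.le]
      rw [lintegral_const_mul _ (by fun_prop), lintegral_sub_right_eq_self (fun t => A t ^ p) r, hN,
        ← ENNReal.rpow_mul, one_div, inv_mul_cancel₀ hp0.ne', ENNReal.rpow_one,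
        ← lintegral_indicator measurableSet_Ioc]
      congr 1
      refine lintegral_congr fun t => ?_
      by_cases htm : t ∈ Set.Ioc t₀ t₁
      · simp [hA, htm]
      · simp [hA, htm, hp0])
  rw [lintegral_mul_const _ hkm, lintegral_Ioc_ofReal_rpow
    (by rw [neg_lt_neg_iff]; have := h.γ_pos; linarith) (sub_nonneg.2 ht)] at h1
  rw [one_div, ENNReal.rpow_inv_le_iff hp0]
  refine le_trans ?_ (h1.trans (le_of_eq ?_))
  · refine le_trans (setLIntegral_mono_ae' measurableSet_Icc (.of_forall fun t htm => ?_))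
      (setLIntegral_le_lintegral _ _)
    refine ENNReal.rpow_le_rpow ?_ hp0.le
    rw [← lintegral_indicator measurableSet_Ioc, ← lintegral_sub_left_eq_self _ t,
      ← lintegral_indicator measurableSet_Ioc]
    refine lintegral_mono_ae ?_
    filter_upwards [(measure_eq_zero_iff_ae_notMem.1 (measure_singleton (μ := (volume : Measure ℝ)) 0))]
      with r hr0
    by_cases hr : t - r ∈ Set.Ioc t₀ t
    · have hr' : 0 < r := lt_of_le_of_ne (by linarith [hr.2]) (fun h => hr0 h.symm)
      have h3 : r ∈ Set.Ioc 0 (t₁ - t₀) := ⟨hr', by linarith [hr.1, htm.2]⟩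
      have h4 : t - r ∈ Set.Ioc t₀ t₁ := ⟨hr.1, hr.2.trans htm.2⟩
      rw [Set.indicator_of_mem hr, Set.indicator_of_mem h3, hA, Set.indicator_of_mem h4,
        sub_sub_cancel, abs_of_pos hr']
    · rw [Set.indicator_of_notMem hr]; exact zero_le
  · rw [neg_add_eq_sub]

end

/-! ### Estimates for the Duhamel integral -/

section

variable {d p p' q q' : ℝ}

/-- The estimates for the Duhamel integral of a force that is the sum of a part acting on `L^q` with
norm `a(s)` and of a part `f(s)` in `L²`; the force is supported in the times after `t₀`. -/
theorem exists_duhamel_estimate (h : IsExponents d p p' q q') :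
    ∃ c : ℝ≥0, ∀ (t₀ t₁ : ℝ), 0 ≤ t₀ → t₀ ≤ t₁ → 0 < t₁ → ∀ (a : ℝ → ℝ≥0∞) (f : ℝ → L2 ℂ)
      (u : ℝ → L2 ℂ), AEMeasurable a (volume.restrict (Set.Ioc t₀ t₁)) →
      AEStronglyMeasurable f (volume.restrict (Set.Ioc t₀ t₁)) →
      (∀ᵐ t ∂(timeMeasure t₁), ∀ g : 𝓢(E3, ℂ), ‖∫ x, g x * u t x‖ₑ ≤
        ∫⁻ s in Set.Ioc t₀ t, (a s * eLpNorm (freeFlow (t - s) (g.toLp 2 : L2 ℂ)) (.ofReal q) volume +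
          ‖pairing (f s) (freeFlow (t - s) (g.toLp 2))‖ₑ)) →
      (∀ᵐ t ∂(timeMeasure t₁), ‖u t‖ₑ ≤ c * (.ofReal ((t₁ - t₀) ^ (1 - 2 / p)) *
        (∫⁻ s in Set.Ioc t₀ t₁, a s ^ p) ^ (1 / p) + ∫⁻ s in Set.Ioc t₀ t₁, ‖f s‖ₑ)) ∧
      mixedNorm (.ofReal p) (.ofReal q) t₁ u ≤ c * (.ofReal ((t₁ - t₀) ^ (1 - 2 / p)) *
        (∫⁻ s in Set.Ioc t₀ t₁, a s ^ p) ^ (1 / p) + ∫⁻ s in Set.Ioc t₀ t₁, ‖f s‖ₑ) := by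
  obtain ⟨c₁, hc₁⟩ := exists_eLpNorm_freeFlow_le h
  set ρ : ℝ≥0 := (strichartzConst p q).toNNReal with hρ
  have hρ' : strichartzConst p q = ρ := (ENNReal.coe_toNNReal (strichartzConst_lt_top h).ne).symm
  have hp0 := h.p_pos
  have hp'0 := h.p'_pos
  have hγ := h.γ_pos
  refine ⟨ρ + 1 + c₁ * (1 / (1 - 2 / p)).toNNReal, fun t₀ t₁ ht₀ ht₀₁ ht₁ a f u ha hf hu => ?_⟩
  have hsub : ∀ t ∈ Set.Icc 0 t₁, Set.Ioc t₀ t ⊆ Set.Ioc t₀ t₁ := fun t ht =>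
    Set.Ioc_subset_Ioc_right ht.2
  have hsub' : Set.Ioc t₀ t₁ ⊆ Set.Icc 0 t₁ := fun s hs => ⟨ht₀.trans hs.1.le, hs.2⟩
  set A := (∫⁻ s in Set.Ioc t₀ t₁, a s ^ p) ^ (1 / p) with hA
  set b := ∫⁻ s in Set.Ioc t₀ t₁, ‖f s‖ₑ with hb
  set τ : ℝ≥0∞ := .ofReal ((t₁ - t₀) ^ (1 - 2 / p)) with hτ
  constructor
  -- The bound in `L²` at a fixed time: the Strichartz estimate is applied to the test function, and
  -- Hölder's inequality in time from `L^p` to `L^{p'}` gains the power of `t₁ - t₀`.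
  · filter_upwards [hu, ae_restrict_mem measurableSet_Icc] with t ht htm
    refine (enorm_le_of_schwartz_pairing (M := (ρ + 1 : ℝ≥0) * (τ * A + b)) fun g => ?_).trans ?_
    · refine (ht g).trans ((lintegral_mono_set (hsub t htm)).trans ?_)
      have hm1 : AEMeasurable (fun s => a s *
          eLpNorm (freeFlow (t - s) (g.toLp 2 : L2 ℂ)) (.ofReal q) volume)
          (volume.restrict (Set.Ioc t₀ t₁)) := ha.mul (aemeasurable_eLpNorm_freeFlow_sub _ t _ _)
      rw [lintegral_add_left' hm1]
      refine (add_le_add (lintegral_mul_eLpNorm_freeFlow_le h ht₁ hsub' ha t _)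
        (lintegral_mono (g := fun s => ‖f s‖ₑ * ‖(g.toLp 2 : L2 ℂ)‖ₑ) fun s => ?_)).trans ?_
      · have := norm_pairing_le (f s) (freeFlow (t - s) (g.toLp 2))
        rw [norm_freeFlow] at this
        beta_reduce
        rw [← ofReal_norm, ← ofReal_norm, ← ofReal_norm, ← ENNReal.ofReal_mul (norm_nonneg _)]
        exact ENNReal.ofReal_le_ofReal this
      · rw [lintegral_mul_const'' _ hf.enorm, ← hb, hρ']
        have h1 := lintegral_rpow_conj_le h ht₀₁ ha
        calc _ ≤ τ * A * (ρ * ‖(g.toLp 2 : L2 ℂ)‖ₑ) + b * ‖(g.toLp 2 : L2 ℂ)‖ₑ := by gcongr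
          _ = (ρ * (τ * A) + b) * ‖(g.toLp 2 : L2 ℂ)‖ₑ := by ring
          _ ≤ _ := by
            gcongr
            push_cast
            rw [add_mul, one_mul, mul_add, add_assoc]
            gcongr
            exact (le_add_left le_rfl).trans (le_add_left le_rfl)
    · exact mul_le_mul' (ENNReal.coe_le_coe.2 le_self_add) le_rfl
  -- The mixed norm: the part with `a` is tested in `L^{q'}`, estimated by the decay of the free
  -- flow and integrated by Young's inequality. The part with `f` is a superposition of free waves,
  -- controlled by Minkowski's inequality and the homogeneous estimate.
  · set a' : ℝ → ℝ≥0∞ := ha.mk a with ha'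
    have hae : ∀ᵐ s ∂(volume.restrict (Set.Ioc t₀ t₁)), a s = a' s := ha.ae_eq_mk
    set n₁ : ℝ → ℝ≥0∞ := fun t => ∫⁻ s in Set.Ioc t₀ t, .ofReal (|t - s| ^ (-(2 / p))) * a' s
      with hn₁
    set n₂ : ℝ → ℝ≥0∞ := fun t => ∫⁻ s in Set.Ioc t₀ t₁,
      eLpNorm (freeFlow (t - s) (f s)) (.ofReal q) volume with hn₂
    have hpt : ∀ᵐ t ∂(timeMeasure t₁), eLpNorm (u t) (.ofReal q) volume ≤ c₁ * n₁ t + n₂ t := by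
      filter_upwards [hu, ae_restrict_mem measurableSet_Icc] with t ht htm
      -- The duality lemma requires a finite bound; an infinite one is trivially true.
      rcases eq_or_ne (c₁ * n₁ t + n₂ t) ∞ with htop | htop
      · rw [htop]; exact le_top
      refine eLpNorm_le_of_schwartz_pairing h.q_gt h.conj_q htop fun g => (ht g).trans ?_
      have hg2 : MemLp ((g.toLp 2 : L2 ℂ) : E3 → ℂ) (.ofReal q') volume :=
        (memLp_congr_ae (g.coeFn_toLp 2 volume)).2 (g.memLp _ _)
      have hgn : eLpNorm ((g.toLp 2 : L2 ℂ) : E3 → ℂ) (.ofReal q') volume =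
          eLpNorm g (.ofReal q') volume := eLpNorm_congr_ae (g.coeFn_toLp 2 volume)
      set G := eLpNorm g (.ofReal q') volume
      have haet : ∀ᵐ s ∂(volume.restrict (Set.Ioc t₀ t)), a s = a' s :=
        ae_mono (Measure.restrict_mono_set _ (hsub t htm)) hae
      have hne : ∀ᵐ s ∂(volume.restrict (Set.Ioc t₀ t)), s ≠ t :=
        ae_restrict_of_ae (measure_eq_zero_iff_ae_notMem.1 (measure_singleton t))
      have hm : Measurable fun s : ℝ => ENNReal.ofReal (|t - s| ^ (-(2 / p))) * a' s :=
        (by fun_prop : Measurable fun s : ℝ => ENNReal.ofReal (|t - s| ^ (-(2 / p)))).mul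
          ha.measurable_mk
      calc _ ≤ ∫⁻ s in Set.Ioc t₀ t, (c₁ * G * (.ofReal (|t - s| ^ (-(2 / p))) * a' s) +
            eLpNorm (freeFlow (t - s) (f s)) (.ofReal q) volume * G) := by
            refine lintegral_mono_ae ?_
            filter_upwards [haet, hne] with s hs hst
            refine add_le_add ?_ ?_
            · rw [hs]
              refine (mul_le_mul_right (hc₁ (t - s) (sub_ne_zero.2 hst.symm) _ hg2) _).trans
                (le_of_eq ?_)
              rw [hgn]; ring
            · rw [pairing_comm, pairing_freeFlow, pairing_comm]
              refine (enorm_integral_mul_le h.conj_q (Lp.aestronglyMeasurable _)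
                (Lp.aestronglyMeasurable _)).trans (le_of_eq ?_)
              rw [hgn]
        _ ≤ c₁ * G * n₁ t + n₂ t * G := by
            rw [lintegral_add_left (hm.const_mul _), lintegral_const_mul _ hm]
            refine add_le_add le_rfl ((lintegral_mono_set (hsub t htm)).trans (le_of_eq ?_))
            rw [lintegral_mul_const'']
            exact aemeasurable_eLpNorm _ (aestronglyMeasurable_freeFlow
              (by fun_prop) hf)
        _ = _ := by ring
    have hn₂m : AEMeasurable (Function.uncurry fun t s : ℝ =>
        eLpNorm (freeFlow (t - s) (f s)) (.ofReal q) volume)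
        ((timeMeasure t₁).prod (volume.restrict (Set.Ioc t₀ t₁))) :=
      aemeasurable_eLpNorm _ (aestronglyMeasurable_freeFlow
        (τ := fun z : ℝ × ℝ => z.1 - z.2) (by fun_prop) hf.comp_snd)
    have hn₂b : (∫⁻ t in Set.Icc 0 t₁, n₂ t ^ p) ^ (1 / p) ≤ ρ * b := by
      rw [one_div, ENNReal.rpow_inv_le_iff hp0, hb, ← lintegral_const_mul'' _ hf.enorm]
      refine lintegral_lintegral_rpow_le (by linarith [h.p_gt]) hn₂m (hf.enorm.const_mul _)
        (.of_forall fun s => ?_)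
      have h1 := mixedNorm_freeFlow_le h ht₁ (freeFlow (-s) (f s))
      rw [mixedNorm_eq_lintegral hp0, one_div, ENNReal.rpow_inv_le_iff hp0, hρ', ← ofReal_norm,
        norm_freeFlow, ofReal_norm] at h1
      refine le_trans (le_of_eq ?_) h1
      simp_rw [freeFlow_freeFlow, sub_eq_add_neg]
    have hn₁b := lintegral_fractional_le h ht₀₁ ha.measurable_mk
    have hA' : (∫⁻ s in Set.Ioc t₀ t₁, a' s ^ p) ^ (1 / p) = A := by
      rw [hA]; congr 1
      exact lintegral_congr_ae (hae.mono fun s hs => by simp only [hs])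
    rw [hA'] at hn₁b
    have hn₂m' : AEMeasurable n₂ (timeMeasure t₁) := hn₂m.lintegral_prod_right'
    have hn₁m : Measurable n₁ := by
      have hS : MeasurableSet {z : ℝ × ℝ | t₀ < z.2 ∧ z.2 ≤ z.1} :=
        (measurableSet_lt measurable_const measurable_snd).inter
          (measurableSet_le measurable_snd measurable_fst)
      have hk : Measurable fun z : ℝ × ℝ => ENNReal.ofReal (|z.1 - z.2| ^ (-(2 / p))) * a' z.2 :=
        (by fun_prop : Measurable fun z : ℝ × ℝ => ENNReal.ofReal (|z.1 - z.2| ^ (-(2 / p)))).mul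
          (ha.measurable_mk.comp measurable_snd)
      have h1 := (hk.indicator hS).lintegral_prod_right' (ν := (volume : Measure ℝ))
      convert h1 using 1
      funext t
      rw [hn₁]
      beta_reduce
      rw [← lintegral_indicator measurableSet_Ioc]
      rfl
    rw [mixedNorm_eq_lintegral hp0]
    calc _ ≤ (∫⁻ t, (n₂ t + c₁ * n₁ t) ^ p ∂(timeMeasure t₁)) ^ (1 / p) := by
          refine ENNReal.rpow_le_rpow (lintegral_mono_ae ?_) (by positivity)
          filter_upwards [hpt] with t ht
          rw [add_comm]
          exact ENNReal.rpow_le_rpow ht hp0.le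
      _ ≤ ρ * b + c₁ * (.ofReal ((t₁ - t₀) ^ (1 - 2 / p) / (1 - 2 / p)) * A) := by
          refine (ENNReal.lintegral_Lp_add_le hn₂m' (hn₁m.const_mul _).aemeasurable
            (by linarith [h.p_gt])).trans (add_le_add hn₂b ?_)
          simp_rw [ENNReal.mul_rpow_of_nonneg _ _ hp0.le]
          rw [lintegral_const_mul _ (hn₁m.pow_const p), ENNReal.mul_rpow_of_nonneg _ _ (by positivity),
            ← ENNReal.rpow_mul, mul_one_div_cancel hp0.ne', ENNReal.rpow_one]
          gcongr
      _ ≤ _ := by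
          rw [div_eq_mul_one_div, ENNReal.ofReal_mul (Real.rpow_nonneg (sub_nonneg.2 ht₀₁) _)]
          change _ + c₁ * (τ * ((1 / (1 - 2 / p)).toNNReal : ℝ≥0∞) * A) ≤ _
          push_cast
          calc _ = ρ * b + c₁ * ((1 / (1 - 2 / p)).toNNReal : ℝ≥0∞) * (τ * A) := by ring
            _ ≤ (ρ + 1) * (τ * A + b) + c₁ * ((1 / (1 - 2 / p)).toNNReal : ℝ≥0∞) * (τ * A + b) := by
              gcongr
              · exact le_self_add
              · exact le_add_left le_rfl
              · exact le_self_add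
            _ = _ := by ring

end

/-! ### Forces and the existence of their Duhamel integrals -/

section

variable {d p p' q q' T : ℝ}

/-- A time dependent force on `[0, T]` that acts on `L² ∩ L^q` with the bound
`a(s) ‖h‖_q + b(s) ‖h‖₂`, where `a ∈ L^{p'}` and `b ∈ L¹` in time. -/
structure IsForce (p' q T : ℝ) (F : ℝ → E3 → ℂ) (a b : ℝ → ℝ≥0∞) : Prop where
  integrable : ∀ᵐ s ∂(timeMeasure T), ∀ h : L2 ℂ, eLpNorm h (.ofReal q) volume ≠ ∞ →
    Integrable (fun x => h x * F s x) volume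
  bound : ∀ᵐ s ∂(timeMeasure T), ∀ h : L2 ℂ, eLpNorm h (.ofReal q) volume ≠ ∞ →
    ‖∫ x, h x * F s x‖ₑ ≤ a s * eLpNorm h (.ofReal q) volume + b s * ‖h‖ₑ
  meas : ∀ G : ℝ → L2 ℂ, Continuous G →
    (∀ᵐ s ∂(timeMeasure T), eLpNorm (G s) (.ofReal q) volume ≠ ∞) →
    AEStronglyMeasurable (fun s => ∫ x, G s x * F s x) (timeMeasure T)
  a_meas : AEMeasurable a (timeMeasure T)
  b_meas : AEMeasurable b (timeMeasure T)
  a_fin : ∫⁻ s in Set.Icc 0 T, a s ^ p' ≠ ∞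
  b_fin : ∫⁻ s in Set.Icc 0 T, b s ≠ ∞

theorem continuous_freeFlow_sub (t : ℝ) (g : L2 ℂ) : Continuous fun s => freeFlow (t - s) g :=
  (continuous_freeFlow_left g).comp (continuous_const.sub continuous_id)

/-- Hölder's inequality in time pairs `a` in `L^{p'}` with the Strichartz norm of the evolved test
function, while `b` in `L¹` meets its conserved `L²` norm. -/
theorem IsForce.lintegral_le {F : ℝ → E3 → ℂ} {a b : ℝ → ℝ≥0∞} (hF : IsForce p' q T F a b)
    (h : IsExponents d p p' q q') (hT : 0 < T) (t : ℝ) (g : L2 ℂ) {S : Set ℝ}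
    (hS : S ⊆ Set.Icc 0 T) :
    ∫⁻ s in S, ‖∫ x, freeFlow (t - s) g x * F s x‖ₑ ≤
      (strichartzConst p q * (∫⁻ s in S, a s ^ p') ^ (1 / p') + ∫⁻ s in S, b s) * ‖g‖ₑ := by
  have hμ : (volume.restrict S) ≤ timeMeasure T := Measure.restrict_mono_set _ hS
  calc _ ≤ ∫⁻ s in S, (a s * eLpNorm (freeFlow (t - s) g) (.ofReal q) volume + b s * ‖g‖ₑ) := by
        refine lintegral_mono_ae ?_
        filter_upwards [ae_mono hμ hF.bound, ae_mono hμ (ae_eLpNorm_freeFlow_sub_ne_top h hT t g)]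
          with s hs hs'
        refine (hs _ hs').trans (le_of_eq ?_)
        rw [← ofReal_norm (freeFlow _ _), norm_freeFlow, ofReal_norm]
    _ ≤ (∫⁻ s in S, a s ^ p') ^ (1 / p') * (strichartzConst p q * ‖g‖ₑ) +
        (∫⁻ s in S, b s) * ‖g‖ₑ := by
        have ha := hF.a_meas.mono_measure hμ
        have hm1 : AEMeasurable (fun s => a s * eLpNorm (freeFlow (t - s) g) (.ofReal q) volume)
          (volume.restrict S) := ha.mul (aemeasurable_eLpNorm_freeFlow_sub _ t g _)
        rw [lintegral_add_left' hm1,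
          lintegral_mul_const'' _ (hF.b_meas.mono_measure hμ)]
        exact add_le_add (lintegral_mul_eLpNorm_freeFlow_le h hT hS ha t g) le_rfl
    _ = _ := by ring

theorem IsForce.integrableOn {F : ℝ → E3 → ℂ} {a b : ℝ → ℝ≥0∞} (hF : IsForce p' q T F a b)
    (h : IsExponents d p p' q q') (hT : 0 < T) (t : ℝ) (g : L2 ℂ) :
    IntegrableOn (fun s => ∫ x, freeFlow (t - s) g x * F s x) (Set.Icc 0 T) volume := by
  refine ⟨hF.meas _ (continuous_freeFlow_sub t g) (ae_eLpNorm_freeFlow_sub_ne_top h hT t g), ?_⟩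
  refine (hF.lintegral_le h hT t g subset_rfl).trans_lt (ENNReal.mul_lt_top ?_ enorm_lt_top)
  exact ENNReal.add_lt_top.2 ⟨ENNReal.mul_lt_top (strichartzConst_lt_top h)
    (ENNReal.rpow_lt_top_of_nonneg (by have := h.p'_pos; positivity) hF.a_fin), hF.b_fin.lt_top⟩

theorem IsForce.ae_map_add {F : ℝ → E3 → ℂ} {a b : ℝ → ℝ≥0∞} (hF : IsForce p' q T F a b)
    (h : IsExponents d p p' q q') (hT : 0 < T) (t : ℝ) (f g : L2 ℂ) :
    ∀ᵐ s ∂(timeMeasure T), ∫ x, freeFlow (t - s) (f + g) x * F s x =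
      (∫ x, freeFlow (t - s) f x * F s x) + ∫ x, freeFlow (t - s) g x * F s x := by
  filter_upwards [hF.integrable, ae_eLpNorm_freeFlow_sub_ne_top h hT t f,
    ae_eLpNorm_freeFlow_sub_ne_top h hT t g] with s hs h1 h2
  rw [← integral_add (hs _ h1) (hs _ h2), freeFlow_add]
  refine integral_congr_ae ?_
  filter_upwards [Lp.coeFn_add (freeFlow (t - s) f) (freeFlow (t - s) g)] with x hx
  rw [hx, Pi.add_apply, add_mul]

theorem IsForce.map_smul (F : ℝ → E3 → ℂ) (t s : ℝ) (c : ℂ) (g : L2 ℂ) :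
    ∫ x, freeFlow (t - s) (c • g) x * F s x = c * ∫ x, freeFlow (t - s) g x * F s x := by
  rw [← integral_const_mul, freeFlow_smul]
  refine integral_congr_ae ?_
  filter_upwards [Lp.coeFn_smul c (freeFlow (t - s) g)] with x hx
  rw [hx, Pi.smul_apply, smul_eq_mul, mul_assoc]

theorem continuous_comp_prodMk {X : Type} [TopologicalSpace X] {u : ℝ × X → X} (hu : Continuous u)
    {w : ℝ → X} (hw : Continuous w) : Continuous fun t => u (t, w t) :=
  hu.comp (continuous_id.prodMk hw)

theorem continuous_freeFlow_curve {F : Type} [NormedAddCommGroup F] [InnerProductSpace ℂ F]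
    [CompleteSpace F] {w : ℝ → L2 F} (hw : Continuous w) : Continuous fun t => freeFlow t (w t) :=
  continuous_comp_prodMk continuous_freeFlow hw

theorem IsForce.enorm_integral_le {F : ℝ → E3 → ℂ} {a b : ℝ → ℝ≥0∞} (hF : IsForce p' q T F a b)
    (h : IsExponents d p p' q q') (hT : 0 < T) (t : ℝ) (g : L2 ℂ) {r s : ℝ}
    (hr : r ∈ Set.Icc 0 T) (hs : s ∈ Set.Icc 0 T) :
    ‖∫ τ in r..s, ∫ x, freeFlow (t - τ) g x * F τ x‖ₑ ≤
      (strichartzConst p q * (∫⁻ τ in Set.uIoc r s, a τ ^ p') ^ (1 / p') +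
        ∫⁻ τ in Set.uIoc r s, b τ) * ‖g‖ₑ := by
  refine le_trans ?_ (hF.lintegral_le h hT t g
    (Set.uIoc_subset_uIcc.trans (Set.ordConnected_Icc.uIcc_subset hr hs)))
  rw [← ofReal_norm, intervalIntegral.norm_intervalIntegral_eq, ofReal_norm]
  exact enorm_integral_le_lintegral_enorm _

theorem IsForce.intervalIntegrable {F : ℝ → E3 → ℂ} {a b : ℝ → ℝ≥0∞}
    (hF : IsForce p' q T F a b) (h : IsExponents d p p' q q') (hT : 0 < T) (t : ℝ) (g : L2 ℂ)
    {r s : ℝ} (hr : r ∈ Set.Icc 0 T) (hs : s ∈ Set.Icc 0 T) :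
    IntervalIntegrable (fun τ => ∫ x, freeFlow (t - τ) g x * F τ x) volume r s :=
  ((hF.integrableOn h hT t g).mono_set
    (Set.ordConnected_Icc.uIcc_subset hr hs)).intervalIntegrable

/-- Riesz representation of a bounded functional on `L²`. It gives a meaning to the integral of
`U(-s) F(s)` over `[0, r]` in `L²` although `F(s)` itself need not be in `L²`. -/
theorem IsForce.exists_pairing_eq {F : ℝ → E3 → ℂ} {a b : ℝ → ℝ≥0∞} (hF : IsForce p' q T F a b)
    (h : IsExponents d p p' q q') (hT : 0 < T) {r : ℝ} (hr : r ∈ Set.Icc 0 T) :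
    ∃ w : L2 ℂ, ∀ g, pairing g w = ∫ s in (0 : ℝ)..r, ∫ x, freeFlow (0 - s) g x * F s x := by
  have h0 : (0 : ℝ) ∈ Set.Icc 0 T := ⟨le_rfl, hT.le⟩
  have hadd : ∀ f g, ∫ s in (0 : ℝ)..r, ∫ x, freeFlow (0 - s) (f + g) x * F s x =
      (∫ s in (0 : ℝ)..r, ∫ x, freeFlow (0 - s) f x * F s x) +
        ∫ s in (0 : ℝ)..r, ∫ x, freeFlow (0 - s) g x * F s x := by
    intro f g
    rw [← intervalIntegral.integral_add (hF.intervalIntegrable h hT 0 f h0 hr)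
      (hF.intervalIntegrable h hT 0 g h0 hr)]
    refine intervalIntegral.integral_congr_ae_restrict ?_
    exact ae_mono (Measure.restrict_mono_set _ (Set.uIoc_subset_uIcc.trans
      (Set.ordConnected_Icc.uIcc_subset h0 hr))) (hF.ae_map_add h hT 0 f g)
  have hsmul : ∀ (c : ℂ) g, ∫ s in (0 : ℝ)..r, ∫ x, freeFlow (0 - s) (c • g) x * F s x =
      c * ∫ s in (0 : ℝ)..r, ∫ x, freeFlow (0 - s) g x * F s x := by
    intro c g
    rw [← intervalIntegral.integral_const_mul]
    exact intervalIntegral.integral_congr fun s _ => IsForce.map_smul F 0 s c g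
  obtain ⟨M, hM⟩ : ∃ M : ℝ, ∀ g, ‖∫ s in (0 : ℝ)..r, ∫ x, freeFlow (0 - s) g x * F s x‖ ≤
      M * ‖g‖ := by
    have hfin : strichartzConst p q * (∫⁻ τ in Set.uIoc 0 r, a τ ^ p') ^ (1 / p') +
        ∫⁻ τ in Set.uIoc 0 r, b τ ≠ ∞ := by
      have hsub : Set.uIoc 0 r ⊆ Set.Icc 0 T :=
        Set.uIoc_subset_uIcc.trans (Set.ordConnected_Icc.uIcc_subset h0 hr)
      exact ENNReal.add_ne_top.2 ⟨ENNReal.mul_ne_top (strichartzConst_lt_top h).ne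
        (ENNReal.rpow_lt_top_of_nonneg (by have := h.p'_pos; positivity)
          (ne_top_of_le_ne_top hF.a_fin (lintegral_mono_set hsub))).ne,
        ne_top_of_le_ne_top hF.b_fin (lintegral_mono_set hsub)⟩
    refine ⟨(strichartzConst p q * (∫⁻ τ in Set.uIoc 0 r, a τ ^ p') ^ (1 / p') +
        ∫⁻ τ in Set.uIoc 0 r, b τ).toReal, fun g => ?_⟩
    have h1 := hF.enorm_integral_le h hT 0 g h0 hr
    rw [← ofReal_norm, ← ofReal_norm g, ← ENNReal.ofReal_toReal hfin,
      ← ENNReal.ofReal_mul ENNReal.toReal_nonneg] at h1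
    exact (ENNReal.ofReal_le_ofReal_iff (by positivity)).1 h1
  let l : L2 ℂ →ₗ[ℂ] ℂ :=
    { toFun := fun g => ∫ s in (0 : ℝ)..r, ∫ x, freeFlow (0 - s) g x * F s x
      map_add' := hadd
      map_smul' := hsmul }
  refine ⟨star ((InnerProductSpace.toDual ℂ (L2 ℂ)).symm (l.mkContinuous M hM)), fun g => ?_⟩
  rw [pairing_comm, pairing_eq_inner, star_star, InnerProductSpace.toDual_symm_apply]
  rfl

/-- Absolute continuity of the integrals of `a^{p'}` and `b` over short intervals. -/
theorem IsForce.tendsto_majorant {F : ℝ → E3 → ℂ} {a b : ℝ → ℝ≥0∞} (hF : IsForce p' q T F a b)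
    (h : IsExponents d p p' q q') {cl : ℝ → ℝ} (hclc : Continuous cl)
    (hcl : ∀ t, cl t ∈ Set.Icc 0 T) (r : ℝ) :
    Filter.Tendsto (fun s => strichartzConst p q *
      (∫⁻ τ in Set.uIoc (cl r) (cl s), a τ ^ p') ^ (1 / p') + ∫⁻ τ in Set.uIoc (cl r) (cl s), b τ)
      (nhds r) (nhds 0) := by
  have hsub : ∀ r s, Set.uIoc (cl r) (cl s) ⊆ Set.Icc 0 T := fun r s =>
    Set.uIoc_subset_uIcc.trans (Set.ordConnected_Icc.uIcc_subset (hcl r) (hcl s))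
  have hvol : Filter.Tendsto (fun s => volume.restrict (Set.Icc 0 T) (Set.uIoc (cl r) (cl s)))
      (nhds r) (nhds 0) := by
    refine tendsto_of_tendsto_of_tendsto_of_le_of_le tendsto_const_nhds
      (h := fun s => ENNReal.ofReal |cl s - cl r|) ?_ (fun s => zero_le) fun s => ?_
    · have : Continuous fun s => ENNReal.ofReal |cl s - cl r| :=
        ENNReal.continuous_ofReal.comp (hclc.sub continuous_const).abs
      have h1 := this.tendsto r
      simpa using h1
    · refine (Measure.restrict_apply_le _ _).trans ?_
      rw [Real.volume_uIoc]
  have hrest : ∀ f : ℝ → ℝ≥0∞, ∫⁻ s in Set.Icc 0 T, f s ≠ ∞ →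
      Filter.Tendsto (fun s => ∫⁻ τ in Set.uIoc (cl r) (cl s), f τ) (nhds r) (nhds 0) := by
    intro f hf
    refine (tendsto_setLIntegral_zero hf hvol).congr fun s => ?_
    rw [Measure.restrict_restrict measurableSet_uIoc,
      Set.inter_eq_self_of_subset_left (hsub r s)]
  have h1 := (ENNReal.continuous_rpow_const (y := 1 / p')).tendsto 0 |>.comp (hrest _ hF.a_fin)
  rw [ENNReal.zero_rpow_of_pos (by have := h.p'_pos; positivity)] at h1
  have h2 := ENNReal.Tendsto.const_mul (a := strichartzConst p q) h1
    (.inr (strichartzConst_lt_top h).ne)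
  have h3 := h2.add (hrest _ hF.b_fin)
  rw [mul_zero, add_zero] at h3
  exact h3

/-- The Duhamel integral of a force exists as a continuous curve in `L²`. -/
theorem IsForce.exists_duhamel {F : ℝ → E3 → ℂ} {a b : ℝ → ℝ≥0∞} (hF : IsForce p' q T F a b)
    (h : IsExponents d p p' q q') (hT : 0 < T) :
    ∃ u : ℝ → L2 ℂ, Continuous u ∧ ∀ t ∈ Set.Icc 0 T, ∀ g : L2 ℂ,
      pairing g (u t) = ∫ s in (0 : ℝ)..t, ∫ x, freeFlow (t - s) g x * F s x := by
  -- Times are clamped to `[0, T]`, so that the curve is defined and continuous on the whole line.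
  obtain ⟨cl, hclc, hclm, hclt⟩ : ∃ cl : ℝ → ℝ, Continuous cl ∧ (∀ t, cl t ∈ Set.Icc 0 T) ∧
      ∀ t ∈ Set.Icc 0 T, cl t = t :=
    ⟨fun t => max 0 (min t T), by fun_prop, fun t => ⟨le_max_left _ _, max_le hT.le
      (min_le_right _ _)⟩, fun t ht => by simp [ht.1, ht.2]⟩
  have h0 : (0 : ℝ) ∈ Set.Icc 0 T := ⟨le_rfl, hT.le⟩
  have hfun := fun r => hF.exists_pairing_eq h hT (hclm r)
  choose w hw using hfun
  have hwn : ∀ r s, ‖w s - w r‖ₑ ≤ strichartzConst p q *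
      (∫⁻ τ in Set.uIoc (cl r) (cl s), a τ ^ p') ^ (1 / p') +
        ∫⁻ τ in Set.uIoc (cl r) (cl s), b τ := by
    intro r s
    refine enorm_le_of_schwartz_pairing fun g => ?_
    rw [← pairing_toLp, pairing_sub_right, hw, hw, ← intervalIntegral.integral_add_adjacent_intervals
      (hF.intervalIntegrable h hT 0 _ h0 (hclm r))
      (hF.intervalIntegrable h hT 0 _ (hclm r) (hclm s)), add_sub_cancel_left]
    exact hF.enorm_integral_le h hT 0 _ (hclm r) (hclm s)
  have hwc : Continuous w := by
    rw [continuous_iff_continuousAt]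
    intro r
    rw [ContinuousAt, tendsto_iff_edist_tendsto_0]
    simp_rw [edist_eq_enorm_sub]
    exact tendsto_of_tendsto_of_tendsto_of_le_of_le tendsto_const_nhds
      (hF.tendsto_majorant h hclc hclm r) (fun s => zero_le) fun s => hwn r s
  -- Factoring the group out of the integral leaves `w`, whose increments only see the force between
  -- the two times; its continuity then carries over to the Duhamel integral.
  refine ⟨fun t => freeFlow t (w t), continuous_freeFlow_curve hwc,
    fun t ht g => ?_⟩
  rw [pairing_comm, pairing_freeFlow, pairing_comm, hw, hclt t ht]
  refine intervalIntegral.integral_congr fun s _ => ?_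
  beta_reduce
  rw [freeFlow_freeFlow, zero_sub, neg_add_eq_sub]

end

/-! ### The quartic form of the interaction -/

section

/-- The quartic form of the interaction `V(|x - y|)`. -/
def quart (V : ℝ → ℝ) (a b c e : E3 → ℂ) : ℂ :=
  ∫ z : E3 × E3, a z.1 * b z.1 * (V ‖z.1 - z.2‖ : ℂ) * (c z.2 * e z.2)

variable {V : ℝ → ℝ} {a b c e a' b' c' e' : E3 → ℂ} {D r : ℝ≥0∞}

theorem aestronglyMeasurable_comp_sub {f : E3 → ℂ} (hf : AEStronglyMeasurable f volume) :
    AEStronglyMeasurable (fun z : E3 × E3 => f (z.1 - z.2)) volume :=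
  hf.comp_quasiMeasurePreserving (quasiMeasurePreserving_sub_of_right_invariant volume volume)

theorem aestronglyMeasurable_potential
    (hV : AEStronglyMeasurable (fun x : E3 => V ‖x‖) volume) :
    AEStronglyMeasurable (fun x : E3 => (V ‖x‖ : ℂ)) volume :=
  Complex.continuous_ofReal.comp_aestronglyMeasurable hV

theorem aestronglyMeasurable_quart (hV : AEStronglyMeasurable (fun x : E3 => V ‖x‖) volume)
    (ha : AEStronglyMeasurable a volume) (hb : AEStronglyMeasurable b volume)
    (hc : AEStronglyMeasurable c volume) (he : AEStronglyMeasurable e volume) :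
    AEStronglyMeasurable (fun z : E3 × E3 =>
      a z.1 * b z.1 * (V ‖z.1 - z.2‖ : ℂ) * (c z.2 * e z.2)) volume :=
  ((ha.comp_fst.mul hb.comp_fst).mul
    (aestronglyMeasurable_comp_sub (aestronglyMeasurable_potential hV))).mul
    (hc.comp_snd.mul he.comp_snd)

theorem eLpNorm_mul_mul_le (hDr : D⁻¹ + (r⁻¹ + r⁻¹) = 1) {v : E3 → ℂ}
    (hv : AEStronglyMeasurable v volume) (ha : AEStronglyMeasurable a volume)
    (hb : AEStronglyMeasurable b volume) :
    ∫⁻ x, ‖a x * b x * v x‖ₑ ≤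
      eLpNorm v D volume * (eLpNorm a r volume * eLpNorm b r volume) := by
  have h1 : ENNReal.HolderTriple r r ((r⁻¹ + r⁻¹)⁻¹) := ⟨by rw [inv_inv]⟩
  have h2 : ENNReal.HolderTriple D ((r⁻¹ + r⁻¹)⁻¹) 1 := ⟨by rw [inv_inv, inv_one, hDr]⟩
  have e1 := eLpNorm_smul_le_mul_eLpNorm (p := r) (q := r) (r := (r⁻¹ + r⁻¹)⁻¹) hb ha
  have e2 := eLpNorm_smul_le_mul_eLpNorm (p := D) (q := (r⁻¹ + r⁻¹)⁻¹) (r := 1) (ha.smul hb) hv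
  rw [eLpNorm_one_eq_lintegral_enorm] at e2
  refine le_trans (le_of_eq (lintegral_congr fun x => ?_)) (e2.trans (mul_le_mul' le_rfl e1))
  simp only [Pi.smul_apply', smul_eq_mul, Pi.mul_apply]
  rw [mul_comm]

/-- For fixed `y`, Hölder's inequality in `x` with the exponents `D`, `r`, `r`; the norm of the
translated potential does not depend on `y`, so that Cauchy-Schwarz in `y` finishes. The unequal
treatment of the two variables leaves only two factors in `L^r`. -/
theorem lintegral_quart_le (hDr : D⁻¹ + (r⁻¹ + r⁻¹) = 1)
    (hV : AEStronglyMeasurable (fun x : E3 => V ‖x‖) volume)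
    (ha : AEStronglyMeasurable a volume) (hb : AEStronglyMeasurable b volume)
    (hc : AEStronglyMeasurable c volume) (he : AEStronglyMeasurable e volume) :
    ∫⁻ z : E3 × E3, ‖a z.1 * b z.1 * (V ‖z.1 - z.2‖ : ℂ) * (c z.2 * e z.2)‖ₑ ≤
      eLpNorm (fun x : E3 => V ‖x‖) D volume * (eLpNorm a r volume * eLpNorm b r volume) *
        (eLpNorm c 2 volume * eLpNorm e 2 volume) := by
  rw [Measure.volume_eq_prod, lintegral_prod_symm _
    (aestronglyMeasurable_quart hV ha hb hc he).enorm]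
  have hVt : ∀ y : E3, eLpNorm (fun x : E3 => (V ‖x - y‖ : ℂ)) D volume =
      eLpNorm (fun x : E3 => V ‖x‖) D volume := by
    intro y
    rw [← eLpNorm_norm (fun x : E3 => V ‖x‖)]
    have h1 := eLpNorm_comp_measurePreserving (p := D) (aestronglyMeasurable_potential hV)
      (measurePreserving_sub_right volume y)
    refine h1.trans ?_
    rw [← eLpNorm_norm]
    simp_rw [Complex.norm_real]
  calc _ ≤ ∫⁻ y, eLpNorm (fun x : E3 => V ‖x‖) D volume *
        (eLpNorm a r volume * eLpNorm b r volume) * ‖c y * e y‖ₑ := by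
        refine lintegral_mono fun y => ?_
        simp_rw [enorm_mul _ (c y * e y)]
        rw [lintegral_mul_const' _ _ enorm_ne_top]
        gcongr
        rw [← hVt y]
        exact eLpNorm_mul_mul_le hDr ((aestronglyMeasurable_potential hV).comp_measurePreserving
          (measurePreserving_sub_right volume y)) ha hb
    _ ≤ _ := by
        have hm : AEMeasurable (fun y => ‖c y * e y‖ₑ) volume := (hc.mul he).enorm
        rw [lintegral_const_mul'' _ hm]
        gcongr
        have h1 := eLpNorm_smul_le_mul_eLpNorm (p := 2) (q := 2) (r := 1) he hc
        rw [eLpNorm_one_eq_lintegral_enorm] at h1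
        exact h1

/-- The functions admissible in the quartic form. -/
structure QuartData (V : ℝ → ℝ) (D r : ℝ≥0∞) (a b c e : E3 → ℂ) : Prop where
  exponents : D⁻¹ + (r⁻¹ + r⁻¹) = 1
  V_mem : MemLp (fun x : E3 => V ‖x‖) D volume
  a_mem : MemLp a r volume
  b_mem : MemLp b r volume
  c_mem : MemLp c 2 volume
  e_mem : MemLp e 2 volume

theorem QuartData.integrable (h : QuartData V D r a b c e) :
    Integrable (fun z : E3 × E3 => a z.1 * b z.1 * (V ‖z.1 - z.2‖ : ℂ) * (c z.2 * e z.2))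
      volume := by
  refine ⟨aestronglyMeasurable_quart h.V_mem.1 h.a_mem.1 h.b_mem.1 h.c_mem.1 h.e_mem.1, ?_⟩
  refine (lintegral_quart_le h.exponents h.V_mem.1 h.a_mem.1 h.b_mem.1 h.c_mem.1
    h.e_mem.1).trans_lt ?_
  exact ENNReal.mul_lt_top (ENNReal.mul_lt_top h.V_mem.2 (ENNReal.mul_lt_top h.a_mem.2 h.b_mem.2))
    (ENNReal.mul_lt_top h.c_mem.2 h.e_mem.2)

theorem enorm_quart_le (hDr : D⁻¹ + (r⁻¹ + r⁻¹) = 1)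
    (hV : AEStronglyMeasurable (fun x : E3 => V ‖x‖) volume)
    (ha : AEStronglyMeasurable a volume) (hb : AEStronglyMeasurable b volume)
    (hc : AEStronglyMeasurable c volume) (he : AEStronglyMeasurable e volume) :
    ‖quart V a b c e‖ₑ ≤
      eLpNorm (fun x : E3 => V ‖x‖) D volume * (eLpNorm a r volume * eLpNorm b r volume) *
        (eLpNorm c 2 volume * eLpNorm e 2 volume) :=
  (enorm_integral_le_lintegral_enorm _).trans (lintegral_quart_le hDr hV ha hb hc he)

/-- Multilinearity: the entries are replaced one at a time, from left to right. -/
theorem enorm_quart_sub_le (h : QuartData V D r a b c e) (h' : QuartData V D r a' b' c' e') :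
    ‖quart V a b c e - quart V a' b' c' e'‖ₑ ≤ eLpNorm (fun x : E3 => V ‖x‖) D volume *
      (eLpNorm (a - a') r volume * eLpNorm b r volume * (eLpNorm c 2 volume * eLpNorm e 2 volume) +
      eLpNorm a' r volume * eLpNorm (b - b') r volume * (eLpNorm c 2 volume * eLpNorm e 2 volume) +
      eLpNorm a' r volume * eLpNorm b' r volume *
        (eLpNorm (c - c') 2 volume * eLpNorm e 2 volume) +
      eLpNorm a' r volume * eLpNorm b' r volume *
        (eLpNorm c' 2 volume * eLpNorm (e - e') 2 volume)) := by
  have h1 : QuartData V D r (a - a') b c e := ⟨h.1, h.2, h.3.sub h'.3, h.4, h.5, h.6⟩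
  have h2 : QuartData V D r a' (b - b') c e := ⟨h.1, h.2, h'.3, h.4.sub h'.4, h.5, h.6⟩
  have h3 : QuartData V D r a' b' (c - c') e := ⟨h.1, h.2, h'.3, h'.4, h.5.sub h'.5, h.6⟩
  have h4 : QuartData V D r a' b' c' (e - e') := ⟨h.1, h.2, h'.3, h'.4, h'.5, h.6.sub h'.6⟩
  have key : quart V a b c e - quart V a' b' c' e' = quart V (a - a') b c e +
      quart V a' (b - b') c e + quart V a' b' (c - c') e + quart V a' b' c' (e - e') := by
    simp only [quart]
    have s1 := integral_add h1.integrable h2.integrable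
    have s2 := integral_add (h1.integrable.add h2.integrable) h3.integrable
    have s3 := integral_add ((h1.integrable.add h2.integrable).add h3.integrable) h4.integrable
    simp only [Pi.add_apply] at s2 s3
    rw [← integral_sub h.integrable h'.integrable, ← s1, ← s2, ← s3]
    refine integral_congr_ae (.of_forall fun z => ?_)
    simp only [Pi.sub_apply]
    ring
  have bd : ∀ {a b c e : E3 → ℂ}, QuartData V D r a b c e → ‖quart V a b c e‖ₑ ≤
      eLpNorm (fun x : E3 => V ‖x‖) D volume * (eLpNorm a r volume * eLpNorm b r volume *
        (eLpNorm c 2 volume * eLpNorm e 2 volume)) := fun h => by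
    rw [← mul_assoc]; exact enorm_quart_le h.1 h.2.1 h.3.1 h.4.1 h.5.1 h.6.1
  rw [key, mul_add, mul_add, mul_add]
  exact (enorm_add_le _ _).trans (add_le_add ((enorm_add_le _ _).trans (add_le_add
    ((enorm_add_le _ _).trans (add_le_add (bd h1) (bd h2))) (bd h3))) (bd h4))

theorem quart_congr_ae (ha : a =ᵐ[volume] a') (hb : b =ᵐ[volume] b') (hc : c =ᵐ[volume] c')
    (he : e =ᵐ[volume] e') : quart V a b c e = quart V a' b' c' e' := by
  refine integral_congr_ae ?_
  have h1 := Measure.quasiMeasurePreserving_fst (μ := (volume : Measure E3))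
    (ν := (volume : Measure E3))
  have h2 := Measure.quasiMeasurePreserving_snd (μ := (volume : Measure E3))
    (ν := (volume : Measure E3))
  filter_upwards [h1.ae_eq_comp ha, h1.ae_eq_comp hb, h2.ae_eq_comp hc, h2.ae_eq_comp he]
    with z w1 w2 w3 w4
  simp only [Function.comp_apply] at w1 w2 w3 w4
  rw [w1, w2, w3, w4]

/-- The quartic form as an iterated integral. -/
theorem QuartData.integrable_iterated (h : QuartData V D r a b c e) :
    Integrable (fun x => a x * b x * ∫ y, c y * (V ‖x - y‖ : ℂ) * e y) volume ∧
      ∫ x, a x * b x * ∫ y, c y * (V ‖x - y‖ : ℂ) * e y = quart V a b c e := by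
  have h1 := h.integrable
  rw [Measure.volume_eq_prod] at h1
  have e1 : (fun x => a x * b x * ∫ y, c y * (V ‖x - y‖ : ℂ) * e y) =
      fun x => ∫ y, a x * b x * (V ‖x - y‖ : ℂ) * (c y * e y) := by
    funext x
    rw [← integral_const_mul]
    congr 1
    funext y
    ring
  rw [e1]
  exact ⟨h1.integral_prod_left, (integral_prod _ h1).symm⟩

end

/-! ### Measurability in time of the quartic form -/

section

theorem continuous_of_quartic_bound {X : Type} [NormedAddCommGroup X] {f : X × X × X × X → ℂ}
    (M : ℝ≥0) (h : ∀ x y : X × X × X × X, ‖f x - f y‖ₑ ≤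
      M * (‖x.1 - y.1‖ₑ * ‖x.2.1‖ₑ * (‖x.2.2.1‖ₑ * ‖x.2.2.2‖ₑ) +
        ‖y.1‖ₑ * ‖x.2.1 - y.2.1‖ₑ * (‖x.2.2.1‖ₑ * ‖x.2.2.2‖ₑ) +
        ‖y.1‖ₑ * ‖y.2.1‖ₑ * (‖x.2.2.1 - y.2.2.1‖ₑ * ‖x.2.2.2‖ₑ) +
        ‖y.1‖ₑ * ‖y.2.1‖ₑ * (‖y.2.2.1‖ₑ * ‖x.2.2.2 - y.2.2.2‖ₑ))) : Continuous f := by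
  rw [continuous_iff_continuousAt]
  intro y
  rw [ContinuousAt, tendsto_iff_edist_tendsto_0]
  simp_rw [edist_eq_enorm_sub]
  set B : X × X × X × X → ℝ≥0 := fun x =>
      M * (‖x.1 - y.1‖₊ * ‖x.2.1‖₊ * (‖x.2.2.1‖₊ * ‖x.2.2.2‖₊) +
        ‖y.1‖₊ * ‖x.2.1 - y.2.1‖₊ * (‖x.2.2.1‖₊ * ‖x.2.2.2‖₊) +
        ‖y.1‖₊ * ‖y.2.1‖₊ * (‖x.2.2.1 - y.2.2.1‖₊ * ‖x.2.2.2‖₊) +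
        ‖y.1‖₊ * ‖y.2.1‖₊ * (‖y.2.2.1‖₊ * ‖x.2.2.2 - y.2.2.2‖₊)) with hB
  have hBc : Continuous B := by fun_prop
  have h0 : B y = 0 := by simp [hB]
  have h1 := hBc.tendsto y
  rw [h0] at h1
  refine tendsto_of_tendsto_of_tendsto_of_le_of_le tendsto_const_nhds (ENNReal.tendsto_coe.2 h1)
    (fun x => zero_le) fun x => ?_
  refine (h x y).trans (le_of_eq ?_)
  simp only [hB]
  push_cast
  rfl

theorem aestronglyMeasurable_comp₄ {X : Type} [TopologicalSpace X] {f : X × X × X × X → ℂ}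
    (hf : Continuous f) {α : Type*} [MeasurableSpace α] {μ : Measure α} {a b c e : α → X}
    (ha : AEStronglyMeasurable a μ) (hb : AEStronglyMeasurable b μ) (hc : AEStronglyMeasurable c μ)
    (he : AEStronglyMeasurable e μ) : AEStronglyMeasurable (fun s => f (a s, b s, c s, e s)) μ :=
  hf.comp_aestronglyMeasurable (ha.prodMk (hb.prodMk (hc.prodMk he)))

/-- The truncation of the potential at height `n`. -/
def truncation (V : ℝ → ℝ) (n : ℕ) (t : ℝ) : ℝ := if |V t| ≤ n then V t else 0

variable {V : ℝ → ℝ} {D r : ℝ≥0∞}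

theorem aestronglyMeasurable_truncation (hV : AEStronglyMeasurable (fun x : E3 => V ‖x‖) volume)
    (n : ℕ) : AEStronglyMeasurable (fun x : E3 => truncation V n ‖x‖) volume := by
  have h1 : Measurable fun y : ℝ => if |y| ≤ n then y else 0 :=
    Measurable.ite (measurableSet_le (by fun_prop) measurable_const) measurable_id measurable_const
  exact (h1.comp_aemeasurable hV.aemeasurable).aestronglyMeasurable

theorem abs_truncation_le (V : ℝ → ℝ) (n : ℕ) (t : ℝ) : |truncation V n t| ≤ n := by
  unfold truncation
  split_ifs with h
  · exact h
  · simp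

theorem memLp_top_truncation (hV : AEStronglyMeasurable (fun x : E3 => V ‖x‖) volume)
    (n : ℕ) : MemLp (fun x : E3 => truncation V n ‖x‖) ⊤ volume :=
  memLp_top_of_bound (aestronglyMeasurable_truncation hV n) n
    (.of_forall fun x => by simpa using abs_truncation_le V n ‖x‖)

theorem eLpNorm_coeFn_sub {F : Type} [NormedAddCommGroup F] (f g : L2 F) (q : ℝ≥0∞) :
    eLpNorm ((f : E3 → F) - (g : E3 → F)) q volume = eLpNorm ((f - g : L2 F) : E3 → F) q volume :=
  (eLpNorm_congr_ae (Lp.coeFn_sub f g)).symm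

/-- For a bounded potential the exponents may be taken as `D = ∞` and `r = 2`, so that the form is
defined and continuous on all of `L²`. -/
theorem continuous_quart_truncation (hV : AEStronglyMeasurable (fun x : E3 => V ‖x‖) volume)
    (n : ℕ) : Continuous fun x : L2 ℂ × L2 ℂ × L2 ℂ × L2 ℂ =>
      quart (truncation V n) x.1 x.2.1 x.2.2.1 x.2.2.2 := by
  have hm := memLp_top_truncation hV n
  have hd : ∀ a b c e : L2 ℂ, QuartData (truncation V n) ⊤ 2 a b c e := fun a b c e =>
    ⟨by rw [ENNReal.inv_top, zero_add, ENNReal.inv_two_add_inv_two], hm, Lp.memLp a, Lp.memLp b,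
      Lp.memLp c, Lp.memLp e⟩
  refine continuous_of_quartic_bound
    (eLpNorm (fun x : E3 => truncation V n ‖x‖) ⊤ volume).toNNReal fun x y => ?_
  rw [ENNReal.coe_toNNReal hm.2.ne]
  have h1 := enorm_quart_sub_le (hd x.1 x.2.1 x.2.2.1 x.2.2.2) (hd y.1 y.2.1 y.2.2.1 y.2.2.2)
  simp_rw [eLpNorm_coeFn_sub, ← Lp.enorm_def] at h1
  exact h1

theorem tendsto_quart_truncation {a b c e : E3 → ℂ} (h : QuartData V D r a b c e) :
    Filter.Tendsto (fun n => quart (truncation V n) a b c e) Filter.atTop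
      (nhds (quart V a b c e)) := by
  refine tendsto_integral_of_dominated_convergence
    (fun z : E3 × E3 => ‖a z.1 * b z.1 * (V ‖z.1 - z.2‖ : ℂ) * (c z.2 * e z.2)‖) (fun n => ?_)
    h.integrable.norm (fun n => .of_forall fun z => ?_) (.of_forall fun z => ?_)
  · exact aestronglyMeasurable_quart (aestronglyMeasurable_truncation h.V_mem.1 n) h.a_mem.1
      h.b_mem.1 h.c_mem.1 h.e_mem.1
  · simp only [norm_mul, Complex.norm_real, Real.norm_eq_abs]
    have h1 : |truncation V n ‖z.1 - z.2‖| ≤ |V ‖z.1 - z.2‖| := by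
      unfold truncation
      split_ifs
      · exact le_rfl
      · simp
    gcongr
  · refine tendsto_const_nhds.congr' ?_
    obtain ⟨N, hN⟩ := exists_nat_ge |V ‖z.1 - z.2‖|
    filter_upwards [Filter.eventually_ge_atTop N] with n hn
    have : |V ‖z.1 - z.2‖| ≤ n := hN.trans (by exact_mod_cast hn)
    simp [truncation, this]

/-- The curves are measurable as maps into `L²` only, where the form of an unbounded potential need
not converge. By dominated convergence it is the limit of the forms of the truncated potentials at
almost every time. -/
theorem aestronglyMeasurable_quart_time {α : Type*} [MeasurableSpace α] {μ : Measure α}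
    {a b c e : α → L2 ℂ} (ha : AEStronglyMeasurable a μ) (hb : AEStronglyMeasurable b μ)
    (hc : AEStronglyMeasurable c μ) (he : AEStronglyMeasurable e μ)
    (h : ∀ᵐ s ∂μ, QuartData V D r (a s) (b s) (c s) (e s))
    (hV : AEStronglyMeasurable (fun x : E3 => V ‖x‖) volume) :
    AEStronglyMeasurable (fun s => quart V (a s) (b s) (c s) (e s)) μ := by
  refine aestronglyMeasurable_of_tendsto_ae Filter.atTop
    (f := fun n s => quart (truncation V n) (a s) (b s) (c s) (e s)) (fun n => ?_) ?_
  · exact aestronglyMeasurable_comp₄ (continuous_quart_truncation hV n) ha hb hc he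
  · filter_upwards [h] with s hs
    exact tendsto_quart_truncation hs

end

/-! ### The bilinear form of the external potential -/

section

theorem IsExponents.holder {d p p' q q' : ℝ} (h : IsExponents d p p' q q') :
    (ENNReal.ofReal d)⁻¹ + ((ENNReal.ofReal q)⁻¹ + (ENNReal.ofReal q)⁻¹) = 1 := by
  have hd : 0 < d := by linarith [h.d_gt]
  have hq := h.q_pos
  rw [← ENNReal.ofReal_inv_of_pos hd, ← ENNReal.ofReal_inv_of_pos hq,
    ← ENNReal.ofReal_add (by positivity) (by positivity),
    ← ENNReal.ofReal_add (by positivity) (by positivity), ← ENNReal.ofReal_one]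
  congr 1
  have := h.potential
  rw [← this]; ring

/-- The bilinear form of the external potential. -/
def bil (U : E3 → ℝ) (a b : E3 → ℂ) : ℂ := ∫ x, a x * b x * (U x : ℂ)

variable {U : E3 → ℝ} {a b a' b' : E3 → ℂ} {D r : ℝ≥0∞}

theorem eLpNorm_ofReal_comp (U : E3 → ℝ) (D : ℝ≥0∞) :
    eLpNorm (fun x => (U x : ℂ)) D volume = eLpNorm U D volume := by
  rw [← eLpNorm_norm, ← eLpNorm_norm U]
  simp_rw [Complex.norm_real]

theorem lintegral_bil_le (hDr : D⁻¹ + (r⁻¹ + r⁻¹) = 1) (hU : AEStronglyMeasurable U volume)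
    (ha : AEStronglyMeasurable a volume) (hb : AEStronglyMeasurable b volume) :
    ∫⁻ x, ‖a x * b x * (U x : ℂ)‖ₑ ≤
      eLpNorm U D volume * (eLpNorm a r volume * eLpNorm b r volume) := by
  rw [← eLpNorm_ofReal_comp U]
  exact eLpNorm_mul_mul_le hDr (Complex.continuous_ofReal.comp_aestronglyMeasurable hU) ha hb

theorem integrable_bil (hDr : D⁻¹ + (r⁻¹ + r⁻¹) = 1) (hU : MemLp U D volume)
    (ha : MemLp a r volume) (hb : MemLp b r volume) :
    Integrable (fun x => a x * b x * (U x : ℂ)) volume :=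
  ⟨(ha.1.mul hb.1).mul (Complex.continuous_ofReal.comp_aestronglyMeasurable hU.1),
    (lintegral_bil_le hDr hU.1 ha.1 hb.1).trans_lt
      (ENNReal.mul_lt_top hU.2 (ENNReal.mul_lt_top ha.2 hb.2))⟩

theorem enorm_bil_le (hDr : D⁻¹ + (r⁻¹ + r⁻¹) = 1) (hU : AEStronglyMeasurable U volume)
    (ha : AEStronglyMeasurable a volume) (hb : AEStronglyMeasurable b volume) :
    ‖bil U a b‖ₑ ≤ eLpNorm U D volume * (eLpNorm a r volume * eLpNorm b r volume) :=
  (enorm_integral_le_lintegral_enorm _).trans (lintegral_bil_le hDr hU ha hb)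

theorem bil_sub_bil (hDr : D⁻¹ + (r⁻¹ + r⁻¹) = 1) (hU : MemLp U D volume)
    (ha : MemLp a r volume) (ha' : MemLp a' r volume) (hb : MemLp b r volume)
    (hb' : MemLp b' r volume) :
    bil U a b - bil U a' b' = bil U (a - a') b + bil U a' (b - b') := by
  simp only [bil]
  rw [← integral_sub (integrable_bil hDr hU ha hb) (integrable_bil hDr hU ha' hb'),
    ← integral_add (integrable_bil hDr hU (ha.sub ha') hb)
      (integrable_bil hDr hU ha' (hb.sub hb'))]
  refine integral_congr_ae (.of_forall fun z => ?_)
  simp only [Pi.sub_apply]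
  ring

theorem continuous_of_bilinear_bound {X : Type} [NormedAddCommGroup X] {f : X × X → ℂ}
    (M : ℝ≥0) (h : ∀ x y : X × X, ‖f x - f y‖ₑ ≤
      M * (‖x.1 - y.1‖ₑ * ‖x.2‖ₑ) + M * (‖y.1‖ₑ * ‖x.2 - y.2‖ₑ)) : Continuous f := by
  rw [continuous_iff_continuousAt]
  intro y
  rw [ContinuousAt, tendsto_iff_edist_tendsto_0]
  simp_rw [edist_eq_enorm_sub]
  set B : X × X → ℝ≥0 := fun x =>
      M * (‖x.1 - y.1‖₊ * ‖x.2‖₊) + M * (‖y.1‖₊ * ‖x.2 - y.2‖₊) with hB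
  have hBc : Continuous B := by fun_prop
  have h0 : B y = 0 := by simp [hB]
  have h1 := hBc.tendsto y
  rw [h0] at h1
  refine tendsto_of_tendsto_of_tendsto_of_le_of_le tendsto_const_nhds (ENNReal.tendsto_coe.2 h1)
    (fun x => zero_le) fun x => ?_
  refine (h x y).trans (le_of_eq ?_)
  simp only [hB]
  push_cast
  rfl

theorem aestronglyMeasurable_comp₂ {X : Type} [TopologicalSpace X] {f : X × X → ℂ}
    (hf : Continuous f) {α : Type*} [MeasurableSpace α] {μ : Measure α} {a b : α → X}
    (ha : AEStronglyMeasurable a μ) (hb : AEStronglyMeasurable b μ) :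
    AEStronglyMeasurable (fun s => f (a s, b s)) μ :=
  hf.comp_aestronglyMeasurable (ha.prodMk hb)

/-- The truncation of the external potential at height `n`. -/
def truncationAt (U : E3 → ℝ) (n : ℕ) (x : E3) : ℝ := if |U x| ≤ n then U x else 0

theorem abs_truncationAt_le (U : E3 → ℝ) (n : ℕ) (x : E3) : |truncationAt U n x| ≤ n := by
  unfold truncationAt
  split_ifs with h
  · exact h
  · simp

theorem aestronglyMeasurable_truncationAt (hU : AEStronglyMeasurable U volume) (n : ℕ) :
    AEStronglyMeasurable (truncationAt U n) volume := by
  have h1 : Measurable fun y : ℝ => if |y| ≤ n then y else 0 :=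
    Measurable.ite (measurableSet_le (by fun_prop) measurable_const) measurable_id measurable_const
  exact (h1.comp_aemeasurable hU.aemeasurable).aestronglyMeasurable

theorem continuous_bil_truncationAt (hU : AEStronglyMeasurable U volume) (n : ℕ) :
    Continuous fun x : L2 ℂ × L2 ℂ => bil (truncationAt U n) x.1 x.2 := by
  have hm : MemLp (truncationAt U n) ⊤ volume :=
    memLp_top_of_bound (aestronglyMeasurable_truncationAt hU n) n
      (.of_forall fun x => by simpa using abs_truncationAt_le U n x)
  have hDr : (⊤ : ℝ≥0∞)⁻¹ + ((2 : ℝ≥0∞)⁻¹ + (2 : ℝ≥0∞)⁻¹) = 1 := by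
    rw [ENNReal.inv_top, zero_add, ENNReal.inv_two_add_inv_two]
  refine continuous_of_bilinear_bound (eLpNorm (truncationAt U n) ⊤ volume).toNNReal fun x y => ?_
  rw [ENNReal.coe_toNNReal hm.2.ne, bil_sub_bil hDr hm (Lp.memLp x.1) (Lp.memLp y.1) (Lp.memLp x.2)
    (Lp.memLp y.2)]
  refine (enorm_add_le _ _).trans (add_le_add ?_ ?_)
  · have := enorm_bil_le (a := (x.1 : E3 → ℂ) - (y.1 : E3 → ℂ)) hDr hm.1
      ((Lp.aestronglyMeasurable x.1).sub (Lp.aestronglyMeasurable y.1))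
      (Lp.aestronglyMeasurable x.2)
    rw [eLpNorm_coeFn_sub, ← Lp.enorm_def, ← Lp.enorm_def] at this
    exact this
  · have := enorm_bil_le (b := (x.2 : E3 → ℂ) - (y.2 : E3 → ℂ)) hDr hm.1
      (Lp.aestronglyMeasurable y.1) ((Lp.aestronglyMeasurable x.2).sub (Lp.aestronglyMeasurable y.2))
    rw [eLpNorm_coeFn_sub, ← Lp.enorm_def, ← Lp.enorm_def] at this
    exact this

/-- The same truncation argument as for the quartic form. -/
theorem aestronglyMeasurable_bil_time {α : Type*} [MeasurableSpace α] {μ : Measure α}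
    {a b : α → L2 ℂ} (ha : AEStronglyMeasurable a μ) (hb : AEStronglyMeasurable b μ)
    (hDr : D⁻¹ + (r⁻¹ + r⁻¹) = 1) (hU : MemLp U D volume)
    (h : ∀ᵐ s ∂μ, MemLp (a s) r volume ∧ MemLp (b s) r volume) :
    AEStronglyMeasurable (fun s => bil U (a s) (b s)) μ := by
  refine aestronglyMeasurable_of_tendsto_ae Filter.atTop
    (f := fun n s => bil (truncationAt U n) (a s) (b s)) (fun n => ?_) ?_
  · exact aestronglyMeasurable_comp₂ (continuous_bil_truncationAt hU.1 n) ha hb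
  · filter_upwards [h] with s hs
    refine tendsto_integral_of_dominated_convergence (fun x => ‖a s x * b s x * (U x : ℂ)‖)
      (fun n => ?_) (integrable_bil hDr hU hs.1 hs.2).norm (fun n => .of_forall fun z => ?_)
      (.of_forall fun z => ?_)
    · exact ((Lp.aestronglyMeasurable _).mul (Lp.aestronglyMeasurable _)).mul
        (Complex.continuous_ofReal.comp_aestronglyMeasurable
          (aestronglyMeasurable_truncationAt hU.1 n))
    · simp only [norm_mul, Complex.norm_real, Real.norm_eq_abs]
      have h1 : |truncationAt U n z| ≤ |U z| := by
        unfold truncationAt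
        split_ifs
        · exact le_rfl
        · simp
      gcongr
    · refine tendsto_const_nhds.congr' ?_
      obtain ⟨N, hN⟩ := exists_nat_ge |U z|
      filter_upwards [Filter.eventually_ge_atTop N] with n hn
      have : |U z| ≤ n := hN.trans (by exact_mod_cast hn)
      simp [truncationAt, this]

theorem bil_congr_ae (ha : a =ᵐ[volume] a') (hb : b =ᵐ[volume] b') : bil U a b = bil U a' b' := by
  refine integral_congr_ae ?_
  filter_upwards [ha, hb] with x h1 h2
  rw [h1, h2]

end

/-! ### Splitting of the force into a potential part and a combination of orbitals -/

section

variable {N K : ℕ}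

/-- The coefficients of the cubic terms of the orbital equations. -/
def cubicCoeff (C : Coeff N K) (i : Fin K) (t : Fin K × Fin K × Fin K) : ℂ :=
  ∑ j, (densityMatrix C)⁻¹ i j * (2 * gammaCoeff C t.1 t.2.1 j t.2.2)

/-- The part of the force that acts on `L^q`. -/
def linForm (U : E3 → ℝ) (V : ℝ → ℝ) (C : Coeff N K) (Φ : E3 → Orb K) (i : Fin K) (h : E3 → ℂ) : ℂ :=
  bil U h (fun x => Φ x i) + ∑ t, cubicCoeff C i t *
    quart V h (fun x => Φ x t.1) (fun x => Φ x t.2.1) (fun x => conj (Φ x t.2.2))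

/-- The matrix elements of the interaction. -/
def quartOrb (V : ℝ → ℝ) (Φ : E3 → Orb K) (n : Fin K) (t : Fin K × Fin K × Fin K) : ℂ :=
  quart V (fun x => conj (Φ x n)) (fun x => Φ x t.1) (fun x => Φ x t.2.1)
    (fun x => conj (Φ x t.2.2))

/-- The coefficients of the projected part of the force with respect to the orbitals. -/
def orbCoeff (V : ℝ → ℝ) (C : Coeff N K) (Φ : E3 → Orb K) (i n : Fin K) : ℂ :=
  -∑ t, cubicCoeff C i t * quartOrb V Φ n t

theorem memLp_orb {Φ : E3 → Orb K} {r : ℝ≥0∞} (h : MemLp Φ r volume) (i : Fin K) :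
    MemLp (fun x => Φ x i) r volume :=
  h.of_le ((PiLp.continuous_apply 2 (fun _ : Fin K => ℂ) i).comp_aestronglyMeasurable h.1)
    (.of_forall fun x => PiLp.norm_apply_le (Φ x) i)

theorem memLp_conj_orb {Φ : E3 → Orb K} {r : ℝ≥0∞} (h : MemLp Φ r volume) (i : Fin K) :
    MemLp (fun x => conj (Φ x i)) r volume :=
  (memLp_orb h i).of_le (Complex.continuous_conj.comp_aestronglyMeasurable (memLp_orb h i).1)
    (.of_forall fun x => by simp)

variable {d p p' q q' : ℝ} {V : ℝ → ℝ} {U : E3 → ℝ}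

theorem quartData_orb (hE : IsExponents d p p' q q')
    (hV : MemLp (fun x : E3 => V ‖x‖) (.ofReal d) volume) {Φ : E3 → Orb K} (h2 : MemLp Φ 2 volume)
    (hq : MemLp Φ (.ofReal q) volume) {h : E3 → ℂ} (hh : MemLp h (.ofReal q) volume) (m k l : Fin K) :
    QuartData V (.ofReal d) (.ofReal q) h (fun x => Φ x m) (fun x => Φ x k)
      (fun x => conj (Φ x l)) :=
  ⟨hE.holder, hV, hh, memLp_orb hq m, memLp_orb h2 k, memLp_conj_orb h2 l⟩

theorem wMatrix_mulVec (C : Coeff N K) (Φ : E3 → Orb K) (x : E3) (j : Fin K) :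
    (wMatrix V C Φ x).mulVec (Φ x) j = ∑ t : Fin K × Fin K × Fin K,
      2 * gammaCoeff C t.1 t.2.1 j t.2.2 *
        (Φ x t.1 * ∫ y, Φ y t.2.1 * (V ‖x - y‖ : ℂ) * conj (Φ y t.2.2)) := by
  simp_rw [Fintype.sum_prod_type, Matrix.mulVec, dotProduct, wMatrix, Matrix.of_apply,
    Finset.mul_sum, Finset.sum_mul]
  refine Finset.sum_congr rfl fun m _ => Finset.sum_congr rfl fun k _ =>
    Finset.sum_congr rfl fun l _ => ?_
  ring

/-- The coefficients of the projection are identified with quartic integrals by Fubini's theorem,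
which is what the bounds in `L²` and `L^q` are for. -/
theorem integral_wMatrix_mulVec (hE : IsExponents d p p' q q')
    (hV : MemLp (fun x : E3 => V ‖x‖) (.ofReal d) volume) {Φ : E3 → Orb K} (h2 : MemLp Φ 2 volume)
    (hq : MemLp Φ (.ofReal q) volume) (C : Coeff N K) (j n : Fin K) :
    ∫ y, (wMatrix V C Φ y).mulVec (Φ y) j * conj (Φ y n) =
      ∑ t, 2 * gammaCoeff C t.1 t.2.1 j t.2.2 * quartOrb V Φ n t := by
  have h1 := fun t : Fin K × Fin K × Fin K =>
    (quartData_orb hE hV h2 hq (memLp_conj_orb hq n) t.1 t.2.1 t.2.2).integrable_iterated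
  calc _ = ∫ y, ∑ t : Fin K × Fin K × Fin K, 2 * gammaCoeff C t.1 t.2.1 j t.2.2 *
        (conj (Φ y n) * Φ y t.1 *
          ∫ z, Φ z t.2.1 * (V ‖y - z‖ : ℂ) * conj (Φ z t.2.2)) := by
        refine integral_congr_ae (.of_forall fun y => ?_)
        beta_reduce
        rw [wMatrix_mulVec, Finset.sum_mul]
        refine Finset.sum_congr rfl fun t _ => ?_
        ring
    _ = _ := by
        rw [integral_finsetSum _ fun t _ => (h1 t).1.const_mul _]
        refine Finset.sum_congr rfl fun t _ => ?_
        rw [integral_const_mul, (h1 t).2, quartOrb]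

/-- The projection contributes a combination of the orbitals with scalar coefficients. This part is
in `L²`, and only the remaining terms have to be tested in `L^q`. -/
theorem forcing_apply (hE : IsExponents d p p' q q')
    (hV : MemLp (fun x : E3 => V ‖x‖) (.ofReal d) volume) {Φ : E3 → Orb K} (h2 : MemLp Φ 2 volume)
    (hq : MemLp Φ (.ofReal q) volume) (C : Coeff N K) (x : E3) (i : Fin K) :
    forcing U V C Φ x i = (U x : ℂ) * Φ x i + ((∑ t, cubicCoeff C i t *
      (Φ x t.1 * ∫ y, Φ y t.2.1 * (V ‖x - y‖ : ℂ) * conj (Φ y t.2.2))) +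
        ∑ n, orbCoeff V C Φ i n * Φ x n) := by
  have e1 : forcing U V C Φ x i = (U x : ℂ) * Φ x i +
      ∑ j, (densityMatrix C)⁻¹ i j * projectedForce V C Φ j x := rfl
  rw [e1]
  congr 1
  simp_rw [projectedForce, proj, integral_wMatrix_mulVec hE hV h2 hq, wMatrix_mulVec, mul_sub,
    Finset.sum_sub_distrib, orbCoeff, cubicCoeff, neg_mul, Finset.sum_neg_distrib, sub_eq_add_neg,
    Finset.sum_mul, Finset.mul_sum]
  congr 1
  · rw [Finset.sum_comm]
    refine Finset.sum_congr rfl fun t _ => Finset.sum_congr rfl fun j _ => ?_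
    ring
  · congr 1
    rw [Finset.sum_comm]
    refine Finset.sum_congr rfl fun n _ => ?_
    rw [Finset.sum_comm]
    refine Finset.sum_congr rfl fun t _ => ?_
    refine Finset.sum_congr rfl fun j _ => ?_
    ring

theorem integral_mul_forcing (hE : IsExponents d p p' q q') (hU : MemLp U (.ofReal d) volume)
    (hV : MemLp (fun x : E3 => V ‖x‖) (.ofReal d) volume) {Φ : E3 → Orb K} (h2 : MemLp Φ 2 volume)
    (hq : MemLp Φ (.ofReal q) volume) (C : Coeff N K) (i : Fin K) {h : E3 → ℂ}
    (hh2 : MemLp h 2 volume) (hhq : MemLp h (.ofReal q) volume) :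
    Integrable (fun x => h x * forcing U V C Φ x i) volume ∧
      ∫ x, h x * forcing U V C Φ x i =
        linForm U V C Φ i h + ∑ n, orbCoeff V C Φ i n * ∫ x, h x * Φ x n := by
  have I1 := integrable_bil hE.holder hU hhq (memLp_orb hq i)
  have I2 := fun t : Fin K × Fin K × Fin K =>
    (quartData_orb hE hV h2 hq hhq t.1 t.2.1 t.2.2).integrable_iterated
  have I3 : ∀ n : Fin K, Integrable (fun x => h x * Φ x n) volume := fun n =>
    hh2.integrable_mul (memLp_orb h2 n)
  have I2' : Integrable (fun x => ∑ t : Fin K × Fin K × Fin K, cubicCoeff C i t * (h x * Φ x t.1 *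
      ∫ y, Φ y t.2.1 * (V ‖x - y‖ : ℂ) * conj (Φ y t.2.2))) volume :=
    integrable_finsetSum _ fun t _ => (I2 t).1.const_mul _
  have I3' : Integrable (fun x => ∑ n, orbCoeff V C Φ i n * (h x * Φ x n)) volume :=
    integrable_finsetSum _ fun n _ => (I3 n).const_mul _
  have e : (fun x => h x * forcing U V C Φ x i) = fun x => h x * Φ x i * (U x : ℂ) +
      ((∑ t : Fin K × Fin K × Fin K, cubicCoeff C i t * (h x * Φ x t.1 *
        ∫ y, Φ y t.2.1 * (V ‖x - y‖ : ℂ) * conj (Φ y t.2.2))) +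
        ∑ n, orbCoeff V C Φ i n * (h x * Φ x n)) := by
    funext x
    rw [forcing_apply hE hV h2 hq, mul_add, mul_add, Finset.mul_sum, Finset.mul_sum]
    congr 1
    · ring
    · congr 1
      · exact Finset.sum_congr rfl fun t _ => by ring
      · exact Finset.sum_congr rfl fun t _ => by ring
  rw [e]
  refine ⟨I1.add (I2'.add I3'), ?_⟩
  have s1 := integral_add I2' I3'
  have s2 := integral_add I1 (I2'.add I3')
  simp only [Pi.add_apply] at s2
  rw [s2, s1, integral_finsetSum _ fun t _ => (I2 t).1.const_mul _,
    integral_finsetSum _ fun n _ => (I3 n).const_mul _, linForm, bil, add_assoc]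
  simp_rw [integral_const_mul, (I2 _).2]

end

/-! ### Bounds and Lipschitz estimates for the force -/

section

variable {N K : ℕ} {d p p' q q' : ℝ} {V : ℝ → ℝ} {U : E3 → ℝ}

/-- The part of the force in `L²`. -/
def orbForce (V : ℝ → ℝ) (C : Coeff N K) (Φ : L2 (Orb K)) (i : Fin K) : L2 ℂ :=
  ∑ n, orbCoeff V C Φ i n • comp n Φ

/-- Common bounds for two states `(C, Φ)` and `(C', Φ')` of the system. -/
structure PairBound (M R : ℝ≥0) (q : ℝ) (C C' : Coeff N K) (Φ Φ' : L2 (Orb K)) (Y : ℝ≥0∞) : Prop where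
  cubic_le : ∀ i t, ‖cubicCoeff C i t‖ₑ ≤ M
  cubic_le' : ∀ i t, ‖cubicCoeff C' i t‖ₑ ≤ M
  cubic_sub_le : ∀ i t, ‖cubicCoeff C i t - cubicCoeff C' i t‖ₑ ≤ M * ‖C - C'‖ₑ
  coeff_le : ‖C‖ₑ ≤ R
  coeff_le' : ‖C'‖ₑ ≤ R
  orb_le : ‖Φ‖ₑ ≤ R
  orb_le' : ‖Φ'‖ₑ ≤ R
  orb_q_le : eLpNorm Φ (.ofReal q) volume ≤ Y
  orb_q_le' : eLpNorm Φ' (.ofReal q) volume ≤ Y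
  Y_ne_top : Y ≠ ∞

theorem PairBound.memLp {M R : ℝ≥0} {C C' : Coeff N K} {Φ Φ' : L2 (Orb K)} {Y : ℝ≥0∞}
    (h : PairBound M R q C C' Φ Φ' Y) : MemLp Φ (.ofReal q) volume :=
  ⟨Lp.aestronglyMeasurable _, h.orb_q_le.trans_lt h.Y_ne_top.lt_top⟩

theorem PairBound.memLp' {M R : ℝ≥0} {C C' : Coeff N K} {Φ Φ' : L2 (Orb K)} {Y : ℝ≥0∞}
    (h : PairBound M R q C C' Φ Φ' Y) : MemLp Φ' (.ofReal q) volume :=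
  ⟨Lp.aestronglyMeasurable _, h.orb_q_le'.trans_lt h.Y_ne_top.lt_top⟩

theorem eLpNorm_orb_le (Φ : E3 → Orb K) (r : ℝ≥0∞) (i : Fin K) :
    eLpNorm (fun x => Φ x i) r volume ≤ eLpNorm Φ r volume :=
  eLpNorm_mono fun x => PiLp.norm_apply_le (Φ x) i

theorem eLpNorm_conj_orb_le (Φ : E3 → Orb K) (r : ℝ≥0∞) (i : Fin K) :
    eLpNorm (fun x => conj (Φ x i)) r volume ≤ eLpNorm Φ r volume :=
  eLpNorm_mono fun x => by rw [RCLike.norm_conj]; exact PiLp.norm_apply_le (Φ x) i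

theorem eLpNorm_orb_sub_le (Φ Φ' : L2 (Orb K)) (r : ℝ≥0∞) (i : Fin K) :
    eLpNorm ((fun x => Φ x i) - fun x => Φ' x i) r volume ≤
      eLpNorm (Φ - Φ' : L2 (Orb K)) r volume := by
  rw [← eLpNorm_coeFn_sub]
  exact eLpNorm_mono fun x => PiLp.norm_apply_le (Φ x - Φ' x) i

theorem eLpNorm_conj_orb_sub_le (Φ Φ' : L2 (Orb K)) (r : ℝ≥0∞) (i : Fin K) :
    eLpNorm ((fun x => conj (Φ x i)) - fun x => conj (Φ' x i)) r volume ≤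
      eLpNorm (Φ - Φ' : L2 (Orb K)) r volume := by
  rw [← eLpNorm_coeFn_sub]
  refine eLpNorm_mono fun x => ?_
  rw [Pi.sub_apply, ← map_sub, RCLike.norm_conj]
  exact PiLp.norm_apply_le (Φ x - Φ' x) i

section Quart

variable {a a' b b' c c' e e' : E3 → ℂ} {D r : ℝ≥0∞} {B R : ℝ≥0} {Y δ δ₂ : ℝ≥0∞}

theorem enorm_quart_le_of_le (h : QuartData V D r a b c e)
    (hB : eLpNorm (fun x : E3 => V ‖x‖) D volume ≤ B) {X : ℝ≥0∞} (ha : eLpNorm a r volume ≤ X)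
    (hb : eLpNorm b r volume ≤ Y) (hc : eLpNorm c 2 volume ≤ R) (he : eLpNorm e 2 volume ≤ R) :
    ‖quart V a b c e‖ₑ ≤ B * (X * Y) * (R * R) :=
  (enorm_quart_le h.1 h.2.1 h.3.1 h.4.1 h.5.1 h.6.1).trans (by gcongr)

/-- The difference of two quartic forms with the same first entry. -/
theorem enorm_quart_sub_le_of_le (h : QuartData V D r a b c e) (h' : QuartData V D r a b' c' e')
    (hB : eLpNorm (fun x : E3 => V ‖x‖) D volume ≤ B)
    (hb' : eLpNorm b' r volume ≤ Y) (hc : eLpNorm c 2 volume ≤ R)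
    (he : eLpNorm e 2 volume ≤ R) (hc' : eLpNorm c' 2 volume ≤ R)
    (hbb : eLpNorm (b - b') r volume ≤ δ) (hcc : eLpNorm (c - c') 2 volume ≤ δ₂)
    (hee : eLpNorm (e - e') 2 volume ≤ δ₂) :
    ‖quart V a b c e - quart V a b' c' e'‖ₑ ≤
      B * eLpNorm a r volume * (R * R * δ + 2 * R * (Y * δ₂)) := by
  refine (enorm_quart_sub_le h h').trans ?_
  rw [sub_self, eLpNorm_zero, zero_mul, zero_mul, zero_add]
  calc _ ≤ B * (eLpNorm a r volume * δ * (R * R) + eLpNorm a r volume * Y * (δ₂ * R) +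
        eLpNorm a r volume * Y * (R * δ₂)) := by gcongr
    _ = _ := by ring

theorem enorm_quart_sub_le_of_le' (h : QuartData V D r a b c e) (h' : QuartData V D r a' b' c' e')
    (hB : eLpNorm (fun x : E3 => V ‖x‖) D volume ≤ B)
    (ha' : eLpNorm a' r volume ≤ Y) (hb : eLpNorm b r volume ≤ Y)
    (hb' : eLpNorm b' r volume ≤ Y) (hc : eLpNorm c 2 volume ≤ R)
    (he : eLpNorm e 2 volume ≤ R) (hc' : eLpNorm c' 2 volume ≤ R)
    (haa : eLpNorm (a - a') r volume ≤ δ)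
    (hbb : eLpNorm (b - b') r volume ≤ δ) (hcc : eLpNorm (c - c') 2 volume ≤ δ₂)
    (hee : eLpNorm (e - e') 2 volume ≤ δ₂) :
    ‖quart V a b c e - quart V a' b' c' e'‖ₑ ≤
      2 * B * (R * R + R) * (Y ^ 2 * δ₂ + Y * δ) := by
  refine (enorm_quart_sub_le h h').trans ?_
  calc _ ≤ B * (δ * Y * (R * R) + Y * δ * (R * R) + Y * Y * (δ₂ * R) + Y * Y * (R * δ₂)) := by gcongr
    _ ≤ B * (δ * Y * (R * R) + Y * δ * (R * R) + Y * Y * (δ₂ * R) + Y * Y * (R * δ₂)) +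
        2 * B * (R * R * (Y ^ 2 * δ₂) + R * (Y * δ)) := le_self_add
    _ = _ := by ring

end Quart

theorem card_triple (K : ℕ) : Fintype.card (Fin K × Fin K × Fin K) = K ^ 3 := by
  simp [pow_succ, mul_assoc]

theorem enorm_mul_sub_mul_le (x y x' y' : ℂ) :
    ‖x * y - x' * y'‖ₑ ≤ ‖x - x'‖ₑ * ‖y‖ₑ + ‖x'‖ₑ * ‖y - y'‖ₑ := by
  rw [← enorm_mul, ← enorm_mul, show x * y - x' * y' = (x - x') * y + x' * (y - y') by ring]
  exact enorm_add_le _ _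

section Estimates

variable {A B M R : ℝ≥0} {C C' : Coeff N K} {Φ Φ' : L2 (Orb K)} {Y : ℝ≥0∞}

/-- The test function is the same for both states, so its norm factors out, and every term contains
exactly one `L^q` norm of an orbital or of a difference of orbitals. The bound is therefore linear
in `Y` and in the `L^q` distance. -/
theorem enorm_linForm_sub_le (hE : IsExponents d p p' q q') (hU : MemLp U (.ofReal d) volume)
    (hV : MemLp (fun x : E3 => V ‖x‖) (.ofReal d) volume) (hA : eLpNorm U (.ofReal d) volume ≤ A)
    (hB : eLpNorm (fun x : E3 => V ‖x‖) (.ofReal d) volume ≤ B)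
    (hP : PairBound M R q C C' Φ Φ' Y) (i : Fin K) {h : E3 → ℂ} (hh : MemLp h (.ofReal q) volume) :
    ‖linForm U V C Φ i h - linForm U V C' Φ' i h‖ₑ ≤
      (A + K ^ 3 * (M * B * (R * R + 2 * R)) : ℝ≥0) *
        (eLpNorm (Φ - Φ' : L2 (Orb K)) (.ofReal q) volume + Y * (‖C - C'‖ₑ + ‖Φ - Φ'‖ₑ)) *
        eLpNorm h (.ofReal q) volume := by
  set H := eLpNorm h (.ofReal q) volume
  set δ := eLpNorm (Φ - Φ' : L2 (Orb K)) (.ofReal q) volume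
  set δ₂ := ‖Φ - Φ'‖ₑ with hδ₂
  set δC := ‖C - C'‖ₑ
  rw [Lp.enorm_def] at hδ₂
  have hR : eLpNorm Φ 2 volume ≤ R := (Lp.enorm_def Φ).symm.le.trans hP.orb_le
  have hR' : eLpNorm Φ' 2 volume ≤ R := (Lp.enorm_def Φ').symm.le.trans hP.orb_le'
  have hd := fun t : Fin K × Fin K × Fin K =>
    quartData_orb hE hV (Lp.memLp Φ) hP.memLp hh t.1 t.2.1 t.2.2
  have hd' := fun t : Fin K × Fin K × Fin K =>
    quartData_orb hE hV (Lp.memLp Φ') hP.memLp' hh t.1 t.2.1 t.2.2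
  have b1 : ‖bil U h (fun x => Φ x i) - bil U h (fun x => Φ' x i)‖ₑ ≤ A * (H * δ) := by
    rw [bil_sub_bil hE.holder hU hh hh (memLp_orb hP.memLp i) (memLp_orb hP.memLp' i), sub_self]
    have : bil U 0 (fun x => Φ x i) = 0 := by simp [bil]
    rw [this, zero_add]
    refine (enorm_bil_le hE.holder hU.1 hh.1
      ((memLp_orb hP.memLp i).1.sub (memLp_orb hP.memLp' i).1)).trans ?_
    gcongr
    exact eLpNorm_orb_sub_le _ _ _ _
  have b2 : ∀ t : Fin K × Fin K × Fin K, ‖cubicCoeff C i t *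
      quart V h (fun x => Φ x t.1) (fun x => Φ x t.2.1) (fun x => conj (Φ x t.2.2)) -
      cubicCoeff C' i t *
      quart V h (fun x => Φ' x t.1) (fun x => Φ' x t.2.1) (fun x => conj (Φ' x t.2.2))‖ₑ ≤
      M * δC * (B * (H * Y) * (R * R)) + M * (B * H * (R * R * δ + 2 * R * (Y * δ₂))) := by
    intro t
    refine (enorm_mul_sub_mul_le _ _ _ _).trans (add_le_add (mul_le_mul' (hP.cubic_sub_le i t) ?_)
      (mul_le_mul' (hP.cubic_le' i t) ?_))
    · exact enorm_quart_le_of_le (hd t) hB le_rfl ((eLpNorm_orb_le _ _ _).trans hP.orb_q_le)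
        ((eLpNorm_orb_le _ _ _).trans hR) ((eLpNorm_conj_orb_le _ _ _).trans hR)
    · exact enorm_quart_sub_le_of_le (hd t) (hd' t) hB ((eLpNorm_orb_le _ _ _).trans hP.orb_q_le')
        ((eLpNorm_orb_le _ _ _).trans hR) ((eLpNorm_conj_orb_le _ _ _).trans hR)
        ((eLpNorm_orb_le _ _ _).trans hR') (eLpNorm_orb_sub_le _ _ _ _)
        (hδ₂ ▸ eLpNorm_orb_sub_le _ _ _ _) (hδ₂ ▸ eLpNorm_conj_orb_sub_le _ _ _ _)
  rw [linForm, linForm, add_sub_add_comm, ← Finset.sum_sub_distrib]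
  calc _ ≤ A * (H * δ) + ∑ _t : Fin K × Fin K × Fin K,
        (M * δC * (B * (H * Y) * (R * R)) + M * (B * H * (R * R * δ + 2 * R * (Y * δ₂)))) :=
        (enorm_add_le _ _).trans (add_le_add b1 ((enorm_sum_le _ _).trans
          (Finset.sum_le_sum fun t _ => b2 t)))
    _ = A * (H * δ) + K ^ 3 * (M * δC * (B * (H * Y) * (R * R)) +
          M * (B * H * (R * R * δ + 2 * R * (Y * δ₂)))) := by
        rw [Finset.sum_const, Finset.card_univ, card_triple, nsmul_eq_mul]; push_cast; rfl
    -- Non-negative terms are added so that the sum factors exactly into the product claimed.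
    _ ≤ A * (H * δ) + K ^ 3 * (M * δC * (B * (H * Y) * (R * R)) +
          M * (B * H * (R * R * δ + 2 * R * (Y * δ₂)))) + (A * (Y * (δC + δ₂)) +
          K ^ 3 * (M * B) * (R * R * (Y * δ₂) + 2 * R * (δ + Y * δC))) * H := le_self_add
    _ = _ := by push_cast; ring

theorem enorm_orbCoeff_le (hE : IsExponents d p p' q q')
    (hV : MemLp (fun x : E3 => V ‖x‖) (.ofReal d) volume)
    (hB : eLpNorm (fun x : E3 => V ‖x‖) (.ofReal d) volume ≤ B)
    (hM : ∀ i t, ‖cubicCoeff C i t‖ₑ ≤ M) (hR : eLpNorm Φ 2 volume ≤ R)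
    (hΦ : MemLp Φ (.ofReal q) volume) (hY : eLpNorm Φ (.ofReal q) volume ≤ Y) (i n : Fin K) :
    ‖orbCoeff V C Φ i n‖ₑ ≤ K ^ 3 * (M * (B * (Y * Y) * (R * R))) := by
  rw [orbCoeff, enorm_neg]
  refine (enorm_sum_le _ _).trans ((Finset.sum_le_sum fun t _ =>
    (enorm_mul _ _).le.trans (mul_le_mul' (hM i t) (enorm_quart_le_of_le
      (quartData_orb hE hV (Lp.memLp Φ) hΦ (memLp_conj_orb hΦ n) t.1 t.2.1 t.2.2) hB
      ((eLpNorm_conj_orb_le _ _ _).trans hY) ((eLpNorm_orb_le _ _ _).trans hY)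
        ((eLpNorm_orb_le _ _ _).trans hR) ((eLpNorm_conj_orb_le _ _ _).trans hR)))).trans ?_)
  rw [Finset.sum_const, Finset.card_univ, card_triple, nsmul_eq_mul]
  push_cast
  rfl

theorem enorm_orbCoeff_sub_le (hE : IsExponents d p p' q q')
    (hV : MemLp (fun x : E3 => V ‖x‖) (.ofReal d) volume)
    (hB : eLpNorm (fun x : E3 => V ‖x‖) (.ofReal d) volume ≤ B)
    (hP : PairBound M R q C C' Φ Φ' Y) (i n : Fin K) :
    ‖orbCoeff V C Φ i n - orbCoeff V C' Φ' i n‖ₑ ≤ (K ^ 3 * (M * (2 * B * (R * R + R))) : ℝ≥0) *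
      (Y ^ 2 * (‖C - C'‖ₑ + ‖Φ - Φ'‖ₑ) + Y * eLpNorm (Φ - Φ' : L2 (Orb K)) (.ofReal q) volume) := by
  set δ := eLpNorm (Φ - Φ' : L2 (Orb K)) (.ofReal q) volume
  set δ₂ := ‖Φ - Φ'‖ₑ with hδ₂
  set δC := ‖C - C'‖ₑ
  rw [Lp.enorm_def] at hδ₂
  have hR : eLpNorm Φ 2 volume ≤ R := (Lp.enorm_def Φ).symm.le.trans hP.orb_le
  have hR' : eLpNorm Φ' 2 volume ≤ R := (Lp.enorm_def Φ').symm.le.trans hP.orb_le'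
  have hd := fun t : Fin K × Fin K × Fin K =>
    quartData_orb hE hV (Lp.memLp Φ) hP.memLp (memLp_conj_orb hP.memLp n) t.1 t.2.1 t.2.2
  have hd' := fun t : Fin K × Fin K × Fin K =>
    quartData_orb hE hV (Lp.memLp Φ') hP.memLp' (memLp_conj_orb hP.memLp' n) t.1 t.2.1 t.2.2
  have b2 : ∀ t : Fin K × Fin K × Fin K,
      ‖cubicCoeff C i t * quartOrb V Φ n t - cubicCoeff C' i t * quartOrb V Φ' n t‖ₑ ≤
      M * δC * (B * (Y * Y) * (R * R)) + M * (2 * B * (R * R + R) * (Y ^ 2 * δ₂ + Y * δ)) := by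
    intro t
    refine (enorm_mul_sub_mul_le _ _ _ _).trans (add_le_add (mul_le_mul' (hP.cubic_sub_le i t) ?_)
      (mul_le_mul' (hP.cubic_le' i t) ?_))
    · exact enorm_quart_le_of_le (hd t) hB ((eLpNorm_conj_orb_le _ _ _).trans hP.orb_q_le)
        ((eLpNorm_orb_le _ _ _).trans hP.orb_q_le)
        ((eLpNorm_orb_le _ _ _).trans hR) ((eLpNorm_conj_orb_le _ _ _).trans hR)
    · exact enorm_quart_sub_le_of_le' (hd t) (hd' t) hB
        ((eLpNorm_conj_orb_le _ _ _).trans hP.orb_q_le')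
        ((eLpNorm_orb_le _ _ _).trans hP.orb_q_le) ((eLpNorm_orb_le _ _ _).trans hP.orb_q_le')
        ((eLpNorm_orb_le _ _ _).trans hR) ((eLpNorm_conj_orb_le _ _ _).trans hR)
        ((eLpNorm_orb_le _ _ _).trans hR') (eLpNorm_conj_orb_sub_le _ _ _ _)
        (eLpNorm_orb_sub_le _ _ _ _)
        (hδ₂ ▸ eLpNorm_orb_sub_le _ _ _ _) (hδ₂ ▸ eLpNorm_conj_orb_sub_le _ _ _ _)
  rw [orbCoeff, orbCoeff, neg_sub_neg, ← enorm_neg, neg_sub, ← Finset.sum_sub_distrib]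
  calc _ ≤ ∑ _t : Fin K × Fin K × Fin K,
        (M * δC * (B * (Y * Y) * (R * R)) + M * (2 * B * (R * R + R) * (Y ^ 2 * δ₂ + Y * δ))) :=
        (enorm_sum_le _ _).trans (Finset.sum_le_sum fun t _ => b2 t)
    _ = K ^ 3 * (M * δC * (B * (Y * Y) * (R * R)) +
          M * (2 * B * (R * R + R) * (Y ^ 2 * δ₂ + Y * δ))) := by
        rw [Finset.sum_const, Finset.card_univ, card_triple, nsmul_eq_mul]; push_cast; rfl
    _ ≤ K ^ 3 * (M * δC * (B * (Y * Y) * (R * R)) +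
          M * (2 * B * (R * R + R) * (Y ^ 2 * δ₂ + Y * δ))) +
          K ^ 3 * (M * B * (R * R + 2 * R) * (Y ^ 2 * δC)) := le_self_add
    _ = _ := by push_cast; ring

/-- The coefficients of the projected part are quadratic in the `L^q` norms, which is why `Y²` and
`Y` times the `L^q` distance appear; in time these products are integrated with `p > 2`. -/
theorem enorm_orbForce_sub_le (hE : IsExponents d p p' q q')
    (hV : MemLp (fun x : E3 => V ‖x‖) (.ofReal d) volume)
    (hB : eLpNorm (fun x : E3 => V ‖x‖) (.ofReal d) volume ≤ B)
    (hP : PairBound M R q C C' Φ Φ' Y) (i : Fin K) :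
    ‖orbForce V C Φ i - orbForce V C' Φ' i‖ₑ ≤
      (K * (K ^ 3 * (M * (2 * B * (R * R + R))) * R + K ^ 3 * (M * (B * (R * R)))) : ℝ≥0) *
      (Y ^ 2 * (‖C - C'‖ₑ + ‖Φ - Φ'‖ₑ) + Y * eLpNorm (Φ - Φ' : L2 (Orb K)) (.ofReal q) volume) := by
  rw [orbForce, orbForce, ← Finset.sum_sub_distrib]
  have h1 : ∀ n, ‖orbCoeff V C Φ i n • comp n Φ - orbCoeff V C' Φ' i n • comp n Φ'‖ₑ ≤
      (K ^ 3 * (M * (2 * B * (R * R + R))) : ℝ≥0) *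
      (Y ^ 2 * (‖C - C'‖ₑ + ‖Φ - Φ'‖ₑ) + Y * eLpNorm (Φ - Φ' : L2 (Orb K)) (.ofReal q) volume) * R +
      K ^ 3 * (M * (B * (Y * Y) * (R * R))) * ‖Φ - Φ'‖ₑ := by
    intro n
    have e : orbCoeff V C Φ i n • comp n Φ - orbCoeff V C' Φ' i n • comp n Φ' =
        (orbCoeff V C Φ i n - orbCoeff V C' Φ' i n) • comp n Φ +
          orbCoeff V C' Φ' i n • comp n (Φ - Φ') := by
      rw [map_sub, sub_smul, smul_sub]; abel
    rw [e]
    refine (enorm_add_le _ _).trans ?_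
    rw [enorm_smul, enorm_smul]
    exact add_le_add (mul_le_mul' (enorm_orbCoeff_sub_le hE hV hB hP i n)
      ((enorm_comp_le n Φ).trans hP.orb_le)) (mul_le_mul' (enorm_orbCoeff_le hE hV hB hP.cubic_le'
        ((Lp.enorm_def Φ').symm.le.trans hP.orb_le') hP.memLp' hP.orb_q_le' i n) (enorm_comp_le n _))
  refine ((enorm_sum_le _ _).trans (Finset.sum_le_sum fun n _ => h1 n)).trans ?_
  rw [Finset.sum_const, Finset.card_univ, Fintype.card_fin, nsmul_eq_mul]
  set δ := eLpNorm (Φ - Φ' : L2 (Orb K)) (.ofReal q) volume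
  set δ₂ := ‖Φ - Φ'‖ₑ
  set δC := ‖C - C'‖ₑ
  refine le_trans (le_self_add (b := K * (K ^ 3 * (M * (B * (R * R)))) *
    (Y ^ 2 * δC + Y * δ))) (le_of_eq ?_)
  push_cast
  ring

end Estimates

end

/-! ### The force in the coefficient equation -/

section

variable {N K : ℕ} {d p p' q q' : ℝ} {V : ℝ → ℝ} {U : E3 → ℝ}

theorem enorm_le_sum_apply {ι : Type} [Fintype ι] (v : EuclideanSpace ℂ ι) : ‖v‖ₑ ≤ ∑ i, ‖v i‖ₑ := by
  have h : ‖v‖ ≤ ∑ i, ‖v i‖ := by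
    rw [EuclideanSpace.norm_eq]
    refine Real.sqrt_le_iff.2 ⟨Finset.sum_nonneg fun i _ => norm_nonneg _, ?_⟩
    exact Finset.sum_sq_le_sq_sum_of_nonneg fun i _ => norm_nonneg _
  rw [← ofReal_norm]
  refine (ENNReal.ofReal_le_ofReal h).trans (le_of_eq ?_)
  rw [ENNReal.ofReal_sum_of_nonneg fun i _ => norm_nonneg _]
  simp_rw [ofReal_norm]

theorem enorm_apply_le {ι : Type} [Fintype ι] (v : EuclideanSpace ℂ ι) (i : ι) : ‖v i‖ₑ ≤ ‖v‖ₑ := by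
  rw [← ofReal_norm, ← ofReal_norm]
  exact ENNReal.ofReal_le_ofReal (PiLp.norm_apply_le v i)

theorem enorm_pairSign (σ : MultiIndex N K) (k l : Fin K) : ‖pairSign σ k l‖ₑ = 1 := by
  unfold pairSign
  split_ifs <;> rw [← ofReal_norm] <;> simp

theorem enorm_half_le : ‖(1 / 2 : ℂ)‖ₑ ≤ 1 := by
  rw [← ofReal_norm]
  refine ENNReal.ofReal_le_one.2 ?_
  norm_num

/-- The matrix elements of the interaction that enter the matrix `𝕂[Φ]`. -/
def quartK (V : ℝ → ℝ) (Φ : E3 → Orb K) (i j k l : Fin K) : ℂ :=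
  quart V (fun x => Φ x i) (fun x => conj (Φ x k)) (fun x => Φ x j) (fun x => conj (Φ x l))

theorem kMatrix_apply (V : ℝ → ℝ) (Φ : E3 → Orb K) (σ τ : MultiIndex N K) :
    kMatrix V Φ σ τ = (1 / 2) * ∑ i ∈ τ.1, ∑ j ∈ τ.1, ∑ k ∈ σ.1, ∑ l ∈ σ.1,
      if i ≠ j ∧ k ≠ l ∧ τ.1 \ {i, j} = σ.1 \ {k, l} then
        pairSign τ i j * pairSign σ k l * quartK V Φ i j k l else 0 := rfl

/-- The factor `N⁴` counts two entries of `τ` and two of `σ`. -/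
theorem enorm_sum_kMatrix_le (σ τ : MultiIndex N K) {f : Fin K → Fin K → Fin K → Fin K → ℂ} {X : ℝ≥0∞}
    (h : ∀ i j k l, ‖f i j k l‖ₑ ≤ X) :
    ‖(1 / 2 : ℂ) * ∑ i ∈ τ.1, ∑ j ∈ τ.1, ∑ k ∈ σ.1, ∑ l ∈ σ.1, f i j k l‖ₑ ≤ N ^ 4 * X := by
  rw [enorm_mul]
  refine (mul_le_mul' enorm_half_le le_rfl).trans ?_
  rw [one_mul]
  have hσ := σ.2
  have hτ := τ.2
  calc _ ≤ ∑ _i ∈ τ.1, ∑ _j ∈ τ.1, ∑ _k ∈ σ.1, ∑ _l ∈ σ.1, X :=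
        (enorm_sum_le _ _).trans (Finset.sum_le_sum fun i _ => (enorm_sum_le _ _).trans
          (Finset.sum_le_sum fun j _ => (enorm_sum_le _ _).trans (Finset.sum_le_sum fun k _ =>
            (enorm_sum_le _ _).trans (Finset.sum_le_sum fun l _ => h i j k l))))
    _ = _ := by
        simp only [Finset.sum_const, hσ, hτ, nsmul_eq_mul]
        ring

section Estimates

variable {A B M R : ℝ≥0} {C C' : Coeff N K} {Φ Φ' : L2 (Orb K)} {Y : ℝ≥0∞}

/-- Of the four orbitals in a matrix element, the two in the variable `x` are measured in `L^q` and
the two in the variable `y` in `L²`. -/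
theorem quartData_quartK (hE : IsExponents d p p' q q')
    (hV : MemLp (fun x : E3 => V ‖x‖) (.ofReal d) volume)
    (hΦ : MemLp Φ (.ofReal q) volume) (i j k l : Fin K) :
    QuartData V (.ofReal d) (.ofReal q) (fun x => Φ x i) (fun x => conj (Φ x k)) (fun x => Φ x j)
      (fun x => conj (Φ x l)) :=
  ⟨hE.holder, hV, memLp_orb hΦ i, memLp_conj_orb hΦ k, memLp_orb (Lp.memLp Φ) j,
    memLp_conj_orb (Lp.memLp Φ) l⟩

theorem enorm_kMatrix_le (hE : IsExponents d p p' q q')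
    (hV : MemLp (fun x : E3 => V ‖x‖) (.ofReal d) volume)
    (hB : eLpNorm (fun x : E3 => V ‖x‖) (.ofReal d) volume ≤ B)
    (hR : ‖Φ‖ₑ ≤ R) (hΦ : MemLp Φ (.ofReal q) volume) (hY : eLpNorm Φ (.ofReal q) volume ≤ Y)
    (σ τ : MultiIndex N K) : ‖kMatrix V Φ σ τ‖ₑ ≤ N ^ 4 * (B * (Y * Y) * (R * R)) := by
  have hR' : eLpNorm Φ 2 volume ≤ R := (Lp.enorm_def Φ).symm.le.trans hR
  rw [kMatrix_apply]
  refine enorm_sum_kMatrix_le σ τ fun i j k l => ?_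
  split_ifs
  · rw [enorm_mul, enorm_mul, enorm_pairSign, enorm_pairSign, one_mul, one_mul]
    exact enorm_quart_le_of_le (quartData_quartK hE hV hΦ i j k l) hB
      ((eLpNorm_orb_le _ _ _).trans hY) ((eLpNorm_conj_orb_le _ _ _).trans hY)
      ((eLpNorm_orb_le _ _ _).trans hR') ((eLpNorm_conj_orb_le _ _ _).trans hR')
  · rw [enorm_zero]; exact zero_le

theorem enorm_kMatrix_sub_le (hE : IsExponents d p p' q q')
    (hV : MemLp (fun x : E3 => V ‖x‖) (.ofReal d) volume)
    (hB : eLpNorm (fun x : E3 => V ‖x‖) (.ofReal d) volume ≤ B)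
    (hP : PairBound M R q C C' Φ Φ' Y) (σ τ : MultiIndex N K) :
    ‖kMatrix V Φ σ τ - kMatrix V Φ' σ τ‖ₑ ≤ N ^ 4 * (2 * B * (R * R + R) * (Y ^ 2 * ‖Φ - Φ'‖ₑ +
      Y * eLpNorm (Φ - Φ' : L2 (Orb K)) (.ofReal q) volume)) := by
  have hR : eLpNorm Φ 2 volume ≤ R := (Lp.enorm_def Φ).symm.le.trans hP.orb_le
  have hR' : eLpNorm Φ' 2 volume ≤ R := (Lp.enorm_def Φ').symm.le.trans hP.orb_le'
  rw [kMatrix_apply, kMatrix_apply, ← mul_sub]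
  simp_rw [← Finset.sum_sub_distrib]
  refine enorm_sum_kMatrix_le σ τ fun i j k l => ?_
  split_ifs
  · rw [← mul_sub, enorm_mul, enorm_mul, enorm_pairSign, enorm_pairSign, one_mul, one_mul,
      Lp.enorm_def]
    exact enorm_quart_sub_le_of_le' (quartData_quartK hE hV hP.memLp i j k l)
      (quartData_quartK hE hV hP.memLp' i j k l) hB
      ((eLpNorm_orb_le _ _ _).trans hP.orb_q_le')
      ((eLpNorm_conj_orb_le _ _ _).trans hP.orb_q_le) ((eLpNorm_conj_orb_le _ _ _).trans hP.orb_q_le')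
      ((eLpNorm_orb_le _ _ _).trans hR) ((eLpNorm_conj_orb_le _ _ _).trans hR)
      ((eLpNorm_orb_le _ _ _).trans hR') (eLpNorm_orb_sub_le _ _ _ _)
      (eLpNorm_conj_orb_sub_le _ _ _ _)
      (eLpNorm_orb_sub_le _ _ _ _) (eLpNorm_conj_orb_sub_le _ _ _ _)
  · rw [sub_zero, enorm_zero]; exact zero_le

/-- The right-hand side `𝕂[Φ] C` of the coefficient equation. -/
def kForce (V : ℝ → ℝ) (C : Coeff N K) (Φ : L2 (Orb K)) : Coeff N K :=
  Matrix.toEuclideanCLM (𝕜 := ℂ) (kMatrix V Φ) C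

theorem kForce_apply (V : ℝ → ℝ) (C : Coeff N K) (Φ : L2 (Orb K)) (σ : MultiIndex N K) :
    kForce V C Φ σ = ∑ τ, kMatrix V Φ σ τ * C τ := rfl

theorem enorm_kForce_le (hE : IsExponents d p p' q q')
    (hV : MemLp (fun x : E3 => V ‖x‖) (.ofReal d) volume)
    (hB : eLpNorm (fun x : E3 => V ‖x‖) (.ofReal d) volume ≤ B) (hC : ‖C‖ₑ ≤ R)
    (hR : ‖Φ‖ₑ ≤ R) (hΦ : MemLp Φ (.ofReal q) volume) (hY : eLpNorm Φ (.ofReal q) volume ≤ Y) :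
    ‖kForce V C Φ‖ₑ ≤
      ((Fintype.card (MultiIndex N K)) ^ 2 * (N ^ 4 * (B * R * R * R)) : ℝ≥0) * Y ^ 2 := by
  refine (enorm_le_sum_apply _).trans ?_
  calc _ ≤ ∑ _σ : MultiIndex N K, ∑ _τ : MultiIndex N K, N ^ 4 * (B * (Y * Y) * (R * R)) * R := by
        refine Finset.sum_le_sum fun σ _ => ?_
        rw [kForce_apply]
        refine (enorm_sum_le _ _).trans (Finset.sum_le_sum fun τ _ => ?_)
        rw [enorm_mul]
        exact mul_le_mul' (enorm_kMatrix_le hE hV hB hR hΦ hY σ τ) ((enorm_apply_le C τ).trans hC)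
    _ = _ := by
        simp only [Finset.sum_const, Finset.card_univ, nsmul_eq_mul]
        push_cast
        ring

theorem enorm_kForce_sub_le (hE : IsExponents d p p' q q')
    (hV : MemLp (fun x : E3 => V ‖x‖) (.ofReal d) volume)
    (hB : eLpNorm (fun x : E3 => V ‖x‖) (.ofReal d) volume ≤ B)
    (hP : PairBound M R q C C' Φ Φ' Y) :
    ‖kForce V C Φ - kForce V C' Φ'‖ₑ ≤
      ((Fintype.card (MultiIndex N K)) ^ 2 * (N ^ 4 * (2 * B * (R * R + R) * R + B * R * R)) : ℝ≥0) *
      (Y ^ 2 * (‖C - C'‖ₑ + ‖Φ - Φ'‖ₑ) + Y * eLpNorm (Φ - Φ' : L2 (Orb K)) (.ofReal q) volume) := by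
  refine (enorm_le_sum_apply _).trans ?_
  set δ := eLpNorm (Φ - Φ' : L2 (Orb K)) (.ofReal q) volume with hδ
  set δ₂ := ‖Φ - Φ'‖ₑ with hδ₂
  set δC := ‖C - C'‖ₑ with hδC
  calc _ ≤ ∑ _σ : MultiIndex N K, ∑ _τ : MultiIndex N K,
        (N ^ 4 * (2 * B * (R * R + R) * (Y ^ 2 * δ₂ + Y * δ)) * R +
          N ^ 4 * (B * (Y * Y) * (R * R)) * δC) := by
        refine Finset.sum_le_sum fun σ _ => ?_
        rw [PiLp.sub_apply, kForce_apply, kForce_apply, ← Finset.sum_sub_distrib]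
        refine (enorm_sum_le _ _).trans (Finset.sum_le_sum fun τ _ => ?_)
        refine (enorm_mul_sub_mul_le _ _ _ _).trans ?_
        exact add_le_add (mul_le_mul' (enorm_kMatrix_sub_le hE hV hB hP σ τ)
          ((enorm_apply_le C τ).trans hP.coeff_le)) (mul_le_mul'
          (enorm_kMatrix_le hE hV hB hP.orb_le' hP.memLp' hP.orb_q_le' σ τ)
          (enorm_apply_le (C - C') τ))
    _ = (Fintype.card (MultiIndex N K)) ^ 2 * (N ^ 4 * (2 * B * (R * R + R) * (Y ^ 2 * δ₂ + Y * δ)) * R +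
          N ^ 4 * (B * (Y * Y) * (R * R)) * δC) := by
        simp only [Finset.sum_const, Finset.card_univ, nsmul_eq_mul]
        ring
    _ ≤ (Fintype.card (MultiIndex N K)) ^ 2 * (N ^ 4 * (2 * B * (R * R + R) * (Y ^ 2 * δ₂ + Y * δ)) * R +
          N ^ 4 * (B * (Y * Y) * (R * R)) * δC) +
          (Fintype.card (MultiIndex N K)) ^ 2 * (N ^ 4 * (2 * B * (R * R + R) * R) * (Y ^ 2 * δC) +
          N ^ 4 * (B * (R * R)) * (Y ^ 2 * δ₂ + Y * δ)) := le_self_add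
    _ = _ := by push_cast; ring

theorem enorm_linForm_le (hE : IsExponents d p p' q q') (hU : MemLp U (.ofReal d) volume)
    (hV : MemLp (fun x : E3 => V ‖x‖) (.ofReal d) volume) (hA : eLpNorm U (.ofReal d) volume ≤ A)
    (hB : eLpNorm (fun x : E3 => V ‖x‖) (.ofReal d) volume ≤ B)
    (hM : ∀ i t, ‖cubicCoeff C i t‖ₑ ≤ M) (hR : ‖Φ‖ₑ ≤ R)
    (hΦ : MemLp Φ (.ofReal q) volume) (i : Fin K) {h : E3 → ℂ} (hh : MemLp h (.ofReal q) volume) :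
    ‖linForm U V C Φ i h‖ₑ ≤ (A + K ^ 3 * (M * B * (R * R)) : ℝ≥0) *
        eLpNorm Φ (.ofReal q) volume * eLpNorm h (.ofReal q) volume := by
  have hR' : eLpNorm Φ 2 volume ≤ R := (Lp.enorm_def Φ).symm.le.trans hR
  rw [linForm]
  set H := eLpNorm h (.ofReal q) volume
  set Y := eLpNorm Φ (.ofReal q) volume
  calc _ ≤ A * (H * Y) + ∑ _t : Fin K × Fin K × Fin K, M * (B * (H * Y) * (R * R)) := by
        refine (enorm_add_le _ _).trans (add_le_add ?_ ((enorm_sum_le _ _).trans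
          (Finset.sum_le_sum fun t _ => ?_)))
        · refine (enorm_bil_le hE.holder hU.1 hh.1 (memLp_orb hΦ i).1).trans ?_
          gcongr
          exact eLpNorm_orb_le _ _ _
        · rw [enorm_mul]
          exact mul_le_mul' (hM i t) (enorm_quart_le_of_le
            (quartData_orb hE hV (Lp.memLp Φ) hΦ hh t.1 t.2.1 t.2.2) hB le_rfl
            (eLpNorm_orb_le _ _ _) ((eLpNorm_orb_le _ _ _).trans hR')
            ((eLpNorm_conj_orb_le _ _ _).trans hR'))
    _ = _ := by
        rw [Finset.sum_const, Finset.card_univ, card_triple, nsmul_eq_mul]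
        push_cast
        ring

theorem enorm_orbForce_le (hE : IsExponents d p p' q q')
    (hV : MemLp (fun x : E3 => V ‖x‖) (.ofReal d) volume)
    (hB : eLpNorm (fun x : E3 => V ‖x‖) (.ofReal d) volume ≤ B)
    (hM : ∀ i t, ‖cubicCoeff C i t‖ₑ ≤ M) (hR : ‖Φ‖ₑ ≤ R)
    (hΦ : MemLp Φ (.ofReal q) volume) (i : Fin K) :
    ‖orbForce V C Φ i‖ₑ ≤ (K * (K ^ 3 * (M * (B * (R * R))) * R) : ℝ≥0) *
        eLpNorm Φ (.ofReal q) volume ^ 2 := by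
  rw [orbForce]
  calc _ ≤ ∑ _n : Fin K, K ^ 3 * (M * (B * (eLpNorm Φ (.ofReal q) volume *
        eLpNorm Φ (.ofReal q) volume) * (R * R))) * R := by
        refine (enorm_sum_le _ _).trans (Finset.sum_le_sum fun n _ => ?_)
        rw [enorm_smul]
        exact mul_le_mul' (enorm_orbCoeff_le hE hV hB hM ((Lp.enorm_def Φ).symm.le.trans hR) hΦ
          le_rfl i n) ((enorm_comp_le n Φ).trans hR)
    _ = _ := by
        rw [Finset.sum_const, Finset.card_univ, Fintype.card_fin, nsmul_eq_mul]
        push_cast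
        ring

end Estimates

end

/-! ### The density matrix near the admissible coefficients -/

section

variable {N K : ℕ}

/-- Smoothness is taken over the reals, since the density matrices contain complex conjugates of the
coefficients. -/
theorem contDiff_coeff_apply (σ : MultiIndex N K) : ContDiff ℝ 1 fun C : Coeff N K => C σ :=
  ((EuclideanSpace.proj σ : Coeff N K →L[ℂ] ℂ).restrictScalars ℝ).contDiff

theorem contDiff_conj_coeff_apply (σ : MultiIndex N K) :
    ContDiff ℝ 1 fun C : Coeff N K => conj (C σ) :=
  Complex.conjCLE.contDiff.comp (contDiff_coeff_apply σ)

theorem contDiff_densityMatrix (i j : Fin K) :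
    ContDiff ℝ 1 fun C : Coeff N K => densityMatrix C i j := by
  unfold densityMatrix
  simp only [Matrix.of_apply]
  refine ContDiff.sum fun σ _ => ContDiff.sum fun τ _ => ?_
  split_ifs
  · exact (contDiff_const.mul (contDiff_conj_coeff_apply σ)).mul (contDiff_coeff_apply τ)
  · exact contDiff_const

theorem contDiff_gammaCoeff (i j k l : Fin K) :
    ContDiff ℝ 1 fun C : Coeff N K => gammaCoeff C i j k l := by
  unfold gammaCoeff
  split_ifs
  · refine contDiff_const.mul (ContDiff.sum fun σ _ => ContDiff.sum fun τ _ => ?_)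
    split_ifs
    · exact (contDiff_const.mul (contDiff_coeff_apply σ)).mul (contDiff_conj_coeff_apply τ)
    · exact contDiff_const
  · exact contDiff_const

theorem contDiff_det {A : Coeff N K → Matrix (Fin K) (Fin K) ℂ}
    (h : ∀ i j, ContDiff ℝ 1 fun C => A C i j) : ContDiff ℝ 1 fun C => (A C).det := by
  simp_rw [Matrix.det_apply']
  exact ContDiff.sum fun σ _ => contDiff_const.mul (contDiff_prod fun i _ => h _ _)

theorem contDiff_adjugate (i j : Fin K) :
    ContDiff ℝ 1 fun C : Coeff N K => (densityMatrix C).adjugate i j := by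
  simp_rw [Matrix.adjugate_apply]
  refine contDiff_det fun k l => ?_
  simp only [Matrix.updateRow_apply]
  split_ifs
  · exact contDiff_const
  · exact contDiff_densityMatrix k l

/-- Cramer's rule. It shows that the coefficients are measurable everywhere, the inverse of a
vanishing determinant being zero by convention, and continuously differentiable where the
determinant does not vanish. -/
theorem cubicCoeff_eq (C : Coeff N K) (i : Fin K) (t : Fin K × Fin K × Fin K) :
    cubicCoeff C i t = ∑ j, (densityMatrix C).det⁻¹ * (densityMatrix C).adjugate i j *
      (2 * gammaCoeff C t.1 t.2.1 j t.2.2) := by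
  unfold cubicCoeff
  refine Finset.sum_congr rfl fun j _ => ?_
  rw [Matrix.inv_def, Ring.inverse_eq_inv', Matrix.smul_apply, smul_eq_mul]

theorem measurable_cubicCoeff (i : Fin K) (t : Fin K × Fin K × Fin K) :
    Measurable fun C : Coeff N K => cubicCoeff C i t := by
  simp_rw [cubicCoeff_eq]
  refine Finset.measurable_fun_sum _ fun j _ => ?_
  exact ((contDiff_det contDiff_densityMatrix).continuous.measurable.inv.mul
    (contDiff_adjugate i j).continuous.measurable).mul
    ((contDiff_gammaCoeff _ _ _ _).continuous.measurable.const_mul 2)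

theorem contDiffAt_cubicCoeff {C : Coeff N K} (hC : IsUnit (densityMatrix C)) (i : Fin K)
    (t : Fin K × Fin K × Fin K) : ContDiffAt ℝ 1 (fun C : Coeff N K => cubicCoeff C i t) C := by
  simp_rw [cubicCoeff_eq]
  have hd : (densityMatrix C).det ≠ 0 := ((Matrix.isUnit_iff_isUnit_det _).1 hC).ne_zero
  refine ContDiffAt.sum fun j _ => ?_
  exact (((contDiff_det contDiff_densityMatrix).contDiffAt.inv hd).mul
    (contDiff_adjugate i j).contDiffAt).mul
    (contDiff_const.mul (contDiff_gammaCoeff _ _ _ _)).contDiffAt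

theorem isOpen_isUnit_densityMatrix : IsOpen {C : Coeff N K | IsUnit (densityMatrix C)} := by
  have e : {C : Coeff N K | IsUnit (densityMatrix C)} = {C | (densityMatrix C).det ≠ 0} := by
    ext C
    rw [Set.mem_ofPred_eq, Set.mem_ofPred_eq, Matrix.isUnit_iff_isUnit_det, isUnit_iff_ne_zero]
  rw [e]
  exact (contDiff_det contDiff_densityMatrix).continuous.isOpen_preimage _ isOpen_ne

/-- On compact sets of coefficients with invertible density matrix the cubic coefficients are bounded
and Lipschitz continuous. -/
theorem exists_cubicCoeff_bound {E : Set (Coeff N K)} (hE : IsCompact E)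
    (hΩ : ∀ C ∈ E, IsUnit (densityMatrix C)) :
    ∃ M : ℝ≥0, (∀ C ∈ E, ∀ i t, ‖cubicCoeff C i t‖ₑ ≤ M) ∧ ∀ C ∈ E, ∀ C' ∈ E, ∀ i t,
      ‖cubicCoeff C i t - cubicCoeff C' i t‖ₑ ≤ M * ‖C - C'‖ₑ := by
  have h1 : ∀ it : Fin K × Fin K × Fin K × Fin K, ∃ M : ℝ≥0, (∀ C ∈ E, ‖cubicCoeff C it.1 it.2‖ₑ ≤ M) ∧
      ∀ C ∈ E, ∀ C' ∈ E, ‖cubicCoeff C it.1 it.2 - cubicCoeff C' it.1 it.2‖ₑ ≤ M * ‖C - C'‖ₑ := by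
    intro it
    have hl : LocallyLipschitzOn E fun C : Coeff N K => cubicCoeff C it.1 it.2 := by
      intro C hC
      obtain ⟨L, t, ht, hL⟩ := (contDiffAt_cubicCoeff (hΩ C hC) it.1 it.2).exists_lipschitzOnWith
      exact ⟨L, t, mem_nhdsWithin_of_mem_nhds ht, hL⟩
    -- Compactness makes the local Lipschitz bounds uniform, although the set need not be convex.
    obtain ⟨L, hL⟩ := hl.exists_lipschitzOnWith_of_compact hE
    obtain ⟨M, hM⟩ := hE.exists_bound_of_continuousOn hL.continuousOn
    refine ⟨M.toNNReal + L, fun C hC => ?_, fun C hC C' hC' => ?_⟩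
    · rw [← ofReal_norm]
      exact (ENNReal.ofReal_le_ofReal (hM C hC)).trans (ENNReal.coe_le_coe.2 le_self_add)
    · have := hL hC hC'
      rw [edist_eq_enorm_sub, edist_eq_enorm_sub] at this
      exact this.trans (mul_le_mul' (ENNReal.coe_le_coe.2 (le_add_left le_rfl)) le_rfl)
  choose M hM hM' using h1
  have hs : ∀ it, (M it : ℝ≥0∞) ≤ (∑ it, M it : ℝ≥0) := fun it =>
    ENNReal.coe_le_coe.2 (Finset.single_le_sum (fun _ _ => zero_le) (Finset.mem_univ it))
  exact ⟨∑ it, M it, fun C hC i t => (hM (i, t) C hC).trans (hs _), fun C hC C' hC' i t =>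
    (hM' (i, t) C hC C' hC').trans (mul_le_mul' (hs _) le_rfl)⟩

/-- The set of normalized coefficients whose density matrix has an inverse of norm at most `θ`. -/
def coeffSet (N K : ℕ) (θ : ℝ≥0) : Set (Coeff N K) :=
  {C | ‖C‖ = 1 ∧ ∀ v : Orb K, ‖v‖ ≤ θ * ‖Matrix.toEuclideanCLM (𝕜 := ℂ) (densityMatrix C) v‖}

theorem continuous_densityMatrix_apply (v : Orb K) :
    Continuous fun C : Coeff N K => Matrix.toEuclideanCLM (𝕜 := ℂ) (densityMatrix C) v := by
  have e : (fun C : Coeff N K => Matrix.toEuclideanCLM (𝕜 := ℂ) (densityMatrix C) v) =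
      fun C => WithLp.toLp 2 fun i => ∑ j, densityMatrix C i j * v j := rfl
  rw [e]
  refine (PiLp.continuous_toLp 2 (fun _ : Fin K => ℂ)).comp (continuous_pi fun i => ?_)
  exact continuous_finsetSum _ fun j _ =>
    (contDiff_densityMatrix i j).continuous.mul continuous_const

/-- The lower bound on the density matrix, imposed for each vector separately, is a closed condition
on the coefficients. A bound on the norm of the inverse would not exclude singular matrices, whose
inverse is zero by convention. -/
theorem isCompact_coeffSet (N K : ℕ) (θ : ℝ≥0) : IsCompact (coeffSet N K θ) := by
  refine Metric.isCompact_of_isClosed_isBounded ?_ ?_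
  · have e : coeffSet N K θ = {C | ‖C‖ = 1} ∩ ⋂ v : Orb K,
        {C | ‖v‖ ≤ θ * ‖Matrix.toEuclideanCLM (𝕜 := ℂ) (densityMatrix C) v‖} := by
      ext C
      simp [coeffSet]
    rw [e]
    refine (isClosed_eq continuous_norm continuous_const).inter ?_
    exact isClosed_iInter fun v => isClosed_le continuous_const
      (continuous_const.mul (continuous_densityMatrix_apply v).norm)
  · refine (Metric.isBounded_closedBall (x := 0) (r := 1)).subset fun C hC => ?_
    rw [mem_closedBall_zero_iff, hC.1]

theorem isUnit_of_mem_coeffSet {θ : ℝ≥0} {C : Coeff N K} (hC : C ∈ coeffSet N K θ) :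
    IsUnit (densityMatrix C) := by
  rw [← Matrix.mulVec_injective_iff_isUnit]
  intro v w hvw
  have h1 := hC.2 (WithLp.toLp 2 (v - w))
  rw [Matrix.toEuclideanCLM_toLp, Matrix.mulVec_sub] at h1
  have hvw' : (densityMatrix C).mulVec v = (densityMatrix C).mulVec w := hvw
  rw [hvw', sub_self, WithLp.toLp_zero, norm_zero, mul_zero, norm_le_zero_iff] at h1
  have h2 : v - w = 0 := by
    have := congrArg WithLp.ofLp h1
    simpa using this
  exact sub_eq_zero.1 h2

/-- The number `δ` becomes the radius within which the coefficients may move; it depends only on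
`N`, `K` and `θ`. -/
theorem exists_thickening (N K : ℕ) (θ : ℝ≥0) : ∃ δ : ℝ, 0 < δ ∧
    ∀ C ∈ Metric.cthickening δ (coeffSet N K θ), IsUnit (densityMatrix C) := by
  obtain ⟨δ, hδ, h⟩ := (isCompact_coeffSet N K θ).exists_cthickening_subset_open
    isOpen_isUnit_densityMatrix fun C hC => isUnit_of_mem_coeffSet hC
  exact ⟨δ, hδ, h⟩

theorem norm_eq_one_of_isRegularData {C : Coeff N K} {Φ : L2 (Orb K)} (h : IsRegularData C Φ) :
    ‖C‖ = 1 := by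
  rw [EuclideanSpace.norm_eq, h.normalized, Real.sqrt_one]

theorem enorm_comp_eq_one_of_isRegularData {C : Coeff N K} {Φ : L2 (Orb K)} (h : IsRegularData C Φ)
    (i : Fin K) : ‖comp i Φ‖ₑ = 1 := by
  have h1 := h.orthonormal i i
  rw [if_pos rfl] at h1
  have h2 : inner ℂ (comp i Φ) (comp i Φ) = (1 : ℂ) := by
    rw [L2.inner_def, ← h1]
    refine integral_congr_ae ?_
    filter_upwards [coeFn_comp i Φ] with x hx
    rw [hx, RCLike.inner_apply]
  rw [inner_self_eq_norm_sq_to_K] at h2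
  have h3 : ‖comp i Φ‖ ^ 2 = 1 := by
    have h5 : (((‖comp i Φ‖ ^ 2 : ℝ)) : ℂ) = ((1 : ℝ) : ℂ) := by
      push_cast
      exact h2
    exact Complex.ofReal_injective h5
  have h4 : ‖comp i Φ‖ = 1 := (pow_eq_one_iff_of_nonneg (norm_nonneg _) two_ne_zero).1 h3
  rw [← ofReal_norm, h4, ENNReal.ofReal_one]

theorem enorm_sq_of_isRegularData {C : Coeff N K} {Φ : L2 (Orb K)} (h : IsRegularData C Φ) :
    ‖Φ‖ₑ ^ 2 = K := by
  rw [enorm_sq_eq_sum_comp]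
  simp_rw [enorm_comp_eq_one_of_isRegularData h]
  simp

/-- Full rank is essential: for a singular matrix the inverse is zero by convention and the bound by
`θ` would say nothing. -/
theorem mem_coeffSet {C : Coeff N K} {Φ : L2 (Orb K)} (h : IsRegularData C Φ) {θ : ℝ≥0}
    (hθ : ‖Matrix.toEuclideanCLM (𝕜 := ℂ) (densityMatrix C)⁻¹‖ ≤ θ) : C ∈ coeffSet N K θ := by
  refine ⟨norm_eq_one_of_isRegularData h, fun v => ?_⟩
  have hu : IsUnit (densityMatrix C) := by
    rw [← Matrix.mulVec_surjective_iff_isUnit]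
    have h2 : LinearMap.range (densityMatrix C).mulVecLin = ⊤ :=
      Submodule.eq_top_of_finrank_eq (by
        have := h.full_rank
        rw [Matrix.rank] at this
        rw [this, Module.finrank_fin_fun])
    exact LinearMap.range_eq_top.1 h2
  have h1 : v = Matrix.toEuclideanCLM (𝕜 := ℂ) (densityMatrix C)⁻¹
      (Matrix.toEuclideanCLM (𝕜 := ℂ) (densityMatrix C) v) := by
    rw [← mul_apply_eq_comp, ← map_mul, Matrix.nonsing_inv_mul _
      ((Matrix.isUnit_iff_isUnit_det _).1 hu), map_one, one_apply_eq_self]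
  calc ‖v‖ = ‖Matrix.toEuclideanCLM (𝕜 := ℂ) (densityMatrix C)⁻¹
          (Matrix.toEuclideanCLM (𝕜 := ℂ) (densityMatrix C) v)‖ := by rw [← h1]
    _ ≤ _ := (ContinuousLinearMap.le_opNorm _ _).trans (by gcongr)

end

/-! ### Measurability along curves and the force of a bounded curve -/

section

variable {N K : ℕ} {d p p' q q' T : ℝ} {V : ℝ → ℝ} {U : E3 → ℝ}

theorem integral_mul_forcing_eq (hE : IsExponents d p p' q q') (hU : MemLp U (.ofReal d) volume)
    (hV : MemLp (fun x : E3 => V ‖x‖) (.ofReal d) volume) {Φ : L2 (Orb K)}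
    (hΦ : MemLp Φ (.ofReal q) volume) (C : Coeff N K) (i : Fin K) {h : L2 ℂ}
    (hh : eLpNorm h (.ofReal q) volume ≠ ∞) :
    Integrable (fun x => h x * forcing U V C Φ x i) volume ∧
      ∫ x, h x * forcing U V C Φ x i = linForm U V C Φ i h + pairing h (orbForce V C Φ i) := by
  obtain ⟨h1, h2⟩ := integral_mul_forcing hE hU hV (Lp.memLp Φ) hΦ C i (Lp.memLp h)
    ⟨Lp.aestronglyMeasurable h, hh.lt_top⟩
  refine ⟨h1, h2.trans ?_⟩
  congr 1
  rw [orbForce, ← pairingCLM_apply, map_sum]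
  refine Finset.sum_congr rfl fun n _ => ?_
  rw [map_smul, pairingCLM_apply, smul_eq_mul, pairing]
  congr 1
  refine integral_congr_ae ?_
  filter_upwards [coeFn_comp n Φ] with x hx
  rw [hx]

section Measurability

variable {μ : Measure ℝ} {C : ℝ → Coeff N K} {Φ : ℝ → L2 (Orb K)}

theorem aestronglyMeasurable_comp_time (hΦ : AEStronglyMeasurable Φ μ) (i : Fin K) :
    AEStronglyMeasurable (fun s => comp i (Φ s)) μ :=
  (comp i).continuous.comp_aestronglyMeasurable hΦ

theorem continuous_star_L2 : Continuous (fun f : L2 ℂ => star f) := by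
  refine LipschitzWith.continuous (K := 1) (LipschitzWith.of_dist_le_mul fun f g => ?_)
  have h1 : star f - star g = star (f - g) := by
    refine Lp.ext ?_
    filter_upwards [Lp.coeFn_sub (star f) (star g), Lp.coeFn_star f, Lp.coeFn_star g,
      Lp.coeFn_star (f - g), Lp.coeFn_sub f g] with x h1 h2 h3 h4 h5
    rw [h1, h4, Pi.sub_apply, h2, h3, Pi.star_apply, Pi.star_apply, Pi.star_apply, h5,
      Pi.sub_apply, star_sub]
  rw [dist_eq_norm, dist_eq_norm, h1, norm_star_L2, NNReal.coe_one, one_mul]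

theorem aestronglyMeasurable_star_comp (hΦ : AEStronglyMeasurable Φ μ) (i : Fin K) :
    AEStronglyMeasurable (fun s => star (comp i (Φ s))) μ :=
  continuous_star_L2.comp_aestronglyMeasurable (aestronglyMeasurable_comp_time hΦ i)

theorem coeFn_star_comp (i : Fin K) (Φ : L2 (Orb K)) :
    (star (comp i Φ) : L2 ℂ) =ᵐ[volume] fun x => conj (Φ x i) := by
  filter_upwards [Lp.coeFn_star (comp i Φ), coeFn_comp i Φ] with x h1 h2
  rw [h1, Pi.star_apply, h2]
  rfl

theorem aestronglyMeasurable_cubicCoeff (hC : AEStronglyMeasurable C μ) (i : Fin K)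
    (t : Fin K × Fin K × Fin K) : AEStronglyMeasurable (fun s => cubicCoeff (C s) i t) μ :=
  ((measurable_cubicCoeff i t).comp_aemeasurable hC.aemeasurable).aestronglyMeasurable

/-- The pointwise components are replaced by the curves `comp i (Φ s)` in `L²` and their conjugates,
for which measurability of the forms is known. -/
theorem aestronglyMeasurable_linForm (hE : IsExponents d p p' q q')
    (hU : MemLp U (.ofReal d) volume) (hV : MemLp (fun x : E3 => V ‖x‖) (.ofReal d) volume)
    (hC : AEStronglyMeasurable C μ) (hΦ : AEStronglyMeasurable Φ μ)
    (hq : ∀ᵐ s ∂μ, MemLp (Φ s) (.ofReal q) volume) {G : ℝ → L2 ℂ} (hG : AEStronglyMeasurable G μ)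
    (hGq : ∀ᵐ s ∂μ, MemLp (G s) (.ofReal q) volume) (i : Fin K) :
    AEStronglyMeasurable (fun s => linForm U V (C s) (Φ s) i (G s)) μ := by
  have e : (fun s => linForm U V (C s) (Φ s) i (G s)) = fun s => bil U (G s) (comp i (Φ s)) +
      ∑ t, cubicCoeff (C s) i t * quart V (G s) (comp t.1 (Φ s)) (comp t.2.1 (Φ s))
        (star (comp t.2.2 (Φ s)) : L2 ℂ) := by
    funext s
    rw [linForm, bil_congr_ae (ae_eq_refl _) (coeFn_comp i (Φ s))]
    congr 1
    refine Finset.sum_congr rfl fun t _ => ?_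
    rw [quart_congr_ae (ae_eq_refl _) (coeFn_comp t.1 (Φ s)) (coeFn_comp t.2.1 (Φ s))
      (coeFn_star_comp t.2.2 (Φ s))]
  rw [e]
  refine (aestronglyMeasurable_bil_time hG (aestronglyMeasurable_comp_time hΦ i) hE.holder hU
    ?_).add (Finset.aestronglyMeasurable_fun_sum _ fun t _ =>
      (aestronglyMeasurable_cubicCoeff hC i t).mul (aestronglyMeasurable_quart_time hG
        (aestronglyMeasurable_comp_time hΦ _) (aestronglyMeasurable_comp_time hΦ _)
        (aestronglyMeasurable_star_comp hΦ _) (D := .ofReal d) (r := .ofReal q) ?_ hV.1))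
  · filter_upwards [hq, hGq] with s h1 h2
    exact ⟨h2, (memLp_congr_ae (coeFn_comp i (Φ s))).2 (memLp_orb h1 i)⟩
  · filter_upwards [hq, hGq] with s h1 h2
    exact ⟨hE.holder, hV, h2, (memLp_congr_ae (coeFn_comp _ (Φ s))).2 (memLp_orb h1 _),
      Lp.memLp _, Lp.memLp _⟩

theorem aestronglyMeasurable_orbCoeff (hE : IsExponents d p p' q q')
    (hV : MemLp (fun x : E3 => V ‖x‖) (.ofReal d) volume)
    (hC : AEStronglyMeasurable C μ) (hΦ : AEStronglyMeasurable Φ μ)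
    (hq : ∀ᵐ s ∂μ, MemLp (Φ s) (.ofReal q) volume) (i n : Fin K) :
    AEStronglyMeasurable (fun s => orbCoeff V (C s) (Φ s) i n) μ := by
  have e : (fun s => orbCoeff V (C s) (Φ s) i n) = fun s =>
      -∑ t, cubicCoeff (C s) i t * quart V (star (comp n (Φ s)) : L2 ℂ) (comp t.1 (Φ s))
        (comp t.2.1 (Φ s)) (star (comp t.2.2 (Φ s)) : L2 ℂ) := by
    funext s
    rw [orbCoeff]
    congr 1
    refine Finset.sum_congr rfl fun t _ => ?_
    rw [quartOrb, quart_congr_ae (coeFn_star_comp n (Φ s)) (coeFn_comp t.1 (Φ s))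
      (coeFn_comp t.2.1 (Φ s)) (coeFn_star_comp t.2.2 (Φ s))]
  rw [e]
  refine (Finset.aestronglyMeasurable_fun_sum _ fun t _ =>
      (aestronglyMeasurable_cubicCoeff hC i t).mul (aestronglyMeasurable_quart_time
        (aestronglyMeasurable_star_comp hΦ _)
        (aestronglyMeasurable_comp_time hΦ _) (aestronglyMeasurable_comp_time hΦ _)
        (aestronglyMeasurable_star_comp hΦ _) (D := .ofReal d) (r := .ofReal q) ?_ hV.1)).neg
  filter_upwards [hq] with s h1
  exact ⟨hE.holder, hV, (memLp_congr_ae (coeFn_star_comp _ (Φ s))).2 (memLp_conj_orb h1 _),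
    (memLp_congr_ae (coeFn_comp _ (Φ s))).2 (memLp_orb h1 _), Lp.memLp _, Lp.memLp _⟩

theorem aestronglyMeasurable_orbForce (hE : IsExponents d p p' q q')
    (hV : MemLp (fun x : E3 => V ‖x‖) (.ofReal d) volume)
    (hC : AEStronglyMeasurable C μ) (hΦ : AEStronglyMeasurable Φ μ)
    (hq : ∀ᵐ s ∂μ, MemLp (Φ s) (.ofReal q) volume) (i : Fin K) :
    AEStronglyMeasurable (fun s => orbForce V (C s) (Φ s) i) μ := by
  unfold orbForce
  exact Finset.aestronglyMeasurable_fun_sum _ fun n _ =>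
    (aestronglyMeasurable_orbCoeff hE hV hC hΦ hq i n).smul (aestronglyMeasurable_comp_time hΦ n)

theorem aestronglyMeasurable_kForce (hE : IsExponents d p p' q q')
    (hV : MemLp (fun x : E3 => V ‖x‖) (.ofReal d) volume)
    (hC : AEStronglyMeasurable C μ) (hΦ : AEStronglyMeasurable Φ μ)
    (hq : ∀ᵐ s ∂μ, MemLp (Φ s) (.ofReal q) volume) :
    AEStronglyMeasurable (fun s => kForce V (C s) (Φ s)) μ := by
  have hQ : ∀ i j k l, AEStronglyMeasurable (fun s => quartK V (Φ s) i j k l) μ := by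
    intro i j k l
    have e : (fun s => quartK V (Φ s) i j k l) = fun s => quart V (comp i (Φ s))
        (star (comp k (Φ s)) : L2 ℂ) (comp j (Φ s)) (star (comp l (Φ s)) : L2 ℂ) := by
      funext s
      rw [quartK, quart_congr_ae (coeFn_comp i (Φ s)) (coeFn_star_comp k (Φ s))
        (coeFn_comp j (Φ s)) (coeFn_star_comp l (Φ s))]
    rw [e]
    refine aestronglyMeasurable_quart_time (aestronglyMeasurable_comp_time hΦ _)
      (aestronglyMeasurable_star_comp hΦ _) (aestronglyMeasurable_comp_time hΦ _)
        (aestronglyMeasurable_star_comp hΦ _) (D := .ofReal d) (r := .ofReal q) ?_ hV.1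
    filter_upwards [hq] with s h1
    exact ⟨hE.holder, hV, (memLp_congr_ae (coeFn_comp _ (Φ s))).2 (memLp_orb h1 _),
      (memLp_congr_ae (coeFn_star_comp _ (Φ s))).2 (memLp_conj_orb h1 _), Lp.memLp _, Lp.memLp _⟩
  have hM : ∀ σ τ : MultiIndex N K, AEStronglyMeasurable (fun s => kMatrix V (Φ s) σ τ) μ := by
    intro σ τ
    simp_rw [kMatrix_apply]
    refine aestronglyMeasurable_const.mul (Finset.aestronglyMeasurable_fun_sum _ fun i _ =>
      Finset.aestronglyMeasurable_fun_sum _ fun j _ => Finset.aestronglyMeasurable_fun_sum _ fun k _ =>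
        Finset.aestronglyMeasurable_fun_sum _ fun l _ => ?_)
    split_ifs
    · exact (hQ i j k l).const_mul _
    · exact aestronglyMeasurable_const
  have e : (fun s => kForce V (C s) (Φ s)) = fun s =>
      WithLp.toLp 2 fun σ => ∑ τ, kMatrix V (Φ s) σ τ * C s τ := rfl
  rw [e]
  refine (PiLp.continuous_toLp 2 (fun _ : MultiIndex N K => ℂ)).comp_aestronglyMeasurable ?_
  refine (aemeasurable_pi_iff.2 fun σ => AEStronglyMeasurable.aemeasurable
    (Finset.aestronglyMeasurable_fun_sum _ fun τ _ => ?_)).aestronglyMeasurable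
  exact (hM σ τ).mul
    ((PiLp.continuous_apply 2 (fun _ : MultiIndex N K => ℂ) τ).comp_aestronglyMeasurable hC)

end Measurability

/-- Measurable curves of coefficients and orbitals on `[0, T]` with uniform bounds. -/
structure CurveBound (M R : ℝ≥0) (p q T : ℝ) (C : ℝ → Coeff N K) (Φ : ℝ → L2 (Orb K)) : Prop where
  coeff_meas : AEStronglyMeasurable C (timeMeasure T)
  orb_meas : AEStronglyMeasurable Φ (timeMeasure T)
  cubic_le : ∀ᵐ s ∂(timeMeasure T), ∀ i t, ‖cubicCoeff (C s) i t‖ₑ ≤ M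
  coeff_le : ∀ᵐ s ∂(timeMeasure T), ‖C s‖ₑ ≤ R
  orb_le : ∀ᵐ s ∂(timeMeasure T), ‖Φ s‖ₑ ≤ R
  mixed_ne_top : mixedNorm (.ofReal p) (.ofReal q) T Φ ≠ ∞

variable {M R : ℝ≥0} {C : ℝ → Coeff N K} {Φ : ℝ → L2 (Orb K)}

theorem CurveBound.ae_memLp (h : CurveBound M R p q T C Φ) (hp : 0 < p) :
    ∀ᵐ s ∂(timeMeasure T), MemLp (Φ s) (.ofReal q) volume := by
  have h1 := h.mixed_ne_top
  rw [mixedNorm_eq_lintegral hp] at h1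
  have h2 : ∫⁻ t, eLpNorm (Φ t) (.ofReal q) volume ^ p ∂(timeMeasure T) ≠ ∞ := by
    intro h3
    rw [h3, ENNReal.top_rpow_of_pos (by positivity)] at h1
    exact h1 rfl
  filter_upwards [ae_lt_top' ((aemeasurable_eLpNorm _ h.orb_meas).pow_const p) h2] with s hs
  refine ⟨Lp.aestronglyMeasurable _, lt_top_iff_ne_top.2 fun h3 => ?_⟩
  rw [h3, ENNReal.top_rpow_of_pos hp] at hs
  exact lt_irrefl _ hs

/-- Hölder's inequality in time for products of two functions. -/
theorem lintegral_mul_time_le (hE : IsExponents d p p' q q') {t₀ t₁ : ℝ} (ht : t₀ ≤ t₁)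
    {a b : ℝ → ℝ≥0∞} (ha : AEMeasurable a (volume.restrict (Set.Ioc t₀ t₁)))
    (hb : AEMeasurable b (volume.restrict (Set.Ioc t₀ t₁))) :
    ∫⁻ s in Set.Ioc t₀ t₁, a s * b s ≤ .ofReal ((t₁ - t₀) ^ (1 - 2 / p)) *
      ((∫⁻ s in Set.Ioc t₀ t₁, a s ^ p) ^ (1 / p) * (∫⁻ s in Set.Ioc t₀ t₁, b s ^ p) ^ (1 / p)) := by
  refine (ENNReal.lintegral_mul_le_Lp_mul_Lq _ hE.conj_p.symm ha hb).trans ?_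
  rw [← mul_assoc]
  gcongr
  exact lintegral_rpow_conj_le hE ht ha

theorem lintegral_Ioc_le_mixedNorm {F : Type} [NormedAddCommGroup F] (hp : 0 < p) {t₀ t₁ : ℝ}
    (ht₀ : 0 ≤ t₀) (ht₁ : t₁ ≤ T) (u : ℝ → L2 F) :
    (∫⁻ s in Set.Ioc t₀ t₁, eLpNorm (u s) (.ofReal q) volume ^ p) ^ (1 / p) ≤
      mixedNorm (.ofReal p) (.ofReal q) T u := by
  rw [mixedNorm_eq_lintegral hp]
  refine ENNReal.rpow_le_rpow (lintegral_mono_set fun s hs => ?_) (by positivity)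
  exact ⟨ht₀.trans hs.1.le, hs.2.trans ht₁⟩

theorem restrict_Icc_eq_Ioc (T : ℝ) : timeMeasure T = volume.restrict (Set.Ioc 0 T) :=
  (restrict_Ioc_eq_restrict_Icc).symm

/-- On a bounded interval `L^p` is contained in `L²` because `p > 2`. This makes the terms quadratic
in the `L^q` norm integrable in time. -/
theorem CurveBound.lintegral_sq_ne_top (h : CurveBound M R p q T C Φ) (hE : IsExponents d p p' q q')
    (hT : 0 < T) : ∫⁻ s, eLpNorm (Φ s) (.ofReal q) volume ^ 2 ∂(timeMeasure T) ≠ ∞ := by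
  have hm : AEMeasurable (fun s => eLpNorm (Φ s) (.ofReal q) volume)
      (volume.restrict (Set.Ioc 0 T)) := by
    rw [← restrict_Icc_eq_Ioc]; exact aemeasurable_eLpNorm _ h.orb_meas
  rw [restrict_Icc_eq_Ioc]
  simp_rw [pow_two]
  have hb := lintegral_Ioc_le_mixedNorm (q := q) hE.p_pos le_rfl (le_refl T) Φ
  have hn := ne_top_of_le_ne_top h.mixed_ne_top hb
  exact ne_top_of_le_ne_top (ENNReal.mul_ne_top ENNReal.ofReal_ne_top (ENNReal.mul_ne_top hn hn))
    (lintegral_mul_time_le hE hT.le hm hm)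

/-- The components of the force along a bounded curve. -/
theorem CurveBound.isForce (h : CurveBound M R p q T C Φ) (hE : IsExponents d p p' q q') (hT : 0 < T)
    (hU : MemLp U (.ofReal d) volume) (hV : MemLp (fun x : E3 => V ‖x‖) (.ofReal d) volume)
    (i : Fin K) : ∃ a b, IsForce p' q T (fun s x => forcing U V (C s) (Φ s) x i) a b := by
  set A := (eLpNorm U (.ofReal d) volume).toNNReal
  set B := (eLpNorm (fun x : E3 => V ‖x‖) (.ofReal d) volume).toNNReal
  have hA : eLpNorm U (.ofReal d) volume ≤ A := (ENNReal.coe_toNNReal hU.2.ne).symm.le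
  have hB : eLpNorm (fun x : E3 => V ‖x‖) (.ofReal d) volume ≤ B :=
    (ENNReal.coe_toNNReal hV.2.ne).symm.le
  set κ₁ : ℝ≥0 := A + K ^ 3 * (M * B * (R * R))
  set κ₂ : ℝ≥0 := K * (K ^ 3 * (M * (B * (R * R))) * R)
  have hq := h.ae_memLp hE.p_pos
  have hm : AEMeasurable (fun s => eLpNorm (Φ s) (.ofReal q) volume) (timeMeasure T) :=
    aemeasurable_eLpNorm _ h.orb_meas
  have hp'0 := hE.p'_pos
  -- The part tested in `L^q` has the size of the `L^q` norm of the orbitals and the projected part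
  -- the size of its square; they are in `L^{p'}` and `L¹` in time because `p' < 2 < p`.
  refine ⟨fun s => κ₁ * eLpNorm (Φ s) (.ofReal q) volume,
    fun s => κ₂ * eLpNorm (Φ s) (.ofReal q) volume ^ 2, ⟨?_, ?_, ?_, ?_, ?_, ?_, ?_⟩⟩
  · filter_upwards [hq] with s hs g hg
    exact (integral_mul_forcing_eq hE hU hV hs (C s) i hg).1
  · filter_upwards [hq, h.cubic_le, h.orb_le] with s hs hM hR g hg
    rw [(integral_mul_forcing_eq hE hU hV hs (C s) i hg).2]
    refine (enorm_add_le _ _).trans (add_le_add ?_ ?_)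
    · exact enorm_linForm_le hE hU hV hA hB hM hR hs i ⟨Lp.aestronglyMeasurable _, hg.lt_top⟩
    · have h1 := norm_pairing_le g (orbForce V (C s) (Φ s) i)
      have h2 : ‖pairing g (orbForce V (C s) (Φ s) i)‖ₑ ≤
          ‖g‖ₑ * ‖orbForce V (C s) (Φ s) i‖ₑ := by
        rw [← ofReal_norm, ← ofReal_norm, ← ofReal_norm, ← ENNReal.ofReal_mul (norm_nonneg _)]
        exact ENNReal.ofReal_le_ofReal h1
      rw [mul_comm] at h2
      exact h2.trans (mul_le_mul' (enorm_orbForce_le hE hV hB hM hR hs i) le_rfl)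
  · intro G hG hGq
    have e : (fun s => linForm U V (C s) (Φ s) i (G s) + pairing (G s) (orbForce V (C s) (Φ s) i))
        =ᵐ[timeMeasure T] fun s => ∫ x, G s x * forcing U V (C s) (Φ s) x i := by
      filter_upwards [hq, hGq] with s hs hg
      exact (integral_mul_forcing_eq hE hU hV hs (C s) i hg).2.symm
    refine AEStronglyMeasurable.congr ?_ e
    refine (aestronglyMeasurable_linForm hE hU hV h.coeff_meas h.orb_meas hq
      hG.aestronglyMeasurable ?_ i).add ?_
    · filter_upwards [hGq] with s hs
      exact ⟨Lp.aestronglyMeasurable _, hs.lt_top⟩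
    · exact aestronglyMeasurable_comp₂ continuous_pairing hG.aestronglyMeasurable
        (aestronglyMeasurable_orbForce hE hV h.coeff_meas h.orb_meas hq i)
  · exact hm.const_mul _
  · exact (hm.pow_const 2).const_mul _
  · simp_rw [ENNReal.mul_rpow_of_nonneg _ _ hp'0.le]
    rw [lintegral_const_mul'' _ (hm.pow_const p')]
    refine ENNReal.mul_ne_top (ENNReal.rpow_ne_top_of_nonneg hp'0.le ENNReal.coe_ne_top) ?_
    have h1 := lintegral_rpow_conj_le hE hT.le (restrict_Icc_eq_Ioc T ▸ hm)
    have h2 := ne_top_of_le_ne_top (ENNReal.mul_ne_top ENNReal.ofReal_ne_top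
      (ne_top_of_le_ne_top h.mixed_ne_top
        (lintegral_Ioc_le_mixedNorm (q := q) hE.p_pos le_rfl (le_refl T) Φ))) h1
    rw [← restrict_Icc_eq_Ioc] at h2
    intro h3
    rw [h3, ENNReal.top_rpow_of_pos (by positivity)] at h2
    exact h2 rfl
  · rw [lintegral_const_mul'' _ (hm.pow_const 2)]
    exact ENNReal.mul_ne_top ENNReal.coe_ne_top (h.lintegral_sq_ne_top hE hT)

theorem CurveBound.integrable_kForce (h : CurveBound M R p q T C Φ) (hE : IsExponents d p p' q q')
    (hT : 0 < T) (hV : MemLp (fun x : E3 => V ‖x‖) (.ofReal d) volume) :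
    Integrable (fun s => kForce V (C s) (Φ s)) (timeMeasure T) := by
  set B := (eLpNorm (fun x : E3 => V ‖x‖) (.ofReal d) volume).toNNReal
  have hB : eLpNorm (fun x : E3 => V ‖x‖) (.ofReal d) volume ≤ B :=
    (ENNReal.coe_toNNReal hV.2.ne).symm.le
  have hq := h.ae_memLp hE.p_pos
  have hm : AEMeasurable (fun s => eLpNorm (Φ s) (.ofReal q) volume) (timeMeasure T) :=
    aemeasurable_eLpNorm _ h.orb_meas
  refine ⟨aestronglyMeasurable_kForce hE hV h.coeff_meas h.orb_meas hq, ?_⟩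
  refine (lintegral_mono_ae (g := fun s => ((Fintype.card (MultiIndex N K)) ^ 2 *
    (N ^ 4 * (B * R * R * R)) : ℝ≥0) * eLpNorm (Φ s) (.ofReal q) volume ^ 2) ?_).trans_lt ?_
  · filter_upwards [hq, h.coeff_le, h.orb_le] with s hs hC hR
    exact enorm_kForce_le hE hV hB hC hR hs le_rfl
  · rw [lintegral_const_mul'' _ (hm.pow_const 2)]
    exact ENNReal.mul_lt_top ENNReal.coe_lt_top (h.lintegral_sq_ne_top hE hT).lt_top

end

/-! ### Duhamel integrals by components, and norms in time -/

section

variable {N K : ℕ} {d p p' q q' T : ℝ} {V : ℝ → ℝ} {U : E3 → ℝ}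

theorem integrable_orb {α : Type*} [MeasurableSpace α] {μ : Measure α} {f : α → Orb K}
    (h : ∀ i, Integrable (fun x => f x i) μ) : Integrable f μ := by
  have e : f = fun x => ∑ i, f x i • (EuclideanSpace.single i (1 : ℂ) : Orb K) := by
    funext x
    ext j
    simp [Pi.single_apply]
  rw [e]
  exact integrable_finsetSum _ fun i _ => (h i).smul_const _

theorem integral_orb_apply {α : Type*} [MeasurableSpace α] {μ : Measure α} {f : α → Orb K}
    (h : Integrable f μ) (i : Fin K) : (∫ x, f x ∂μ) i = ∫ x, f x i ∂μ :=
  ((EuclideanSpace.proj i : Orb K →L[ℂ] ℂ).integral_comp_comm h).symm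

theorem integrable_schwartz_smul (g : 𝓢(E3, ℂ)) (u : L2 (Orb K)) :
    Integrable (fun x => g x • u x) volume := by
  refine integrable_orb fun i => ?_
  simp only [PiLp.smul_apply, smul_eq_mul]
  exact (g.memLp 2 volume).integrable_mul (memLp_orb (Lp.memLp u) i)

theorem pairing_toLp_comp (g : 𝓢(E3, ℂ)) (u : L2 (Orb K)) (i : Fin K) :
    pairing (g.toLp 2) (comp i u) = (∫ x, g x • u x) i := by
  rw [integral_orb_apply (integrable_schwartz_smul g u), pairing_toLp]
  refine integral_congr_ae ?_
  filter_upwards [coeFn_comp i u] with x hx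
  rw [hx, PiLp.smul_apply, smul_eq_mul]

theorem integral_freeFlowSchwartz_mul (t : ℝ) (g : 𝓢(E3, ℂ)) (f : E3 → ℂ) :
    ∫ x, freeFlow t (g.toLp 2 : L2 ℂ) x * f x = ∫ x, freeFlowSchwartz t g x * f x := by
  refine integral_congr_ae ?_
  filter_upwards [coeFn_freeFlow_toLp t g] with x hx
  rw [hx]

/-- The components of a Duhamel integral. -/
theorem IsDuhamelIntegral.pairing_comp {F : ℝ → E3 → Orb K} {t : ℝ} (ht : 0 ≤ t) {u : L2 (Orb K)}
    (h : IsDuhamelIntegral F t u) (g : 𝓢(E3, ℂ)) (i : Fin K) :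
    pairing (g.toLp 2) (comp i u) =
      ∫ s in (0 : ℝ)..t, ∫ x, freeFlow (t - s) (g.toLp 2 : L2 ℂ) x * F s x i := by
  obtain ⟨h1, h2, h3⟩ := h g
  rw [pairing_toLp_comp, h3]
  refine ((EuclideanSpace.proj i : Orb K →L[ℂ] ℂ).intervalIntegral_comp_comm h2).symm.trans ?_
  refine intervalIntegral.integral_congr_ae_restrict ?_
  rw [Set.uIoc_of_le ht, restrict_Ioc_eq_restrict_Icc]
  filter_upwards [h1] with s hs
  rw [integral_freeFlowSchwartz_mul]
  exact integral_orb_apply hs i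

/-- Integrability in space and in time can be checked by components, and on Schwartz data the flow
on `L²` agrees with the flow on Schwartz functions; the scalar theory thus gives the vector-valued
identity. -/
theorem isDuhamelIntegral_of_comp {F : ℝ → E3 → Orb K} (hE : IsExponents d p p' q q') (hT : 0 < T)
    (hF : ∀ i, ∃ a b, IsForce p' q T (fun s x => F s x i) a b) {t : ℝ} (ht : t ∈ Set.Icc 0 T)
    {u : L2 (Orb K)} (hu : ∀ i (g : L2 ℂ), pairing g (comp i u) =
      ∫ s in (0 : ℝ)..t, ∫ x, freeFlow (t - s) g x * F s x i) : IsDuhamelIntegral F t u := by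
  intro g
  choose a b hF using hF
  have h0 : (0 : ℝ) ∈ Set.Icc 0 T := ⟨le_rfl, hT.le⟩
  have hsub : volume.restrict (Set.Icc 0 t) ≤ timeMeasure T :=
    Measure.restrict_mono_set _ (Set.Icc_subset_Icc_right ht.2)
  have h1 : ∀ᵐ s ∂(volume.restrict (Set.Icc 0 t)),
      Integrable (fun x => freeFlowSchwartz (t - s) g x • F s x) volume := by
    filter_upwards [ae_mono hsub (ae_all_iff.2 fun i => (hF i).integrable),
      ae_mono hsub (ae_eLpNorm_freeFlow_sub_ne_top hE hT t (g.toLp 2))] with s hs hs'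
    refine integrable_orb fun i => (hs i _ hs').congr ?_
    filter_upwards [coeFn_freeFlow_toLp (t - s) g] with x hx
    rw [hx, PiLp.smul_apply, smul_eq_mul]
  have h1' : ∀ᵐ s ∂(volume.restrict (Set.uIoc 0 t)), ∀ i,
      (∫ x, freeFlowSchwartz (t - s) g x • F s x) i =
        ∫ x, freeFlow (t - s) (g.toLp 2 : L2 ℂ) x * F s x i := by
    rw [Set.uIoc_of_le ht.1, restrict_Ioc_eq_restrict_Icc]
    filter_upwards [h1] with s hs i
    rw [integral_orb_apply hs, integral_freeFlowSchwartz_mul]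
    rfl
  have h2 : IntervalIntegrable (fun s => ∫ x, freeFlowSchwartz (t - s) g x • F s x) volume 0 t := by
    rw [intervalIntegrable_iff]
    refine integrable_orb fun i => ?_
    refine ((intervalIntegrable_iff.1 ((hF i).intervalIntegrable hE hT t (g.toLp 2) h0 ht)).congr ?_)
    filter_upwards [h1'] with s hs
    exact (hs i).symm
  refine ⟨h1, h2, ?_⟩
  ext i
  rw [← pairing_toLp_comp, hu]
  refine Eq.trans ?_ ((EuclideanSpace.proj i : Orb K →L[ℂ] ℂ).intervalIntegral_comp_comm h2)
  refine intervalIntegral.integral_congr_ae_restrict ?_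
  filter_upwards [h1'] with s hs
  exact (hs i).symm

/-- The `L^p` norm on a time interval. -/
def timeNorm (p t₀ t₁ : ℝ) (f : ℝ → ℝ≥0∞) : ℝ≥0∞ := (∫⁻ s in Set.Ioc t₀ t₁, f s ^ p) ^ (1 / p)

theorem timeNorm_add_le (hp : 1 ≤ p) {t₀ t₁ : ℝ} {f g : ℝ → ℝ≥0∞}
    (hf : AEMeasurable f (volume.restrict (Set.Ioc t₀ t₁)))
    (hg : AEMeasurable g (volume.restrict (Set.Ioc t₀ t₁))) :
    timeNorm p t₀ t₁ (fun s => f s + g s) ≤ timeNorm p t₀ t₁ f + timeNorm p t₀ t₁ g :=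
  ENNReal.lintegral_Lp_add_le hf hg hp

theorem timeNorm_const_mul (hp : 0 < p) {t₀ t₁ : ℝ} {f : ℝ → ℝ≥0∞} (c : ℝ≥0∞)
    (hf : AEMeasurable f (volume.restrict (Set.Ioc t₀ t₁))) :
    timeNorm p t₀ t₁ (fun s => c * f s) = c * timeNorm p t₀ t₁ f := by
  unfold timeNorm
  simp_rw [ENNReal.mul_rpow_of_nonneg _ _ hp.le]
  rw [lintegral_const_mul'' _ (hf.pow_const p), ENNReal.mul_rpow_of_nonneg _ _ (by positivity),
    ← ENNReal.rpow_mul, mul_one_div_cancel hp.ne', ENNReal.rpow_one]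

theorem timeNorm_mono (hp : 0 < p) {t₀ t₁ : ℝ} {f g : ℝ → ℝ≥0∞}
    (h : ∀ᵐ s ∂(volume.restrict (Set.Ioc t₀ t₁)), f s ≤ g s) :
    timeNorm p t₀ t₁ f ≤ timeNorm p t₀ t₁ g := by
  refine ENNReal.rpow_le_rpow (lintegral_mono_ae ?_) (by positivity)
  filter_upwards [h] with s hs
  exact ENNReal.rpow_le_rpow hs hp.le

theorem enorm_coeff_add_orb_le (C : ℝ → Coeff N K) (Φ : ℝ → L2 (Orb K)) :
    ∀ᵐ s ∂(timeMeasure T), ‖C s‖ₑ + ‖Φ s‖ₑ ≤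
      eLpNorm C ∞ (timeMeasure T) + mixedNorm ∞ 2 T Φ := by
  have h1 : ∀ᵐ s ∂(timeMeasure T), ‖C s‖ₑ ≤ eLpNorm C ∞ (timeMeasure T) := by
    rw [eLpNorm_exponent_top]; exact enorm_ae_le_eLpNormEssSup _ _
  have h2 : ∀ᵐ s ∂(timeMeasure T), ‖eLpNorm (Φ s) 2 volume‖ₑ ≤ mixedNorm ∞ 2 T Φ := by
    rw [mixedNorm, eLpNorm_exponent_top]; exact enorm_ae_le_eLpNormEssSup _ _
  filter_upwards [h1, h2] with s hs hs'
  rw [enorm_eq_self, ← Lp.enorm_def] at hs'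
  exact add_le_add hs hs'

theorem eLpNorm_coeff_le {C : ℝ → Coeff N K} {c : ℝ≥0∞} (h : ∀ᵐ s ∂(timeMeasure T), ‖C s‖ₑ ≤ c) :
    eLpNorm C ∞ (timeMeasure T) ≤ c := by
  rw [eLpNorm_exponent_top]; exact essSup_le_of_ae_le _ h

theorem mixedNorm_top_le {Φ : ℝ → L2 (Orb K)} {c : ℝ≥0∞}
    (h : ∀ᵐ s ∂(timeMeasure T), ‖Φ s‖ₑ ≤ c) : mixedNorm ∞ 2 T Φ ≤ c := by
  rw [mixedNorm, eLpNorm_exponent_top]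
  refine essSup_le_of_ae_le _ ?_
  filter_upwards [h] with s hs
  rw [enorm_eq_self, ← Lp.enorm_def]
  exact hs

end

/-! ### Comparison of the images of two curves -/

section

variable {N K : ℕ} {d p p' q q' T : ℝ} {V : ℝ → ℝ} {U : E3 → ℝ}

/-- `(C₁, Φ₁)` is the image of `(C, Φ)` under the integral equations with data `(C₀, Φ₀)`. -/
structure IsImage (T : ℝ) (U : E3 → ℝ) (V : ℝ → ℝ) (C₀ : Coeff N K) (Φ₀ : L2 (Orb K))
    (C : ℝ → Coeff N K) (Φ : ℝ → L2 (Orb K)) (C₁ : ℝ → Coeff N K) (Φ₁ : ℝ → L2 (Orb K)) : Prop where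
  orb_meas : AEStronglyMeasurable Φ₁ (timeMeasure T)
  coeff_eq : ∀ t ∈ Set.Icc 0 T, C₁ t = C₀ - Complex.I • ∫ s in (0 : ℝ)..t, kForce V (C s) (Φ s)
  orbital_eq : ∀ᵐ t ∂(timeMeasure T), ∃ u : L2 (Orb K),
    IsDuhamelIntegral (fun s => forcing U V (C s) (Φ s)) t u ∧ Φ₁ t = freeFlow t Φ₀ - Complex.I • u

/-- Two curves on `[0, T]` that agree up to the time `t₀`, with common bounds. -/
structure CurvePair (M R : ℝ≥0) (p q t₀ T : ℝ) (C C' : ℝ → Coeff N K) (Φ Φ' : ℝ → L2 (Orb K)) :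
    Prop where
  left : CurveBound M R p q T C Φ
  right : CurveBound M R p q T C' Φ'
  cubic_sub_le : ∀ᵐ s ∂(timeMeasure T), ∀ i t,
    ‖cubicCoeff (C s) i t - cubicCoeff (C' s) i t‖ₑ ≤ M * ‖C s - C' s‖ₑ
  eq_before : ∀ᵐ s ∂(timeMeasure T), s ≤ t₀ → C s = C' s ∧ Φ s = Φ' s

variable {M R : ℝ≥0} {C C' C₁ C₁' : ℝ → Coeff N K} {Φ Φ' Φ₁ Φ₁' : ℝ → L2 (Orb K)} {t₀ t₁ : ℝ}
  {C₀ C₀' : Coeff N K} {Φ₀ Φ₀' : L2 (Orb K)}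

theorem CurvePair.ae_pairBound (h : CurvePair M R p q t₀ T C C' Φ Φ') (hp : 0 < p) :
    ∀ᵐ s ∂(timeMeasure T), PairBound M R q (C s) (C' s) (Φ s) (Φ' s)
      (eLpNorm (Φ s) (.ofReal q) volume + eLpNorm (Φ' s) (.ofReal q) volume) := by
  filter_upwards [h.left.cubic_le, h.right.cubic_le, h.cubic_sub_le, h.left.coeff_le,
    h.right.coeff_le, h.left.orb_le, h.right.orb_le, h.left.ae_memLp hp, h.right.ae_memLp hp]
    with s h1 h2 h3 h4 h5 h6 h7 h8 h9
  exact ⟨h1, h2, h3, h4, h5, h6, h7, le_self_add, le_add_left le_rfl,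
    ENNReal.add_ne_top.2 ⟨h8.2.ne, h9.2.ne⟩⟩

/-- The time integrals of the majorants. -/
theorem CurvePair.majorant_le (h : CurvePair M R p q t₀ T C C' Φ Φ') (hE : IsExponents d p p' q q')
    (ht₀ : 0 ≤ t₀) (ht : t₀ ≤ T) (κ : ℝ≥0) :
    timeNorm p t₀ T (fun s => κ * (eLpNorm (Φ s - Φ' s : L2 (Orb K)) (.ofReal q) volume +
      (eLpNorm (Φ s) (.ofReal q) volume + eLpNorm (Φ' s) (.ofReal q) volume) *
        (‖C s - C' s‖ₑ + ‖Φ s - Φ' s‖ₑ))) ≤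
      κ * ((1 + (mixedNorm (.ofReal p) (.ofReal q) T Φ + mixedNorm (.ofReal p) (.ofReal q) T Φ')) ^ 2 *
        xNorm p q T (C - C') (Φ - Φ')) ∧
    ∫⁻ s in Set.Ioc t₀ T, κ * ((eLpNorm (Φ s) (.ofReal q) volume +
      eLpNorm (Φ' s) (.ofReal q) volume) ^ 2 * (‖C s - C' s‖ₑ + ‖Φ s - Φ' s‖ₑ) +
      (eLpNorm (Φ s) (.ofReal q) volume + eLpNorm (Φ' s) (.ofReal q) volume) *
        eLpNorm (Φ s - Φ' s : L2 (Orb K)) (.ofReal q) volume) ≤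
      .ofReal ((T - t₀) ^ (1 - 2 / p)) * (κ * ((1 + (mixedNorm (.ofReal p) (.ofReal q) T Φ +
        mixedNorm (.ofReal p) (.ofReal q) T Φ')) ^ 2 * xNorm p q T (C - C') (Φ - Φ'))) := by
  have hp0 := hE.p_pos
  have hp1 : 1 ≤ p := by linarith [hE.p_gt]
  have hsub : volume.restrict (Set.Ioc t₀ T) ≤ timeMeasure T :=
    Measure.restrict_mono_set _ fun s hs => ⟨ht₀.trans hs.1.le, hs.2⟩
  set y : ℝ → ℝ≥0∞ := fun s => eLpNorm (Φ s) (.ofReal q) volume +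
    eLpNorm (Φ' s) (.ofReal q) volume with hy
  set z : ℝ → ℝ≥0∞ := fun s => eLpNorm (Φ s - Φ' s : L2 (Orb K)) (.ofReal q) volume with hz
  have hym1 : AEMeasurable (fun s => eLpNorm (Φ s) (.ofReal q) volume)
      (volume.restrict (Set.Ioc t₀ T)) :=
    aemeasurable_eLpNorm _ (h.left.orb_meas.mono_measure hsub)
  have hym2 : AEMeasurable (fun s => eLpNorm (Φ' s) (.ofReal q) volume)
      (volume.restrict (Set.Ioc t₀ T)) :=
    aemeasurable_eLpNorm _ (h.right.orb_meas.mono_measure hsub)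
  have hym : AEMeasurable y (volume.restrict (Set.Ioc t₀ T)) := hym1.add hym2
  have hzm : AEMeasurable z (volume.restrict (Set.Ioc t₀ T)) :=
    aemeasurable_eLpNorm _ ((h.left.orb_meas.sub h.right.orb_meas).mono_measure hsub)
  set μ := mixedNorm (.ofReal p) (.ofReal q) T Φ + mixedNorm (.ofReal p) (.ofReal q) T Φ'
  set D₁ := eLpNorm (C - C') ∞ (timeMeasure T) + mixedNorm ∞ 2 T (Φ - Φ')
  set D₂ := mixedNorm (.ofReal p) (.ofReal q) T (Φ - Φ')
  have hD : xNorm p q T (C - C') (Φ - Φ') = D₁ + D₂ := by rw [xNorm, add_assoc]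
  have hδ : ∀ᵐ s ∂(volume.restrict (Set.Ioc t₀ T)), ‖C s - C' s‖ₑ + ‖Φ s - Φ' s‖ₑ ≤ D₁ :=
    ae_mono hsub (enorm_coeff_add_orb_le (C - C') (Φ - Φ'))
  have hyn : timeNorm p t₀ T y ≤ μ := (timeNorm_add_le hp1 hym1 hym2).trans
    (add_le_add (lintegral_Ioc_le_mixedNorm hp0 ht₀ le_rfl Φ)
      (lintegral_Ioc_le_mixedNorm hp0 ht₀ le_rfl Φ'))
  have hzn : timeNorm p t₀ T z ≤ D₂ := lintegral_Ioc_le_mixedNorm hp0 ht₀ le_rfl (Φ - Φ')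
  -- The factor `(1 + μ)²` dominates both the majorant linear in the mixed norms and the quadratic
  -- one below, so that all estimates share one form.
  have hfin : D₂ + D₁ * μ ≤ (1 + μ) ^ 2 * (D₁ + D₂) := by
    calc D₂ + D₁ * μ ≤ D₂ + D₁ * μ + (D₁ + D₁ * μ + 2 * μ * D₂ + μ ^ 2 * (D₁ + D₂)) := le_self_add
      _ = _ := by ring
  have hfin' : D₁ * (μ * μ) + μ * D₂ ≤ (1 + μ) ^ 2 * (D₁ + D₂) := by
    calc D₁ * (μ * μ) + μ * D₂ ≤ D₁ * (μ * μ) + μ * D₂ +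
          (D₁ + D₂ + 2 * μ * D₁ + μ * D₂ + μ ^ 2 * D₂) := le_self_add
      _ = _ := by ring
  rw [hD]
  constructor
  · refine le_trans (timeNorm_mono hp0 (g := fun s => κ * (z s + D₁ * y s)) ?_) ?_
    · filter_upwards [hδ] with s hs
      rw [mul_comm D₁]
      exact mul_le_mul' le_rfl (add_le_add le_rfl (mul_le_mul' le_rfl hs))
    · have hs : AEMeasurable (fun s => z s + D₁ * y s) (volume.restrict (Set.Ioc t₀ T)) :=
        hzm.add (hym.const_mul _)
      rw [timeNorm_const_mul hp0 _ hs]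
      refine mul_le_mul' le_rfl (le_trans ?_ hfin)
      refine (timeNorm_add_le hp1 hzm (hym.const_mul _)).trans (add_le_add hzn ?_)
      rw [timeNorm_const_mul hp0 _ hym]
      exact mul_le_mul' le_rfl hyn
  · refine le_trans (lintegral_mono_ae (g := fun s => κ * (D₁ * (y s * y s) + y s * z s)) ?_) ?_
    · filter_upwards [hδ] with s hs
      rw [mul_comm D₁, ← pow_two]
      exact mul_le_mul' le_rfl (add_le_add (mul_le_mul' le_rfl hs) le_rfl)
    · have hyy : AEMeasurable (fun s => y s * y s) (volume.restrict (Set.Ioc t₀ T)) := hym.mul hym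
      have hyz : AEMeasurable (fun s => y s * z s) (volume.restrict (Set.Ioc t₀ T)) := hym.mul hzm
      have hy1 : AEMeasurable (fun s => D₁ * (y s * y s)) (volume.restrict (Set.Ioc t₀ T)) :=
        hyy.const_mul _
      have hs : AEMeasurable (fun s => D₁ * (y s * y s) + y s * z s)
          (volume.restrict (Set.Ioc t₀ T)) := hy1.add hyz
      rw [lintegral_const_mul'' _ hs, lintegral_add_left' hy1, lintegral_const_mul'' _ hyy]
      have h1 := lintegral_mul_time_le hE ht hym hym
      have h2 := lintegral_mul_time_le hE ht hym hzm
      calc _ ≤ κ * (D₁ * (.ofReal ((T - t₀) ^ (1 - 2 / p)) * (μ * μ)) +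
            .ofReal ((T - t₀) ^ (1 - 2 / p)) * (μ * D₂)) := by
            gcongr
            · exact h1.trans (mul_le_mul' le_rfl (mul_le_mul' hyn hyn))
            · exact h2.trans (mul_le_mul' le_rfl (mul_le_mul' hyn hzn))
        _ = .ofReal ((T - t₀) ^ (1 - 2 / p)) * (κ * (D₁ * (μ * μ) + μ * D₂)) := by ring
        _ ≤ _ := by gcongr

/-- An integrand that vanishes up to `t₀` contributes only at later times. Through this the gain in
the difference estimate is a power of `T - t₀` rather than of `T`. -/
theorem enorm_intervalIntegral_le_of_eq_zero {F : Type} [NormedAddCommGroup F] [NormedSpace ℝ F]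
    {f : ℝ → F} {g : ℝ → ℝ≥0∞} {t : ℝ} (ht : 0 ≤ t)
    (h0 : ∀ᵐ s ∂(volume.restrict (Set.Ioc 0 t)), s ≤ t₀ → f s = 0)
    (hg : ∀ᵐ s ∂(volume.restrict (Set.Ioc 0 t)), ‖f s‖ₑ ≤ g s) :
    ‖∫ s in (0 : ℝ)..t, f s‖ₑ ≤ ∫⁻ s in Set.Ioc t₀ t, g s := by
  rw [intervalIntegral.integral_of_le ht]
  refine (enorm_integral_le_lintegral_enorm _).trans ?_
  rw [← lintegral_indicator measurableSet_Ioc (f := g)]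
  refine le_trans (lintegral_mono_ae ?_) (setLIntegral_le_lintegral (Set.Ioc 0 t) _)
  filter_upwards [h0, hg, ae_restrict_mem measurableSet_Ioc] with s h1 h2 hs
  by_cases hst : s ≤ t₀
  · rw [h1 hst, enorm_zero]; exact zero_le
  · rw [Set.indicator_of_mem (show s ∈ Set.Ioc t₀ t from ⟨not_le.1 hst, hs.2⟩)]; exact h2

/-- The difference of the images of two curves: the coefficients. -/
theorem CurvePair.coeff_sub_le (h : CurvePair M R p q t₀ T C C' Φ Φ')
    (hE : IsExponents d p p' q q') (hT : 0 < T) (ht₀ : 0 ≤ t₀) (ht : t₀ ≤ T)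
    (hV : MemLp (fun x : E3 => V ‖x‖) (.ofReal d) volume) {B : ℝ≥0}
    (hB : eLpNorm (fun x : E3 => V ‖x‖) (.ofReal d) volume ≤ B)
    (hI : IsImage T U V C₀ Φ₀ C Φ C₁ Φ₁) (hI' : IsImage T U V C₀' Φ₀' C' Φ' C₁' Φ₁') :
    ∀ t ∈ Set.Icc 0 T, ‖C₁ t - C₁' t‖ₑ ≤ ‖C₀ - C₀'‖ₑ + .ofReal ((T - t₀) ^ (1 - 2 / p)) *
      (((Fintype.card (MultiIndex N K)) ^ 2 * (N ^ 4 * (2 * B * (R * R + R) * R + B * R * R)) : ℝ≥0) *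
      ((1 + (mixedNorm (.ofReal p) (.ofReal q) T Φ + mixedNorm (.ofReal p) (.ofReal q) T Φ')) ^ 2 *
        xNorm p q T (C - C') (Φ - Φ'))) := by
  intro t htm
  have hsub : volume.restrict (Set.Ioc 0 t) ≤ timeMeasure T :=
    Measure.restrict_mono_set _ fun s hs => ⟨hs.1.le, hs.2.trans htm.2⟩
  have hi : ∀ {C : ℝ → Coeff N K} {Φ : ℝ → L2 (Orb K)}, CurveBound M R p q T C Φ →
      IntervalIntegrable (fun s => kForce V (C s) (Φ s)) volume 0 t := fun hc => by
    rw [intervalIntegrable_iff_integrableOn_Ioc_of_le htm.1]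
    exact (hc.integrable_kForce hE hT hV).mono_measure hsub
  rw [hI.coeff_eq t htm, hI'.coeff_eq t htm, sub_sub_sub_comm, ← smul_sub,
    ← intervalIntegral.integral_sub (hi h.left) (hi h.right)]
  have hI1 : ‖(Complex.I : ℂ)‖ₑ = 1 := by rw [← ofReal_norm]; simp
  refine (enorm_sub_le).trans (add_le_add le_rfl ?_)
  rw [enorm_smul, hI1, one_mul]
  refine le_trans ?_ (h.majorant_le hE ht₀ ht _).2
  refine (enorm_intervalIntegral_le_of_eq_zero htm.1 ?_ ?_).trans
    (lintegral_mono_set (Set.Ioc_subset_Ioc_right htm.2))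
  · filter_upwards [ae_mono hsub h.eq_before] with s hs hst
    rw [(hs hst).1, (hs hst).2, sub_self]
  · filter_upwards [ae_mono hsub (h.ae_pairBound hE.p_pos)] with s hs
    exact enorm_kForce_sub_le hE hV hB hs

end

/-! ### The basic difference estimate -/

section

variable {N K : ℕ} {d p p' q q' T : ℝ} {V : ℝ → ℝ} {U : E3 → ℝ}
  {M R : ℝ≥0} {C C' C₁ C₁' : ℝ → Coeff N K} {Φ Φ' Φ₁ Φ₁' : ℝ → L2 (Orb K)} {t₀ t₁ : ℝ}
  {C₀ C₀' : Coeff N K} {Φ₀ Φ₀' : L2 (Orb K)}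

theorem enorm_I : ‖(Complex.I : ℂ)‖ₑ = 1 := by rw [← ofReal_norm]; simp

/-- After subtraction of the free wave of the difference of the data, what is left is `-i` times the
difference of two Duhamel integrals. Paired with a test function, its integrand splits into a part
bounded through the `L^q` norm of the evolved test function and the pairing with an `L²` function,
as the Duhamel estimate requires. -/
theorem CurvePair.pairing_le (h : CurvePair M R p q t₀ T C C' Φ Φ')
    (hE : IsExponents d p p' q q') (hT : 0 < T)
    (hU : MemLp U (.ofReal d) volume) (hV : MemLp (fun x : E3 => V ‖x‖) (.ofReal d) volume)
    {A B : ℝ≥0} (hA : eLpNorm U (.ofReal d) volume ≤ A)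
    (hB : eLpNorm (fun x : E3 => V ‖x‖) (.ofReal d) volume ≤ B)
    (hI : IsImage T U V C₀ Φ₀ C Φ C₁ Φ₁) (hI' : IsImage T U V C₀' Φ₀' C' Φ' C₁' Φ₁') (i : Fin K) :
    ∀ᵐ t ∂(timeMeasure T), ∀ g : 𝓢(E3, ℂ),
      ‖pairing (g.toLp 2) (comp i (Φ₁ t - Φ₁' t - freeFlow t (Φ₀ - Φ₀')))‖ₑ ≤
        ∫⁻ s in Set.Ioc t₀ t, ((A + K ^ 3 * (M * B * (R * R + 2 * R)) : ℝ≥0) *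
          (eLpNorm (Φ s - Φ' s : L2 (Orb K)) (.ofReal q) volume +
            (eLpNorm (Φ s) (.ofReal q) volume + eLpNorm (Φ' s) (.ofReal q) volume) *
            (‖C s - C' s‖ₑ + ‖Φ s - Φ' s‖ₑ)) *
          eLpNorm (freeFlow (t - s) (g.toLp 2 : L2 ℂ)) (.ofReal q) volume +
          ‖pairing (orbForce V (C s) (Φ s) i - orbForce V (C' s) (Φ' s) i)
            (freeFlow (t - s) (g.toLp 2))‖ₑ) := by
  filter_upwards [hI.orbital_eq, hI'.orbital_eq, ae_restrict_mem measurableSet_Icc]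
    with t ht ht' htm g
  obtain ⟨u, hu, hΦ⟩ := ht
  obtain ⟨u', hu', hΦ'⟩ := ht'
  have e : Φ₁ t - Φ₁' t - freeFlow t (Φ₀ - Φ₀') = (-Complex.I) • (u - u') := by
    rw [hΦ, hΦ', freeFlow_sub, smul_sub, neg_smul, neg_smul]; abel
  have hsub : volume.restrict (Set.Ioc 0 t) ≤ timeMeasure T :=
    Measure.restrict_mono_set _ fun s hs => ⟨hs.1.le, hs.2.trans htm.2⟩
  have h0 : (0 : ℝ) ∈ Set.Icc 0 T := ⟨le_rfl, hT.le⟩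
  obtain ⟨a, b, hF⟩ := h.left.isForce hE hT hU hV i
  obtain ⟨a', b', hF'⟩ := h.right.isForce hE hT hU hV i
  rw [e, map_smul, ← pairingCLM_apply, map_smul, enorm_smul, enorm_neg, enorm_I, one_mul, map_sub,
    map_sub, pairingCLM_apply, pairingCLM_apply, hu.pairing_comp htm.1, hu'.pairing_comp htm.1,
    ← intervalIntegral.integral_sub (hF.intervalIntegrable hE hT t _ h0 htm)
      (hF'.intervalIntegrable hE hT t _ h0 htm)]
  refine enorm_intervalIntegral_le_of_eq_zero htm.1 ?_ ?_
  · filter_upwards [ae_mono hsub h.eq_before] with s hs hst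
    rw [(hs hst).1, (hs hst).2, sub_self]
  · filter_upwards [ae_mono hsub (h.ae_pairBound hE.p_pos),
      ae_mono hsub (ae_eLpNorm_freeFlow_sub_ne_top hE hT t (g.toLp 2))] with s hs hg
    rw [(integral_mul_forcing_eq hE hU hV hs.memLp (C s) i hg).2,
      (integral_mul_forcing_eq hE hU hV hs.memLp' (C' s) i hg).2, add_sub_add_comm,
      ← pairing_sub_right, pairing_comm (orbForce V (C s) (Φ s) i - orbForce V (C' s) (Φ' s) i)]
    refine (enorm_add_le _ _).trans (add_le_add ?_ le_rfl)
    exact enorm_linForm_sub_le hE hU hV hA hB hs i ⟨Lp.aestronglyMeasurable _, hg.lt_top⟩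

/-- The difference of the images of two curves that agree up to the time `t₀`. -/
theorem exists_image_sub_le (N K : ℕ) (hE : IsExponents d p p' q q') (A B M R : ℝ≥0) :
    ∃ c : ℝ≥0, ∀ (U : E3 → ℝ) (V : ℝ → ℝ), MemLp U (.ofReal d) volume →
      MemLp (fun x : E3 => V ‖x‖) (.ofReal d) volume → eLpNorm U (.ofReal d) volume ≤ A →
      eLpNorm (fun x : E3 => V ‖x‖) (.ofReal d) volume ≤ B →
      ∀ (t₀ T : ℝ), 0 < T → 0 ≤ t₀ → t₀ ≤ T → ∀ (C C' C₁ C₁' : ℝ → Coeff N K)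
      (Φ Φ' Φ₁ Φ₁' : ℝ → L2 (Orb K)) (C₀ C₀' : Coeff N K) (Φ₀ Φ₀' : L2 (Orb K)),
      CurvePair M R p q t₀ T C C' Φ Φ' → IsImage T U V C₀ Φ₀ C Φ C₁ Φ₁ →
      IsImage T U V C₀' Φ₀' C' Φ' C₁' Φ₁' → ∀ D : ℝ≥0∞,
      D = c * (.ofReal ((T - t₀) ^ (1 - 2 / p)) * ((1 + (mixedNorm (.ofReal p) (.ofReal q) T Φ +
        mixedNorm (.ofReal p) (.ofReal q) T Φ')) ^ 2 * xNorm p q T (C - C') (Φ - Φ'))) →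
      (∀ t ∈ Set.Icc 0 T, ‖C₁ t - C₁' t‖ₑ ≤ ‖C₀ - C₀'‖ₑ + D) ∧
      (∀ᵐ t ∂(timeMeasure T), ‖Φ₁ t - Φ₁' t‖ₑ ≤ ‖Φ₀ - Φ₀'‖ₑ + D) ∧
      mixedNorm (.ofReal p) (.ofReal q) T (Φ₁ - Φ₁') ≤ strichartzConst p q * ‖Φ₀ - Φ₀'‖ₑ + D := by
  obtain ⟨c, hc⟩ := exists_duhamel_estimate hE
  set κ₁ : ℝ≥0 := A + K ^ 3 * (M * B * (R * R + 2 * R)) with hκ₁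
  set κ₂ : ℝ≥0 := K * (K ^ 3 * (M * (2 * B * (R * R + R))) * R + K ^ 3 * (M * (B * (R * R))))
    with hκ₂
  set κ₃ : ℝ≥0 := (Fintype.card (MultiIndex N K)) ^ 2 *
    (N ^ 4 * (2 * B * (R * R + R) * R + B * R * R)) with hκ₃
  -- Here `c` comes from the Duhamel estimate, `κ₁` and `κ₂` from the two parts of the force in each
  -- of the `K` components, and `κ₃` from the coefficient equation.
  refine ⟨K * (c * (κ₁ + κ₂)) + κ₃, ?_⟩
  intro U V hU hV hA hB t₀ T hT ht₀ ht C C' C₁ C₁' Φ Φ' Φ₁ Φ₁' C₀ C₀' Φ₀ Φ₀' h hI hI' D hD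
  have hp0 := hE.p_pos
  have hp1 : 1 ≤ p := by linarith [hE.p_gt]
  have hq1 : 1 ≤ q := by linarith [hE.q_gt]
  set τ := ENNReal.ofReal ((T - t₀) ^ (1 - 2 / p))
  set P := (1 + (mixedNorm (.ofReal p) (.ofReal q) T Φ +
        mixedNorm (.ofReal p) (.ofReal q) T Φ')) ^ 2 * xNorm p q T (C - C') (Φ - Φ')
  have hκ₃D : τ * (κ₃ * P) ≤ D := by
    rw [hD]
    calc τ * (κ₃ * P) ≤ τ * (κ₃ * P) + K * (c * (κ₁ + κ₂)) * (τ * P) := le_self_add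
      _ = _ := by push_cast; ring
  have hcD : ∑ _i : Fin K, (c * (τ * (κ₁ * P) + τ * (κ₂ * P)) : ℝ≥0∞) ≤ D := by
    rw [hD, Finset.sum_const, Finset.card_univ, Fintype.card_fin, nsmul_eq_mul]
    calc K * (c * (τ * (κ₁ * P) + τ * (κ₂ * P))) ≤
          K * (c * (τ * (κ₁ * P) + τ * (κ₂ * P))) + κ₃ * (τ * P) := le_self_add
      _ = _ := by push_cast; ring
  have hsub : volume.restrict (Set.Ioc t₀ T) ≤ timeMeasure T :=
    Measure.restrict_mono_set _ fun s hs => ⟨ht₀.trans hs.1.le, hs.2⟩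
  -- Only the remainder after the free wave goes through the componentwise estimates; the free wave
  -- itself is bounded with the exact constant, which the factor 2 in the final bound requires.
  set W : ℝ → L2 (Orb K) := fun t => Φ₁ t - Φ₁' t - freeFlow t (Φ₀ - Φ₀') with hW
  have hflow : AEStronglyMeasurable (fun t => freeFlow t (Φ₀ - Φ₀')) (timeMeasure T) :=
    (continuous_freeFlow_left _).aestronglyMeasurable
  have hWm : AEStronglyMeasurable W (timeMeasure T) := (hI.orb_meas.sub hI'.orb_meas).sub hflow
  have hcomp : ∀ i, (∀ᵐ t ∂(timeMeasure T), ‖comp i (W t)‖ₑ ≤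
      c * (τ * (κ₁ * P) + τ * (κ₂ * P))) ∧
      mixedNorm (.ofReal p) (.ofReal q) T (fun t => comp i (W t)) ≤
        c * (τ * (κ₁ * P) + τ * (κ₂ * P)) := by
    intro i
    have hm1 := h.left.orb_meas.mono_measure hsub
    have hm2 := h.right.orb_meas.mono_measure hsub
    have hf : ∀ {C : ℝ → Coeff N K} {Φ : ℝ → L2 (Orb K)}, CurveBound M R p q T C Φ →
        AEStronglyMeasurable (fun s => orbForce V (C s) (Φ s) i)
          (volume.restrict (Set.Ioc t₀ T)) := fun hc =>
      aestronglyMeasurable_orbForce hE hV (hc.coeff_meas.mono_measure hsub)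
        (hc.orb_meas.mono_measure hsub) (ae_mono hsub (hc.ae_memLp hp0)) i
    have ham : AEMeasurable (fun s => κ₁ * (eLpNorm (Φ s - Φ' s : L2 (Orb K)) (.ofReal q) volume +
            (eLpNorm (Φ s) (.ofReal q) volume + eLpNorm (Φ' s) (.ofReal q) volume) *
            (‖C s - C' s‖ₑ + ‖Φ s - Φ' s‖ₑ))) (volume.restrict (Set.Ioc t₀ T)) := by
      refine AEMeasurable.const_mul ((aemeasurable_eLpNorm _ (hm1.sub hm2)).add
        (((aemeasurable_eLpNorm _ hm1).add (aemeasurable_eLpNorm _ hm2)).mul ?_)) _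
      exact ((h.left.coeff_meas.sub h.right.coeff_meas).mono_measure hsub).enorm.add
        (hm1.sub hm2).enorm
    obtain ⟨h1, h2⟩ := hc t₀ T ht₀ ht hT _ _ (fun t => comp i (W t)) ham
      ((hf h.left).sub (hf h.right)) (by
        filter_upwards [h.pairing_le hE hT hU hV hA hB hI hI' i] with t ht g
        rw [← pairing_toLp]
        exact ht g)
    have hle : τ * (∫⁻ s in Set.Ioc t₀ T, (κ₁ *
          (eLpNorm (Φ s - Φ' s : L2 (Orb K)) (.ofReal q) volume +
            (eLpNorm (Φ s) (.ofReal q) volume + eLpNorm (Φ' s) (.ofReal q) volume) *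
            (‖C s - C' s‖ₑ + ‖Φ s - Φ' s‖ₑ))) ^ p) ^ (1 / p) +
          ∫⁻ s in Set.Ioc t₀ T, ‖orbForce V (C s) (Φ s) i - orbForce V (C' s) (Φ' s) i‖ₑ ≤
        τ * (κ₁ * P) + τ * (κ₂ * P) := by
      refine add_le_add (mul_le_mul' le_rfl (h.majorant_le hE ht₀ ht κ₁).1) ?_
      refine le_trans (lintegral_mono_ae ?_) (h.majorant_le hE ht₀ ht κ₂).2
      filter_upwards [ae_mono hsub (h.ae_pairBound hp0)] with s hs
      exact enorm_orbForce_sub_le hE hV hB hs i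
    refine ⟨?_, h2.trans (mul_le_mul' le_rfl hle)⟩
    filter_upwards [h1] with t ht
    exact ht.trans (mul_le_mul' le_rfl hle)
  have hΦW : ∀ t, Φ₁ t - Φ₁' t = freeFlow t (Φ₀ - Φ₀') + W t := fun t =>
    (add_sub_cancel _ _).symm
  refine ⟨fun t htm => ?_, ?_, ?_⟩
  · exact (h.coeff_sub_le hE hT ht₀ ht hV hB hI hI' t htm).trans (add_le_add le_rfl hκ₃D)
  · filter_upwards [ae_all_iff.2 fun i => (hcomp i).1] with t htm
    rw [hΦW]
    refine (enorm_add_le _ _).trans (add_le_add ?_ ?_)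
    · rw [← ofReal_norm, norm_freeFlow, ofReal_norm]
    · exact (enorm_le_sum_comp _).trans ((Finset.sum_le_sum fun i _ => htm i).trans hcD)
  · have e : Φ₁ - Φ₁' = (fun t => freeFlow t (Φ₀ - Φ₀')) + W := funext hΦW
    rw [e]
    refine (mixedNorm_add_le hp1 hq1 hflow hWm).trans (add_le_add
      (mixedNorm_freeFlow_orb_le hE hT _) ?_)
    exact (mixedNorm_le_sum_comp hE.p_gt.le hE.q_gt.le hWm).trans
      ((Finset.sum_le_sum fun i _ => (hcomp i).2).trans hcD)

end

/-! ### Images of curves and the ball for the fixed point -/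

section

variable {N K : ℕ} {d p p' q q' T : ℝ} {V : ℝ → ℝ} {U : E3 → ℝ}
  {M R : ℝ≥0} {C C' C₁ C₁' : ℝ → Coeff N K} {Φ Φ' Φ₁ Φ₁' : ℝ → L2 (Orb K)} {t₀ t₁ : ℝ}
  {C₀ C₀' : Coeff N K} {Φ₀ Φ₀' : L2 (Orb K)}

/-- With `t₀ = 0` the requirement that two curves agree up to the time `t₀` is therefore void almost
everywhere. -/
theorem ae_not_nonpos (T : ℝ) : ∀ᵐ s ∂(timeMeasure T), ¬ s ≤ 0 := by
  rw [restrict_Icc_eq_Ioc]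
  filter_upwards [ae_restrict_mem measurableSet_Ioc] with s hs
  exact not_le.2 hs.1

theorem forcing_eq_zero (U : E3 → ℝ) (V : ℝ → ℝ) (C : Coeff N K) {Φ : E3 → Orb K} {x : E3}
    (h : Φ x = 0) : forcing U V C Φ x = 0 := by
  have h1 : (fun i => projectedForce V C Φ i x) = 0 := by
    funext i
    rw [projectedForce, proj, h, WithLp.ofLp_zero, Matrix.mulVec_zero]
    simp
  rw [forcing, lTerm, h1, h, Matrix.mulVec_zero, smul_zero, WithLp.toLp_zero, add_zero]

theorem isDuhamelIntegral_zero (U : E3 → ℝ) (V : ℝ → ℝ) (C : ℝ → Coeff N K) (t : ℝ) :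
    IsDuhamelIntegral (fun s => forcing U V (C s) (0 : L2 (Orb K))) t (0 : L2 (Orb K)) := by
  have h0 : ((0 : L2 (Orb K)) : E3 → Orb K) =ᵐ[volume] 0 := Lp.coeFn_zero _ _ _
  have h1 : ∀ (g : 𝓢(E3, ℂ)) s,
      (fun x => freeFlowSchwartz (t - s) g x • forcing U V (C s) (0 : L2 (Orb K)) x) =ᵐ[volume]
        fun _ => 0 := by
    intro g s
    filter_upwards [h0] with x hx
    rw [forcing_eq_zero U V (C s) hx, smul_zero]
  have h2 : ∀ (g : 𝓢(E3, ℂ)) s,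
      ∫ x, freeFlowSchwartz (t - s) g x • forcing U V (C s) (0 : L2 (Orb K)) x = 0 := fun g s => by
    rw [integral_congr_ae (h1 g s), integral_zero]
  intro g
  refine ⟨.of_forall fun s => (integrable_zero _ _ _).congr (h1 g s).symm, ?_, ?_⟩
  · simp_rw [h2]; exact intervalIntegrable_const
  · simp_rw [h2]
    rw [intervalIntegral.integral_zero]
    refine integral_eq_zero_of_ae ?_
    filter_upwards [h0] with x hx
    rw [hx, Pi.zero_apply, smul_zero]

theorem eLpNorm_zero_L2 {F : Type} [NormedAddCommGroup F] (q : ℝ≥0∞) :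
    eLpNorm (0 : L2 F) q volume = 0 := by
  rw [eLpNorm_congr_ae (Lp.coeFn_zero F 2 volume), eLpNorm_zero]

theorem mixedNorm_zero {F : Type} [NormedAddCommGroup F] (p q : ℝ≥0∞) (T : ℝ) :
    mixedNorm p q T (0 : ℝ → L2 F) = 0 := by
  simp_rw [mixedNorm, Pi.zero_apply, eLpNorm_zero_L2]
  exact eLpNorm_zero'

theorem kForce_zero (hE : IsExponents d p p' q q')
    (hV : MemLp (fun x : E3 => V ‖x‖) (.ofReal d) volume) (C : Coeff N K) :
    kForce V C (0 : L2 (Orb K)) = 0 := by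
  have h := enorm_kForce_le (Φ := (0 : L2 (Orb K))) (C := C) (R := ‖C‖₊) (Y := 0) hE hV
    (ENNReal.coe_toNNReal hV.2.ne).symm.le le_rfl (by rw [enorm_zero]; exact zero_le)
    ⟨Lp.aestronglyMeasurable _, by rw [eLpNorm_zero_L2]; exact ENNReal.zero_lt_top⟩
    (by rw [eLpNorm_zero_L2])
  rw [zero_pow two_ne_zero, mul_zero] at h
  exact enorm_eq_zero.1 (le_antisymm h zero_le)

/-- A reference image: comparison with it turns the difference estimate into bounds for the image of
a single curve. -/
theorem isImage_zero (hE : IsExponents d p p' q q')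
    (hV : MemLp (fun x : E3 => V ‖x‖) (.ofReal d) volume) (U : E3 → ℝ) (T : ℝ) (C₀ : Coeff N K)
    (C : ℝ → Coeff N K) : IsImage T U V C₀ (0 : L2 (Orb K)) C 0 (fun _ => C₀) 0 := by
  refine ⟨aestronglyMeasurable_zero, fun t _ => ?_, .of_forall fun t =>
    ⟨0, isDuhamelIntegral_zero U V C t, ?_⟩⟩
  · simp_rw [Pi.zero_apply, kForce_zero hE hV]
    rw [intervalIntegral.integral_zero, smul_zero, sub_zero]
  · rw [freeFlow_zero, smul_zero, sub_zero, Pi.zero_apply]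

theorem continuousOn_sub_smul {X : Type} [NormedAddCommGroup X] [NormedSpace ℂ X] {f g : ℝ → X}
    {S : Set ℝ} (hf : ContinuousOn f S) (hg : ContinuousOn g S) (c : ℂ) :
    ContinuousOn (fun t => f t - c • g t) S := by
  have h : ContinuousOn (fun t => c • g t) S := (continuous_const_smul c).comp_continuousOn hg
  exact hf.sub h

/-- Every bounded curve has an image. -/
theorem CurveBound.exists_image (h : CurveBound M R p q T C Φ) (hE : IsExponents d p p' q q')
    (hT : 0 < T) (hU : MemLp U (.ofReal d) volume)
    (hV : MemLp (fun x : E3 => V ‖x‖) (.ofReal d) volume) (C₀ : Coeff N K) (Φ₀ : L2 (Orb K)) :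
    ∃ (C₁ : ℝ → Coeff N K) (Φ₁ : ℝ → L2 (Orb K)), AEStronglyMeasurable C₁ (timeMeasure T) ∧
      IsImage T U V C₀ Φ₀ C Φ C₁ Φ₁ := by
  have hF := h.isForce hE hT hU hV
  have hu : ∀ i, ∃ u : ℝ → L2 ℂ, Continuous u ∧ ∀ t ∈ Set.Icc 0 T, ∀ g : L2 ℂ,
      pairing g (u t) =
        ∫ s in (0 : ℝ)..t, ∫ x, freeFlow (t - s) g x * forcing U V (C s) (Φ s) x i := fun i => by
    obtain ⟨a, b, hab⟩ := hF i
    exact hab.exists_duhamel hE hT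
  choose u huc hu using hu
  refine ⟨fun t => C₀ - Complex.I • ∫ s in (0 : ℝ)..t, kForce V (C s) (Φ s),
    fun t => freeFlow t Φ₀ - Complex.I • ofComp fun i => u i t, ?_, ⟨?_, fun _ _ => rfl, ?_⟩⟩
  · refine ContinuousOn.aestronglyMeasurable ?_ measurableSet_Icc
    -- The new coefficients are a primitive of an integrable function, hence continuous on `[0, T]`.
    have h1 := intervalIntegral.continuousOn_primitive_interval (μ := volume) (a := (0 : ℝ)) (b := T)
      (f := fun s => kForce V (C s) (Φ s)) (by
        rw [Set.uIcc_of_le hT.le]; exact h.integrable_kForce hE hT hV)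
    rw [Set.uIcc_of_le hT.le] at h1
    exact continuousOn_sub_smul continuousOn_const h1 _
  · have h1 := continuousOn_sub_smul (continuous_freeFlow_left Φ₀).continuousOn
      (continuous_ofComp huc).continuousOn Complex.I (S := Set.Icc 0 T)
    exact h1.aestronglyMeasurable measurableSet_Icc
  · filter_upwards [ae_restrict_mem measurableSet_Icc] with t ht
    refine ⟨_, isDuhamelIntegral_of_comp hE hT hF ht fun i g => ?_, rfl⟩
    rw [comp_ofComp, hu i t ht]

theorem xNorm_le {x y z : ℝ≥0∞} (hC : ∀ t ∈ Set.Icc 0 T, ‖C t‖ₑ ≤ x)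
    (hΦ : ∀ᵐ t ∂(timeMeasure T), ‖Φ t‖ₑ ≤ y) (hm : mixedNorm (.ofReal p) (.ofReal q) T Φ ≤ z) :
    xNorm p q T C Φ ≤ x + (y + z) := by
  refine add_le_add (eLpNorm_coeff_le ?_) (add_le_add (mixedNorm_top_le hΦ) hm)
  filter_upwards [ae_restrict_mem measurableSet_Icc] with t ht
  exact hC t ht

/-- The curves to which the fixed point argument applies. -/
structure InBall (p q T : ℝ) (δ : ℝ≥0) (C₀ : Coeff N K) (Φ₀ : L2 (Orb K)) (C : ℝ → Coeff N K)
    (Φ : ℝ → L2 (Orb K)) : Prop where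
  coeff_meas : AEStronglyMeasurable C (timeMeasure T)
  orb_meas : AEStronglyMeasurable Φ (timeMeasure T)
  coeff_le : ∀ t ∈ Set.Icc 0 T, ‖C t - C₀‖ₑ ≤ δ
  orb_le : ∀ᵐ t ∂(timeMeasure T), ‖Φ t‖ₑ ≤ 2 * ‖Φ₀‖ₑ
  mixed_le : mixedNorm (.ofReal p) (.ofReal q) T Φ ≤ 2 * strichartzConst p q * ‖Φ₀‖ₑ

/-- The set of initial data of the main theorem, described by what the estimates use. -/
structure IsAdmissibleData (θ : ℝ≥0) (C₀ : Coeff N K) (Φ₀ : L2 (Orb K)) : Prop where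
  coeff_mem : C₀ ∈ coeffSet N K θ
  orb_le : ‖Φ₀‖ₑ ≤ K

theorem isAdmissibleData_of_isRegularData (h : IsRegularData C₀ Φ₀) {θ : ℝ≥0}
    (hθ : ‖Matrix.toEuclideanCLM (𝕜 := ℂ) (densityMatrix C₀)⁻¹‖ ≤ θ) :
    IsAdmissibleData θ C₀ Φ₀ := by
  refine ⟨mem_coeffSet h hθ, (ENNReal.pow_le_pow_left_iff two_ne_zero).1 ?_⟩
  -- Orthonormality makes the square of the norm equal to `K`; since `K ≤ K²`, the norm is at most
  -- `K`, a bound free of square roots.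
  rw [enorm_sq_of_isRegularData h]
  exact_mod_cast Nat.le_self_pow two_ne_zero K

/-- Bounds for the cubic coefficients near the admissible data. -/
def IsCoeffBound (N K : ℕ) (θ δ M : ℝ≥0) : Prop :=
  ∀ C ∈ Metric.cthickening (δ : ℝ) (coeffSet N K θ),
    IsUnit (densityMatrix C) ∧ (∀ i t, ‖cubicCoeff C i t‖ₑ ≤ M) ∧
      ∀ C' ∈ Metric.cthickening (δ : ℝ) (coeffSet N K θ), ∀ i t,
        ‖cubicCoeff C i t - cubicCoeff C' i t‖ₑ ≤ M * ‖C - C'‖ₑ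

theorem exists_isCoeffBound (N K : ℕ) (θ : ℝ≥0) :
    ∃ δ M : ℝ≥0, 0 < δ ∧ IsCoeffBound N K θ δ M := by
  obtain ⟨δ, hδ, h⟩ := exists_thickening N K θ
  obtain ⟨M, h1, h2⟩ := exists_cubicCoeff_bound ((isCompact_coeffSet N K θ).cthickening (r := δ)) h
  have e : ((δ.toNNReal : ℝ≥0) : ℝ) = δ := Real.coe_toNNReal δ hδ.le
  refine ⟨δ.toNNReal, M, Real.toNNReal_pos.2 hδ, ?_⟩
  rw [IsCoeffBound, e]
  exact fun C hC => ⟨h C hC, h1 C hC, fun C' hC' => h2 C hC C' hC'⟩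

variable {θ δ : ℝ≥0}

theorem InBall.coeff_mem (h : InBall p q T δ C₀ Φ₀ C Φ) (h₀ : IsAdmissibleData θ C₀ Φ₀) {t : ℝ}
    (ht : t ∈ Set.Icc 0 T) : C t ∈ Metric.cthickening (δ : ℝ) (coeffSet N K θ) := by
  refine Metric.mem_cthickening_of_dist_le _ C₀ _ _ h₀.coeff_mem ?_
  have := h.coeff_le t ht
  rw [dist_eq_norm]
  rw [← ofReal_norm, ← ENNReal.ofReal_coe_nnreal] at this
  exact (ENNReal.ofReal_le_ofReal_iff δ.2).1 this

theorem InBall.curveBound (h : InBall p q T δ C₀ Φ₀ C Φ) (h₀ : IsAdmissibleData θ C₀ Φ₀)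
    (hM : IsCoeffBound N K θ δ M) (hE : IsExponents d p p' q q') :
    CurveBound M (1 + δ + 2 * K) p q T C Φ := by
  have hb : (2 : ℝ≥0∞) * ‖Φ₀‖ₑ ≤ 2 * K := mul_le_mul' le_rfl h₀.orb_le
  refine ⟨h.coeff_meas, h.orb_meas, ?_, ?_, ?_, ?_⟩
  · filter_upwards [ae_restrict_mem measurableSet_Icc] with t ht
    exact (hM _ (h.coeff_mem h₀ ht)).2.1
  · filter_upwards [ae_restrict_mem measurableSet_Icc] with t ht
    have h1 : ‖C₀‖ₑ = 1 := by rw [← ofReal_norm, h₀.coeff_mem.1, ENNReal.ofReal_one]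
    calc ‖C t‖ₑ = ‖C₀ + (C t - C₀)‖ₑ := by rw [add_sub_cancel]
      _ ≤ 1 + δ := (enorm_add_le _ _).trans (add_le_add h1.le (h.coeff_le t ht))
      _ ≤ 1 + δ + 2 * K := le_self_add
      _ = _ := by push_cast; rfl
  · filter_upwards [h.orb_le] with t ht
    refine (ht.trans hb).trans ?_
    push_cast
    exact le_add_left le_rfl
  · refine ne_top_of_le_ne_top ?_ h.mixed_le
    exact ENNReal.mul_ne_top (ENNReal.mul_ne_top ENNReal.ofNat_ne_top (strichartzConst_lt_top hE).ne)
      enorm_ne_top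

theorem InBall.curvePair (h : InBall p q T δ C₀ Φ₀ C Φ) (h' : InBall p q T δ C₀' Φ₀' C' Φ')
    (h₀ : IsAdmissibleData θ C₀ Φ₀) (h₀' : IsAdmissibleData θ C₀' Φ₀')
    (hM : IsCoeffBound N K θ δ M) (hE : IsExponents d p p' q q') :
    CurvePair M (1 + δ + 2 * K) p q 0 T C C' Φ Φ' := by
  refine ⟨h.curveBound h₀ hM hE, h'.curveBound h₀' hM hE, ?_, ?_⟩
  · filter_upwards [ae_restrict_mem measurableSet_Icc] with t ht
    exact (hM _ (h.coeff_mem h₀ ht)).2.2 _ (h'.coeff_mem h₀' ht)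
  · filter_upwards [ae_not_nonpos T] with s hs hs0
    exact (hs hs0).elim

/-- The second curve keeps the coefficients of the first and has vanishing orbitals, so that no
difference of coefficients enters the estimate. -/
theorem InBall.curvePair_zero (h : InBall p q T δ C₀ Φ₀ C Φ) (h₀ : IsAdmissibleData θ C₀ Φ₀)
    (hM : IsCoeffBound N K θ δ M) (hE : IsExponents d p p' q q') :
    CurvePair M (1 + δ + 2 * K) p q 0 T C C Φ 0 := by
  have hb := h.curveBound h₀ hM hE
  refine ⟨hb, ⟨hb.coeff_meas, aestronglyMeasurable_zero, hb.cubic_le, hb.coeff_le, ?_, ?_⟩, ?_, ?_⟩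
  · exact .of_forall fun s => by rw [Pi.zero_apply, enorm_zero]; exact zero_le
  · rw [mixedNorm_zero]; exact ENNReal.zero_ne_top
  · exact .of_forall fun s i t => by rw [sub_self, enorm_zero]; exact zero_le
  · filter_upwards [ae_not_nonpos T] with s hs hs0
    exact (hs hs0).elim

end

/-! ### Choice of the time and the contraction property -/

section

variable {N K : ℕ} {d p p' q q' T : ℝ} {V : ℝ → ℝ} {U : E3 → ℝ}
  {M R : ℝ≥0} {C C' C₁ C₁' : ℝ → Coeff N K} {Φ Φ' Φ₁ Φ₁' : ℝ → L2 (Orb K)} {t₀ t₁ : ℝ}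
  {C₀ C₀' : Coeff N K} {Φ₀ Φ₀' : L2 (Orb K)} {θ δ c : ℝ≥0}

/-- The conclusion of `exists_image_sub_le` for fixed potentials. -/
def ImageEstimate (N K : ℕ) (p q : ℝ) (U : E3 → ℝ) (V : ℝ → ℝ) (M R c : ℝ≥0) : Prop :=
  ∀ (t₀ T : ℝ), 0 < T → 0 ≤ t₀ → t₀ ≤ T → ∀ (C C' C₁ C₁' : ℝ → Coeff N K)
      (Φ Φ' Φ₁ Φ₁' : ℝ → L2 (Orb K)) (C₀ C₀' : Coeff N K) (Φ₀ Φ₀' : L2 (Orb K)),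
      CurvePair M R p q t₀ T C C' Φ Φ' → IsImage T U V C₀ Φ₀ C Φ C₁ Φ₁ →
      IsImage T U V C₀' Φ₀' C' Φ' C₁' Φ₁' → ∀ D : ℝ≥0∞,
      D = c * (.ofReal ((T - t₀) ^ (1 - 2 / p)) * ((1 + (mixedNorm (.ofReal p) (.ofReal q) T Φ +
        mixedNorm (.ofReal p) (.ofReal q) T Φ')) ^ 2 * xNorm p q T (C - C') (Φ - Φ'))) →
      (∀ t ∈ Set.Icc 0 T, ‖C₁ t - C₁' t‖ₑ ≤ ‖C₀ - C₀'‖ₑ + D) ∧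
      (∀ᵐ t ∂(timeMeasure T), ‖Φ₁ t - Φ₁' t‖ₑ ≤ ‖Φ₀ - Φ₀'‖ₑ + D) ∧
      mixedNorm (.ofReal p) (.ofReal q) T (Φ₁ - Φ₁') ≤ strichartzConst p q * ‖Φ₀ - Φ₀'‖ₑ + D

/-- The factor in front of the nonlinear terms on `[0, T]`. -/
def growth (K : ℕ) (p q T : ℝ) (c : ℝ≥0) : ℝ≥0∞ :=
  c * (1 + 4 * strichartzConst p q * K) ^ 2 * .ofReal (T ^ (1 - 2 / p))

/-- The first two inequalities keep the norms of the image in $L^{\infty,2}_T$ and $L^{p,q}_T$ below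
$2\|\Phi_0\|$ and $2\rho\|\Phi_0\|$, the third keeps the coefficients within `δ` of their initial
value, and the last one makes the map a contraction; its factor 3 counts the three norms summed in
`xNorm`. -/
structure IsSmallTime (K : ℕ) (p q : ℝ) (c δ : ℝ≥0) (T : ℝ) : Prop where
  pos : 0 < T
  le_one : growth K p q T c * (2 + 2 * strichartzConst p q) ≤ 1
  le_strichartz : growth K p q T c * (2 + 2 * strichartzConst p q) ≤ strichartzConst p q
  le_radius : growth K p q T c * ((2 + 2 * strichartzConst p q) * K) ≤ δ
  le_half : 3 * growth K p q T c ≤ 1 / 2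

theorem eventually_mul_ofReal_rpow_le {γ : ℝ} (hγ : 0 < γ) {Q η : ℝ≥0∞} (hQ : Q ≠ ∞) (hη : η ≠ 0) :
    ∀ᶠ T in nhdsWithin (0 : ℝ) (Set.Ioi 0), Q * .ofReal (T ^ γ) ≤ η := by
  have h1 : Filter.Tendsto (fun T : ℝ => T ^ γ) (nhdsWithin 0 (Set.Ioi 0)) (nhds 0) := by
    have := (Real.continuousAt_rpow_const 0 γ (.inr hγ.le)).tendsto
    rw [Real.zero_rpow hγ.ne'] at this
    exact this.mono_left nhdsWithin_le_nhds
  have h2 := ENNReal.Tendsto.const_mul (ENNReal.tendsto_ofReal h1) (a := Q) (.inr hQ)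
  rw [ENNReal.ofReal_zero, mul_zero] at h2
  exact h2.eventually_le_const (pos_iff_ne_zero.2 hη)

theorem exists_isSmallTime (K : ℕ) (hE : IsExponents d p p' q q') (c : ℝ≥0) (hδ : 0 < δ) :
    ∃ T, IsSmallTime K p q c δ T := by
  have hρ := (strichartzConst_lt_top hE).ne
  have hρ0 := strichartzConst_ne_zero hE
  have hγ := hE.γ_pos
  have hQ : (c : ℝ≥0∞) * (1 + 4 * strichartzConst p q * K) ^ 2 ≠ ∞ := by finiteness
  have key : ∀ X η : ℝ≥0∞, X ≠ ∞ → η ≠ 0 →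
      ∀ᶠ T in nhdsWithin (0 : ℝ) (Set.Ioi 0), growth K p q T c * X ≤ η := fun X η hX hη => by
    filter_upwards [eventually_mul_ofReal_rpow_le hγ (ENNReal.mul_ne_top hQ hX) hη] with T hT
    refine le_trans (le_of_eq ?_) hT
    rw [growth]; ring
  have hX : (2 + 2 * strichartzConst p q) ≠ ∞ := by finiteness
  have hXK : ((2 + 2 * strichartzConst p q) * K) ≠ ∞ := by finiteness
  obtain ⟨T, h1, h2, h3, h4, h5⟩ := (((key _ 1 hX one_ne_zero).and ((key _ _ hX hρ0).and
    ((key _ δ hXK (by exact_mod_cast hδ.ne')).and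
    ((key 3 (1 / 2) (by finiteness) (by simp)).and self_mem_nhdsWithin)))).exists)
  exact ⟨T, h5, h1, h2, h3, by rwa [mul_comm]⟩

theorem CurveBound.xNorm_ne_top (h : CurveBound M R p q T C Φ) : xNorm p q T C Φ ≠ ∞ :=
  ENNReal.add_ne_top.2 ⟨ne_top_of_le_ne_top ENNReal.coe_ne_top (eLpNorm_coeff_le h.coeff_le),
    ENNReal.add_ne_top.2 ⟨ne_top_of_le_ne_top ENNReal.coe_ne_top (mixedNorm_top_le h.orb_le),
      h.mixed_ne_top⟩⟩

theorem CurveBound.xNorm_sub_ne_top {M' R' : ℝ≥0} (h : CurveBound M R p q T C Φ)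
    (h' : CurveBound M' R' p q T C' Φ') (hp : 1 ≤ p) (hq : 1 ≤ q) :
    xNorm p q T (C - C') (Φ - Φ') ≠ ∞ := by
  refine ENNReal.add_ne_top.2 ⟨ne_top_of_le_ne_top (b := (R + R' : ℝ≥0∞)) (by finiteness)
    (eLpNorm_coeff_le ?_), ENNReal.add_ne_top.2 ⟨ne_top_of_le_ne_top (b := (R + R' : ℝ≥0∞))
    (by finiteness) (mixedNorm_top_le ?_), ne_top_of_le_ne_top
    (ENNReal.add_ne_top.2 ⟨h.mixed_ne_top, h'.mixed_ne_top⟩)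
    (mixedNorm_sub_le hp hq h.orb_meas h'.orb_meas)⟩⟩
  · filter_upwards [h.coeff_le, h'.coeff_le] with s h1 h2
    exact enorm_sub_le.trans (add_le_add h1 h2)
  · filter_upwards [h.orb_le, h'.orb_le] with s h1 h2
    exact enorm_sub_le.trans (add_le_add h1 h2)

theorem InBall.image (h : InBall p q T δ C₀ Φ₀ C Φ) (h₀ : IsAdmissibleData θ C₀ Φ₀)
    (hE : IsExponents d p p' q q') (hV : MemLp (fun x : E3 => V ‖x‖) (.ofReal d) volume)
    (hM : IsCoeffBound N K θ δ M) (hc : ImageEstimate N K p q U V M (1 + δ + 2 * K) c)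
    (hT : IsSmallTime K p q c δ T) (hC₁ : AEStronglyMeasurable C₁ (timeMeasure T))
    (hI : IsImage T U V C₀ Φ₀ C Φ C₁ Φ₁) : InBall p q T δ C₀ Φ₀ C₁ Φ₁ := by
  -- Comparison with vanishing orbitals and datum, whose image has the constant coefficients `C₀`:
  -- the conclusions bound `C₁ - C₀` and `Φ₁` themselves.
  obtain ⟨h1, h2, h3⟩ := hc 0 T hT.pos le_rfl hT.pos.le C C C₁ (fun _ => C₀) Φ 0 Φ₁ 0 C₀ C₀ Φ₀ 0
    (h.curvePair_zero h₀ hM hE) hI (isImage_zero hE hV U T C₀ C) _ rfl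
  set ρ := strichartzConst p q
  set m := mixedNorm (.ofReal p) (.ofReal q) T Φ
  have hx : xNorm p q T (C - C) (Φ - 0) ≤ (2 + 2 * ρ) * ‖Φ₀‖ₑ := by
    rw [sub_self, sub_zero, xNorm, eLpNorm_zero, zero_add, add_mul]
    exact add_le_add (mixedNorm_top_le h.orb_le) h.mixed_le
  have hm : 1 + (m + mixedNorm (.ofReal p) (.ofReal q) T (0 : ℝ → L2 (Orb K))) ≤ 1 + 4 * ρ * K := by
    rw [mixedNorm_zero, add_zero]
    refine add_le_add le_rfl (h.mixed_le.trans (mul_le_mul' (mul_le_mul' ?_ le_rfl) h₀.orb_le))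
    norm_num
  have hD : c * (.ofReal ((T - 0) ^ (1 - 2 / p)) *
      ((1 + (m + mixedNorm (.ofReal p) (.ofReal q) T (0 : ℝ → L2 (Orb K)))) ^ 2 *
        xNorm p q T (C - C) (Φ - 0))) ≤ growth K p q T c * (2 + 2 * ρ) * ‖Φ₀‖ₑ := by
    rw [sub_zero]
    calc _ ≤ c * (.ofReal (T ^ (1 - 2 / p)) * ((1 + 4 * ρ * K) ^ 2 * ((2 + 2 * ρ) * ‖Φ₀‖ₑ))) := by
          gcongr
      _ = _ := by rw [growth]; ring
  rw [sub_zero] at h2 h3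
  refine ⟨hC₁, hI.orb_meas, fun t ht => ?_, ?_, ?_⟩
  · refine (h1 t ht).trans ?_
    rw [sub_self, enorm_zero, zero_add]
    refine hD.trans (le_trans ?_ hT.le_radius)
    rw [mul_assoc]
    gcongr
    exact h₀.orb_le
  · filter_upwards [h2] with t ht
    rw [Pi.zero_apply, sub_zero] at ht
    refine ht.trans ?_
    rw [two_mul]
    refine add_le_add le_rfl (hD.trans ?_)
    exact (mul_le_mul' hT.le_one le_rfl).trans (one_mul _).le
  · rw [sub_zero] at h3
    refine h3.trans ?_
    rw [mul_assoc, two_mul]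
    exact add_le_add le_rfl (hD.trans (mul_le_mul' hT.le_strichartz le_rfl))

/-- The integral equations define a contraction up to the difference of the data. -/
theorem InBall.image_sub_le (h : InBall p q T δ C₀ Φ₀ C Φ) (h' : InBall p q T δ C₀' Φ₀' C' Φ')
    (h₀ : IsAdmissibleData θ C₀ Φ₀) (h₀' : IsAdmissibleData θ C₀' Φ₀')
    (hE : IsExponents d p p' q q') (hM : IsCoeffBound N K θ δ M)
    (hc : ImageEstimate N K p q U V M (1 + δ + 2 * K) c)
    (hT : IsSmallTime K p q c δ T)
    (hI : IsImage T U V C₀ Φ₀ C Φ C₁ Φ₁) (hI' : IsImage T U V C₀' Φ₀' C' Φ' C₁' Φ₁') :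
    (∀ t ∈ Set.Icc 0 T, ‖C₁ t - C₁' t‖ₑ ≤
      ‖C₀ - C₀'‖ₑ + growth K p q T c * xNorm p q T (C - C') (Φ - Φ')) ∧
    (∀ᵐ t ∂(timeMeasure T), ‖Φ₁ t - Φ₁' t‖ₑ ≤
      ‖Φ₀ - Φ₀'‖ₑ + growth K p q T c * xNorm p q T (C - C') (Φ - Φ')) ∧
    xNorm p q T (C₁ - C₁') (Φ₁ - Φ₁') ≤ ‖C₀ - C₀'‖ₑ + (1 + strichartzConst p q) * ‖Φ₀ - Φ₀'‖ₑ +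
      1 / 2 * xNorm p q T (C - C') (Φ - Φ') := by
  obtain ⟨h1, h2, h3⟩ := hc 0 T hT.pos le_rfl hT.pos.le C C' C₁ C₁' Φ Φ' Φ₁ Φ₁' C₀ C₀' Φ₀ Φ₀'
    (h.curvePair h' h₀ h₀' hM hE) hI hI' _ rfl
  set ρ := strichartzConst p q
  set x := xNorm p q T (C - C') (Φ - Φ')
  have hD : c * (.ofReal ((T - 0) ^ (1 - 2 / p)) * ((1 + (mixedNorm (.ofReal p) (.ofReal q) T Φ +
        mixedNorm (.ofReal p) (.ofReal q) T Φ')) ^ 2 * x)) ≤ growth K p q T c * x := by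
    have hb : ∀ {C : ℝ → Coeff N K} {Φ C₀ Φ₀}, InBall p q T δ C₀ Φ₀ C Φ →
        IsAdmissibleData θ C₀ Φ₀ → mixedNorm (.ofReal p) (.ofReal q) T Φ ≤ 2 * ρ * K := fun h h₀ =>
      h.mixed_le.trans (mul_le_mul' le_rfl h₀.orb_le)
    rw [sub_zero]
    -- Each of the two mixed norms is at most `2 ρ K`, whence the `4 ρ K` in `growth`.
    calc _ ≤ c * (.ofReal (T ^ (1 - 2 / p)) * ((1 + (2 * ρ * K + 2 * ρ * K)) ^ 2 * x)) := by
          gcongr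
          · exact hb h h₀
          · exact hb h' h₀'
      _ = _ := by rw [growth]; ring
  have h1' : ∀ t ∈ Set.Icc 0 T, ‖C₁ t - C₁' t‖ₑ ≤ ‖C₀ - C₀'‖ₑ + growth K p q T c * x :=
    fun t ht => (h1 t ht).trans (add_le_add le_rfl hD)
  have h2' : ∀ᵐ t ∂(timeMeasure T), ‖Φ₁ t - Φ₁' t‖ₑ ≤ ‖Φ₀ - Φ₀'‖ₑ + growth K p q T c * x := by
    filter_upwards [h2] with t ht
    exact ht.trans (add_le_add le_rfl hD)
  refine ⟨h1', h2', (xNorm_le h1' h2' (h3.trans (add_le_add le_rfl hD))).trans ?_⟩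
  calc _ = ‖C₀ - C₀'‖ₑ + (1 + ρ) * ‖Φ₀ - Φ₀'‖ₑ + 3 * growth K p q T c * x := by ring
    _ ≤ _ := add_le_add le_rfl (mul_le_mul' hT.le_half le_rfl)

theorem inBall_const (T : ℝ) (δ : ℝ≥0) (C₀ : Coeff N K) (Φ₀ : L2 (Orb K)) :
    InBall p q T δ C₀ Φ₀ (fun _ => C₀) 0 := by
  refine ⟨aestronglyMeasurable_const, aestronglyMeasurable_zero, fun t _ => ?_,
    .of_forall fun t => ?_, ?_⟩
  · rw [sub_self, enorm_zero]; exact zero_le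
  · rw [Pi.zero_apply, enorm_zero]; exact zero_le
  · rw [mixedNorm_zero]; exact zero_le

end

/-! ### Successive approximations and their limit -/

section

variable {N K : ℕ} {d p p' q q' T : ℝ} {V : ℝ → ℝ} {U : E3 → ℝ}
  {M R : ℝ≥0} {C C' C₁ C₁' : ℝ → Coeff N K} {Φ Φ' Φ₁ Φ₁' : ℝ → L2 (Orb K)} {t₀ t₁ : ℝ}
  {C₀ C₀' : Coeff N K} {Φ₀ Φ₀' : L2 (Orb K)} {θ δ c : ℝ≥0}

/-- The successive approximations. -/
theorem exists_iteration (h₀ : IsAdmissibleData θ C₀ Φ₀) (hE : IsExponents d p p' q q')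
    (hU : MemLp U (.ofReal d) volume) (hV : MemLp (fun x : E3 => V ‖x‖) (.ofReal d) volume)
    (hM : IsCoeffBound N K θ δ M) (hc : ImageEstimate N K p q U V M (1 + δ + 2 * K) c)
    (hT : IsSmallTime K p q c δ T) :
    ∃ (C : ℕ → ℝ → Coeff N K) (Φ : ℕ → ℝ → L2 (Orb K)),
      (∀ n, InBall p q T δ C₀ Φ₀ (C n) (Φ n)) ∧
      ∀ n, IsImage T U V C₀ Φ₀ (C n) (Φ n) (C (n + 1)) (Φ (n + 1)) := by
  have step : ∀ z : {z : (ℝ → Coeff N K) × (ℝ → L2 (Orb K)) // InBall p q T δ C₀ Φ₀ z.1 z.2},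
      ∃ w : {z : (ℝ → Coeff N K) × (ℝ → L2 (Orb K)) // InBall p q T δ C₀ Φ₀ z.1 z.2},
        IsImage T U V C₀ Φ₀ z.1.1 z.1.2 w.1.1 w.1.2 := by
    rintro ⟨⟨C, Φ⟩, h⟩
    obtain ⟨C₁, Φ₁, hm, hI⟩ := (h.curveBound h₀ hM hE).exists_image hE hT.pos hU hV C₀ Φ₀
    exact ⟨⟨(C₁, Φ₁), h.image h₀ hE hV hM hc hT hm hI⟩, hI⟩
  choose G hG using step
  let z : ℕ → {z : (ℝ → Coeff N K) × (ℝ → L2 (Orb K)) // InBall p q T δ C₀ Φ₀ z.1 z.2} :=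
    fun n => G^[n] ⟨(fun _ => C₀, 0), inBall_const T δ C₀ Φ₀⟩
  refine ⟨fun n => (z n).1.1, fun n => (z n).1.2, fun n => (z n).2, fun n => ?_⟩
  have hz : z (n + 1) = G (z n) := Function.iterate_succ_apply' _ _ _
  simp only [hz]
  exact hG (z n)

theorem tendsto_div_two_pow {x : ℝ≥0∞} (hx : x ≠ ∞) :
    Filter.Tendsto (fun n : ℕ => x / 2 ^ n) Filter.atTop (nhds 0) := by
  have h := ENNReal.Tendsto.const_mul (a := x)
    (ENNReal.tendsto_pow_atTop_nhds_zero_of_lt_one (r := 2⁻¹) (by norm_num)) (.inr hx)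
  rw [mul_zero] at h
  refine h.congr fun n => ?_
  rw [div_eq_mul_inv, ENNReal.inv_pow]

theorem tendsto_of_enorm_sub_le {X : Type} [NormedAddCommGroup X] {f : ℕ → X} {a : X}
    {e : ℕ → ℝ≥0∞} (he : Filter.Tendsto e Filter.atTop (nhds 0)) (h : ∀ n, ‖f n - a‖ₑ ≤ e n) :
    Filter.Tendsto f Filter.atTop (nhds a) := by
  rw [tendsto_iff_edist_tendsto_0]
  simp_rw [edist_eq_enorm_sub]
  exact tendsto_of_tendsto_of_tendsto_of_le_of_le tendsto_const_nhds he (fun _ => zero_le) h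

theorem exists_limit_of_enorm_sub_le {X : Type} [NormedAddCommGroup X] [CompleteSpace X] {f : ℕ → X}
    {D : ℝ≥0∞} (hD : D ≠ ∞) (h : ∀ n, ‖f (n + 1) - f n‖ₑ ≤ D / 2 ^ n) :
    ∃ a, Filter.Tendsto f Filter.atTop (nhds a) ∧ ∀ n, ‖f n - a‖ₑ ≤ 2 * D / 2 ^ n := by
  have h' : ∀ n, edist (f n) (f (n + 1)) ≤ D / 2 ^ n := fun n => by
    rw [edist_comm, edist_eq_enorm_sub]; exact h n
  obtain ⟨a, ha⟩ := cauchySeq_tendsto_of_complete (cauchySeq_of_edist_le_geometric_two D hD h')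
  refine ⟨a, ha, fun n => ?_⟩
  rw [← edist_eq_enorm_sub]
  exact edist_le_of_edist_le_geometric_two_of_tendsto D h' ha n

theorem mixedNorm_sub_le_of_geometric (hp : 1 ≤ p) (hq : 1 ≤ q) {u : ℕ → ℝ → L2 (Orb K)}
    (hu : ∀ n, AEStronglyMeasurable (u n) (timeMeasure T)) {D : ℝ≥0∞}
    (h : ∀ n, mixedNorm (.ofReal p) (.ofReal q) T (u (n + 1) - u n) ≤ D / 2 ^ n) (k n : ℕ) :
    mixedNorm (.ofReal p) (.ofReal q) T (u (n + k) - u n) ≤ 2 * D / 2 ^ n := by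
  induction k generalizing n with
  | zero => rw [add_zero, sub_self, mixedNorm_zero]; exact zero_le
  | succ k ih =>
    have e : u (n + (k + 1)) - u n = (u (n + 1 + k) - u (n + 1)) + (u (n + 1) - u n) := by
      rw [sub_add_sub_cancel, add_assoc, add_comm 1 k]
    rw [e]
    refine (mixedNorm_add_le hp hq ((hu _).sub (hu _)) ((hu _).sub (hu _))).trans
      ((add_le_add (ih (n + 1)) (h n)).trans (le_of_eq ?_))
    have h2 : 2 * D / 2 ^ (n + 1) = D / 2 ^ n := by
      rw [pow_succ', ENNReal.mul_div_mul_left _ _ two_ne_zero ENNReal.ofNat_ne_top]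
    rw [h2, ← two_mul, mul_div_assoc]

/-- The limit of the successive approximations is a fixed point. -/
theorem exists_fixedPoint (h₀ : IsAdmissibleData θ C₀ Φ₀) (hE : IsExponents d p p' q q')
    (hU : MemLp U (.ofReal d) volume) (hV : MemLp (fun x : E3 => V ‖x‖) (.ofReal d) volume)
    (hM : IsCoeffBound N K θ δ M) (hc : ImageEstimate N K p q U V M (1 + δ + 2 * K) c)
    (hT : IsSmallTime K p q c δ T) :
    ∃ (C : ℝ → Coeff N K) (Φ : ℝ → L2 (Orb K)),
      InBall p q T δ C₀ Φ₀ C Φ ∧ IsImage T U V C₀ Φ₀ C Φ C Φ := by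
  have hp0 := hE.p_pos
  have hp1 : 1 ≤ p := by linarith [hE.p_gt]
  have hq1 : 1 ≤ q := by linarith [hE.q_gt]
  obtain ⟨C, Φ, hB, hI⟩ := exists_iteration h₀ hE hU hV hM hc hT
  set X : ℕ → ℝ≥0∞ := fun n => xNorm p q T (C (n + 1) - C n) (Φ (n + 1) - Φ n) with hX
  have hX0 : X 0 ≠ ∞ := ((hB 1).curveBound h₀ hM hE).xNorm_sub_ne_top
    ((hB 0).curveBound h₀ hM hE) hp1 hq1
  have hest := fun n => (hB (n + 1)).image_sub_le (hB n) h₀ h₀ hE hM hc hT (hI (n + 1)) (hI n)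
  -- All iterates have the same data, so only the contraction term of the difference estimate
  -- survives.
  have hXs : ∀ n, X n ≤ X 0 / 2 ^ n := by
    intro n
    induction n with
    | zero => simp
    | succ n ih =>
      have h1 := (hest n).2.2
      rw [sub_self, sub_self, enorm_zero, enorm_zero, mul_zero, zero_add, zero_add] at h1
      refine h1.trans ((mul_le_mul' le_rfl ih).trans (le_of_eq ?_))
      rw [pow_succ', one_div, div_eq_mul_inv, div_eq_mul_inv, ENNReal.mul_inv (.inl two_ne_zero)
        (.inl ENNReal.ofNat_ne_top)]
      ring
  have hg1 : growth K p q T c ≤ 1 := by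
    refine le_trans ?_ hT.le_one
    calc growth K p q T c = growth K p q T c * 1 := (mul_one _).symm
      _ ≤ _ := mul_le_mul' le_rfl (le_trans (by norm_num) le_self_add)
  have hgX : ∀ x, growth K p q T c * x ≤ x := fun x => (mul_le_mul' hg1 le_rfl).trans (one_mul x).le
  -- The bounds at single times concern images of curves, so the index is shifted by one: the
  -- members from the first on are images of the preceding ones.
  have hCs : ∀ t ∈ Set.Icc 0 T, ∀ n, ‖C (n + 1 + 1) t - C (n + 1) t‖ₑ ≤ X 0 / 2 ^ n := by
    intro t ht n
    have h1 := (hest n).1 t ht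
    rw [sub_self, enorm_zero, zero_add] at h1
    exact h1.trans ((hgX _).trans (hXs n))
  -- The exceptional times depend on `n`, but a countable union of null sets is null. Convergence
  -- thus holds at almost every time in `L²`, and no completeness of the mixed-norm space is used.
  have hΦs : ∀ᵐ t ∂(timeMeasure T), ∀ n, ‖Φ (n + 1 + 1) t - Φ (n + 1) t‖ₑ ≤ X 0 / 2 ^ n := by
    refine ae_all_iff.2 fun n => ?_
    filter_upwards [(hest n).2.1] with t ht
    rw [sub_self, enorm_zero, zero_add] at ht
    exact ht.trans ((hgX _).trans (hXs n))
  have hms : ∀ n, mixedNorm (.ofReal p) (.ofReal q) T (Φ (n + 1 + 1) - Φ (n + 1)) ≤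
      X 0 / 2 ^ n := fun n => by
    refine le_trans ?_ ((hXs (n + 1)).trans (ENNReal.div_le_div_left ?_ _))
    · exact (le_add_left le_rfl : _ ≤ _ + mixedNorm _ _ _ _).trans (le_add_left le_rfl)
    · exact pow_le_pow_right₀ (by norm_num) (Nat.le_succ n)
  have hCl : ∀ t, ∃ a, t ∈ Set.Icc 0 T → Filter.Tendsto (fun n => C (n + 1) t) Filter.atTop (nhds a) ∧
      ∀ n, ‖C (n + 1) t - a‖ₑ ≤ 2 * X 0 / 2 ^ n := fun t => by
    by_cases ht : t ∈ Set.Icc 0 T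
    · obtain ⟨a, ha⟩ := exists_limit_of_enorm_sub_le (f := fun n => C (n + 1) t) hX0 (hCs t ht)
      exact ⟨a, fun _ => ha⟩
    · exact ⟨0, fun h => (ht h).elim⟩
  choose C' hC' using hCl
  obtain ⟨Φ', -, hΦ'⟩ := exists_stronglyMeasurable_limit_of_tendsto_ae
    (fun n => (hB (n + 1)).orb_meas) (hΦs.mono fun t ht =>
      (exists_limit_of_enorm_sub_le (f := fun n => Φ (n + 1) t) hX0 ht).imp fun a ha => ha.1)
  have hΦ'' : ∀ᵐ t ∂(timeMeasure T), ∀ n, ‖Φ (n + 1) t - Φ' t‖ₑ ≤ 2 * X 0 / 2 ^ n := by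
    filter_upwards [hΦ', hΦs] with t h1 h2
    obtain ⟨a, ha, hb⟩ := exists_limit_of_enorm_sub_le (f := fun n => Φ (n + 1) t) hX0 h2
    rwa [tendsto_nhds_unique h1 ha]
  have hΦm : AEStronglyMeasurable Φ' (timeMeasure T) :=
    aestronglyMeasurable_of_tendsto_ae _ (fun n => (hB (n + 1)).orb_meas) hΦ'
  -- The ball is closed under this convergence: the pointwise bounds pass to the limit and the mixed
  -- norm is lower semicontinuous.
  have hBall : InBall p q T δ C₀ Φ₀ C' Φ' := by
    refine ⟨?_, hΦm, fun t ht => ?_, ?_, ?_⟩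
    · refine aestronglyMeasurable_of_tendsto_ae Filter.atTop (fun n => (hB (n + 1)).coeff_meas) ?_
      filter_upwards [ae_restrict_mem measurableSet_Icc] with t ht
      exact (hC' t ht).1
    · exact le_of_tendsto ((hC' t ht).1.sub_const C₀).enorm
        (.of_forall fun n => (hB (n + 1)).coeff_le t ht)
    · filter_upwards [hΦ', ae_all_iff.2 fun n => (hB (n + 1)).orb_le] with t h1 h2
      exact le_of_tendsto h1.enorm (.of_forall h2)
    · exact mixedNorm_le_of_tendsto hp0 (fun n => (hB (n + 1)).orb_meas) hΦ'
        (.of_forall fun n => (hB (n + 1)).mixed_le)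
  have hmix : ∀ n, mixedNorm (.ofReal p) (.ofReal q) T (Φ' - Φ (n + 1)) ≤ 2 * X 0 / 2 ^ n := by
    intro n
    refine mixedNorm_le_of_tendsto hp0 (u := fun k => Φ (n + k + 1) - Φ (n + 1))
      (fun k => (hB _).orb_meas.sub (hB _).orb_meas) ?_ (.of_forall fun k =>
      mixedNorm_sub_le_of_geometric hp1 hq1 (u := fun n => Φ (n + 1)) (fun n => (hB _).orb_meas)
        hms k n)
    filter_upwards [hΦ'] with t ht
    have h1 := ht.comp (Filter.tendsto_add_atTop_nat n)
    refine Filter.Tendsto.sub_const (h1.congr fun k => ?_) _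
    rw [Function.comp_apply, add_comm k n]
  -- The factor 6 collects a factor 2 from the geometric series for each of the three norms.
  have hxn : ∀ n, xNorm p q T (C' - C (n + 1)) (Φ' - Φ (n + 1)) ≤ 6 * X 0 / 2 ^ n := by
    intro n
    have h1 : ∀ t ∈ Set.Icc 0 T, ‖(C' - C (n + 1)) t‖ₑ ≤ 2 * X 0 / 2 ^ n := fun t ht => by
      rw [Pi.sub_apply, ← enorm_neg, neg_sub]; exact (hC' t ht).2 n
    have h2 : ∀ᵐ t ∂(timeMeasure T), ‖(Φ' - Φ (n + 1)) t‖ₑ ≤ 2 * X 0 / 2 ^ n := by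
      filter_upwards [hΦ''] with t ht
      rw [Pi.sub_apply, ← enorm_neg, neg_sub]; exact ht n
    refine (xNorm_le h1 h2 (hmix n)).trans (le_of_eq ?_)
    simp_rw [div_eq_mul_inv]
    ring
  -- By the difference estimate the iterates also converge to the image of the limit. Both limits
  -- agree, for the coefficients at every time and for the orbitals at almost every time.
  obtain ⟨C₁, Φ₁, hm, hI₁⟩ := (hBall.curveBound h₀ hM hE).exists_image hE hT.pos hU hV C₀ Φ₀
  have hest' := fun n => (hBall.image_sub_le (hB (n + 1)) h₀ h₀ hE hM hc hT hI₁ (hI (n + 1)))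
  have h6 : Filter.Tendsto (fun n : ℕ => 6 * X 0 / 2 ^ n) Filter.atTop (nhds 0) :=
    tendsto_div_two_pow (ENNReal.mul_ne_top ENNReal.ofNat_ne_top hX0)
  have hCeq : ∀ t ∈ Set.Icc 0 T, C' t = C₁ t := by
    intro t ht
    refine tendsto_nhds_unique ((hC' t ht).1.comp (Filter.tendsto_add_atTop_nat 1))
      (tendsto_of_enorm_sub_le h6 fun n => ?_)
    have h1 := (hest' n).1 t ht
    rw [sub_self, enorm_zero, zero_add] at h1
    rw [Function.comp_apply, ← enorm_neg, neg_sub]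
    exact h1.trans ((hgX _).trans (hxn n))
  have hΦeq : ∀ᵐ t ∂(timeMeasure T), Φ' t = Φ₁ t := by
    filter_upwards [hΦ', ae_all_iff.2 fun n => (hest' n).2.1] with t h1 h2
    refine tendsto_nhds_unique (h1.comp (Filter.tendsto_add_atTop_nat 1))
      (tendsto_of_enorm_sub_le h6 fun n => ?_)
    have h3 := h2 n
    rw [sub_self, enorm_zero, zero_add] at h3
    rw [Function.comp_apply, ← enorm_neg, neg_sub]
    exact h3.trans ((hgX _).trans (hxn n))
  refine ⟨C', Φ', hBall, hΦm, fun t ht => ?_, ?_⟩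
  · rw [hCeq t ht]; exact hI₁.coeff_eq t ht
  · filter_upwards [hI₁.orbital_eq, hΦeq] with t h1 h2
    rw [h2]; exact h1

theorem InBall.isSolution (h : InBall p q T δ C₀ Φ₀ C Φ) (h₀ : IsAdmissibleData θ C₀ Φ₀)
    (hI : IsImage T U V C₀ Φ₀ C Φ C Φ) (hE : IsExponents d p p' q q') (hT : 0 < T)
    (hV : MemLp (fun x : E3 => V ‖x‖) (.ofReal d) volume) (hM : IsCoeffBound N K θ δ M) :
    IsSolution p q T U V C₀ Φ₀ C Φ := by
  have hb := h.curveBound h₀ hM hE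
  refine ⟨⟨h.coeff_meas, h.orb_meas, hb.xNorm_ne_top.lt_top⟩,
    fun t ht => (hM _ (h.coeff_mem h₀ ht)).1, ?_, hI.coeff_eq, hI.orbital_eq⟩
  rw [intervalIntegrable_iff_integrableOn_Icc_of_le hT.le]
  exact hb.integrable_kForce hE hT hV

end

/-! ### Uniqueness, dependence on the data, and the exponents -/

section

variable {N K : ℕ} {d p p' q q' T : ℝ} {V : ℝ → ℝ} {U : E3 → ℝ}
  {M R : ℝ≥0} {C C' C₁ C₁' : ℝ → Coeff N K} {Φ Φ' Φ₁ Φ₁' : ℝ → L2 (Orb K)} {t₀ t₁ : ℝ}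
  {C₀ C₀' : Coeff N K} {Φ₀ Φ₀' : L2 (Orb K)} {θ δ c : ℝ≥0}

theorem timeMeasure_mono (h : t₁ ≤ T) : timeMeasure t₁ ≤ timeMeasure T :=
  Measure.restrict_mono_set _ (Set.Icc_subset_Icc_right h)

theorem mixedNorm_mono_time {F : Type} [NormedAddCommGroup F] {p q : ℝ≥0∞} (h : t₁ ≤ T)
    (u : ℝ → L2 F) : mixedNorm p q t₁ u ≤ mixedNorm p q T u :=
  eLpNorm_mono_measure _ (timeMeasure_mono h)

theorem CurveBound.mono (h : CurveBound M R p q T C Φ) (ht : t₁ ≤ T) :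
    CurveBound M R p q t₁ C Φ :=
  have hm := timeMeasure_mono ht
  ⟨h.coeff_meas.mono_measure hm, h.orb_meas.mono_measure hm, ae_mono hm h.cubic_le,
    ae_mono hm h.coeff_le, ae_mono hm h.orb_le,
    ne_top_of_le_ne_top h.mixed_ne_top (mixedNorm_mono_time ht Φ)⟩

theorem IsSolution.isImage (h : IsSolution p q T U V C₀ Φ₀ C Φ) (ht : t₁ ≤ T) :
    IsImage t₁ U V C₀ Φ₀ C Φ C Φ :=
  ⟨h.mem.orbital_meas.mono_measure (timeMeasure_mono ht),
    fun t htm => h.coeff_eq t ⟨htm.1, htm.2.trans ht⟩, ae_mono (timeMeasure_mono ht) h.orbital_eq⟩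

/-- The coefficient equation, valid at every time, represents `C` as a primitive. The resulting
compactness of its range yields bounds for the inverse density matrix. -/
theorem IsSolution.continuousOn (h : IsSolution p q T U V C₀ Φ₀ C Φ) (hT : 0 ≤ T) :
    ContinuousOn C (Set.Icc 0 T) := by
  have h1 := intervalIntegral.continuousOn_primitive_interval (μ := volume) (a := (0 : ℝ)) (b := T)
    (f := fun s => kForce V (C s) (Φ s)) (by
      rw [Set.uIcc_of_le hT]
      exact (intervalIntegrable_iff_integrableOn_Icc_of_le hT).1 h.coeff_integrable)
  rw [Set.uIcc_of_le hT] at h1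
  exact (continuousOn_sub_smul continuousOn_const h1 Complex.I).congr h.coeff_eq

theorem IsSolution.exists_bound (h : IsSolution p q T U V C₀ Φ₀ C Φ) :
    ∃ R : ℝ≥0, (∀ᵐ s ∂(timeMeasure T), ‖C s‖ₑ ≤ R) ∧ (∀ᵐ s ∂(timeMeasure T), ‖Φ s‖ₑ ≤ R) ∧
      mixedNorm (.ofReal p) (.ofReal q) T Φ ≠ ∞ := by
  have hx := h.mem.norm_lt_top.ne
  refine ⟨(xNorm p q T C Φ).toNNReal, ?_, ?_, ?_⟩
  · filter_upwards [enorm_coeff_add_orb_le (T := T) C Φ] with s hs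
    rw [ENNReal.coe_toNNReal hx, xNorm, ← add_assoc]
    exact (le_self_add.trans hs).trans le_self_add
  · filter_upwards [enorm_coeff_add_orb_le (T := T) C Φ] with s hs
    rw [ENNReal.coe_toNNReal hx, xNorm, ← add_assoc]
    exact ((le_add_left le_rfl).trans hs).trans le_self_add
  · exact ne_top_of_le_ne_top hx ((le_add_left le_rfl : _ ≤ mixedNorm ∞ 2 T Φ + _).trans
      (le_add_left le_rfl))

/-- The coefficients of both solutions range over a compact set on which the density matrix is
invertible, so the cubic coefficients are bounded and Lipschitz there. The constants depend on the
solutions, which is harmless for uniqueness; neither solution is assumed to stay in the ball. -/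
theorem IsSolution.exists_curveBound (h : IsSolution p q T U V C₀ Φ₀ C Φ)
    (h' : IsSolution p q T U V C₀' Φ₀' C' Φ') (hT : 0 ≤ T) :
    ∃ M R : ℝ≥0, CurveBound M R p q T C Φ ∧ CurveBound M R p q T C' Φ' ∧
      ∀ᵐ s ∂(timeMeasure T), ∀ i t,
        ‖cubicCoeff (C s) i t - cubicCoeff (C' s) i t‖ₑ ≤ M * ‖C s - C' s‖ₑ := by
  obtain ⟨R, h1, h2, h3⟩ := h.exists_bound
  obtain ⟨R', h1', h2', h3'⟩ := h'.exists_bound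
  obtain ⟨M, hM, hM'⟩ := exists_cubicCoeff_bound (E := C '' Set.Icc 0 T ∪ C' '' Set.Icc 0 T)
    ((isCompact_Icc.image_of_continuousOn (h.continuousOn hT)).union
      (isCompact_Icc.image_of_continuousOn (h'.continuousOn hT))) (by
      rintro _ (⟨t, ht, rfl⟩ | ⟨t, ht, rfl⟩)
      · exact h.full_rank t ht
      · exact h'.full_rank t ht)
  have hR : (R : ℝ≥0∞) ≤ (R + R' : ℝ≥0) := ENNReal.coe_le_coe.2 le_self_add
  have hR' : (R' : ℝ≥0∞) ≤ (R + R' : ℝ≥0) := ENNReal.coe_le_coe.2 (le_add_left le_rfl)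
  have hmem : ∀ᵐ s ∂(timeMeasure T), C s ∈ C '' Set.Icc 0 T ∪ C' '' Set.Icc 0 T ∧
      C' s ∈ C '' Set.Icc 0 T ∪ C' '' Set.Icc 0 T := by
    filter_upwards [ae_restrict_mem measurableSet_Icc] with s hs
    exact ⟨.inl ⟨s, hs, rfl⟩, .inr ⟨s, hs, rfl⟩⟩
  exact ⟨M, R + R', ⟨h.mem.coeff_meas, h.mem.orbital_meas, hmem.mono fun s hs => hM _ hs.1,
      h1.mono fun s hs => hs.trans hR, h2.mono fun s hs => hs.trans hR, h3⟩,
    ⟨h'.mem.coeff_meas, h'.mem.orbital_meas, hmem.mono fun s hs => hM _ hs.2,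
      h1'.mono fun s hs => hs.trans hR', h2'.mono fun s hs => hs.trans hR', h3'⟩,
    hmem.mono fun s hs => hM' _ hs.1 _ hs.2⟩

/-- Two solutions that agree up to some time agree a little longer. -/
theorem IsSolution.exists_step (hE : IsExponents d p p' q q') (hT : 0 < T)
    (hU : MemLp U (.ofReal d) volume) (hV : MemLp (fun x : E3 => V ‖x‖) (.ofReal d) volume)
    (h : IsSolution p q T U V C₀ Φ₀ C Φ) (h' : IsSolution p q T U V C₀ Φ₀ C' Φ') :
    ∃ τ : ℝ, 0 < τ ∧ ∀ t₀ t₁, 0 ≤ t₀ → t₀ ≤ t₁ → 0 < t₁ → t₁ ≤ T → t₁ - t₀ ≤ τ →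
      (∀ᵐ s ∂(timeMeasure T), s ≤ t₀ → C s = C' s ∧ Φ s = Φ' s) →
      ∀ᵐ s ∂(timeMeasure T), s ≤ t₁ → C s = C' s ∧ Φ s = Φ' s := by
  have hp1 : 1 ≤ p := by linarith [hE.p_gt]
  have hq1 : 1 ≤ q := by linarith [hE.q_gt]
  obtain ⟨M, R, hb, hb', hM⟩ := h.exists_curveBound h' hT.le
  obtain ⟨c, hc⟩ := exists_image_sub_le N K hE (eLpNorm U (.ofReal d) volume).toNNReal
    (eLpNorm (fun x : E3 => V ‖x‖) (.ofReal d) volume).toNNReal M R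
  replace hc := hc U V hU hV (ENNReal.coe_toNNReal hU.2.ne).symm.le
    (ENNReal.coe_toNNReal hV.2.ne).symm.le
  set m := mixedNorm (.ofReal p) (.ofReal q) T Φ + mixedNorm (.ofReal p) (.ofReal q) T Φ'
  have hm : m ≠ ∞ := ENNReal.add_ne_top.2 ⟨hb.mixed_ne_top, hb'.mixed_ne_top⟩
  have hQ : 3 * c * (1 + m) ^ 2 ≠ ∞ := by finiteness
  -- The step length depends on the two solutions over all of `[0, T]`, but not on `t₀`, so that
  -- finitely many steps suffice. The factor 3 again counts the norms in `xNorm`.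
  obtain ⟨τ, hτ, hτ0⟩ := ((eventually_mul_ofReal_rpow_le hE.γ_pos hQ (η := 1 / 2) (by simp)).and
    self_mem_nhdsWithin).exists
  refine ⟨τ, hτ0, fun t₀ t₁ ht₀ ht ht₁ ht₁T hle hag => ?_⟩
  set D := xNorm p q t₁ (C - C') (Φ - Φ') with hD
  have hP : CurvePair M R p q t₀ t₁ C C' Φ Φ' :=
    ⟨hb.mono ht₁T, hb'.mono ht₁T, ae_mono (timeMeasure_mono ht₁T) hM,
      ae_mono (timeMeasure_mono ht₁T) hag⟩
  obtain ⟨h1, h2, h3⟩ := hc t₀ t₁ ht₁ ht₀ ht C C' C C' Φ Φ' Φ Φ' C₀ C₀ Φ₀ Φ₀ hP (h.isImage ht₁T)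
    (h'.isImage ht₁T) _ rfl
  rw [sub_self, enorm_zero, zero_add] at h1 h2
  rw [sub_self, enorm_zero, mul_zero, zero_add] at h3
  have hD2 : D ≤ 1 / 2 * D := by
    refine (xNorm_le h1 h2 h3).trans ?_
    have hg : ENNReal.ofReal ((t₁ - t₀) ^ (1 - 2 / p)) ≤ .ofReal (τ ^ (1 - 2 / p)) :=
      ENNReal.ofReal_le_ofReal (Real.rpow_le_rpow (sub_nonneg.2 ht) hle hE.γ_pos.le)
    calc _ = 3 * c * (1 + (mixedNorm (.ofReal p) (.ofReal q) t₁ Φ +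
            mixedNorm (.ofReal p) (.ofReal q) t₁ Φ')) ^ 2 *
            .ofReal ((t₁ - t₀) ^ (1 - 2 / p)) * D := by ring
      _ ≤ 3 * c * (1 + m) ^ 2 * .ofReal (τ ^ (1 - 2 / p)) * D := by
          gcongr
          exact add_le_add (mixedNorm_mono_time ht₁T _) (mixedNorm_mono_time ht₁T _)
      _ ≤ _ := mul_le_mul' hτ le_rfl
  have hDfin : D ≠ ∞ := hP.left.xNorm_sub_ne_top hP.right hp1 hq1
  -- A finite quantity that is at most half of itself vanishes.
  have hD0 : D = 0 := by
    by_contra hne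
    rw [one_div, mul_comm, ← div_eq_mul_inv] at hD2
    exact absurd hD2 (not_le.2 (ENNReal.half_lt_self hne hDfin))
  have hz : ∀ᵐ s ∂(timeMeasure t₁), C s = C' s ∧ Φ s = Φ' s := by
    filter_upwards [enorm_coeff_add_orb_le (T := t₁) (C - C') (Φ - Φ')] with s hs
    have h0 : ‖(C - C') s‖ₑ + ‖(Φ - Φ') s‖ₑ ≤ 0 := by
      refine hs.trans (le_trans ?_ hD0.le)
      rw [hD, xNorm, ← add_assoc]
      exact le_self_add
    rw [nonpos_iff_eq_zero, add_eq_zero, enorm_eq_zero, enorm_eq_zero] at h0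
    exact ⟨sub_eq_zero.1 h0.1, sub_eq_zero.1 h0.2⟩
  rw [ae_restrict_iff' measurableSet_Icc] at hz ⊢
  filter_upwards [hz] with s hs hsT hst
  exact hs ⟨hsT.1, hst⟩

theorem IsSolution.ae_eq (hE : IsExponents d p p' q q') (hT : 0 < T)
    (hU : MemLp U (.ofReal d) volume) (hV : MemLp (fun x : E3 => V ‖x‖) (.ofReal d) volume)
    (h : IsSolution p q T U V C₀ Φ₀ C Φ) (h' : IsSolution p q T U V C₀ Φ₀ C' Φ') :
    ∀ᵐ s ∂(timeMeasure T), C s = C' s ∧ Φ s = Φ' s := by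
  obtain ⟨τ, hτ, hstep⟩ := h.exists_step hE hT hU hV h'
  -- Agreement is propagated in steps of length `τ`; the minimum with `T` keeps the last interval
  -- inside `[0, T]`.
  have hag : ∀ n : ℕ, ∀ᵐ s ∂(timeMeasure T), s ≤ min (n * τ) T → C s = C' s ∧ Φ s = Φ' s := by
    intro n
    induction n with
    | zero =>
      filter_upwards [ae_not_nonpos T] with s hs hs0
      rw [Nat.cast_zero, zero_mul, min_eq_left hT.le] at hs0
      exact (hs hs0).elim
    | succ n ih =>
      have hn : (n : ℝ) * τ ≤ (n + 1 : ℕ) * τ := by push_cast; nlinarith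
      refine hstep (min (n * τ) T) (min ((n + 1 : ℕ) * τ) T) (le_min (by positivity) hT.le)
        (min_le_min_right _ hn) (lt_min (by positivity) hT) (min_le_right _ _) ?_ ih
      rcases le_total ((n : ℝ) * τ) T with h1 | h1
      · rw [min_eq_left h1]
        refine (sub_le_sub_right (min_le_left _ _) _).trans (le_of_eq ?_)
        push_cast; ring
      · rw [min_eq_right h1, min_eq_right (h1.trans hn), sub_self]
        exact hτ.le
  obtain ⟨n, hn⟩ := exists_nat_ge (T / τ)
  filter_upwards [hag n, ae_restrict_mem measurableSet_Icc] with s hs hsT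
  refine hs (le_min (hsT.2.trans ?_) hsT.2)
  rwa [div_le_iff₀ hτ] at hn

theorem IsSolution.unique (hE : IsExponents d p p' q q') (hT : 0 < T)
    (hU : MemLp U (.ofReal d) volume) (hV : MemLp (fun x : E3 => V ‖x‖) (.ofReal d) volume)
    (h : IsSolution p q T U V C₀ Φ₀ C Φ) (h' : IsSolution p q T U V C₀ Φ₀ C' Φ') :
    Set.EqOn C C' (Set.Icc 0 T) ∧ Φ =ᵐ[timeMeasure T] Φ' := by
  have hae := h.ae_eq hE hT hU hV h'
  refine ⟨fun t ht => ?_, by filter_upwards [hae] with s hs using hs.2⟩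
  have hsub : volume.restrict (Set.Ioc 0 t) ≤ timeMeasure T :=
    Measure.restrict_mono_set _ fun s hs => ⟨hs.1.le, hs.2.trans ht.2⟩
  -- Agreement almost everywhere gives equal integrals, and the coefficient equation then gives
  -- agreement of the coefficients at every single time.
  have hk : ∫ s in (0 : ℝ)..t, kForce V (C s) (Φ s) = ∫ s in (0 : ℝ)..t, kForce V (C' s) (Φ' s) := by
    rw [intervalIntegral.integral_of_le ht.1, intervalIntegral.integral_of_le ht.1]
    refine integral_congr_ae ?_
    filter_upwards [ae_mono hsub hae] with s hs
    simp only [hs.1, hs.2]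
  rw [(h.isImage le_rfl).coeff_eq t ht, (h'.isImage le_rfl).coeff_eq t ht, hk]

theorem xNorm_congr_ae {D D' : ℝ → Coeff N K} {Ψ Ψ' : ℝ → L2 (Orb K)}
    (hD : D =ᵐ[timeMeasure T] D') (hΨ : Ψ =ᵐ[timeMeasure T] Ψ') :
    xNorm p q T D Ψ = xNorm p q T D' Ψ' := by
  have h : ∀ r s, mixedNorm r s T Ψ = mixedNorm r s T Ψ' := fun r s =>
    eLpNorm_congr_ae (hΨ.mono fun t ht => by simp only [ht])
  rw [xNorm, xNorm, h, h, eLpNorm_congr_ae hD]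

/-- Fixed points in the ball depend Lipschitz continuously on the data. -/
theorem InBall.sub_le (h : InBall p q T δ C₀ Φ₀ C Φ) (h' : InBall p q T δ C₀' Φ₀' C' Φ')
    (h₀ : IsAdmissibleData θ C₀ Φ₀) (h₀' : IsAdmissibleData θ C₀' Φ₀')
    (hE : IsExponents d p p' q q') (hM : IsCoeffBound N K θ δ M)
    (hc : ImageEstimate N K p q U V M (1 + δ + 2 * K) c) (hT : IsSmallTime K p q c δ T)
    (hI : IsImage T U V C₀ Φ₀ C Φ C Φ) (hI' : IsImage T U V C₀' Φ₀' C' Φ' C' Φ') :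
    xNorm p q T (C - C') (Φ - Φ') ≤
      2 * (1 + strichartzConst p q) * (‖C₀ - C₀'‖ₑ + ‖Φ₀ - Φ₀'‖ₑ) := by
  have hx := (h.image_sub_le h' h₀ h₀' hE hM hc hT hI hI').2.2
  have hfin : xNorm p q T (C - C') (Φ - Φ') ≠ ∞ := (h.curveBound h₀ hM hE).xNorm_sub_ne_top
    (h'.curveBound h₀' hM hE) (by linarith [hE.p_gt]) (by linarith [hE.q_gt])
  set x := xNorm p q T (C - C') (Φ - Φ')
  set y := ‖C₀ - C₀'‖ₑ + (1 + strichartzConst p q) * ‖Φ₀ - Φ₀'‖ₑ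
  -- Half of the distance is absorbed into the left-hand side, which its finiteness permits.
  have hy : x ≤ 2 * y := by
    have h2 : 1 / 2 * x ≠ ∞ := by finiteness
    have h1 : 1 / 2 * x + 1 / 2 * x ≤ y + 1 / 2 * x := by
      rw [← add_mul, ENNReal.div_add_div_same, one_add_one_eq_two,
        ENNReal.div_self two_ne_zero ENNReal.ofNat_ne_top, one_mul]
      exact hx
    have h3 : 1 / 2 * x ≤ y := (ENNReal.add_le_add_iff_right h2).1 h1
    calc x = 2 * (1 / 2 * x) := by
          rw [← mul_assoc, ENNReal.mul_div_cancel two_ne_zero ENNReal.ofNat_ne_top, one_mul]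
      _ ≤ _ := mul_le_mul' le_rfl h3
  refine hy.trans ?_
  calc 2 * y ≤ 2 * y + 2 * strichartzConst p q * ‖C₀ - C₀'‖ₑ := le_self_add
    _ = _ := by ring

/-- The exponents of the main theorem. -/
theorem isExponents_of_admissible (hd : 3 / 2 < d) (hq : q = 2 * d / (d - 1))
    (hpq : Admissible p q) : IsExponents d p p.conjExponent q q.conjExponent := by
  obtain ⟨hp0, h1, -, -⟩ := hpq
  have hd1 : 0 < d - 1 := by linarith
  have hd0 : 0 < d := by linarith
  have hqi : 1 / q = 1 / 2 - 1 / (2 * d) := by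
    rw [hq]; field_simp
  -- With `1/q = 1/2 - 1/(2d)` admissibility reads `2/(3p) = 1/(2d)`; thus `p > 2` is equivalent to
  -- `d > 3/2`.
  have hp : p = 4 * d / 3 := by
    rw [hqi] at h1
    field_simp at h1
    linarith
  have hp2 : 2 < p := by rw [hp]; linarith
  have hq2 : 2 < q := by
    rw [hq, lt_div_iff₀ hd1]; linarith
  refine ⟨hd, hp2, hq2, Real.HolderConjugate.conjExponent (by linarith),
    Real.HolderConjugate.conjExponent (by linarith), ?_, ?_⟩
  · have : 2 / q = 2 * (1 / q) := by ring
    rw [this, hqi, hp]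
    field_simp
    ring
  · have : 2 / q = 2 * (1 / q) := by ring
    rw [this, hqi]
    field_simp
    ring

end

end

end MCTDHF

/-! ### The main theorem -/

theorem mainTheorem2 (N K : ℕ) (hN : 1 ≤ N) (hNK : N ≤ K) (d p q : ℝ) (hd : 3 / 2 < d)
    (hq : q = 2 * d / (d - 1)) (hpq : MCTDHF.Admissible p q) (A B θ : ℝ≥0) :
    MCTDHF.strichartzConst p q < ∞ ∧
    ∃ T : ℝ, 0 < T ∧ ∃ L : ℝ≥0, ∀ (U : MCTDHF.E3 → ℝ) (V : ℝ → ℝ),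
      MemLp U (ENNReal.ofReal d) volume →
      MemLp (fun x : MCTDHF.E3 => V ‖x‖) (ENNReal.ofReal d) volume →
      eLpNorm U (ENNReal.ofReal d) volume ≤ A →
      eLpNorm (fun x : MCTDHF.E3 => V ‖x‖) (ENNReal.ofReal d) volume ≤ B →
      (∀ (C₀ : MCTDHF.Coeff N K) (Φ₀ : MCTDHF.L2 (MCTDHF.Orb K)),
        MCTDHF.IsRegularData C₀ Φ₀ →
        ‖Matrix.toEuclideanCLM (𝕜 := ℂ) (MCTDHF.densityMatrix C₀)⁻¹‖ ≤ θ →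
        ∃ (C : ℝ → MCTDHF.Coeff N K) (Φ : ℝ → MCTDHF.L2 (MCTDHF.Orb K)),
          MCTDHF.IsSolution p q T U V C₀ Φ₀ C Φ ∧
          MCTDHF.mixedNorm (ENNReal.ofReal p) (ENNReal.ofReal q) T Φ
            ≤ 2 * MCTDHF.strichartzConst p q * ‖Φ₀‖ₑ ∧
          ∀ (C' : ℝ → MCTDHF.Coeff N K) (Φ' : ℝ → MCTDHF.L2 (MCTDHF.Orb K)),
            MCTDHF.IsSolution p q T U V C₀ Φ₀ C' Φ' →
            Set.EqOn C' C (Set.Icc 0 T) ∧ Φ' =ᵐ[MCTDHF.timeMeasure T] Φ) ∧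
      (∀ (C₀ C₀' : MCTDHF.Coeff N K) (Φ₀ Φ₀' : MCTDHF.L2 (MCTDHF.Orb K))
        (C C' : ℝ → MCTDHF.Coeff N K) (Φ Φ' : ℝ → MCTDHF.L2 (MCTDHF.Orb K)),
        MCTDHF.IsRegularData C₀ Φ₀ → MCTDHF.IsRegularData C₀' Φ₀' →
        ‖Matrix.toEuclideanCLM (𝕜 := ℂ) (MCTDHF.densityMatrix C₀)⁻¹‖ ≤ θ →
        ‖Matrix.toEuclideanCLM (𝕜 := ℂ) (MCTDHF.densityMatrix C₀')⁻¹‖ ≤ θ →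
        MCTDHF.IsSolution p q T U V C₀ Φ₀ C Φ → MCTDHF.IsSolution p q T U V C₀' Φ₀' C' Φ' →
        MCTDHF.xNorm p q T (C - C') (Φ - Φ') ≤ L * (‖C₀ - C₀'‖ₑ + ‖Φ₀ - Φ₀'‖ₑ)) := by
  have hE := MCTDHF.isExponents_of_admissible hd hq hpq
  have hρ := MCTDHF.strichartzConst_lt_top hE
  refine ⟨hρ, ?_⟩
  -- The constants are fixed before the potentials and the data: `δ` and `M` depend on `N`, `K`,
  -- `θ`, then `c` also on the exponents and on `A`, `B`, and `T` is chosen last.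
  obtain ⟨δ, M, hδ, hM⟩ := MCTDHF.exists_isCoeffBound N K θ
  obtain ⟨c, hc⟩ := MCTDHF.exists_image_sub_le N K hE A B M (1 + δ + 2 * K)
  obtain ⟨T, hT⟩ := MCTDHF.exists_isSmallTime K hE c hδ
  refine ⟨T, hT.pos, (2 * (1 + MCTDHF.strichartzConst p q)).toNNReal, ?_⟩
  intro U V hU hV hA hB
  have hest : MCTDHF.ImageEstimate N K p q U V M (1 + δ + 2 * K) c := hc U V hU hV hA hB
  have hfix := fun (C₀ : MCTDHF.Coeff N K) (Φ₀ : MCTDHF.L2 (MCTDHF.Orb K))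
    (h₀ : MCTDHF.IsAdmissibleData θ C₀ Φ₀) =>
      MCTDHF.exists_fixedPoint h₀ hE hU hV hM hest hT
  refine ⟨fun C₀ Φ₀ hreg hθ => ?_, fun C₀ C₀' Φ₀ Φ₀' C C' Φ Φ' hreg hreg' hθ hθ' hS hS' => ?_⟩
  · have h₀ := MCTDHF.isAdmissibleData_of_isRegularData hreg hθ
    obtain ⟨C, Φ, hB, hI⟩ := hfix C₀ Φ₀ h₀
    have hS := hB.isSolution h₀ hI hE hT.pos hV hM
    exact ⟨C, Φ, hS, hB.mixed_le, fun C' Φ' hS' => hS'.unique hE hT.pos hU hV hS⟩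
  · have h₀ := MCTDHF.isAdmissibleData_of_isRegularData hreg hθ
    have h₀' := MCTDHF.isAdmissibleData_of_isRegularData hreg' hθ'
    obtain ⟨D, Ψ, hB, hI⟩ := hfix C₀ Φ₀ h₀
    obtain ⟨D', Ψ', hB', hI'⟩ := hfix C₀' Φ₀' h₀'
    -- Uniqueness identifies the given solutions with the fixed points in the ball, to which the
    -- Lipschitz estimate applies.
    obtain ⟨h1, h2⟩ := hS.unique hE hT.pos hU hV (hB.isSolution h₀ hI hE hT.pos hV hM)
    obtain ⟨h1', h2'⟩ := hS'.unique hE hT.pos hU hV (hB'.isSolution h₀' hI' hE hT.pos hV hM)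
    have hae : ∀ {f g : ℝ → MCTDHF.Coeff N K}, Set.EqOn f g (Set.Icc 0 T) →
        f =ᵐ[MCTDHF.timeMeasure T] g := fun h => by
      filter_upwards [ae_restrict_mem measurableSet_Icc] with t ht using h ht
    rw [MCTDHF.xNorm_congr_ae ((hae h1).sub (hae h1')) (h2.sub h2'), ENNReal.coe_toNNReal
      (ENNReal.mul_ne_top ENNReal.ofNat_ne_top (ENNReal.add_ne_top.2 ⟨ENNReal.one_ne_top, hρ.ne⟩))]
    exact hB.sub_le hB' h₀ h₀' hE hM hest hT hI hI'
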